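/- **Setting.** Let $n\ge 2$, $N\ge 1$ be integers, $p\ge 2$, $s>n$ real, and let $\Omega\subset\mathbb R^n$ be a bounded domain. All norms $|\cdot|$ are Euclidean, and $B_r(x)$ denotes the open ball of centre $x$ and radius $r$. Let $f\in L^s_{\rm loc}(\Omega;\mathbb R^N)$ and let $\mathcal F:\Omega\times\mathbb R^{n\times N}\to\mathbb R$ be such that $x\mapsto\mathcal F(x,\xi)$ is measurable for every $\xi$ and, for a.e. $x\in\Omega$, $\xi\mapsto\mathcal F(x,\xi)$ is continuous and convex on $\mathbb R^{n\times N}$ and of class $C^2$ on $\{|\xi|>1\}$. Assume that there are constants $\ell,L,L_1,\nu>0$ and a function $0\le k\in L^s_{\rm loc}(\Omega)$ such that, for a.e. $x\in\Omega$: * (F0) $\ell(|\xi|^p-1)\le\mathcal F(x,\xi)\le L(|\xi|^p+1)$ for all $\xi\in\mathbb R^{n\times N}$; * (F1) $\mathcal F(x,\xi)=F(x,|\xi|)$ for all $|\xi|\ge1$, for some function $F:\Omega\times[1,\infty)\to\mathbb R$; * (F2) $\langle D_{\xi\xi}\mathcal F(x,\xi)\lambda,\lambda\rangle\ge\nu|\xi|^{p-2}|\lambda|^2$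 for all $|\xi|>1$, $\lambda\in\mathbb R^{n\times N}$; * (F3) $|D_{\xi\xi}\mathcal F(x,\xi)|\le L_1|\xi|^{p-2}$ for all $|\xi|>1$; * (F4) $|D_{x\xi}\mathcal F(x,\xi)|\le k(x)|\xi|^{p-1}$ for all $|\xi|>1$, where, for each such $\xi$, $D_{x\xi}\mathcal F(\cdot,\xi)$ is the weak derivative of $x\mapsto D_\xi\mathcal F(x,\xi)$ in $\Omega$. For $A\subset\Omega$ put $\mathbb F(u;A)=\int_A\big(\mathcal F(x,Du)+f\cdot u\big)\,dx$. A function $u\in W^{1,p}_{\rm loc}(\Omega;\mathbb R^N)$ is a *local minimizer* of $\mathbb F$ in $\Omega$ if $\mathbb F(u;K)\le\mathbb F(v;K)$ for every compact $K\subset\Omega$ and every $v\in W^{1,p}_{\rm loc}(\Omega;\mathbb R^N)$ with $v=u$ a.e. in $\Omega\setminus K$. Suprema are essential suprema. **Theorem.** There is an exponent $\tau=\tau(n,s)>0$ with the following properties. **(A)** Let $u\in W^{2,2}_{\rm loc}(\Omega;\mathbb R^N)\cap W^{1,\infty}_{\rm loc}(\Omega;\mathbb R^N)$ be a local minimizer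 of $\mathbb F$ in $\Omega$ with $|Du|^{p-2}|D^2u|^2\in L^1_{\rm loc}(\Omega)$. Then, for concentric balls, $$\sup_{B_\rho}|Du|\le C\big(1+\|k\|_{L^s(B_R)}+\|f\|_{L^s(B_R)}\big)^\tau\Big(\int_{B_R}(1+|Du|)^p\,dx\Big)^{1/p}$$ whenever $0<\rho<R$ and $B_R\Subset\Omega$, and $$\int_{B_\rho}\frac{(|Du|-1)_+^2}{(1+(|Du|-1)_+)^2}|Du|^{p-2}|D^2u|^2\,dx\le C\big(1+\|k\|_{L^s(B_{2R})}+\|f\|_{L^s(B_{2R})}\big)^\tau\int_{B_{2R}}(1+|Du|^p)\,dx$$ whenever $0<\rho\le R$ and $B_{2R}\Subset\Omega$, with a constant $C=C(n,N,p,s,L,L_1,\nu,\rho,R)>0$. **(B)** Let $B_r(x_0)\Subset\Omega$, let $u,\bar u\in W^{1,p}(B_r(x_0);\mathbb R^N)$, and let $v$ minimize $$\widetilde{\mathbb F}(w)=\mathbb F(w;B_r(x_0))+\int_{B_r(x_0)}\arctan(|w-\bar u|^2)\,dx$$ among all $w\in u+W^{1,p}_0(B_r(x_0);\mathbb R^N)$.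 Assume that $v\in W^{2,2}_{\rm loc}(B_r(x_0);\mathbb R^N)\cap W^{1,\infty}_{\rm loc}(B_r(x_0);\mathbb R^N)$ and $|Dv|^{p-2}|D^2v|^2\in L^1_{\rm loc}(B_r(x_0))$. Then, whenever $0<\rho<R$ and $B_R=B_R(\bar x)\Subset B_r(x_0)$, with $B_\rho=B_\rho(\bar x)$, $$\sup_{B_\rho}|Dv|\le C_1\big(1+\|k\|_{L^s(B_R)}+\|f\|_{L^s(B_R)}\big)^\tau\Big(\int_{B_R}(1+|Dv|)^p\,dx\Big)^{1/p},$$ $$\int_{B_\rho}\frac{(|Dv|-1)_+^2}{(1+(|Dv|-1)_+)^2}|Dv|^{p-2}|D^2v|^2\,dx\le C_2\big(1+\|k\|_{L^s(B_R)}+\|f\|_{L^s(B_R)}\big)^\tau\int_{B_R}(1+|Dv|^p)\,dx,$$ with constants $C_1=C_1(n,N,p,s,L_1,\nu,\rho,R)>0$ and $C_2=C_2(n,N,p,s,L,L_1,\nu,\rho,R)>0$. -/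

import Mathlib

open MeasureTheory Set
open scoped ENNReal ContDiff

noncomputable section

/-- `ℝⁿ` with the Euclidean norm. -/
abbrev Vec (n : ℕ) : Type := EuclideanSpace ℝ (Fin n)

/-- `n × N` matrices with the Euclidean (Frobenius) norm; the entry `(α, i)` of `Du` is
`∂ᵢ u^α`. -/
abbrev Mat (n N : ℕ) : Type := EuclideanSpace ℝ (Fin N × Fin n)

/-- The type of values of `D²u`, with the Euclidean norm; the entry `((α, i), j)` of `D²u` is
`∂ⱼ ∂ᵢ u^α`. -/
abbrev Tens (n N : ℕ) : Type := EuclideanSpace ℝ ((Fin N × Fin n) × Fin n)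

/-- `G` is the weak (distributional) gradient of `g` in `Ω`: both are locally integrable in `Ω` and
`∫_Ω g^a ∂ᵢφ = - ∫_Ω G_{a,i} φ` for all components `a`, all directions `i` and all scalar test
functions `φ ∈ C_c^∞(Ω)`. -/
def IsWeakGrad {n : ℕ} {ι : Type} [Fintype ι] (Ω : Set (Vec n))
    (g : Vec n → EuclideanSpace ℝ ι) (G : Vec n → EuclideanSpace ℝ (ι × Fin n)) : Prop :=
  LocallyIntegrableOn g Ω volume ∧ LocallyIntegrableOn G Ω volume ∧
    ∀ φ : Vec n → ℝ, ContDiff ℝ ∞ φ → HasCompactSupport φ → tsupport φ ⊆ Ω →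
      ∀ (a : ι) (i : Fin n),
        ∫ x in Ω, g x a * fderiv ℝ φ x (EuclideanSpace.single i 1) = - ∫ x in Ω, G x (a, i) * φ x

/-- `g ∈ L^q_loc(Ω)`. -/
def MemLpLoc {n : ℕ} {E : Type} [NormedAddCommGroup E] (g : Vec n → E) (q : ℝ≥0∞)
    (Ω : Set (Vec n)) : Prop :=
  ∀ K : Set (Vec n), IsCompact K → K ⊆ Ω → MemLp g q (volume.restrict K)

/-- `u ∈ W^{1,q}_loc(Ω; ℝ^N)`, with weak gradient `Du`. -/
def MemW1Loc {n N : ℕ} (Ω : Set (Vec n)) (q : ℝ≥0∞) (u : Vec n → Vec N) (Du : Vec n → Mat n N) :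
    Prop :=
  IsWeakGrad Ω u Du ∧ MemLpLoc u q Ω ∧ MemLpLoc Du q Ω

/-- `u ∈ W^{2,q}_loc(Ω; ℝ^N)`, with weak gradient `Du` and weak second derivatives `D2u`. -/
def MemW2Loc {n N : ℕ} (Ω : Set (Vec n)) (q : ℝ≥0∞) (u : Vec n → Vec N) (Du : Vec n → Mat n N)
    (D2u : Vec n → Tens n N) : Prop :=
  MemW1Loc Ω q u Du ∧ IsWeakGrad Ω Du D2u ∧ MemLpLoc D2u q Ω

/-- `u ∈ W^{1,q}(B; ℝ^N)`, with weak gradient `Du`. -/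
def MemW1 {n N : ℕ} (B : Set (Vec n)) (q : ℝ≥0∞) (u : Vec n → Vec N) (Du : Vec n → Mat n N) :
    Prop :=
  IsWeakGrad B u Du ∧ MemLp u q (volume.restrict B) ∧ MemLp Du q (volume.restrict B)

/-- The classical Jacobian matrix of `φ : ℝⁿ → ℝ^N`. -/
def jacobian {n N : ℕ} (φ : Vec n → Vec N) (x : Vec n) : Mat n N :=
  WithLp.toLp 2 fun ai => (fderiv ℝ φ x (EuclideanSpace.single ai.2 1)) ai.1

/-- `w ∈ W_0^{1,q}(B; ℝ^N)`, with weak gradient `Dw`: `w` belongs to the closure of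
`C_c^∞(B; ℝ^N)` in `W^{1,q}(B; ℝ^N)`. -/
def MemW1Zero {n N : ℕ} (B : Set (Vec n)) (q : ℝ≥0∞) (w : Vec n → Vec N)
    (Dw : Vec n → Mat n N) : Prop :=
  MemW1 B q w Dw ∧
    ∀ ε : ℝ≥0∞, 0 < ε → ∃ φ : Vec n → Vec N,
      ContDiff ℝ ∞ φ ∧ HasCompactSupport φ ∧ tsupport φ ⊆ B ∧
        eLpNorm (fun x => w x - φ x) q (volume.restrict B) +
          eLpNorm (fun x => Dw x - jacobian φ x) q (volume.restrict B) ≤ ε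

/-- The Hessian `D_{ξξ} F` of a function of a matrix variable, as a linear map. -/
def hessian {n N : ℕ} (F : Mat n N → ℝ) (ξ : Mat n N) : Mat n N →L[ℝ] Mat n N :=
  fderiv ℝ (gradient F) ξ

/-- The Euclidean norm of the Hessian: the square root of the sum of the squares of all second
partial derivatives. -/
def hessianNorm {n N : ℕ} (F : Mat n N → ℝ) (ξ : Mat n N) : ℝ :=
  √ (∑ b : Fin N × Fin n, ‖hessian F ξ (EuclideanSpace.single b 1)‖ ^ 2)

/-- The structure conditions on the energy density `F(x, ξ)`: a Carathéodory function, convex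
in `ξ`, with `p`-growth, and radial, `C²` and uniformly `p`-elliptic in `ξ` outside the unit ball,
where moreover `D_ξ F` has Sobolev dependence on `x` controlled by the function `k ∈ L^s_loc(Ω)`. -/
structure StructureConditions {n N : ℕ} (Ω : Set (Vec n)) (p L L₁ ν s : ℝ) (k : Vec n → ℝ)
    (F : Vec n → Mat n N → ℝ) : Prop where
  /-- measurability in `x` -/
  aemeasurable : ∀ ξ, AEMeasurable (fun x => F x ξ) (volume.restrict Ω)
  /-- continuity in `ξ` -/
  continuous : ∀ᵐ x ∂(volume.restrict Ω), Continuous (F x)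
  /-- convexity in `ξ` -/
  convex : ∀ᵐ x ∂(volume.restrict Ω), ConvexOn ℝ univ (F x)
  /-- `C²` regularity in `ξ` outside the unit ball -/
  contDiff : ∀ᵐ x ∂(volume.restrict Ω), ContDiffOn ℝ 2 (F x) {ξ | 1 < ‖ξ‖}
  /-- `p`-growth -/
  growth : ∃ ℓ : ℝ, 0 < ℓ ∧ ∀ᵐ x ∂(volume.restrict Ω), ∀ ξ,
    ℓ * (‖ξ‖ ^ p - 1) ≤ F x ξ ∧ F x ξ ≤ L * (‖ξ‖ ^ p + 1)
  /-- radial structure outside the unit ball -/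
  radial : ∃ g : Vec n → ℝ → ℝ, ∀ᵐ x ∂(volume.restrict Ω), ∀ ξ, 1 ≤ ‖ξ‖ → F x ξ = g x ‖ξ‖
  /-- ellipticity outside the unit ball -/
  elliptic : ∀ᵐ x ∂(volume.restrict Ω), ∀ ξ, 1 < ‖ξ‖ → ∀ η : Mat n N,
    ν * ‖ξ‖ ^ (p - 2) * ‖η‖ ^ 2 ≤ inner ℝ (hessian (F x) ξ η) η
  /-- bound of the Hessian outside the unit ball -/
  hessian_le : ∀ᵐ x ∂(volume.restrict Ω), ∀ ξ, 1 < ‖ξ‖ →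
    hessianNorm (F x) ξ ≤ L₁ * ‖ξ‖ ^ (p - 2)
  /-- `k` is nonnegative -/
  k_nonneg : ∀ᵐ x ∂(volume.restrict Ω), 0 ≤ k x
  /-- `k ∈ L^s_loc(Ω)` -/
  k_mem : MemLpLoc k (ENNReal.ofReal s) Ω
  /-- weak derivative `M = D_{xξ} F` of `x ↦ D_ξ F(x, ξ)`, for `ξ` outside the unit ball -/
  mixed : ∃ M : Vec n → Mat n N → Tens n N,
    (∀ ξ, 1 < ‖ξ‖ → IsWeakGrad Ω (fun x => gradient (F x) ξ) (fun x => M x ξ)) ∧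
      ∀ᵐ x ∂(volume.restrict Ω), ∀ ξ, 1 < ‖ξ‖ → ‖M x ξ‖ ≤ k x * ‖ξ‖ ^ (p - 1)

/-- The energy `∫_A (F(x, Du) + f · u) dx`. -/
def energy {n N : ℕ} (F : Vec n → Mat n N → ℝ) (f : Vec n → Vec N) (A : Set (Vec n))
    (u : Vec n → Vec N) (Du : Vec n → Mat n N) : ℝ :=
  ∫ x in A, (F x (Du x) + inner ℝ (f x) (u x))

/-- `u` (with weak gradient `Du`) is a local minimizer of the energy in `Ω`: it lies in
`W^{1,p}_loc(Ω)`, and its energy does not exceed the energy of any competitor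
`v ∈ W^{1,p}_loc(Ω)` that differs from `u` only on a compact subset `K` of `Ω` (both energies being
computed on `K`). -/
def IsLocalMinimizer {n N : ℕ} (Ω : Set (Vec n)) (p : ℝ) (F : Vec n → Mat n N → ℝ)
    (f : Vec n → Vec N) (u : Vec n → Vec N) (Du : Vec n → Mat n N) : Prop :=
  MemW1Loc Ω (ENNReal.ofReal p) u Du ∧
    ∀ K : Set (Vec n), IsCompact K → K ⊆ Ω →
      ∀ (v : Vec n → Vec N) (Dv : Vec n → Mat n N), MemW1Loc Ω (ENNReal.ofReal p) v Dv →
        (∀ᵐ x ∂(volume.restrict (Ω \ K)), v x = u x) →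
          energy F f K u Du ≤ energy F f K v Dv

/-- The perturbed energy `∫_B (F(x, Dv) + f · v) dx + ∫_B arctan(|v - ū|²) dx`. -/
def perturbedEnergy {n N : ℕ} (F : Vec n → Mat n N → ℝ) (f : Vec n → Vec N) (ubar : Vec n → Vec N)
    (B : Set (Vec n)) (v : Vec n → Vec N) (Dv : Vec n → Mat n N) : ℝ :=
  energy F f B v Dv + ∫ x in B, Real.arctan (‖v x - ubar x‖ ^ 2)

/-- `v` (with weak gradient `Dv`) minimizes the perturbed energy on `B` in the Dirichlet class
`u + W_0^{1,p}(B; ℝ^N)`. -/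
def IsPerturbedMinimizer {n N : ℕ} (B : Set (Vec n)) (p : ℝ) (F : Vec n → Mat n N → ℝ)
    (f : Vec n → Vec N) (ubar : Vec n → Vec N) (u : Vec n → Vec N) (Du : Vec n → Mat n N)
    (v : Vec n → Vec N) (Dv : Vec n → Mat n N) : Prop :=
  MemW1Zero B (ENNReal.ofReal p) (fun x => v x - u x) (fun x => Dv x - Du x) ∧
    ∀ (w : Vec n → Vec N) (Dw : Vec n → Mat n N),
      MemW1Zero B (ENNReal.ofReal p) (fun x => w x - u x) (fun x => Dw x - Du x) →
        perturbedEnergy F f ubar B v Dv ≤ perturbedEnergy F f ubar B w Dw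

/-- `u ∈ W^{2,2}_loc(Ω) ∩ W^{1,∞}_loc(Ω)` and `|Du|^{p-2} |D²u|² ∈ L¹_loc(Ω)`. -/
structure AprioriRegular {n N : ℕ} (Ω : Set (Vec n)) (p : ℝ) (u : Vec n → Vec N)
    (Du : Vec n → Mat n N) (D2u : Vec n → Tens n N) : Prop where
  memW2 : MemW2Loc Ω 2 u Du D2u
  memW1 : MemW1Loc Ω ∞ u Du
  weighted : LocallyIntegrableOn (fun x => ‖Du x‖ ^ (p - 2) * ‖D2u x‖ ^ 2) Ω volume

/-- `1 + ‖k‖_{L^s(B)} + ‖f‖_{L^s(B)}`. -/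
def dataSize {n N : ℕ} (s : ℝ) (k : Vec n → ℝ) (f : Vec n → Vec N) (B : Set (Vec n)) : ℝ≥0∞ :=
  1 + eLpNorm k (ENNReal.ofReal s) (volume.restrict B) +
    eLpNorm f (ENNReal.ofReal s) (volume.restrict B)

/-- The estimate
`sup_{B'} |Du| ≤ C (1 + ‖k‖_{L^s(B)} + ‖f‖_{L^s(B)})^τ (∫_B (1 + |Du|)^p dx)^{1/p}`
(with the essential supremum), in `[0, ∞]`. -/
def GradientBound {n N : ℕ} (C τ p s : ℝ) (k : Vec n → ℝ) (f : Vec n → Vec N)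
    (Du : Vec n → Mat n N) (B' B : Set (Vec n)) : Prop :=
  eLpNorm Du ∞ (volume.restrict B') ≤
    ENNReal.ofReal C * dataSize s k f B ^ τ *
      (∫⁻ x in B, ENNReal.ofReal ((1 + ‖Du x‖) ^ p)) ^ (1 / p)

/-- The weighted Caccioppoli inequality
`∫_{B'} (|Du|-1)_+² / (1 + (|Du|-1)_+)² |Du|^{p-2} |D²u|² dx
  ≤ C (1 + ‖k‖_{L^s(B)} + ‖f‖_{L^s(B)})^τ ∫_B (1 + |Du|^p) dx`, in `[0, ∞]`. -/
def CaccioppoliBound {n N : ℕ} (C τ p s : ℝ) (k : Vec n → ℝ) (f : Vec n → Vec N)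
    (Du : Vec n → Mat n N) (D2u : Vec n → Tens n N) (B' B : Set (Vec n)) : Prop :=
  ∫⁻ x in B', ENNReal.ofReal
      ((max (‖Du x‖ - 1) 0) ^ 2 / (1 + max (‖Du x‖ - 1) 0) ^ 2 * ‖Du x‖ ^ (p - 2) * ‖D2u x‖ ^ 2) ≤
    ENNReal.ofReal C * dataSize s k f B ^ τ * ∫⁻ x in B, ENNReal.ofReal (1 + ‖Du x‖ ^ p)

end

set_option linter.unusedSectionVars false
set_option linter.style.haveILetI false

/-! ### Translations and averages of translates in `L²`. -/

section WeakCalculus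

open Filter Topology

variable {n : ℕ} {E E' : Type*} [NormedAddCommGroup E] [NormedSpace ℝ E]
  [NormedAddCommGroup E'] [NormedSpace ℝ E']

/-! Nothing is known about derivatives of the density on the unit ball, so the whole argument tests
only with functions living where `|Du| > 1 + δ` and arranges that the remaining set leaves no trace
in the estimates.

Both kinds of minimizers satisfy one inequality, `EulerLagrangeIneq`, obtained from the variations
`u + tφ`, `t > 0`. Where `|Du| > 1` the density is differentiable in `ξ`; where `|Du| ≤ 1` convexity
and `p`-growth still make it Lipschitz, which costs an error `C ∫_{|Du| ≤ 1} |Dφ|`. The arctan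
perturbation is Lipschitz with constant 2 in the competitor and only turns `|f|` into `|f| + 2`.
Next (`EulerLagrangeIneq.differentiated`) `φ` is a backward difference quotient of a function whose
gradient vanishes on `|Du| ≤ 1 + δ`. If `|Du(x)| > 1 + δ` while `|Du(x + he)| ≤ 1`, then `Du` jumps
by more than `δ`, so at such points `1/h` is bounded by the `L²`-error of the difference quotients
of `Du`. This error vanishes as `h → 0`, and so does the contribution of the bad set
(`norm_diffQuot_sub_le`).

The inequality differentiated in direction `s` is tested with `η² Φ(|Du|) ∂ₛu` and summed over `s`.
The Hessian of a radial density is `a I + b ξ ⊗ ξ`, and ellipticity bounds both `a` and `a + b|ξ|²`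
from below; together with the symmetry of second derivatives this makes the term containing `Φ'`
nonnegative (`le_sum_inner_hessian_tensorRow`), which could fail for a general system. Young's
inequality then gives `RegularSolution.caccioppoli`, whose right side carries the weight `|∇η|² +
κ²η²` with `κ = 2^(p-1) k + |f| + 2`.

For the supremum bound, `Φ` is built from powers of `softMax`, a smooth substitute for `max(1, P)`
that is constant for `P ≤ 3/2`. With a Sobolev exponent `q` given by `1/q = 1/2 - 1/s₀`, `n < s₀ <
s`, the surplus integrability of `κ` allows it to be truncated and its large part to be absorbed
(`eLpNorm_mul_le_truncate`, `sq_le_of_absorb`) at the price of a fixed power of the data norm. Moser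
iteration raises these prices to geometrically decaying exponents, so their product converges
(`exists_sup_const`).

For the second estimate, `Φ(P) = t²/(1+t)²` with `t = (P - 1 - δ)₊` is bounded and `P Φ'(P)` is
bounded as well. The right side is then at most `sup |Du|^p ∫ (|∇η|² + κ²)`; the supremum bound
applies and `δ → 0` by Fatou. The exponent `τ` is the power of the data in the bound of `|Du|^p`,
plus 2 for `∫ κ²`. The assumed regularity of `u` only makes test functions and integrals legitimate;
it does not enter the constants. -/

theorem eLpNorm_two_sq {α : Type*} [MeasurableSpace α] (μ : Measure α) (f : α → E) :
    eLpNorm f 2 μ ^ 2 = ∫⁻ x, ‖f x‖ₑ ^ 2 ∂μ := by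
  have := eLpNorm_nnreal_pow_eq_lintegral (f := f) (μ := μ) (p := 2) (by norm_num)
  simpa using this

theorem sq_lintegral_le_lintegral_sq {α : Type*} [MeasurableSpace α] {μ : Measure α}
    [IsProbabilityMeasure μ] {f : α → E} (hf : AEStronglyMeasurable f μ) :
    (∫⁻ x, ‖f x‖ₑ ∂μ) ^ 2 ≤ ∫⁻ x, ‖f x‖ₑ ^ 2 ∂μ := by
  rw [← eLpNorm_two_sq, ← eLpNorm_one_eq_lintegral_enorm]
  gcongr
  exact eLpNorm_le_eLpNorm_of_exponent_le (by norm_num) hf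

/-- Composition with measure-preserving maps is continuous in `L²` with respect to the map, and
translations form a continuous family of such maps. -/
theorem tendsto_eLpNorm_translate_sub {g : Vec n → E} (hg : MemLp g 2 volume) :
    Tendsto (fun y : Vec n => eLpNorm (fun x => g (x + y) - g x) 2 volume) (𝓝 0) (𝓝 0) := by
  haveI : Fact ((1 : ℝ≥0∞) ≤ 2) := ⟨by norm_num⟩
  let G : Vec n → C(Vec n, Vec n) := fun y => ⟨fun x => x + y, by fun_prop⟩
  have hG : Continuous G := by
    refine ContinuousMap.continuous_of_continuous_uncurry _ ?_
    simp only [G, Function.uncurry_def, ContinuousMap.coe_mk]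
    fun_prop
  have hmp : ∀ y, MeasurePreserving (G y) volume volume := fun y =>
    measurePreserving_add_right volume y
  have hc := Continuous.compMeasurePreservingLp (f := fun _ : Vec n => hg.toLp g) (g := G)
    continuous_const hG hmp (by norm_num)
  have h0 := (hc.tendsto 0)
  rw [tendsto_iff_edist_tendsto_0] at h0
  refine h0.congr fun y => ?_
  rw [Lp.toLp_compMeasurePreserving, Lp.toLp_compMeasurePreserving, Lp.edist_toLp_toLp]
  refine eLpNorm_congr_ae (Eventually.of_forall fun x => ?_)
  simp [G]

/-- For each fixed parameter the map is a translation, so by Tonelli preimages of null sets are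
null. This lets a.e. statements and a.e. measurable functions be pulled back to the product space.
-/
theorem quasiMeasurePreserving_add_comp {T : Type*} [MeasurableSpace T] {μ : Measure T}
    [SFinite μ] {y : T → Vec n} (hy : Measurable y) :
    Measure.QuasiMeasurePreserving (fun z : Vec n × T => z.1 + y z.2) (volume.prod μ)
      (volume : Measure (Vec n)) := by
  have hm : Measurable (fun z : Vec n × T => z.1 + y z.2) := by fun_prop
  refine ⟨hm, Measure.AbsolutelyContinuous.mk fun S hS h0 => ?_⟩
  rw [Measure.map_apply hm hS, Measure.prod_apply_symm (hm hS)]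
  rw [lintegral_eq_zero_iff (measurable_measure_prodMk_right (hm hS))]
  refine Eventually.of_forall fun t => ?_
  have : (fun x => (x, t)) ⁻¹' ((fun z : Vec n × T => z.1 + y z.2) ⁻¹' S)
      = (fun x => x + y t) ⁻¹' S := rfl
  simp only [this, Pi.zero_apply]
  rw [measure_preimage_add_right, h0]

/-- Jensen pointwise, then Tonelli. It serves two purposes: averages along a segment (difference
quotients) and averages against a mollifier. -/
theorem eLpNorm_average_translate_sub_le {T : Type*} [MeasurableSpace T] {μ : Measure T}
    [IsProbabilityMeasure μ] [CompleteSpace E] {y : T → Vec n} (hy : Measurable y) {g : Vec n → E}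
    (hg : AEStronglyMeasurable g volume) {δ : ℝ≥0∞}
    (h : ∀ᵐ t ∂μ, eLpNorm (fun x => g (x + y t) - g x) 2 volume ≤ δ) :
    eLpNorm (fun x => (∫ t, g (x + y t) ∂μ) - g x) 2 volume ≤ δ := by
  have hm2 : AEStronglyMeasurable (fun z : Vec n × T => g (z.1 + y z.2)) (volume.prod μ) :=
    hg.comp_quasiMeasurePreserving (quasiMeasurePreserving_add_comp hy)
  have hm1 : AEStronglyMeasurable (fun z : Vec n × T => g z.1) (volume.prod μ) :=
    hg.comp_fst
  have hm3 : AEStronglyMeasurable (fun z : Vec n × T => g (z.1 + y z.2) - g z.1) (volume.prod μ) :=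
    hm2.sub hm1
  have hx : ∀ᵐ x, AEStronglyMeasurable (fun t => g (x + y t)) μ := hm2.prodMk_left
  have key : ∀ᵐ x, ‖(∫ t, g (x + y t) ∂μ) - g x‖ₑ ^ 2 ≤ ∫⁻ t, ‖g (x + y t) - g x‖ₑ ^ 2 ∂μ := by
    filter_upwards [hx] with x hx
    have hx' : AEStronglyMeasurable (fun t => g (x + y t) - g x) μ :=
      hx.sub aestronglyMeasurable_const
    refine le_trans ?_ (sq_lintegral_le_lintegral_sq hx')
    gcongr
    -- If the average is not a convergent integral, the right side is infinite, so no integrability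
    -- of `g` is needed.
    by_cases hi : Integrable (fun t => g (x + y t)) μ
    · have : (∫ t, g (x + y t) ∂μ) - g x = ∫ t, (g (x + y t) - g x) ∂μ := by
        rw [integral_sub hi (integrable_const _)]; simp
      rw [this]
      exact enorm_integral_le_lintegral_enorm _
    · have : ∫⁻ t, ‖g (x + y t) - g x‖ₑ ∂μ = ⊤ := by
        by_contra hne
        apply hi
        have h2 : Integrable (fun t => g (x + y t) - g x) μ :=
          ⟨hx', lt_top_iff_ne_top.2 hne⟩
        refine (h2.add (integrable_const (g x))).congr (Eventually.of_forall fun t => ?_)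
        simp
      rw [this]; exact le_top
  have hsq : eLpNorm (fun x => (∫ t, g (x + y t) ∂μ) - g x) 2 volume ^ 2 ≤ δ ^ 2 := by
    rw [eLpNorm_two_sq]
    calc _ ≤ ∫⁻ x, ∫⁻ t, ‖g (x + y t) - g x‖ₑ ^ 2 ∂μ := lintegral_mono_ae key
      _ = ∫⁻ t, (∫⁻ x, ‖g (x + y t) - g x‖ₑ ^ 2) ∂μ := by
        rw [lintegral_lintegral_swap]
        exact (hm3.enorm.pow_const 2)
      _ ≤ ∫⁻ t, δ ^ 2 ∂μ := by
        refine lintegral_mono_ae ?_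
        filter_upwards [h] with t ht
        rw [← eLpNorm_two_sq]
        gcongr
      _ = δ ^ 2 := by simp
  exact (ENNReal.pow_le_pow_left_iff (by norm_num)).1 hsq

end WeakCalculus

/-! ### Weak directional derivatives and difference quotients. -/

section WeakDerivatives

open Filter Topology

variable {n : ℕ} {E E' : Type*} [NormedAddCommGroup E] [NormedSpace ℝ E] [CompleteSpace E]
  [NormedAddCommGroup E'] [NormedSpace ℝ E'] [CompleteSpace E']

/-- `G` is the weak derivative of `g` in direction `e` in the open set `U`. -/
def HasWeakDeriv (U : Set (Vec n)) (e : Vec n) (g G : Vec n → E) : Prop :=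
  ∀ φ : Vec n → ℝ, ContDiff ℝ ∞ φ → HasCompactSupport φ → tsupport φ ⊆ U →
    ∫ x, fderiv ℝ φ x e • g x = -∫ x, φ x • G x

instance isProbabilityMeasure_restrict_Ioc_zero_one :
    IsProbabilityMeasure (volume.restrict (Ioc (0 : ℝ) 1)) :=
  ⟨by simp⟩

theorem exists_bound_fderiv {φ : Vec n → ℝ} (h1 : ContDiff ℝ ∞ φ) (h2 : HasCompactSupport φ)
    (e : Vec n) : ∃ C : ℝ, ∀ x, ‖fderiv ℝ φ x e‖ ≤ C := by
  have hc : Continuous (fun x => fderiv ℝ φ x e) :=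
    (h1.continuous_fderiv (by simp)).clm_apply continuous_const
  have hs : HasCompactSupport (fun x => fderiv ℝ φ x e) := h2.fderiv_apply ℝ e
  exact hs.exists_bound_of_continuous hc

theorem integrable_translate_prod {G : Vec n → E} (hG : Integrable G) {T : Type*}
    [MeasurableSpace T] {μ : Measure T} [IsFiniteMeasure μ] {y : T → Vec n} (hy : Measurable y) :
    Integrable (fun z : Vec n × T => G (z.1 + y z.2)) (volume.prod μ) := by
  have hm : AEStronglyMeasurable (fun z : Vec n × T => G (z.1 + y z.2)) (volume.prod μ) :=
    hG.1.comp_quasiMeasurePreserving (quasiMeasurePreserving_add_comp hy)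
  rw [integrable_prod_iff' hm]
  refine ⟨Eventually.of_forall fun t => hG.comp_add_right (y t), ?_⟩
  have : ∀ t, ∫ x, ‖G (x + y t)‖ = ∫ x, ‖G x‖ := fun t =>
    integral_add_right_eq_self (fun x => ‖G x‖) (y t)
  simp only [this]
  exact integrable_const _

/-- Difference quotients of a function are averages of its weak derivative. -/
theorem HasWeakDeriv.sub_eq_average {e : Vec n} {g G : Vec n → E}
    (h : HasWeakDeriv univ e g G) (hg : Integrable g) (hG : Integrable G) (τ : ℝ) :
    ∀ᵐ x, g (x + τ • e) - g x = τ • ∫ t in Ioc (0 : ℝ) 1, G (x + (t * τ) • e) := by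
  have hy : Measurable (fun t : ℝ => (t * τ) • e) := by fun_prop
  have hprod := integrable_translate_prod hG (μ := volume.restrict (Ioc (0 : ℝ) 1)) hy
  have hR : Integrable (fun x => ∫ t in Ioc (0 : ℝ) 1, G (x + (t * τ) • e)) :=
    hprod.integral_prod_left
  -- Test with `φ`: the increment moves onto `φ`, is written as an integral of its derivative along
  -- the segment, and for each `t` the definition of the weak derivative is applied to the translate
  -- of `φ`; Fubini exchanges the integrals.
  refine ae_eq_of_integral_contDiff_smul_eq
    ((hg.comp_add_right _).sub hg).locallyIntegrable (hR.smul τ).locallyIntegrable ?_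
  intro φ hφ hφs
  have hbd : ∃ C, ∀ x, ‖φ x‖ ≤ C := hφs.exists_bound_of_continuous hφ.continuous
  obtain ⟨C, hC⟩ := hbd
  obtain ⟨C', hC'⟩ := exists_bound_fderiv hφ hφs e
  have i1 : Integrable (fun x => φ x • g (x + τ • e)) :=
    (hg.comp_add_right (τ • e)).bdd_smul C hφ.continuous.aestronglyMeasurable
      (Eventually.of_forall hC)
  have i2 : Integrable (fun x => φ x • g x) :=
    hg.bdd_smul C hφ.continuous.aestronglyMeasurable (Eventually.of_forall hC)
  have i3 : Integrable (fun x => φ (x - τ • e) • g x) :=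
    hg.bdd_smul C (hφ.continuous.comp (by fun_prop)).aestronglyMeasurable
      (Eventually.of_forall fun x => hC _)
  have e1 : ∫ x, φ x • (g (x + τ • e) - g x) = ∫ x, (φ (x - τ • e) - φ x) • g x := by
    simp only [smul_sub, sub_smul]
    rw [integral_sub i1 i2, integral_sub i3 i2]
    congr 1
    rw [← integral_add_right_eq_self (fun x => φ (x - τ • e) • g x) (τ • e)]
    simp
  have hcd : Continuous (fun x => fderiv ℝ φ x e) :=
    (hφ.continuous_fderiv (by simp)).clm_apply continuous_const
  have e2 : ∀ x, φ (x - τ • e) - φ x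
      = ∫ t in Ioc (0 : ℝ) 1, -τ * fderiv ℝ φ (x - (t * τ) • e) e := by
    intro x
    have hd : ∀ t ∈ uIcc (0 : ℝ) 1, HasDerivAt (fun t : ℝ => φ (x - (t * τ) • e))
        (-τ * fderiv ℝ φ (x - (t * τ) • e) e) t := by
      intro t _
      have h1 : HasDerivAt (fun t : ℝ => x - (t * τ) • e) (-(τ • e)) t := by
        have := (((hasDerivAt_id t).mul_const τ).smul_const e).const_sub x
        simpa using this
      have h2 := ((hφ.differentiable (by simp)).differentiableAt
        (x := x - (t * τ) • e)).hasFDerivAt.comp_hasDerivAt t h1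
      refine h2.congr_deriv ?_
      simp
    have := intervalIntegral.integral_eq_sub_of_hasDerivAt hd
      (Continuous.intervalIntegrable (by fun_prop) _ _)
    rw [← intervalIntegral.integral_of_le zero_le_one, this]
    simp
  have hprod2 : Integrable (fun z : Vec n × ℝ =>
      (-τ * fderiv ℝ φ (z.1 - (z.2 * τ) • e) e) • g z.1)
      (volume.prod (volume.restrict (Ioc (0 : ℝ) 1))) := by
    refine (hg.comp_fst _).bdd_smul (‖τ‖ * C') (Continuous.aestronglyMeasurable (by fun_prop))
      (Eventually.of_forall fun z => ?_)
    rw [norm_mul, norm_neg]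
    gcongr
    exact hC' _
  have hprod3 : Integrable (fun z : Vec n × ℝ => φ z.1 • τ • G (z.1 + (z.2 * τ) • e))
      (volume.prod (volume.restrict (Ioc (0 : ℝ) 1))) :=
    (hprod.smul τ).bdd_smul C (Continuous.aestronglyMeasurable (by fun_prop))
      (Eventually.of_forall fun z => hC _)
  have e3 : ∀ t : ℝ, ∫ x, (-τ * fderiv ℝ φ (x - (t * τ) • e) e) • g x
      = ∫ x, φ x • τ • G (x + (t * τ) • e) := by
    intro t
    have hw := h (fun x => φ (x - (t * τ) • e)) (hφ.comp (by fun_prop))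
      (hφs.comp_homeomorph (Homeomorph.subRight ((t * τ) • e))) (subset_univ _)
    have hf : ∀ x, fderiv ℝ (fun x => φ (x - (t * τ) • e)) x e
        = fderiv ℝ φ (x - (t * τ) • e) e := by
      intro x; rw [fderiv_comp_sub]
    simp only [hf] at hw
    have hs : ∀ x, (-τ * fderiv ℝ φ (x - (t * τ) • e) e) • g x
        = -τ • fderiv ℝ φ (x - (t * τ) • e) e • g x := fun x => mul_smul _ _ _
    simp only [hs]
    rw [integral_smul, hw, smul_neg, neg_smul, neg_neg]
    rw [← integral_add_right_eq_self (fun x => φ (x - (t * τ) • e) • G x) ((t * τ) • e),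
      ← integral_smul]
    refine integral_congr_ae (Eventually.of_forall fun x => ?_)
    simp only [add_sub_cancel_right]
    rw [smul_comm]
  rw [e1]
  calc ∫ x, (φ (x - τ • e) - φ x) • g x
      = ∫ x, ∫ t in Ioc (0 : ℝ) 1, (-τ * fderiv ℝ φ (x - (t * τ) • e) e) • g x := by
        refine integral_congr_ae (Eventually.of_forall fun x => ?_)
        simp only
        rw [e2 x, integral_smul_const]
    _ = ∫ t in Ioc (0 : ℝ) 1, (∫ x, (-τ * fderiv ℝ φ (x - (t * τ) • e) e) • g x) :=
        integral_integral_swap hprod2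
    _ = ∫ t in Ioc (0 : ℝ) 1, (∫ x, φ x • τ • G (x + (t * τ) • e)) := by simp only [e3]
    _ = ∫ x, ∫ t in Ioc (0 : ℝ) 1, φ x • τ • G (x + (t * τ) • e) :=
        (integral_integral_swap hprod3).symm
    _ = _ := by simp only [integral_smul]

/-- The quotient is an average of translates of `G` by vectors no longer than `|τ| ‖e‖`, each close
to `G` in `L²`. -/
theorem HasWeakDeriv.tendsto_diffQuot {e : Vec n} {g G : Vec n → E}
    (h : HasWeakDeriv univ e g G) (hg : Integrable g) (hG : Integrable G)
    (hG2 : MemLp G 2 volume) :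
    Tendsto (fun τ : ℝ => eLpNorm (fun x => τ⁻¹ • (g (x + τ • e) - g x) - G x) 2 volume)
      (𝓝[≠] 0) (𝓝 0) := by
  rw [ENNReal.tendsto_nhds_zero]
  intro ε hε
  have h1 := (ENNReal.tendsto_nhds_zero.1 (tendsto_eLpNorm_translate_sub hG2)) ε hε
  rw [Metric.eventually_nhds_iff] at h1
  obtain ⟨r, hr, h1⟩ := h1
  have h2 : ∀ᶠ τ : ℝ in 𝓝[≠] 0, ‖τ • e‖ < r := by
    have : Tendsto (fun τ : ℝ => ‖τ • e‖) (𝓝[≠] 0) (𝓝 0) := by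
      have hc : Continuous (fun τ : ℝ => ‖τ • e‖) := by fun_prop
      have := hc.tendsto 0
      simp only [zero_smul, norm_zero] at this
      exact this.mono_left nhdsWithin_le_nhds
    exact this.eventually (gt_mem_nhds hr)
  filter_upwards [h2, self_mem_nhdsWithin] with τ hτ hτ0
  have hτ0 : τ ≠ 0 := hτ0
  have hy : Measurable (fun t : ℝ => (t * τ) • e) := by fun_prop
  have h3 := eLpNorm_average_translate_sub_le (μ := volume.restrict (Ioc (0 : ℝ) 1)) hy
    hG2.1 (δ := ε) (by
      rw [ae_restrict_iff' measurableSet_Ioc]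
      refine Eventually.of_forall fun t ht => ?_
      apply h1
      rw [dist_zero_right, mul_smul, norm_smul, Real.norm_of_nonneg ht.1.le]
      exact lt_of_le_of_lt (mul_le_of_le_one_left (norm_nonneg _) ht.2) hτ)
  refine le_trans (le_of_eq (eLpNorm_congr_ae ?_)) h3
  filter_upwards [h.sub_eq_average hg hG τ] with x hx
  rw [hx, smul_smul, inv_mul_cancel₀ hτ0, one_smul]

end WeakDerivatives

/-! ### Products with cutoffs and the chain rule. -/

section WeakProducts

open Filter Topology

variable {n : ℕ} {E E' : Type*} [NormedAddCommGroup E] [NormedSpace ℝ E] [CompleteSpace E]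
  [NormedAddCommGroup E'] [NormedSpace ℝ E'] [CompleteSpace E']

theorem integrable_smul_of_locallyIntegrableOn {U : Set (Vec n)} {g : Vec n → E}
    (hg : LocallyIntegrableOn g U volume) {c : Vec n → ℝ} (hc : Continuous c)
    (hcs : HasCompactSupport c) (hcU : tsupport c ⊆ U) : Integrable (fun x => c x • g x) := by
  have hK : IsCompact (tsupport c) := hcs
  have h1 : IntegrableOn g (tsupport c) volume := hg.integrableOn_compact_subset hcU hK
  obtain ⟨C, hC⟩ := hcs.exists_bound_of_continuous hc
  have h2 : IntegrableOn (fun x => c x • g x) (tsupport c) volume :=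
    h1.bdd_smul C hc.aestronglyMeasurable (Eventually.of_forall hC)
  refine (integrableOn_iff_integrable_of_support_subset ?_).1 h2
  intro x hx
  refine subset_tsupport c ?_
  intro h0
  exact hx (by simp [h0])

theorem HasCompactSupport.fderiv_apply_tsupport_subset {χ : Vec n → ℝ} (e : Vec n) :
    tsupport (fun x => fderiv ℝ χ x e) ⊆ tsupport χ :=
  (closure_mono (fun x hx => by
    have : fderiv ℝ χ x ≠ 0 := fun h => hx (by simp [h])
    exact this)).trans (tsupport_fderiv_subset ℝ)

theorem integrable_weakDeriv_smul {U : Set (Vec n)} {e : Vec n} {g G : Vec n → E}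
    (hg : LocallyIntegrableOn g U volume) (hG : LocallyIntegrableOn G U volume)
    {χ : Vec n → ℝ} (hχ : ContDiff ℝ ∞ χ) (hχs : HasCompactSupport χ) (hχU : tsupport χ ⊆ U) :
    Integrable (fun x => χ x • G x + fderiv ℝ χ x e • g x) := by
  refine (integrable_smul_of_locallyIntegrableOn hG hχ.continuous hχs hχU).add
    (integrable_smul_of_locallyIntegrableOn hg
      ((hχ.continuous_fderiv (by simp)).clm_apply continuous_const) (hχs.fderiv_apply ℝ e)
      ((HasCompactSupport.fderiv_apply_tsupport_subset e).trans hχU))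

/-- Product of a weakly differentiable function with a smooth cutoff function. -/
theorem HasWeakDeriv.smul_cutoff {U : Set (Vec n)} {e : Vec n} {g G : Vec n → E}
    (h : HasWeakDeriv U e g G) (hg : LocallyIntegrableOn g U volume)
    (hG : LocallyIntegrableOn G U volume) {χ : Vec n → ℝ} (hχ : ContDiff ℝ ∞ χ)
    (hχs : HasCompactSupport χ) (hχU : tsupport χ ⊆ U) :
    HasWeakDeriv univ e (fun x => χ x • g x) (fun x => χ x • G x + fderiv ℝ χ x e • g x) := by
  intro φ hφ hφs _
  have hcd : ∀ {f : Vec n → ℝ}, ContDiff ℝ ∞ f → Continuous (fun x => fderiv ℝ f x e) :=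
    fun hf => (hf.continuous_fderiv (by simp)).clm_apply continuous_const
  have hsub : ∀ f : Vec n → ℝ, tsupport (fun x => f x * χ x) ⊆ U := fun f =>
    (tsupport_mul_subset_right (f := f) (g := χ)).trans hχU
  have h1 := h (fun x => φ x * χ x) (hφ.mul hχ) (hχs.mul_left) (hsub φ)
  have hd : ∀ x, fderiv ℝ (fun x => φ x * χ x) x e
      = fderiv ℝ φ x e * χ x + fderiv ℝ χ x e * φ x := by
    intro x
    have := fderiv_fun_mul (hφ.differentiable (by simp) x) (hχ.differentiable (by simp) x)
    rw [this]
    simp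
    ring
  have i1 : Integrable (fun x => (fderiv ℝ φ x e * χ x) • g x) :=
    integrable_smul_of_locallyIntegrableOn hg ((hcd hφ).mul hχ.continuous) hχs.mul_left
      (hsub _)
  have i2 : Integrable (fun x => (fderiv ℝ χ x e * φ x) • g x) :=
    integrable_smul_of_locallyIntegrableOn hg ((hcd hχ).mul hφ.continuous) hφs.mul_left
      ((tsupport_mul_subset_left (f := fun x => fderiv ℝ χ x e) (g := φ)).trans
        ((HasCompactSupport.fderiv_apply_tsupport_subset e).trans hχU))
  have i3 : Integrable (fun x => (φ x * χ x) • G x) :=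
    integrable_smul_of_locallyIntegrableOn hG (hφ.continuous.mul hχ.continuous) hχs.mul_left
      (hsub φ)
  simp only [hd, add_smul] at h1
  rw [integral_add i1 i2] at h1
  have i3' : Integrable (fun x => φ x • χ x • G x) := by simpa only [mul_smul] using i3
  have i2' : Integrable (fun x => φ x • fderiv ℝ χ x e • g x) := by
    refine i2.congr (Eventually.of_forall fun x => ?_)
    simp only [smul_smul, mul_comm]
  simp only [smul_add]
  rw [integral_add i3' i2', neg_add]
  have e1 : ∫ x, φ x • χ x • G x = ∫ x, (φ x * χ x) • G x := by simp only [mul_smul]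
  have e2 : ∫ x, φ x • fderiv ℝ χ x e • g x = ∫ x, (fderiv ℝ χ x e * φ x) • g x := by
    simp only [smul_smul, mul_comm]
  have e3 : ∫ x, fderiv ℝ φ x e • χ x • g x = ∫ x, (fderiv ℝ φ x e * χ x) • g x := by
    simp only [mul_smul]
  rw [e1, e2, e3, ← h1]
  abel

theorem integral_norm_mul_norm_le {α : Type*} [MeasurableSpace α] {μ : Measure α} {f : α → E}
    {g : α → E'} (hf : AEStronglyMeasurable f μ) (hg : AEStronglyMeasurable g μ) :
    ENNReal.ofReal (∫ x, ‖f x‖ * ‖g x‖ ∂μ) ≤ eLpNorm f 2 μ * eLpNorm g 2 μ := by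
  have h1 : ENNReal.ofReal (∫ x, ‖f x‖ * ‖g x‖ ∂μ) ≤ ∫⁻ x, ‖‖f x‖ * ‖g x‖‖ₑ ∂μ := by
    refine le_trans ?_ (enorm_integral_le_lintegral_enorm _)
    rw [← ofReal_norm]
    exact ENNReal.ofReal_le_ofReal (le_abs_self _)
  refine h1.trans ?_
  have h2 := ENNReal.lintegral_mul_le_Lp_mul_Lq μ Real.HolderConjugate.two_two
    hf.enorm hg.enorm
  simp only [Pi.mul_apply] at h2
  rw [eLpNorm_eq_lintegral_rpow_enorm_toReal (by norm_num) (by norm_num),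
    eLpNorm_eq_lintegral_rpow_enorm_toReal (by norm_num) (by norm_num)]
  simpa [enorm_mul] using h2

theorem tendsto_integral_norm_mul_norm_zero {α ι : Type*} [MeasurableSpace α] {μ : Measure α}
    {l : Filter ι} {f : ι → α → E} {g : α → E'} (hf : ∀ i, AEStronglyMeasurable (f i) μ)
    (hg : MemLp g 2 μ) (h : Tendsto (fun i => eLpNorm (f i) 2 μ) l (𝓝 0)) :
    Tendsto (fun i => ∫ x, ‖f i x‖ * ‖g x‖ ∂μ) l (𝓝 0) := by
  have h1 : Tendsto (fun i => eLpNorm (f i) 2 μ * eLpNorm g 2 μ) l (𝓝 0) := by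
    have := ENNReal.Tendsto.mul_const (b := eLpNorm g 2 μ) h (Or.inr hg.eLpNorm_ne_top)
    simpa using this
  have h2 : Tendsto (fun i => ENNReal.ofReal (∫ x, ‖f i x‖ * ‖g x‖ ∂μ)) l (𝓝 0) :=
    tendsto_of_tendsto_of_tendsto_of_le_of_le tendsto_const_nhds h1 (fun i => zero_le)
      (fun i => integral_norm_mul_norm_le (hf i) hg.1)
  have h3 := (ENNReal.tendsto_toReal ENNReal.zero_ne_top).comp h2
  simp only [ENNReal.toReal_zero] at h3
  refine h3.congr fun i => ?_
  exact ENNReal.toReal_ofReal (integral_nonneg fun x => by positivity)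

theorem integrable_norm_mul_norm {α : Type*} [MeasurableSpace α] {μ : Measure α} {f : α → E}
    {g : α → E'} (hf : MemLp f 2 μ) (hg : MemLp g 2 μ) :
    Integrable (fun x => ‖f x‖ * ‖g x‖) μ := by
  have := hf.norm.integrable_mul hg.norm
  exact this

theorem integral_fderiv_smul_const {φ : Vec n → ℝ} (hφ : ContDiff ℝ ∞ φ)
    (hφs : HasCompactSupport φ) (e : Vec n) (c : E) : ∫ x, fderiv ℝ φ x e • c = 0 := by
  have hcd : Continuous (fun x => fderiv ℝ φ x e) :=
    (hφ.continuous_fderiv (by simp)).clm_apply continuous_const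
  have hi : Integrable (fun x => fderiv ℝ φ x e) :=
    hcd.integrable_of_hasCompactSupport (hφs.fderiv_apply ℝ e)
  rw [integral_smul_const]
  have h := integral_mul_fderiv_eq_neg_fderiv_mul_of_integrable (𝕜 := ℝ) (μ := volume)
    (f := fun _ : Vec n => (1 : ℝ)) (g := φ) (v := e) (by simp) (by simpa using hi)
    (by simpa using hφ.continuous.integrable_of_hasCompactSupport hφs)
    (fun x _ => by fun_prop) (fun x _ => hφ.differentiable (by simp) x)
  simp at h
  rw [h, zero_smul]

/-- Chain rule for Lipschitz functions of class `C¹`. -/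
theorem HasWeakDeriv.comp_lipschitz {e : Vec n} {g G : Vec n → E} (h : HasWeakDeriv univ e g G)
    (hg : Integrable g) (hG : Integrable G) (hG2 : MemLp G 2 volume)
    {Ψ : E → E'} {K : NNReal} (hΨ : Differentiable ℝ Ψ) (hK : LipschitzWith K Ψ) :
    HasWeakDeriv univ e (fun x => Ψ (g x)) (fun x => fderiv ℝ Ψ (g x) (G x)) := by
  intro φ hφ hφs _
  have hcd : Continuous (fun x => fderiv ℝ φ x e) :=
    (hφ.continuous_fderiv (by simp)).clm_apply continuous_const
  obtain ⟨C, hC⟩ := hφs.exists_bound_of_continuous hφ.continuous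
  obtain ⟨C', hC'⟩ := exists_bound_fderiv hφ hφs e
  have hΨm : ∀ {f : Vec n → E}, AEStronglyMeasurable f volume →
      AEStronglyMeasurable (fun x => Ψ (f x)) volume := fun hf =>
    hΨ.continuous.comp_aestronglyMeasurable hf
  -- Subtracting `Ψ 0` makes the composition integrable, and the left side does not change because
  -- derivatives of test functions have integral zero.
  let W : Vec n → E' := fun x => Ψ (g x) - Ψ 0
  have hWb : ∀ x, ‖W x‖ ≤ K * ‖g x‖ := fun x => by
    have := hK.norm_sub_le (g x) 0
    simpa using this
  have hW : Integrable W := by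
    refine Integrable.mono' (hg.norm.const_mul (K : ℝ)) ((hΨm hg.1).sub aestronglyMeasurable_const)
      (Eventually.of_forall hWb)
  have hφ2 : MemLp φ 2 volume := hφ.continuous.memLp_of_hasCompactSupport hφs
  have eqL : ∫ x, fderiv ℝ φ x e • Ψ (g x) = ∫ x, fderiv ℝ φ x e • W x := by
    have i1 : Integrable (fun x => fderiv ℝ φ x e • W x) :=
      hW.bdd_smul C' hcd.aestronglyMeasurable (Eventually.of_forall hC')
    have i2 : Integrable (fun x => fderiv ℝ φ x e • Ψ 0) :=
      (hcd.integrable_of_hasCompactSupport (hφs.fderiv_apply ℝ e)).smul_const _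
    have : ∀ x, fderiv ℝ φ x e • Ψ (g x) = fderiv ℝ φ x e • W x + fderiv ℝ φ x e • Ψ 0 := by
      intro x; rw [← smul_add]; simp [W]
    simp only [this]
    rw [integral_add i1 i2, integral_fderiv_smul_const hφ hφs, add_zero]
  have hlim1 : Tendsto (fun τ : ℝ => ∫ x, (τ⁻¹ * (φ x - φ (x - τ • e))) • W x) (𝓝[≠] 0)
      (𝓝 (∫ x, fderiv ℝ φ x e • W x)) := by
    refine tendsto_integral_filter_of_dominated_convergence (fun x => C' * ‖W x‖)
      (Eventually.of_forall fun τ => ?_) ?_ (hW.norm.const_mul _) (Eventually.of_forall fun x => ?_)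
    · exact (Continuous.aestronglyMeasurable (by have := hφ.continuous; fun_prop)).smul hW.1
    · filter_upwards [self_mem_nhdsWithin] with τ hτ
      have hτ : τ ≠ 0 := hτ
      refine Eventually.of_forall fun x => ?_
      rw [norm_smul]
      gcongr
      have hd : ∀ t ∈ (univ : Set ℝ), HasDerivWithinAt (fun t : ℝ => φ (x - t • e))
          (-fderiv ℝ φ (x - t • e) e) univ t := by
        intro t _
        have h1 : HasDerivAt (fun t : ℝ => x - t • e) (-e) t := by
          have := ((hasDerivAt_id t).smul_const e).const_sub x
          simpa using this
        have h2 := (hφ.differentiable (by simp) (x - t • e)).hasFDerivAt.comp_hasDerivAt t h1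
        refine (h2.congr_deriv ?_).hasDerivWithinAt
        simp
      have := convex_univ.norm_image_sub_le_of_norm_hasDerivWithin_le hd
        (fun t _ => by rw [norm_neg]; exact hC' _) (mem_univ τ) (mem_univ 0)
      simp only [zero_smul, sub_zero, zero_sub, norm_neg] at this
      rw [norm_mul, norm_inv]
      rw [inv_mul_le_iff₀ (norm_pos_iff.2 hτ), mul_comm]
      exact this
    · refine Tendsto.smul_const ?_ _
      have h1 : HasDerivAt (fun t : ℝ => φ x - φ (x - t • e)) (fderiv ℝ φ x e) 0 := by
        have h1 : HasDerivAt (fun t : ℝ => x - t • e) (-e) 0 := by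
          have := ((hasDerivAt_id (0 : ℝ)).smul_const e).const_sub x
          simpa using this
        have h2 := ((hφ.differentiable (by simp) (x - (0 : ℝ) • e)).hasFDerivAt.comp_hasDerivAt
          (0 : ℝ) h1).const_sub (φ x)
        refine h2.congr_deriv ?_
        simp
      have := h1.tendsto_slope_zero
      simpa using this
  -- Discrete integration by parts. The increment of `Ψ ∘ g` is then split at `Ψ (g + τ G)`: one
  -- part is small by the Lipschitz bound and the `L²` convergence of the quotients of `g`, the
  -- other converges pointwise under the majorant `K |G| |φ|`. Hence mere differentiability of `Ψ`
  -- suffices.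
  have hint : ∀ τ : ℝ, ∫ x, (τ⁻¹ * (φ x - φ (x - τ • e))) • W x
      = -∫ x, φ x • τ⁻¹ • (Ψ (g (x + τ • e)) - Ψ (g x)) := by
    intro τ
    have i1 : Integrable (fun x => φ x • W x) :=
      hW.bdd_smul C hφ.continuous.aestronglyMeasurable (Eventually.of_forall hC)
    have i2 : Integrable (fun x => φ (x - τ • e) • W x) :=
      hW.bdd_smul C (hφ.continuous.comp (by fun_prop)).aestronglyMeasurable
        (Eventually.of_forall fun x => hC _)
    have i3 : Integrable (fun x => φ x • W (x + τ • e)) :=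
      (hW.comp_add_right (τ • e)).bdd_smul C hφ.continuous.aestronglyMeasurable
        (Eventually.of_forall hC)
    have e1 : ∫ x, φ (x - τ • e) • W x = ∫ x, φ x • W (x + τ • e) := by
      rw [← integral_add_right_eq_self (fun x => φ (x - τ • e) • W x) (τ • e)]
      simp
    have e2 : ∀ x, (τ⁻¹ * (φ x - φ (x - τ • e))) • W x
        = τ⁻¹ • (φ x • W x - φ (x - τ • e) • W x) := by
      intro x; rw [mul_smul, sub_smul]
    have e3 : ∀ x, φ x • τ⁻¹ • (Ψ (g (x + τ • e)) - Ψ (g x))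
        = τ⁻¹ • (φ x • W (x + τ • e) - φ x • W x) := by
      intro x; rw [← smul_sub, smul_comm]; simp [W]
    simp only [e2, e3]
    rw [integral_smul, integral_smul, integral_sub i1 i2, integral_sub i3 i1, e1, ← smul_neg,
      neg_sub]
  have hmd : ∀ τ : ℝ, AEStronglyMeasurable
      (fun x => τ⁻¹ • (g (x + τ • e) - g x) - G x) volume := fun τ =>
    (((hg.comp_add_right (τ • e)).1.sub hg.1).const_smul _).sub hG.1
  have hKi : ∀ τ : ℝ, τ ≠ 0 → ∀ a b : E, ‖τ⁻¹ • (Ψ a - Ψ b)‖ ≤ K * ‖τ⁻¹ • (a - b)‖ := by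
    intro τ _ a b
    rw [norm_smul, norm_smul]
    have := hK.norm_sub_le a b
    calc ‖τ⁻¹‖ * ‖Ψ a - Ψ b‖ ≤ ‖τ⁻¹‖ * (K * ‖a - b‖) := by gcongr
      _ = _ := by ring
  have hm1 : ∀ τ : ℝ, AEStronglyMeasurable
      (fun x => φ x • τ⁻¹ • (Ψ (g (x + τ • e)) - Ψ (g x + τ • G x))) volume := fun τ =>
    hφ.continuous.aestronglyMeasurable.smul
      (((hΨm (hg.comp_add_right (τ • e)).1).sub (hΨm (hg.1.add (hG.1.const_smul τ)))).const_smul _)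
  have hm2 : ∀ τ : ℝ, AEStronglyMeasurable
      (fun x => φ x • τ⁻¹ • (Ψ (g x + τ • G x) - Ψ (g x))) volume := fun τ =>
    hφ.continuous.aestronglyMeasurable.smul
      (((hΨm (hg.1.add (hG.1.const_smul τ))).sub (hΨm hg.1)).const_smul _)
  have hGφ : Integrable (fun x => ‖G x‖ * ‖φ x‖) := integrable_norm_mul_norm hG2 hφ2
  have hb1 : ∀ τ : ℝ, τ ≠ 0 → ∀ x,
      ‖φ x • τ⁻¹ • (Ψ (g (x + τ • e)) - Ψ (g x + τ • G x))‖
        ≤ K * (‖τ⁻¹ • (g (x + τ • e) - g x) - G x‖ * ‖φ x‖) := by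
    intro τ hτ x
    rw [norm_smul]
    have h1 := hKi τ hτ (g (x + τ • e)) (g x + τ • G x)
    have h2 : τ⁻¹ • (g (x + τ • e) - (g x + τ • G x)) = τ⁻¹ • (g (x + τ • e) - g x) - G x := by
      rw [← sub_sub, smul_sub _ _ (τ • G x), smul_smul, inv_mul_cancel₀ hτ, one_smul]
    rw [h2] at h1
    calc _ ≤ ‖φ x‖ * (K * ‖τ⁻¹ • (g (x + τ • e) - g x) - G x‖) := by gcongr
      _ = _ := by ring
  have hb2 : ∀ τ : ℝ, τ ≠ 0 → ∀ x,
      ‖φ x • τ⁻¹ • (Ψ (g x + τ • G x) - Ψ (g x))‖ ≤ K * (‖G x‖ * ‖φ x‖) := by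
    intro τ hτ x
    rw [norm_smul]
    have h1 := hKi τ hτ (g x + τ • G x) (g x)
    rw [add_sub_cancel_left, smul_smul, inv_mul_cancel₀ hτ, one_smul] at h1
    calc _ ≤ ‖φ x‖ * (K * ‖G x‖) := by gcongr
      _ = _ := by ring
  have hlim2 : Tendsto (fun τ : ℝ => ∫ x, φ x • τ⁻¹ • (Ψ (g x + τ • G x) - Ψ (g x))) (𝓝[≠] 0)
      (𝓝 (∫ x, φ x • fderiv ℝ Ψ (g x) (G x))) := by
    refine tendsto_integral_filter_of_dominated_convergence (fun x => K * (‖G x‖ * ‖φ x‖))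
      (Eventually.of_forall hm2) ?_ (hGφ.const_mul _) (Eventually.of_forall fun x => ?_)
    · filter_upwards [self_mem_nhdsWithin] with τ hτ
      exact Eventually.of_forall (hb2 τ hτ)
    · refine Tendsto.const_smul ?_ _
      have h1 : HasDerivAt (fun t : ℝ => Ψ (g x + t • G x)) (fderiv ℝ Ψ (g x) (G x)) 0 := by
        have h1 : HasDerivAt (fun t : ℝ => g x + t • G x) (G x) 0 := by
          have := ((hasDerivAt_id (0 : ℝ)).smul_const (G x)).const_add (g x)
          simpa using this
        have h2 := (hΨ (g x + (0 : ℝ) • G x)).hasFDerivAt.comp_hasDerivAt (0 : ℝ) h1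
        refine h2.congr_deriv ?_
        simp
      have := h1.tendsto_slope_zero
      simpa using this
  have hlim3 : Tendsto (fun τ : ℝ => ∫ x, φ x • τ⁻¹ • (Ψ (g (x + τ • e)) - Ψ (g x + τ • G x)))
      (𝓝[≠] 0) (𝓝 0) := by
    have h0 := (tendsto_integral_norm_mul_norm_zero hmd hφ2
      (h.tendsto_diffQuot hg hG hG2)).const_mul (K : ℝ)
    rw [mul_zero] at h0
    refine squeeze_zero_norm' ?_ h0
    have hev : ∀ᶠ τ : ℝ in 𝓝[≠] 0,
        eLpNorm (fun x => τ⁻¹ • (g (x + τ • e) - g x) - G x) 2 volume < 1 :=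
      (h.tendsto_diffQuot hg hG hG2).eventually (gt_mem_nhds (by norm_num))
    filter_upwards [self_mem_nhdsWithin, hev] with τ hτ hfin
    rw [← integral_const_mul]
    refine norm_integral_le_of_norm_le ?_ (Eventually.of_forall (hb1 τ hτ))
    exact (integrable_norm_mul_norm ⟨hmd τ, hfin.trans ENNReal.one_lt_top⟩ hφ2).const_mul _
  rw [eqL]
  refine tendsto_nhds_unique hlim1 ?_
  have hsum := (hlim3.add hlim2).neg
  rw [zero_add] at hsum
  refine hsum.congr' ?_
  have hev : ∀ᶠ τ : ℝ in 𝓝[≠] 0,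
      eLpNorm (fun x => τ⁻¹ • (g (x + τ • e) - g x) - G x) 2 volume < 1 :=
    (h.tendsto_diffQuot hg hG hG2).eventually (gt_mem_nhds (by norm_num))
  filter_upwards [self_mem_nhdsWithin, hev] with τ hτ hfin
  rw [hint τ, ← integral_add]
  · congr 1
    refine integral_congr_ae (Eventually.of_forall fun x => ?_)
    simp only
    rw [← smul_add, ← smul_add, sub_add_sub_cancel]
  · exact Integrable.mono' ((integrable_norm_mul_norm
      ⟨hmd τ, hfin.trans ENNReal.one_lt_top⟩ hφ2).const_mul _) (hm1 τ)
      (Eventually.of_forall (hb1 τ hτ))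
  · exact Integrable.mono' (hGφ.const_mul _) (hm2 τ) (Eventually.of_forall (hb2 τ hτ))

end WeakProducts

/-! ### Bounded chain rule and smooth approximation. -/

section Mollification

open Filter Topology

variable {n : ℕ} {E E' : Type*} [NormedAddCommGroup E] [NormedSpace ℝ E] [CompleteSpace E]
  [NormedAddCommGroup E'] [NormedSpace ℝ E'] [CompleteSpace E']

theorem HasWeakDeriv.congr_ae {U : Set (Vec n)} {e : Vec n} {g g' G G' : Vec n → E}
    (h : HasWeakDeriv U e g G) (hg : g =ᵐ[volume] g') (hG : G =ᵐ[volume] G') :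
    HasWeakDeriv U e g' G' := by
  intro φ h1 h2 h3
  have := h φ h1 h2 h3
  have e1 : ∫ x, fderiv ℝ φ x e • g x = ∫ x, fderiv ℝ φ x e • g' x :=
    integral_congr_ae (by filter_upwards [hg] with x hx; rw [hx])
  have e2 : ∫ x, φ x • G x = ∫ x, φ x • G' x :=
    integral_congr_ae (by filter_upwards [hG] with x hx; rw [hx])
  rw [← e1, ← e2, this]

/-- Chain rule for essentially bounded functions. -/
theorem HasWeakDeriv.comp_bounded {ι : Type*} [Fintype ι] {e : Vec n}
    {g G : Vec n → EuclideanSpace ℝ ι} (h : HasWeakDeriv univ e g G)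
    (hg : Integrable g) (hG : Integrable G) (hG2 : MemLp G 2 volume) {M : ℝ}
    (hM : ∀ᵐ x, ‖g x‖ ≤ M) {Ψ : EuclideanSpace ℝ ι → E'} (hΨ : ContDiff ℝ 1 Ψ) :
    HasWeakDeriv univ e (fun x => Ψ (g x)) (fun x => fderiv ℝ Ψ (g x) (G x)) := by
  -- `χ` equals 1 near every value of `g`, so `χ Ψ` is compactly supported, hence Lipschitz, and
  -- agrees there with `Ψ` to first order.
  let χ : ContDiffBump (0 : EuclideanSpace ℝ ι) :=
    ⟨|M| + 1, |M| + 2, by positivity, by linarith⟩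
  have hΨ' : ContDiff ℝ 1 (fun ξ => χ ξ • Ψ ξ) := (χ.contDiff (n := 1)).smul hΨ
  have hs : HasCompactSupport (fun ξ => χ ξ • Ψ ξ) := χ.hasCompactSupport.smul_right
  obtain ⟨K, hK⟩ := hΨ'.lipschitzWith_of_hasCompactSupport hs (by norm_num)
  have h1 := h.comp_lipschitz hg hG hG2 (hΨ'.differentiable (by norm_num)) hK
  refine h1.congr_ae ?_ ?_
  · filter_upwards [hM] with x hx
    have : χ (g x) = 1 := χ.one_of_mem_closedBall (by
      simp only [χ, Metric.mem_closedBall, dist_zero_right]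
      linarith [le_abs_self M])
    simp [this]
  · filter_upwards [hM] with x hx
    have hev : (fun ξ => χ ξ • Ψ ξ) =ᶠ[𝓝 (g x)] Ψ := by
      have : χ =ᶠ[𝓝 (g x)] 1 := χ.eventuallyEq_one_of_mem_ball (by
        simp only [χ, Metric.mem_ball, dist_zero_right]
        linarith [le_abs_self M])
      filter_upwards [this] with ξ hξ
      simp [hξ]
    rw [hev.fderiv_eq]

theorem tsupport_convolution_normed_subset {w : Vec n → E}
    (ρ : ContDiffBump (0 : Vec n)) :
    tsupport (convolution (ρ.normed volume) w (ContinuousLinearMap.lsmul ℝ ℝ) volume)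
      ⊆ Metric.cthickening ρ.rOut (tsupport w) := by
  refine closure_minimal ?_ Metric.isClosed_cthickening
  refine (support_convolution_subset _).trans ?_
  rintro _ ⟨a, ha, b, hb, rfl⟩
  rw [ρ.support_normed_eq] at ha
  refine Metric.mem_cthickening_of_dist_le _ b _ _ (subset_tsupport w hb) ?_
  simp only [Metric.mem_ball, dist_zero_right] at ha
  simpa using ha.le

/-- The kernel is a probability density, so mollification falls under the estimate for averages of
translates. -/
theorem convolution_normed_eq_average (ρ : ContDiffBump (0 : Vec n)) (w : Vec n → E) (x : Vec n) :
    convolution (ρ.normed volume) w (ContinuousLinearMap.lsmul ℝ ℝ) volume x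
      = ∫ t, w (x + -t) ∂(volume.withDensity fun t => ENNReal.ofReal (ρ.normed volume t)) := by
  rw [integral_withDensity_eq_integral_toReal_smul
    (ρ.continuous_normed.measurable.ennreal_ofReal) (by simp)]
  simp only [convolution_def, ContinuousLinearMap.lsmul_apply]
  refine integral_congr_ae (Eventually.of_forall fun t => ?_)
  simp only
  rw [ENNReal.toReal_ofReal (ρ.nonneg_normed t), sub_eq_add_neg]

theorem isProbabilityMeasure_withDensity_normed (ρ : ContDiffBump (0 : Vec n)) :
    IsProbabilityMeasure (volume.withDensity fun t => ENNReal.ofReal (ρ.normed volume t)) := by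
  refine ⟨?_⟩
  rw [withDensity_apply _ MeasurableSet.univ, Measure.restrict_univ,
    ← ofReal_integral_eq_lintegral_ofReal ρ.integrable_normed
      (Eventually.of_forall ρ.nonneg_normed), ρ.integral_normed, ENNReal.ofReal_one]

theorem eLpNorm_convolution_normed_sub_le (ρ : ContDiffBump (0 : Vec n)) {w : Vec n → E}
    (hw : AEStronglyMeasurable w volume) {δ : ℝ≥0∞}
    (h : ∀ y : Vec n, ‖y‖ < ρ.rOut → eLpNorm (fun x => w (x + y) - w x) 2 volume ≤ δ) :
    eLpNorm (fun x => convolution (ρ.normed volume) w (ContinuousLinearMap.lsmul ℝ ℝ) volume x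
      - w x) 2 volume ≤ δ := by
  haveI := isProbabilityMeasure_withDensity_normed ρ
  simp only [convolution_normed_eq_average]
  refine eLpNorm_average_translate_sub_le (y := fun t => -t) (by fun_prop) hw ?_
  rw [ae_withDensity_iff (ρ.continuous_normed.measurable.ennreal_ofReal)]
  refine Eventually.of_forall fun t ht => h _ ?_
  have : t ∈ Function.support (ρ.normed volume) := by
    intro h0
    exact ht (by simp [h0])
  rw [ρ.support_normed_eq] at this
  simpa using this

/-- The derivative falls on the kernel, and `y ↦ ρ(x - y)` is itself an admissible test function for
the weak derivative. -/
theorem HasWeakDeriv.fderiv_convolution {e : Vec n} {g G : Vec n → E}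
    (h : HasWeakDeriv univ e g G) (hg : LocallyIntegrable g) (ρ : ContDiffBump (0 : Vec n))
    (x : Vec n) :
    fderiv ℝ (convolution (ρ.normed volume) g (ContinuousLinearMap.lsmul ℝ ℝ) volume) x e
      = convolution (ρ.normed volume) G (ContinuousLinearMap.lsmul ℝ ℝ) volume x := by
  have hρ : ContDiff ℝ ∞ (ρ.normed volume : Vec n → ℝ) := ρ.contDiff_normed
  have hρs : HasCompactSupport (ρ.normed volume : Vec n → ℝ) := ρ.hasCompactSupport_normed
  have h1 := hρs.hasFDerivAt_convolution_left (ContinuousLinearMap.lsmul ℝ ℝ (E := E))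
    (μ := volume) (hρ.of_le (by exact_mod_cast le_top)) hg x
  rw [h1.fderiv, convolution_def]
  have hex := (hρs.fderiv ℝ).convolutionExists_left
    ((ContinuousLinearMap.lsmul ℝ ℝ (E := E)).precompL (Vec n)) (μ := volume)
    (hρ.continuous_fderiv (by simp)) hg x
  rw [ContinuousLinearMap.integral_apply hex]
  simp only [ContinuousLinearMap.precompL_apply, ContinuousLinearMap.lsmul_apply]
  rw [convolution_lsmul_swap]
  have hw := h (fun y => ρ.normed volume (x - y)) (hρ.comp (by fun_prop))
    (hρs.comp_homeomorph (Homeomorph.subLeft x)) (subset_univ _)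
  have hf : ∀ y, fderiv ℝ (fun y => ρ.normed volume (x - y)) y e
      = -fderiv ℝ (ρ.normed volume : Vec n → ℝ) (x - y) e := by
    intro y
    have h2 : HasFDerivAt (fun y => x - y) (-ContinuousLinearMap.id ℝ (Vec n)) y :=
      (hasFDerivAt_id y).const_sub x
    have h3 := ((hρ.differentiable (by simp) (x - y)).hasFDerivAt.comp y h2).fderiv
    have h4 : fderiv ℝ (fun y => ρ.normed volume (x - y)) y = _ := h3
    rw [h4]
    simp
  simp only [hf, neg_smul, integral_neg, neg_inj] at hw
  rw [← hw]
  rw [← integral_sub_left_eq_self _ volume x]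
  simp

/-- Approximation of compactly supported Sobolev functions by smooth functions. -/
theorem exists_smooth_approx {w : Vec n → E} {G : Fin n → Vec n → E} (hw : MemLp w 2 volume)
    (hws : HasCompactSupport w) (hG : ∀ i, MemLp (G i) 2 volume)
    (h : ∀ i, HasWeakDeriv univ (EuclideanSpace.single i 1) w (G i)) {ε : ℝ} (hε : 0 < ε) :
    ∃ φ : Vec n → E, ContDiff ℝ ∞ φ ∧ HasCompactSupport φ ∧
      tsupport φ ⊆ Metric.cthickening ε (tsupport w) ∧
      eLpNorm (fun x => φ x - w x) 2 volume ≤ ENNReal.ofReal ε ∧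
      ∀ i, eLpNorm (fun x => fderiv ℝ φ x (EuclideanSpace.single i 1) - G i x) 2 volume
        ≤ ENNReal.ofReal ε := by
  have hε' : (0 : ℝ≥0∞) < ENNReal.ofReal ε := ENNReal.ofReal_pos.2 hε
  have h1 : ∀ᶠ y in 𝓝 (0 : Vec n), eLpNorm (fun x => w (x + y) - w x) 2 volume
      ≤ ENNReal.ofReal ε ∧ ∀ i, eLpNorm (fun x => G i (x + y) - G i x) 2 volume
      ≤ ENNReal.ofReal ε := by
    refine ((ENNReal.tendsto_nhds_zero.1 (tendsto_eLpNorm_translate_sub hw)) _ hε').and ?_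
    rw [eventually_all]
    exact fun i => (ENNReal.tendsto_nhds_zero.1 (tendsto_eLpNorm_translate_sub (hG i))) _ hε'
  obtain ⟨r, hr, h2⟩ := Metric.eventually_nhds_iff.1 h1
  have hr' : 0 < min r ε := lt_min hr hε
  let ρ : ContDiffBump (0 : Vec n) := ⟨min r ε / 2, min r ε, by positivity, by linarith⟩
  have hloc : LocallyIntegrable w := hw.locallyIntegrable (by norm_num)
  have hρs : HasCompactSupport (ρ.normed volume : Vec n → ℝ) := ρ.hasCompactSupport_normed
  refine ⟨convolution (ρ.normed volume) w (ContinuousLinearMap.lsmul ℝ ℝ) volume, ?_, ?_, ?_, ?_,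
    fun i => ?_⟩
  · exact hρs.contDiff_convolution_left _ ρ.contDiff_normed hloc
  · exact hρs.convolution _ hws
  · exact (tsupport_convolution_normed_subset ρ).trans
      (Metric.cthickening_mono (min_le_right _ _) _)
  · refine eLpNorm_convolution_normed_sub_le ρ hw.1 fun y hy => (h2 ?_).1
    rw [dist_zero_right]; exact hy.trans_le (min_le_left _ _)
  · simp only [(h i).fderiv_convolution hloc ρ]
    refine eLpNorm_convolution_normed_sub_le ρ (hG i).1 fun y hy => (h2 ?_).2 i
    rw [dist_zero_right]; exact hy.trans_le (min_le_left _ _)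

end Mollification

/-! ### A subcritical Sobolev inequality in `W^{1,2}`. -/

section Sobolev

open Filter Topology

variable {n : ℕ}

theorem norm_fderiv_le_sum (φ : Vec n → ℝ) (x : Vec n) :
    ‖fderiv ℝ φ x‖ ≤ ∑ i, ‖fderiv ℝ φ x (EuclideanSpace.single i 1)‖ := by
  refine ContinuousLinearMap.opNorm_le_bound _ (by positivity) fun v => ?_
  have hv : v = ∑ i, v i • EuclideanSpace.single i (1 : ℝ) := by
    ext j
    simp [Finset.sum_apply, Pi.single_apply]
  conv_lhs => rw [hv]
  rw [map_sum, Finset.sum_mul]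
  refine (norm_sum_le _ _).trans (Finset.sum_le_sum fun i _ => ?_)
  rw [map_smul, norm_smul, mul_comm]
  gcongr
  exact PiLp.norm_apply_le v i

theorem exists_subseq_tendsto_ae {E : Type*} [NormedAddCommGroup E] {f : ℕ → Vec n → E}
    {g : Vec n → E} (hf : ∀ m, AEStronglyMeasurable (f m) volume)
    (hg : AEStronglyMeasurable g volume)
    (h : Tendsto (fun m => eLpNorm (fun x => f m x - g x) 2 volume) atTop (𝓝 0)) :
    ∃ ns : ℕ → ℕ, StrictMono ns ∧
      ∀ᵐ x, Tendsto (fun m => f (ns m) x) atTop (𝓝 (g x)) := by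
  have := tendstoInMeasure_of_tendsto_eLpNorm (p := 2) (by norm_num) hf hg h
  exact this.exists_seq_tendsto_ae

/-- The exponent gained by the Sobolev inequality, strictly larger than `2s/(s-2)`. -/
noncomputable def sobolevExp (n : ℕ) (s : ℝ) : ℝ := (1 / 2 - (1 / n + 1 / s) / 2)⁻¹

theorem sobolevExp_inv (n : ℕ) (s : ℝ) :
    (sobolevExp n s)⁻¹ = 1 / 2 - (1 / n + 1 / s) / 2 := by
  rw [sobolevExp, inv_inv]

theorem sobolevExp_inv_pos (hn : 2 ≤ n) {s : ℝ} (hs : (n : ℝ) < s) : 0 < (sobolevExp n s)⁻¹ := by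
  have hn' : (2 : ℝ) ≤ n := by exact_mod_cast hn
  have h1 : (1 : ℝ) / n ≤ 1 / 2 := one_div_le_one_div_of_le (by norm_num) hn'
  have h2 : 1 / s < 1 / n := one_div_lt_one_div_of_lt (by linarith) hs
  rw [sobolevExp_inv]
  linarith

theorem sobolevExp_pos (hn : 2 ≤ n) {s : ℝ} (hs : (n : ℝ) < s) : 0 < sobolevExp n s :=
  inv_pos.1 (sobolevExp_inv_pos hn hs)

theorem two_lt_sobolevExp (hn : 2 ≤ n) {s : ℝ} (hs : (n : ℝ) < s) : 2 < sobolevExp n s := by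
  have hn' : (2 : ℝ) ≤ n := by exact_mod_cast hn
  have h0 := sobolevExp_inv n s
  have h1 : (0 : ℝ) < 1 / n := by positivity
  have h2 : 0 < 1 / s := by have : 0 < s := by linarith
                            positivity
  have h3 : (sobolevExp n s)⁻¹ < 2⁻¹ := by rw [h0]; linarith
  exact (inv_lt_inv₀ (sobolevExp_pos hn hs) (by norm_num)).1 h3

/-- The integrability of the gradient is first lowered from 2 to a value below 2, whose Sobolev
conjugate is exactly `sobolevExp n s`; Hölder on the ball returns to 2. This treats `n = 2`, where 2
is the critical exponent, on the same footing as `n > 2`. -/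
theorem exists_sobolev_const_smooth (hn : 2 ≤ n) {s : ℝ} (hs : (n : ℝ) < s) (R : ℝ) :
    ∃ C : NNReal, ∀ (x₀ : Vec n) (φ : Vec n → ℝ), ContDiff ℝ ∞ φ → HasCompactSupport φ →
      tsupport φ ⊆ Metric.closedBall x₀ R →
      eLpNorm φ (ENNReal.ofReal (sobolevExp n s)) volume
        ≤ C * ∑ i, eLpNorm (fun x => fderiv ℝ φ x (EuclideanSpace.single i 1)) 2 volume := by
  have hn' : (2 : ℝ) ≤ n := by exact_mod_cast hn
  have hs0 : 0 < s := by linarith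
  have h1 : (1 : ℝ) / n ≤ 1 / 2 := one_div_le_one_div_of_le (by norm_num) hn'
  have h2 : 1 / s < 1 / n := one_div_lt_one_div_of_lt (by linarith) hs
  have h3 : 0 < 1 / s := by positivity
  -- The reciprocal of the lowered exponent: chosen so that `r - 1/n` is the reciprocal of
  -- `sobolevExp n s`.
  set r : ℝ := 1 / 2 + (1 / n - 1 / s) / 2 with hr
  have hr0 : 0 < r := by linarith
  have hr1 : r ≤ 1 := by linarith
  have hr2 : 1 / 2 < r := by linarith
  obtain ⟨p, hp⟩ : ∃ p : NNReal, (p : ℝ) = r⁻¹ := ⟨⟨r⁻¹, by positivity⟩, rfl⟩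
  obtain ⟨q, hq⟩ : ∃ q : NNReal, (q : ℝ) = sobolevExp n s :=
    ⟨⟨sobolevExp n s, (sobolevExp_pos hn hs).le⟩, rfl⟩
  have hp1 : 1 ≤ p := by
    have : (1 : ℝ) ≤ p := by rw [hp]; exact (one_le_inv₀ hr0).2 hr1
    exact_mod_cast this
  have hp2 : (p : ℝ≥0∞) ≤ 2 := by
    have : (p : ℝ) ≤ 2 := by
      rw [hp, inv_le_comm₀ hr0 (by norm_num)]; linarith
    have h : p ≤ 2 := by exact_mod_cast this
    exact_mod_cast h
  have hpq : (q : ℝ)⁻¹ = (p : ℝ)⁻¹ - (Module.finrank ℝ (Vec n) : ℝ)⁻¹ := by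
    simp only [finrank_euclideanSpace, Fintype.card_fin]
    rw [hq, hp, sobolevExp_inv, inv_inv, hr]
    ring
  obtain ⟨V, hVdef⟩ : ∃ V : ℝ≥0∞, V = volume (Metric.closedBall (0 : Vec n) R) := ⟨_, rfl⟩
  have hV : V ≠ ⊤ := by rw [hVdef]; exact (isCompact_closedBall _ _).measure_lt_top.ne
  obtain ⟨t, htdef⟩ : ∃ t : ℝ, t = 1 / (p : ℝ≥0∞).toReal - 1 / (2 : ℝ≥0∞).toReal := ⟨_, rfl⟩
  have ht : 0 ≤ t := by
    have : t = r - 1 / 2 := by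
      rw [htdef, ENNReal.coe_toReal, hp]
      simp
    rw [this]; linarith
  refine ⟨eLpNormLESNormFDerivOfEqInnerConst (volume : Measure (Vec n)) p * (V ^ t).toNNReal,
    fun x₀ φ hφ hφs hφR => ?_⟩
  have e1 := eLpNorm_le_eLpNorm_fderiv_of_eq_inner (volume : Measure (Vec n))
    (hφ.of_le (by exact_mod_cast le_top)) hφs (p := p) (p' := q) hp1
    (by simp; omega) (by exact_mod_cast hpq)
  have hq' : (q : ℝ≥0∞) = ENNReal.ofReal (sobolevExp n s) := by
    rw [← hq, ENNReal.ofReal_coe_nnreal]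
  rw [hq'] at e1
  refine e1.trans ?_
  rw [ENNReal.coe_mul, mul_assoc]
  gcongr
  have hc : Continuous (fderiv ℝ φ) := hφ.continuous_fderiv (by simp)
  have hVx : volume (Metric.closedBall x₀ R) = V := by
    rw [hVdef, Measure.addHaar_closedBall_center]
  have e2 : eLpNorm (fderiv ℝ φ) p volume ≤ V ^ t * eLpNorm (fderiv ℝ φ) 2 volume := by
    have hsub := (subset_tsupport _).trans ((tsupport_fderiv_subset ℝ (f := φ)).trans hφR)
    have r1 := eLpNorm_restrict_eq_of_support_subset (μ := volume)
      (f := fderiv ℝ φ) (p := (p : ℝ≥0∞)) hsub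
    have r2 := eLpNorm_restrict_eq_of_support_subset (μ := volume)
      (f := fderiv ℝ φ) (p := (2 : ℝ≥0∞)) hsub
    rw [← r1, ← r2]
    have := eLpNorm_le_eLpNorm_mul_rpow_measure_univ (μ := volume.restrict
      (Metric.closedBall x₀ R)) hp2 hc.aestronglyMeasurable
    rw [Measure.restrict_apply_univ, hVx, ← htdef, mul_comm] at this
    exact this
  rw [ENNReal.coe_toNNReal (ENNReal.rpow_ne_top_of_nonneg ht hV)]
  refine e2.trans ?_
  gcongr
  have hcd : ∀ i : Fin n, Continuous (fun x => fderiv ℝ φ x (EuclideanSpace.single i 1)) :=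
    fun i => hc.clm_apply continuous_const
  calc eLpNorm (fderiv ℝ φ) 2 volume
      ≤ eLpNorm (fun x => ∑ i, ‖fderiv ℝ φ x (EuclideanSpace.single i 1)‖) 2 volume := by
        refine eLpNorm_mono fun x => (norm_fderiv_le_sum φ x).trans (le_abs_self _)
    _ = eLpNorm (∑ i, fun x => ‖fderiv ℝ φ x (EuclideanSpace.single i 1)‖) 2 volume := by
        congr 1; ext x; simp
    _ ≤ ∑ i, eLpNorm (fun x => ‖fderiv ℝ φ x (EuclideanSpace.single i 1)‖) 2 volume :=
        eLpNorm_sum_le (fun i _ => (hcd i).norm.aestronglyMeasurable) (by norm_num)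
    _ = _ := by simp only [eLpNorm_norm]

/-- The Sobolev inequality for compactly supported functions in `W^{1,2}`. -/
theorem exists_sobolev_const (hn : 2 ≤ n) {s : ℝ} (hs : (n : ℝ) < s) (R : ℝ) :
    ∃ C : NNReal, ∀ (x₀ : Vec n) (w : Vec n → ℝ) (G : Fin n → Vec n → ℝ), MemLp w 2 volume →
      tsupport w ⊆ Metric.closedBall x₀ R → (∀ i, MemLp (G i) 2 volume) →
      (∀ i, HasWeakDeriv univ (EuclideanSpace.single i 1) w (G i)) →
      eLpNorm w (ENNReal.ofReal (sobolevExp n s)) volume ≤ C * ∑ i, eLpNorm (G i) 2 volume := by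
  -- The radius is enlarged by 1 to hold the supports of the mollified functions.
  obtain ⟨C, hC⟩ := exists_sobolev_const_smooth hn hs (R + 1)
  refine ⟨C, fun x₀ w G hw hwR hG h => ?_⟩
  have hws : HasCompactSupport w :=
    IsCompact.of_isClosed_subset (isCompact_closedBall x₀ R) (isClosed_tsupport w) hwR
  have hpos : ∀ m : ℕ, (0 : ℝ) < 1 / ((m : ℝ) + 1) := fun m => by positivity
  choose φ hφ hφs hφR hφw hφG using fun m : ℕ => exists_smooth_approx hw hws hG h (hpos m)
  have hlim0 : Tendsto (fun m : ℕ => ENNReal.ofReal (1 / ((m : ℝ) + 1))) atTop (𝓝 0) := by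
    have := (ENNReal.continuous_ofReal.tendsto 0).comp
      (tendsto_one_div_add_atTop_nhds_zero_nat (𝕜 := ℝ))
    rw [ENNReal.ofReal_zero] at this
    exact this
  have hlim : Tendsto (fun m => eLpNorm (fun x => φ m x - w x) 2 volume) atTop (𝓝 0) :=
    tendsto_of_tendsto_of_tendsto_of_le_of_le tendsto_const_nhds hlim0 (fun _ => zero_le) hφw
  -- The approximation converges only in `L²`; an a.e. convergent subsequence and Fatou carry the
  -- bound to the higher exponent.
  obtain ⟨ns, hns, hae⟩ := exists_subseq_tendsto_ae
    (fun m => (hφ m).continuous.aestronglyMeasurable) hw.1 hlim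
  have h1 := Lp.eLpNorm_lim_le_liminf_eLpNorm (p := ENNReal.ofReal (sobolevExp n s))
    (fun m => (hφ (ns m)).continuous.aestronglyMeasurable) w hae
  refine h1.trans ?_
  have h2 : ∀ m, eLpNorm (φ (ns m)) (ENNReal.ofReal (sobolevExp n s)) volume
      ≤ C * ∑ i, (eLpNorm (G i) 2 volume + ENNReal.ofReal (1 / ((ns m : ℝ) + 1))) := by
    intro m
    refine (hC x₀ (φ (ns m)) (hφ _) (hφs _) ?_).trans ?_
    · refine (hφR _).trans ?_
      refine (Metric.cthickening_mono (?_ : 1 / ((ns m : ℝ) + 1) ≤ 1) _).trans ?_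
      · rw [div_le_one (by positivity)]
        linarith [Nat.cast_nonneg (α := ℝ) (ns m)]
      · refine (Metric.cthickening_subset_of_subset 1 hwR).trans ?_
        rcases lt_or_ge R 0 with hR | hR
        · simp [Metric.closedBall_eq_empty.2 hR]
        · rw [cthickening_closedBall zero_le_one hR, add_comm]
    · gcongr with i
      have hcd : AEStronglyMeasurable
          (fun x => fderiv ℝ (φ (ns m)) x (EuclideanSpace.single i 1)) volume :=
        (((hφ _).continuous_fderiv (by simp)).clm_apply continuous_const).aestronglyMeasurable
      have h3 := eLpNorm_add_le (hG i).1 (hcd.sub (hG i).1) (p := 2) (by norm_num)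
      have h4 : (G i + ((fun x => fderiv ℝ (φ (ns m)) x (EuclideanSpace.single i 1)) - G i))
          = fun x => fderiv ℝ (φ (ns m)) x (EuclideanSpace.single i 1) := by
        ext x; simp
      rw [h4] at h3
      exact h3.trans (by gcongr; exact hφG _ i)
  have h5 : Tendsto (fun m => C * ∑ i, (eLpNorm (G i) 2 volume
      + ENNReal.ofReal (1 / ((ns m : ℝ) + 1)))) atTop (𝓝 (C * ∑ i, eLpNorm (G i) 2 volume)) := by
    refine ENNReal.Tendsto.const_mul ?_ (Or.inr ENNReal.coe_ne_top)
    refine tendsto_finsetSum _ fun i _ => ?_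
    have := (hlim0.comp hns.tendsto_atTop).const_add (eLpNorm (G i) 2 volume)
    simpa using this
  calc _ ≤ liminf (fun m => C * ∑ i, (eLpNorm (G i) 2 volume
      + ENNReal.ofReal (1 / ((ns m : ℝ) + 1)))) atTop := liminf_le_liminf (Eventually.of_forall h2)
    _ = _ := h5.liminf_eq

end Sobolev

/-! ### Columns of gradients and symmetry of second derivatives. -/

section WeakGradients

open Filter Topology

variable {n : ℕ} {ι : Type} [Fintype ι]

/-- The `i`-th column of a matrix: the map sending a gradient to its `i`-th partial derivative. -/
noncomputable def column (i : Fin n) : EuclideanSpace ℝ (ι × Fin n) →L[ℝ] EuclideanSpace ℝ ι :=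
  LinearMap.toContinuousLinearMap
    { toFun := fun T => WithLp.toLp 2 fun a => T (a, i)
      map_add' := fun S T => by ext a; simp
      map_smul' := fun c T => by ext a; simp }

@[simp] theorem column_apply (i : Fin n) (T : EuclideanSpace ℝ (ι × Fin n)) (a : ι) :
    column i T a = T (a, i) := rfl

theorem sum_norm_column_sq (T : EuclideanSpace ℝ (ι × Fin n)) :
    ∑ i, ‖column i T‖ ^ 2 = ‖T‖ ^ 2 := by
  simp only [EuclideanSpace.real_norm_sq_eq, column_apply]
  rw [Finset.sum_comm, ← Fintype.sum_prod_type']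

theorem norm_column_le (i : Fin n) (T : EuclideanSpace ℝ (ι × Fin n)) : ‖column i T‖ ≤ ‖T‖ := by
  refine (sq_le_sq₀ (norm_nonneg _) (norm_nonneg _)).1 ?_
  rw [← sum_norm_column_sq T]
  exact Finset.single_le_sum (f := fun i => ‖column i T‖ ^ 2) (fun i _ => by positivity)
    (Finset.mem_univ i)

theorem HasWeakDeriv.of_setIntegral {E : Type*} [NormedAddCommGroup E] [NormedSpace ℝ E]
    {Ω : Set (Vec n)} {φ : Vec n → ℝ} (hφ : tsupport φ ⊆ Ω) (g : Vec n → E) :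
    ∫ x in Ω, φ x • g x = ∫ x, φ x • g x := by
  refine setIntegral_eq_integral_of_forall_compl_eq_zero fun x hx => ?_
  have : φ x = 0 := image_eq_zero_of_notMem_tsupport fun h => hx (hφ h)
  simp [this]

theorem IsWeakGrad.hasWeakDeriv {Ω : Set (Vec n)} {g : Vec n → EuclideanSpace ℝ ι}
    {G : Vec n → EuclideanSpace ℝ (ι × Fin n)} (h : IsWeakGrad Ω g G) (i : Fin n) :
    HasWeakDeriv Ω (EuclideanSpace.single i 1) g (fun x => column i (G x)) := by
  intro φ hφ hφs hφΩ
  have hcd : Continuous (fun x => fderiv ℝ φ x (EuclideanSpace.single i 1)) :=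
    (hφ.continuous_fderiv (by simp)).clm_apply continuous_const
  have hts : tsupport (fun x => fderiv ℝ φ x (EuclideanSpace.single i 1)) ⊆ Ω :=
    (HasCompactSupport.fderiv_apply_tsupport_subset _).trans hφΩ
  have i1 := integrable_smul_of_locallyIntegrableOn h.1 hcd (hφs.fderiv_apply ℝ _) hts
  have i2' := integrable_smul_of_locallyIntegrableOn h.2.1 hφ.continuous hφs hφΩ
  have i2 : Integrable (fun x => φ x • column i (G x)) := by
    have := (column i).integrable_comp i2'
    simpa using this
  ext a
  have e1 := (EuclideanSpace.proj (𝕜 := ℝ) a).integral_comp_comm i1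
  have e2 := (EuclideanSpace.proj (𝕜 := ℝ) a).integral_comp_comm i2
  simp only [PiLp.proj_apply, PiLp.smul_apply, smul_eq_mul] at e1 e2
  rw [PiLp.neg_apply, ← e1, ← e2]
  have h3 := h.2.2 φ hφ hφs hφΩ a i
  have e3 := HasWeakDeriv.of_setIntegral hts (fun x => g x a)
  have e4 := HasWeakDeriv.of_setIntegral hφΩ (fun x => G x (a, i))
  simp only [smul_eq_mul] at e3 e4
  rw [← e3]
  simp only [column_apply]
  rw [← e4]
  simpa only [mul_comm] using h3

/-- Weak second derivatives are symmetric. -/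
theorem IsWeakGrad.symm {Ω : Set (Vec n)} (hΩ : IsOpen Ω) {u : Vec n → EuclideanSpace ℝ ι}
    {Du : Vec n → EuclideanSpace ℝ (ι × Fin n)}
    {D2u : Vec n → EuclideanSpace ℝ ((ι × Fin n) × Fin n)} (h1 : IsWeakGrad Ω u Du)
    (h2 : IsWeakGrad Ω Du D2u) :
    ∀ᵐ x ∂(volume.restrict Ω), ∀ a i j, D2u x ((a, i), j) = D2u x ((a, j), i) := by
  simp only [eventually_all]
  intro a i j
  rw [ae_restrict_iff' hΩ.measurableSet]
  have hl : ∀ b, LocallyIntegrableOn (fun x => D2u x b) Ω volume := by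
    intro b x hx
    obtain ⟨t, ht, hti⟩ := h2.2.1 x hx
    exact ⟨t, ht, (EuclideanSpace.proj (𝕜 := ℝ) b).integrable_comp hti⟩
  have hz := hΩ.ae_eq_zero_of_integral_contDiff_smul_eq_zero (μ := volume)
    (f := fun x => D2u x ((a, i), j) - D2u x ((a, j), i)) ((hl _).sub (hl _)) ?_
  · filter_upwards [hz] with x hx hxΩ
    exact sub_eq_zero.1 (hx hxΩ)
  intro φ hφ hφs hφΩ
  -- Both derivatives are moved onto the test function, where they commute.
  have key : ∀ i j : Fin n, ∫ x, φ x • D2u x ((a, i), j)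
      = ∫ x in Ω, u x a * fderiv ℝ (fun y => fderiv ℝ φ y (EuclideanSpace.single j 1)) x
          (EuclideanSpace.single i 1) := by
    intro i j
    have hφ' : ContDiff ℝ ∞ (fun y => fderiv ℝ φ y (EuclideanSpace.single j 1)) :=
      (hφ.fderiv_right (m := ∞) (by simp)).clm_apply contDiff_const
    have ht := (HasCompactSupport.fderiv_apply_tsupport_subset
      (EuclideanSpace.single j 1)).trans hφΩ
    have k1 := h2.2.2 φ hφ hφs hφΩ (a, i) j
    have k2 := h1.2.2 _ hφ' (hφs.fderiv_apply ℝ _) ht a i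
    rw [← HasWeakDeriv.of_setIntegral hφΩ, k2]
    rw [k1, neg_neg]
    simp only [smul_eq_mul, mul_comm]
  have i1 : ∀ b, Integrable (fun x => φ x • D2u x b) := fun b =>
    integrable_smul_of_locallyIntegrableOn (hl b) hφ.continuous hφs hφΩ
  simp only [smul_sub]
  rw [integral_sub (i1 _) (i1 _), key i j, key j i, sub_eq_zero]
  congr 1
  ext x
  congr 1
  have hd : ∀ v w : Vec n, fderiv ℝ (fun y => fderiv ℝ φ y v) x w
      = fderiv ℝ (fderiv ℝ φ) x w v := by
    intro v w
    have : DifferentiableAt ℝ (fderiv ℝ φ) x :=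
      (hφ.fderiv_right (m := ∞) (by simp)).differentiable (by simp) x
    rw [fderiv_clm_apply this (by fun_prop)]
    simp
  rw [hd, hd]
  exact ((contDiff_infty.1 hφ 2).contDiffAt.isSymmSndFDerivAt (by simp)) _ _

end WeakGradients

/-! ### Measurability of superpositions. -/

section Caratheodory

open Filter Topology

theorem aemeasurable_comp_simpleFunc {α A B : Type*} [MeasurableSpace α] [MeasurableSpace B]
    {μ : Measure α} {G : α → A → B} (hG : ∀ ξ, AEMeasurable (fun x => G x ξ) μ)
    (S : SimpleFunc α A) : AEMeasurable (fun x => G x (S x)) μ := by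
  have hU : (⋃ ξ : S.range, S ⁻¹' {(ξ : A)}) = univ := by
    ext x
    simp only [mem_iUnion, mem_preimage, mem_singleton_iff, mem_univ, iff_true]
    exact ⟨⟨S x, SimpleFunc.mem_range_self S x⟩, rfl⟩
  rw [← Measure.restrict_univ (μ := μ), ← hU, aemeasurable_iUnion_iff]
  intro ξ
  refine ((hG ξ).mono_measure Measure.restrict_le_self).congr ?_
  rw [EventuallyEq, ae_restrict_iff' (S.measurableSet_fiber _)]
  exact Eventually.of_forall fun x hx => by rw [mem_preimage, mem_singleton_iff] at hx; rw [hx]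

/-- Carathéodory functions are superpositionally measurable. -/
theorem aemeasurable_caratheodory {α A B : Type*} [MeasurableSpace α] {μ : Measure α}
    [NormedAddCommGroup A] [SecondCountableTopology A] [MeasurableSpace A] [BorelSpace A]
    [NormedAddCommGroup B] [MeasurableSpace B] [BorelSpace B]
    {G : α → A → B} (hG : ∀ ξ, AEMeasurable (fun x => G x ξ) μ) {V : α → A}
    (hV : AEMeasurable V μ) (hc : ∀ᵐ x ∂μ, ContinuousAt (G x) (V x)) :
    AEMeasurable (fun x => G x (V x)) μ := by
  have hsm := hV.measurable_mk.stronglyMeasurable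
  refine aemeasurable_of_tendsto_metrizable_ae atTop
    (fun m => aemeasurable_comp_simpleFunc hG (hsm.approx m)) ?_
  filter_upwards [hc, hV.ae_eq_mk] with x hx hxV
  have h1 := hsm.tendsto_approx x
  rw [← hxV] at h1
  exact hx.tendsto.comp h1

end Caratheodory

/-! ### The Hessian of a radial function. -/

section Radial

open Filter Topology

variable {W : Type*} [NormedAddCommGroup W] [InnerProductSpace ℝ W] [CompleteSpace W]

theorem hasFDerivAt_gradient {F : W → ℝ} (hF : ContDiffOn ℝ 2 F {ξ | 1 < ‖ξ‖}) {ξ : W}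
    (hξ : 1 < ‖ξ‖) : HasFDerivAt (gradient F) (fderiv ℝ (gradient F) ξ) ξ := by
  have ho : IsOpen {ξ : W | 1 < ‖ξ‖} := isOpen_lt continuous_const continuous_norm
  have h1 : ContDiffAt ℝ 2 F ξ := hF.contDiffAt (ho.mem_nhds hξ)
  have h2 : ContDiffAt ℝ 1 (fderiv ℝ F) ξ := h1.fderiv_right (by norm_num)
  have h3 : DifferentiableAt ℝ (fderiv ℝ F) ξ := h2.differentiableAt (by norm_num)
  have h4 : DifferentiableAt ℝ (gradient F) ξ :=
    ((InnerProductSpace.toDual ℝ W).symm.toContinuousLinearEquiv.differentiableAt).comp ξ h3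
  exact h4.hasFDerivAt

theorem hasGradientAt_of_one_lt {F : W → ℝ} (hF : ContDiffOn ℝ 2 F {ξ | 1 < ‖ξ‖}) {ξ : W}
    (hξ : 1 < ‖ξ‖) : HasGradientAt F (gradient F ξ) ξ := by
  have ho : IsOpen {ξ : W | 1 < ‖ξ‖} := isOpen_lt continuous_const continuous_norm
  have h1 : ContDiffAt ℝ 2 F ξ := hF.contDiffAt (ho.mem_nhds hξ)
  exact (h1.differentiableAt (by norm_num)).hasGradientAt

/-- The Hessian of a radial function. -/
theorem exists_hessian_radial {F : W → ℝ} {g : ℝ → ℝ} (hF : ContDiffOn ℝ 2 F {ξ | 1 < ‖ξ‖})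
    (hg : ∀ ξ, 1 ≤ ‖ξ‖ → F ξ = g ‖ξ‖) {ξ : W} (hξ : 1 < ‖ξ‖) :
    ∃ a b : ℝ, ∀ η, fderiv ℝ (gradient F) ξ η = a • η + (b * inner ℝ ξ η) • ξ := by
  have ho : IsOpen {ξ : W | 1 < ‖ξ‖} := isOpen_lt continuous_const continuous_norm
  have hξ0 : ‖ξ‖ ≠ 0 := by positivity
  let e : W := ‖ξ‖⁻¹ • ξ
  have he : ‖e‖ = 1 := by simp [e, norm_smul, hξ0]
  -- The given profile has no assumed smoothness, so a profile in the variable `|ξ|²` is read off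
  -- from `F` along the ray through `ξ`; it inherits `C²` from `F`, and `|ξ|²` is easier to
  -- differentiate than `|ξ|`.
  let G : ℝ → ℝ := fun r => F (√r • e)
  have hn : ∀ r : ℝ, ‖√r • e‖ = √r := fun r => by
    rw [norm_smul, he, mul_one, Real.norm_of_nonneg (Real.sqrt_nonneg r)]
  have hG : ∀ r : ℝ, 1 < r → ContDiffAt ℝ 2 G r := by
    intro r hr
    have h1 : (1 : ℝ) < ‖√r • e‖ := by
      rw [hn, Real.lt_sqrt (by norm_num)]; simpa using hr
    have h2 : ContDiffAt ℝ 2 F (√r • e) := hF.contDiffAt (ho.mem_nhds h1)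
    refine ContDiffAt.comp r h2 ?_
    exact (Real.contDiffAt_sqrt (by linarith : r ≠ 0)).smul contDiffAt_const
  have hFG : ∀ η : W, 1 < ‖η‖ → F η = G (‖η‖ ^ 2) := by
    intro η hη
    simp only [G]
    rw [hg η hη.le, hg _ (by rw [hn, Real.sqrt_sq (norm_nonneg η)]; exact hη.le), hn,
      Real.sqrt_sq (norm_nonneg η)]
  have hsq : ∀ η : W, 1 < ‖η‖ → 1 < ‖η‖ ^ 2 := fun η hη => by nlinarith
  have hgr : ∀ η : W, 1 < ‖η‖ → gradient F η = (2 * deriv G (‖η‖ ^ 2)) • η := by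
    intro η hη
    refine HasGradientAt.gradient ?_
    rw [hasGradientAt_iff_hasFDerivAt]
    have h1 : HasFDerivAt (fun η : W => ‖η‖ ^ 2) (2 • (innerSL ℝ η)) η :=
      (hasStrictFDerivAt_norm_sq η).hasFDerivAt
    have h2 : HasDerivAt G (deriv G (‖η‖ ^ 2)) (‖η‖ ^ 2) :=
      ((hG _ (hsq η hη)).differentiableAt (by norm_num)).hasDerivAt
    have h3 := h2.comp_hasFDerivAt η h1
    have h4 : F =ᶠ[𝓝 η] (G ∘ fun η : W => ‖η‖ ^ 2) := by
      filter_upwards [ho.mem_nhds hη] with ζ hζ using hFG ζ hζ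
    refine (h3.congr_of_eventuallyEq h4).congr_fderiv ?_
    ext ζ
    simp
    ring
  have hev : gradient F =ᶠ[𝓝 ξ] fun η => (2 * deriv G (‖η‖ ^ 2)) • η := by
    filter_upwards [ho.mem_nhds hξ] with ζ hζ using hgr ζ hζ
  have hG' : DifferentiableAt ℝ (deriv G) (‖ξ‖ ^ 2) := by
    have h1 : ContDiffAt ℝ 1 (fderiv ℝ G) (‖ξ‖ ^ 2) :=
      (hG _ (hsq ξ hξ)).fderiv_right (by norm_num)
    have h2 : DifferentiableAt ℝ (fderiv ℝ G) (‖ξ‖ ^ 2) := h1.differentiableAt (by norm_num)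
    exact h2.clm_apply (differentiableAt_const 1)
  have h1 : HasFDerivAt (fun η : W => ‖η‖ ^ 2) (2 • (innerSL ℝ ξ)) ξ :=
    (hasStrictFDerivAt_norm_sq ξ).hasFDerivAt
  have h2 := ((hG'.hasDerivAt.comp_hasFDerivAt ξ h1).const_mul 2).smul (hasFDerivAt_id ξ)
  refine ⟨2 * deriv G (‖ξ‖ ^ 2), 4 * deriv (deriv G) (‖ξ‖ ^ 2), fun η => ?_⟩
  have h3 : fderiv ℝ (gradient F) ξ = _ := hev.fderiv_eq.trans h2.fderiv
  rw [h3]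
  simp
  congr 1
  ring

end Radial

/-! ### Linear algebra of the form `a I + b ξ ⊗ ξ`. -/

section HessianAlgebra

variable {n N : ℕ}

theorem norm_apply_le_hilbertSchmidt {κ : Type*} [Fintype κ] [DecidableEq κ]
    (A : EuclideanSpace ℝ κ →L[ℝ] EuclideanSpace ℝ κ) (η : EuclideanSpace ℝ κ) :
    ‖A η‖ ≤ √ (∑ b, ‖A (EuclideanSpace.single b 1)‖ ^ 2) * ‖η‖ := by
  have hη : η = ∑ b, η b • EuclideanSpace.single b (1 : ℝ) := by
    ext j
    simp [Finset.sum_apply, Pi.single_apply]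
  conv_lhs => rw [hη]
  rw [map_sum]
  calc ‖∑ b, A (η b • EuclideanSpace.single b (1 : ℝ))‖
      ≤ ∑ b, ‖A (EuclideanSpace.single b 1)‖ * ‖η b‖ := by
        refine (norm_sum_le _ _).trans (Finset.sum_le_sum fun b _ => ?_)
        rw [map_smul, norm_smul, mul_comm]
    _ ≤ √ (∑ b, ‖A (EuclideanSpace.single b 1)‖ ^ 2) * √ (∑ b, ‖η b‖ ^ 2) :=
        Real.sum_mul_le_sqrt_mul_sqrt _ _ _
    _ = _ := by rw [EuclideanSpace.norm_eq η]

theorem exists_ne_zero_inner_eq_zero {κ : Type*} [Fintype κ] [DecidableEq κ] {b c : κ}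
    (hbc : b ≠ c) (ξ : EuclideanSpace ℝ κ) :
    ∃ η : EuclideanSpace ℝ κ, η ≠ 0 ∧ inner ℝ ξ η = 0 := by
  by_cases h : ξ b = 0
  · refine ⟨EuclideanSpace.single b 1, fun h0 => ?_, ?_⟩
    · have := congrArg (fun v : EuclideanSpace ℝ κ => v b) h0
      simp at this
    · simp [EuclideanSpace.inner_single_right, h]
  · refine ⟨ξ c • EuclideanSpace.single b 1 - ξ b • EuclideanSpace.single c 1, fun h0 => ?_, ?_⟩
    · have := congrArg (fun v : EuclideanSpace ℝ κ => v c) h0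
      simp [hbc.symm] at this
      exact h this
    · rw [inner_sub_right, inner_smul_right, inner_smul_right]
      simp [EuclideanSpace.inner_single_right]
      ring

/-- The two numbers are the eigenvalues of `A` orthogonal to `ξ` and along `ξ`. The first one is
seen by ellipticity only if a nonzero orthogonal vector exists, which is why two distinct indices
are required. -/
theorem coeff_bounds_of_elliptic {κ : Type*} [Fintype κ] [DecidableEq κ] {b₁ b₂ : κ}
    (hb : b₁ ≠ b₂) {A : EuclideanSpace ℝ κ → EuclideanSpace ℝ κ} {ξ : EuclideanSpace ℝ κ}
    (hξ : ξ ≠ 0) {a b c : ℝ} (hA : ∀ η, A η = a • η + (b * inner ℝ ξ η) • ξ)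
    (h : ∀ η, c * ‖η‖ ^ 2 ≤ inner ℝ (A η) η) : c ≤ a ∧ c ≤ a + b * ‖ξ‖ ^ 2 := by
  have hA' : ∀ η, inner ℝ (A η) η = a * ‖η‖ ^ 2 + b * inner ℝ ξ η ^ 2 := by
    intro η
    rw [hA, inner_add_left, inner_smul_left, inner_smul_left, real_inner_self_eq_norm_sq]
    simp
    ring
  constructor
  · obtain ⟨η, hη, h0⟩ := exists_ne_zero_inner_eq_zero hb ξ
    have h1 := h η
    rw [hA', h0] at h1
    have : 0 < ‖η‖ ^ 2 := by positivity
    nlinarith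
  · have h1 := h ξ
    rw [hA', real_inner_self_eq_norm_sq] at h1
    have : 0 < ‖ξ‖ ^ 2 := by positivity
    nlinarith

/-- The matrix with entries `zᵢ V_{α s}`. -/
noncomputable def tensorRow (z : Vec n) (V : Mat n N) (s : Fin n) : Mat n N :=
  WithLp.toLp 2 fun ai => z ai.2 * V (ai.1, s)

@[simp] theorem tensorRow_apply (z : Vec n) (V : Mat n N) (s : Fin n) (ai : Fin N × Fin n) :
    tensorRow z V s ai = z ai.2 * V (ai.1, s) := rfl

theorem norm_tensorRow (z : Vec n) (V : Mat n N) (s : Fin n) :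
    ‖tensorRow z V s‖ = ‖z‖ * ‖column s V‖ := by
  rw [← sq_eq_sq₀ (norm_nonneg _) (by positivity), mul_pow]
  simp only [EuclideanSpace.real_norm_sq_eq, tensorRow_apply, column_apply]
  rw [Finset.sum_mul_sum, Finset.sum_comm, ← Fintype.sum_prod_type']
  simp only [mul_pow]

/-- This is where the symmetry of second derivatives enters: exchanging the two derivative indices
rebuilds `⟨V, Dᵢ⟩` from entries that are contracted the wrong way. -/
theorem sum_inner_tensorRow {V : Mat n N} {D : Tens n N}
    (hD : ∀ a i j, D ((a, i), j) = D ((a, j), i)) (z : Vec n) :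
    ∑ s, inner ℝ (column s D) (tensorRow z V s) = ∑ i, z i * inner ℝ V (column i D) := by
  simp only [PiLp.inner_apply, tensorRow_apply, column_apply, Fintype.sum_prod_type,
    RCLike.inner_apply, conj_trivial, Finset.mul_sum]
  rw [Finset.sum_comm]
  conv_rhs => rw [Finset.sum_comm]
  refine Finset.sum_congr rfl fun a _ => ?_
  rw [Finset.sum_comm]
  refine Finset.sum_congr rfl fun i _ => Finset.sum_congr rfl fun s _ => ?_
  rw [hD a i s]
  ring

theorem sum_mul_inner_tensorRow {V : Mat n N} (z : Vec n) :
    ∑ s, z s * inner ℝ V (tensorRow z V s) = ∑ a, (∑ i, z i * V (a, i)) ^ 2 := by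
  simp only [PiLp.inner_apply, tensorRow_apply, Fintype.sum_prod_type,
    RCLike.inner_apply, conj_trivial, Finset.mul_sum, pow_two, Finset.sum_mul]
  rw [Finset.sum_comm]
  refine Finset.sum_congr rfl fun a _ => Finset.sum_congr rfl fun s _ =>
    Finset.sum_congr rfl fun i _ => ?_
  ring

/-- Positivity of the mixed term produced by testing with radial multiples of `Du`. -/
theorem le_sum_inner_hessian_tensorRow {V : Mat n N} {D : Tens n N}
    (hD : ∀ a i j, D ((a, i), j) = D ((a, j), i)) {A : Mat n N → Mat n N} {a b c : ℝ}
    (hA : ∀ η, A η = a • η + (b * inner ℝ V η) • V) (ha : c ≤ a) (hb : c ≤ a + b * ‖V‖ ^ 2)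
    {z : Vec n} (hz : ∀ i, z i = inner ℝ V (column i D)) :
    c * ‖z‖ ^ 2 ≤ ∑ s, inner ℝ (A (column s D)) (tensorRow z V s) := by
  have h1 : ∑ s, inner ℝ (A (column s D)) (tensorRow z V s)
      = a * ‖z‖ ^ 2 + b * ∑ a, (∑ i, z i * V (a, i)) ^ 2 := by
    simp only [hA, inner_add_left, inner_smul_left, conj_trivial, Finset.sum_add_distrib]
    congr 1
    · rw [← Finset.mul_sum, sum_inner_tensorRow hD]
      congr 1
      rw [EuclideanSpace.real_norm_sq_eq]
      refine Finset.sum_congr rfl fun i _ => ?_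
      rw [← hz i, pow_two]
    · rw [← sum_mul_inner_tensorRow, Finset.mul_sum]
      refine Finset.sum_congr rfl fun s _ => ?_
      rw [← hz s, mul_assoc]
  have h2 : 0 ≤ ∑ a, (∑ i, z i * V (a, i)) ^ 2 := Finset.sum_nonneg fun a _ => sq_nonneg _
  have h3 : ∑ a, (∑ i, z i * V (a, i)) ^ 2 ≤ ‖z‖ ^ 2 * ‖V‖ ^ 2 := by
    simp only [EuclideanSpace.real_norm_sq_eq, Fintype.sum_prod_type, Finset.mul_sum]
    refine Finset.sum_le_sum fun a _ => ?_
    rw [← Finset.mul_sum]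
    exact Finset.sum_mul_sq_le_sq_mul_sq _ _ _
  rw [h1]
  -- For `b ≥ 0` the second sum is dropped and `a ≥ c` is enough; for `b ≤ 0` it is at most `|z|²
  -- |V|²` by Cauchy–Schwarz, and `a + b|V|² ≥ c` is used.
  rcases le_total 0 b with hb0 | hb0
  · nlinarith [sq_nonneg ‖z‖, mul_nonneg hb0 h2]
  · nlinarith [sq_nonneg ‖z‖, mul_le_mul_of_nonpos_left h3 hb0]

end HessianAlgebra

/-! ### From variations of the energy to a first-order inequality. -/

section EulerLagrange

open Filter Topology

variable {n N : ℕ}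

theorem column_jacobian {φ : Vec n → Vec N} (x : Vec n) (i : Fin n) :
    column i (jacobian φ x) = fderiv ℝ φ x (EuclideanSpace.single i 1) := by
  ext a
  simp [jacobian]

theorem continuous_jacobian {φ : Vec n → Vec N} (hφ : ContDiff ℝ ∞ φ) :
    Continuous (jacobian φ) := by
  have h : Continuous (fderiv ℝ φ) := hφ.continuous_fderiv (by simp)
  unfold jacobian
  fun_prop

theorem jacobian_eq_zero {φ : Vec n → Vec N} {x : Vec n} (hx : x ∉ tsupport φ) :
    jacobian φ x = 0 := by
  have : fderiv ℝ φ x = 0 := by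
    by_contra h
    exact hx (tsupport_fderiv_subset ℝ (subset_tsupport _ h))
  ext ai
  simp [jacobian, this]

theorem hasCompactSupport_jacobian {φ : Vec n → Vec N} (hφs : HasCompactSupport φ) :
    HasCompactSupport (jacobian φ) :=
  HasCompactSupport.intro hφs fun _ hx => jacobian_eq_zero hx

theorem jacobian_const_smul {φ : Vec n → Vec N} (hφ : ContDiff ℝ ∞ φ) (t : ℝ) (x : Vec n) :
    jacobian (fun y => t • φ y) x = t • jacobian φ x := by
  have : fderiv ℝ (fun y => t • φ y) x = t • fderiv ℝ φ x :=
    fderiv_fun_const_smul (hφ.differentiable (by simp) x) t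
  ext ai
  simp [jacobian, this]

theorem jacobian_add {φ ψ : Vec n → Vec N} (hφ : ContDiff ℝ ∞ φ) (hψ : ContDiff ℝ ∞ ψ)
    (x : Vec n) : jacobian (fun y => φ y + ψ y) x = jacobian φ x + jacobian ψ x := by
  have : fderiv ℝ (fun y => φ y + ψ y) x = fderiv ℝ φ x + fderiv ℝ ψ x :=
    fderiv_fun_add (hφ.differentiable (by simp) x) (hψ.differentiable (by simp) x)
  ext ai
  simp [jacobian, this]

/-- `D_ξ F(x, V(x))` where `|V(x)| > 1`, and zero elsewhere. -/
noncomputable def exteriorGradient (F : Vec n → Mat n N → ℝ) (V : Vec n → Mat n N) (x : Vec n) :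
    Mat n N :=
  open Classical in if 1 < ‖V x‖ then gradient (F x) (V x) else 0

section StructureConsequences

variable {Ω : Set (Vec n)} {p L L₁ ν s : ℝ} {k : Vec n → ℝ} {F : Vec n → Mat n N → ℝ}

theorem StructureConditions.exists_abs_le (hS : StructureConditions Ω p L L₁ ν s k F) : ∃ A : ℝ, 0 < A ∧
      ∀ᵐ x ∂(volume.restrict Ω), ∀ ξ, |F x ξ| ≤ A * (‖ξ‖ ^ p + 1) := by
  obtain ⟨ℓ, hℓ, h⟩ := hS.growth
  refine ⟨ℓ + |L|, by positivity, ?_⟩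
  filter_upwards [h] with x hx ξ
  have h1 := hx ξ
  have h2 : 0 ≤ ‖ξ‖ ^ p := by positivity
  have h3 := le_abs_self L
  have h4 := abs_nonneg L
  rw [abs_le]
  constructor <;> nlinarith

/-- A convex function bounded on a ball is Lipschitz on a smaller one. The growth bound is uniform
in `x`, hence so is the constant. -/
theorem StructureConditions.exists_lipschitz (hS : StructureConditions Ω p L L₁ ν s k F)
    (hp : 0 ≤ p) {M : ℝ} : ∃ C : NNReal,
      ∀ᵐ x ∂(volume.restrict Ω), LipschitzOnWith C (F x) (Metric.ball 0 (M + 1)) := by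
  obtain ⟨A, hA, h⟩ := hS.exists_abs_le
  refine ⟨(2 * (A * ((M + 2) ^ p + 1)) / 1).toNNReal, ?_⟩
  filter_upwards [h, hS.convex] with x hx hc
  have hc' : ConvexOn ℝ (Metric.ball (0 : Mat n N) (M + 2)) (F x) :=
    hc.subset (subset_univ _) (convex_ball _ _)
  have := hc'.lipschitzOnWith_of_abs_le (ε := 1) one_pos
    (M := A * ((M + 2) ^ p + 1)) (fun ξ hξ => (hx ξ).trans (by
      rw [dist_zero_right] at hξ
      gcongr))
  rwa [show M + 2 - 1 = M + 1 by ring] at this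

theorem norm_gradient_le {F₀ : Mat n N → ℝ} {M : ℝ} {C : NNReal}
    (hL : LipschitzOnWith C F₀ (Metric.ball 0 (M + 1))) (hF : ContDiffOn ℝ 2 F₀ {ξ | 1 < ‖ξ‖})
    {ξ : Mat n N} (hξ : 1 < ‖ξ‖) (hξM : ‖ξ‖ < M + 1) : ‖gradient F₀ ξ‖ ≤ C := by
  have h1 := (hasGradientAt_of_one_lt hF hξ).hasFDerivAt
  have h2 := h1.le_of_lipschitzOn (Metric.isOpen_ball.mem_nhds (by simpa using hξM)) hL
  rwa [LinearIsometryEquiv.norm_map] at h2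

end StructureConsequences

theorem aemeasurable_integrand {μ : Measure (Vec n)} {F : Vec n → Mat n N → ℝ}
    (hm : ∀ ξ, AEMeasurable (fun x => F x ξ) μ) (hc : ∀ᵐ x ∂μ, Continuous (F x))
    {V : Vec n → Mat n N} (hV : AEMeasurable V μ) : AEMeasurable (fun x => F x (V x)) μ :=
  aemeasurable_caratheodory hm hV (hc.mono fun _ hx => hx.continuousAt)

theorem tendsto_diffQuot_gradient {F₀ : Mat n N → ℝ} (hF : ContDiffOn ℝ 2 F₀ {ξ | 1 < ‖ξ‖})
    {ξ : Mat n N} (hξ : 1 < ‖ξ‖) (η : Mat n N) :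
    Tendsto (fun t : ℝ => t⁻¹ * (F₀ (ξ + t • η) - F₀ ξ)) (𝓝[≠] 0)
      (𝓝 (inner ℝ (gradient F₀ ξ) η)) := by
  have h1 := (hasGradientAt_of_one_lt hF hξ).hasFDerivAt
  have h2 : HasDerivAt (fun t : ℝ => ξ + t • η) η 0 := by
    have := ((hasDerivAt_id (0 : ℝ)).smul_const η).const_add ξ
    simpa using this
  have h3 : HasFDerivAt F₀ (InnerProductSpace.toDual ℝ _ (gradient F₀ ξ)) (ξ + (0 : ℝ) • η) := by
    simpa using h1
  have h4 := (h3.comp_hasDerivAt (0 : ℝ) h2).tendsto_slope_zero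
  simpa using h4

/-- Each component is a pointwise limit of difference quotients of the Carathéodory function itself,
so no measurability of the gradient in `x` has to be assumed. -/
theorem aemeasurable_exteriorGradient {μ : Measure (Vec n)} {F : Vec n → Mat n N → ℝ}
    (hm : ∀ ξ, AEMeasurable (fun x => F x ξ) μ) (hc : ∀ᵐ x ∂μ, Continuous (F x))
    (hF : ∀ᵐ x ∂μ, ContDiffOn ℝ 2 (F x) {ξ | 1 < ‖ξ‖})
    {V : Vec n → Mat n N} (hV : AEMeasurable V μ) : AEMeasurable (exteriorGradient F V) μ := by
  have hcomp : ∀ b, AEMeasurable (fun x => exteriorGradient F V x b) μ := by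
    intro b
    have hseq : Tendsto (fun m : ℕ => ((m : ℝ) + 1)⁻¹) atTop (𝓝[≠] 0) := by
      refine tendsto_nhdsWithin_iff.2 ⟨?_, Eventually.of_forall fun m => ?_⟩
      · simpa [one_div] using tendsto_one_div_add_atTop_nhds_zero_nat (𝕜 := ℝ)
      · have : (0 : ℝ) < ((m : ℝ) + 1)⁻¹ := by positivity
        exact this.ne'
    obtain ⟨V', hV'm, hV'⟩ := hV
    have hset : MeasurableSet {x | 1 < ‖V' x‖} := measurableSet_lt measurable_const hV'm.norm
    refine aemeasurable_of_tendsto_metrizable_ae (μ := μ) atTop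
      (f := fun (m : ℕ) x => indicator {x | 1 < ‖V' x‖} (fun x => (((m : ℝ) + 1)⁻¹)⁻¹ *
        (F x (V' x + ((m : ℝ) + 1)⁻¹ • EuclideanSpace.single b 1) - F x (V' x))) x)
      (fun m => ?_) ?_
    · refine AEMeasurable.indicator ?_ hset
      exact ((aemeasurable_integrand hm hc (hV'm.add_const _).aemeasurable).sub
        (aemeasurable_integrand hm hc hV'm.aemeasurable)).const_mul _
    · filter_upwards [hV', hF] with x hx hFx
      by_cases h1 : 1 < ‖V x‖
      · have h2 : x ∈ {x | 1 < ‖V' x‖} := by simpa [← hx] using h1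
        simp only [indicator_of_mem h2]
        have := (tendsto_diffQuot_gradient hFx h1 (EuclideanSpace.single b 1)).comp hseq
        have e : exteriorGradient F V x b
            = inner ℝ (gradient (F x) (V x)) (EuclideanSpace.single b 1) := by
          rw [exteriorGradient, if_pos h1, EuclideanSpace.inner_single_right]
          simp
        rw [e, ← hx]
        exact this
      · have h2 : x ∉ {x | 1 < ‖V' x‖} := by simpa [← hx] using h1
        simp only [indicator_of_notMem h2]
        simp [exteriorGradient, h1]
  have h := Finset.aemeasurable_fun_sum Finset.univ
    (fun b _ => (hcomp b).smul_const (EuclideanSpace.single b (1 : ℝ)))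
  refine h.congr (Eventually.of_forall fun x => ?_)
  ext j
  simp [Finset.sum_apply, Pi.single_apply]

/-- Passage from one-sided difference quotients of the energy to the Euler-Lagrange
inequality. -/
theorem neg_le_of_diffQuot_nonneg {μ : Measure (Vec n)} [IsFiniteMeasure μ]
    {F : Vec n → Mat n N → ℝ}
    (hm : ∀ ξ, AEMeasurable (fun x => F x ξ) μ) (hc : ∀ᵐ x ∂μ, Continuous (F x))
    (hF : ∀ᵐ x ∂μ, ContDiffOn ℝ 2 (F x) {ξ | 1 < ‖ξ‖}) {M : ℝ} {C : NNReal}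
    (hL : ∀ᵐ x ∂μ, LipschitzOnWith C (F x) (Metric.ball 0 (M + 1)))
    {V J : Vec n → Mat n N} (hV : AEMeasurable V μ) (hVM : ∀ᵐ x ∂μ, ‖V x‖ ≤ M)
    (hJ : Continuous J) {B : ℝ} (hB : ∀ x, ‖J x‖ ≤ B) {c : ℝ}
    (hmin : ∀ t : ℝ, 0 < t → 0 ≤ (∫ x, (F x (V x + t • J x) - F x (V x)) ∂μ) + t * c) :
    -c ≤ (∫ x, inner ℝ (exteriorGradient F V x) (J x) ∂μ)
      + C * ∫ x, indicator {x | ‖V x‖ ≤ 1} (fun x => ‖J x‖) x ∂μ := by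
  have hB0 : 0 ≤ B := (norm_nonneg (J 0)).trans (hB 0)
  have hJi : Integrable (fun x => ‖J x‖) μ :=
    Integrable.mono' (integrable_const B) hJ.norm.aestronglyMeasurable
      (Eventually.of_forall fun x => by simpa using hB x)
  have hset : NullMeasurableSet {x | ‖V x‖ ≤ 1} μ :=
    nullMeasurableSet_le hV.norm aemeasurable_const
  let Q : ℝ → Vec n → ℝ := fun t x => t⁻¹ * (F x (V x + t • J x) - F x (V x))
  have hQm : ∀ t, AEMeasurable (Q t) μ := fun t =>
    ((aemeasurable_integrand hm hc (hV.add (hJ.const_smul t).aemeasurable)).sub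
      (aemeasurable_integrand hm hc hV)).const_mul _
  have hsmall : ∀ᶠ t : ℝ in 𝓝[>] 0, 0 < t ∧ t * B < 1 := by
    have h1 : Tendsto (fun t : ℝ => t * B) (𝓝[>] 0) (𝓝 0) := by
      have : Continuous (fun t : ℝ => t * B) := by fun_prop
      have := this.tendsto 0
      rw [zero_mul] at this
      exact this.mono_left nhdsWithin_le_nhds
    filter_upwards [self_mem_nhdsWithin, h1.eventually (gt_mem_nhds one_pos)] with t h1 h2
    exact ⟨h1, h2⟩
  -- For small `t` the whole increment stays in the ball where `F x` is Lipschitz. The bound acts as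
  -- a majorant where `|V| > 1` and is all that is available where `|V| ≤ 1`.
  have hQb : ∀ t : ℝ, 0 < t ∧ t * B < 1 → ∀ᵐ x ∂μ, |Q t x| ≤ C * ‖J x‖ := by
    rintro t ⟨ht, htB⟩
    filter_upwards [hL, hVM] with x hx hxM
    have h1 : ‖t • J x‖ < 1 := by
      rw [norm_smul, Real.norm_of_nonneg ht.le]
      exact lt_of_le_of_lt (by gcongr; exact hB x) htB
    have h2 := hx.norm_sub_le (x := V x + t • J x) (y := V x)
      (by rw [mem_ball_zero_iff]; exact lt_of_le_of_lt (norm_add_le _ _) (by linarith))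
      (by rw [mem_ball_zero_iff]; linarith)
    rw [add_sub_cancel_left, norm_smul, Real.norm_of_nonneg ht.le, Real.norm_eq_abs] at h2
    rw [abs_mul, abs_inv, abs_of_pos ht, inv_mul_le_iff₀ ht]
    linarith
  have hlim : Tendsto (fun t => ∫ x, indicator {x | 1 < ‖V x‖} (Q t) x ∂μ) (𝓝[>] 0)
      (𝓝 (∫ x, inner ℝ (exteriorGradient F V x) (J x) ∂μ)) := by
    have hset' : NullMeasurableSet {x | 1 < ‖V x‖} μ :=
      nullMeasurableSet_lt aemeasurable_const hV.norm
    refine tendsto_integral_filter_of_dominated_convergence (fun x => C * ‖J x‖)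
      (Eventually.of_forall fun t => ?_) ?_ (hJi.const_mul _) ?_
    · exact ((hQm t).indicator₀ hset').aestronglyMeasurable
    · filter_upwards [hsmall] with t ht
      filter_upwards [hQb t ht] with x hx
      refine (norm_indicator_le_norm_self _ _).trans ?_
      exact hx
    · filter_upwards [hF] with x hFx
      by_cases h1 : 1 < ‖V x‖
      · have h2 : x ∈ {x | 1 < ‖V x‖} := h1
        simp only [indicator_of_mem h2]
        have := (tendsto_diffQuot_gradient hFx h1 (J x)).mono_left
          (nhdsWithin_mono 0 (fun t (ht : 0 < t) => ht.ne'))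
        have e : exteriorGradient F V x = gradient (F x) (V x) := if_pos h1
        rw [e]
        exact this
      · have h2 : x ∉ {x | 1 < ‖V x‖} := h1
        simp only [indicator_of_notMem h2]
        simp [exteriorGradient, h1]
  have hJind : Integrable (indicator {x | ‖V x‖ ≤ 1} (fun x => ‖J x‖)) μ :=
    hJi.indicator₀ hset
  refine ge_of_tendsto (hlim.add_const _) ?_
  filter_upwards [hsmall] with t ht
  have h1 := hmin t ht.1
  have hQi : Integrable (Q t) μ :=
    Integrable.mono' (hJi.const_mul C) (hQm t).aestronglyMeasurable (hQb t ht)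
  have h2 : ∫ x, (F x (V x + t • J x) - F x (V x)) ∂μ = t * ∫ x, Q t x ∂μ := by
    rw [← integral_const_mul]
    refine integral_congr_ae (Eventually.of_forall fun x => ?_)
    simp only [Q]
    rw [mul_inv_cancel_left₀ ht.1.ne']
  rw [h2, ← mul_add] at h1
  have h3 : 0 ≤ (∫ x, Q t x ∂μ) + c := nonneg_of_mul_nonneg_right h1 ht.1
  have hset' : NullMeasurableSet {x | 1 < ‖V x‖} μ :=
    nullMeasurableSet_lt aemeasurable_const hV.norm
  have h4 : ∫ x, Q t x ∂μ ≤ (∫ x, indicator {x | 1 < ‖V x‖} (Q t) x ∂μ)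
      + C * ∫ x, indicator {x | ‖V x‖ ≤ 1} (fun x => ‖J x‖) x ∂μ := by
    rw [← integral_const_mul, ← integral_add (hQi.indicator₀ hset') (hJind.const_mul _)]
    refine integral_mono_ae hQi ((hQi.indicator₀ hset').add (hJind.const_mul _)) ?_
    filter_upwards [hQb t ht] with x hx
    by_cases h : 1 < ‖V x‖
    · have ha : x ∈ {x | 1 < ‖V x‖} := h
      have hb : x ∉ {x | ‖V x‖ ≤ 1} := not_le.2 h
      simp [indicator_of_mem ha, indicator_of_notMem hb]
    · have ha : x ∉ {x | 1 < ‖V x‖} := h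
      have hb : x ∈ {x | ‖V x‖ ≤ 1} := not_lt.1 h
      simp only [indicator_of_notMem ha, indicator_of_mem hb, zero_add]
      exact (le_abs_self _).trans hx
  linarith

end EulerLagrange

/-! ### The Euler–Lagrange inequality for both minimization problems. -/

section Minimizers

open Filter Topology

variable {n N : ℕ}

theorem LocallyIntegrableOn.component {ι : Type} [Fintype ι] {Ω : Set (Vec n)}
    {g : Vec n → EuclideanSpace ℝ ι} (h : LocallyIntegrableOn g Ω volume) (b : ι) :
    LocallyIntegrableOn (fun x => g x b) Ω volume := by
  intro x hx
  obtain ⟨t, ht, hti⟩ := h x hx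
  exact ⟨t, ht, (EuclideanSpace.proj (𝕜 := ℝ) b).integrable_comp hti⟩

theorem isWeakGrad_smooth {Ω : Set (Vec n)} {φ : Vec n → Vec N} (hφ : ContDiff ℝ ∞ φ) :
    IsWeakGrad Ω φ (jacobian φ) := by
  refine ⟨hφ.continuous.locallyIntegrable.locallyIntegrableOn _,
    (continuous_jacobian hφ).locallyIntegrable.locallyIntegrableOn _, ?_⟩
  intro η hη hηs hηΩ a i
  have hφa : ContDiff ℝ ∞ (fun x => φ x a) :=
    (EuclideanSpace.proj (𝕜 := ℝ) a).contDiff.comp hφ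
  have hd : ∀ x, fderiv ℝ (fun x => φ x a) x (EuclideanSpace.single i 1) = jacobian φ x (a, i) := by
    intro x
    have h1 := ((EuclideanSpace.proj (𝕜 := ℝ) a).hasFDerivAt.comp x
      (hφ.differentiable (by simp) x).hasFDerivAt).fderiv
    have h2 : fderiv ℝ (fun x => φ x a) x = _ := h1
    rw [h2]
    simp [jacobian]
  have hηd : Continuous (fun x => fderiv ℝ η x (EuclideanSpace.single i 1)) :=
    (hη.continuous_fderiv (by simp)).clm_apply continuous_const
  have hφd : Continuous (fun x => fderiv ℝ (fun x => φ x a) x (EuclideanSpace.single i 1)) :=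
    (hφa.continuous_fderiv (by simp)).clm_apply continuous_const
  have h := integral_mul_fderiv_eq_neg_fderiv_mul_of_integrable (𝕜 := ℝ) (μ := volume)
    (f := fun x => φ x a) (g := η) (v := EuclideanSpace.single i 1)
    ((hφd.mul hη.continuous).integrable_of_hasCompactSupport hηs.mul_left)
    ((hφa.continuous.mul hηd).integrable_of_hasCompactSupport (hηs.fderiv_apply ℝ _).mul_left)
    ((hφa.continuous.mul hη.continuous).integrable_of_hasCompactSupport hηs.mul_left)
    (fun x _ => hφa.differentiable (by simp) x) (fun x _ => hη.differentiable (by simp) x)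
  simp only [hd] at h
  have e1 := HasWeakDeriv.of_setIntegral
    ((HasCompactSupport.fderiv_apply_tsupport_subset (EuclideanSpace.single i 1)).trans hηΩ)
    (fun x => φ x a)
  have e2 := HasWeakDeriv.of_setIntegral hηΩ (fun x => jacobian φ x (a, i))
  simp only [smul_eq_mul, mul_comm (fderiv ℝ η _ _)] at e1
  simp only [smul_eq_mul, mul_comm (η _)] at e2
  rw [e1, e2, h]

theorem IsWeakGrad.add {ι : Type} [Fintype ι] {Ω : Set (Vec n)}
    {g g' : Vec n → EuclideanSpace ℝ ι} {G G' : Vec n → EuclideanSpace ℝ (ι × Fin n)}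
    (h : IsWeakGrad Ω g G) (h' : IsWeakGrad Ω g' G') :
    IsWeakGrad Ω (fun x => g x + g' x) (fun x => G x + G' x) := by
  refine ⟨h.1.add h'.1, h.2.1.add h'.2.1, ?_⟩
  intro φ hφ hφs hφΩ a i
  have hd : Continuous (fun x => fderiv ℝ φ x (EuclideanSpace.single i 1)) :=
    (hφ.continuous_fderiv (by simp)).clm_apply continuous_const
  have hi1 : ∀ {w : Vec n → EuclideanSpace ℝ ι}, LocallyIntegrableOn w Ω volume →
      IntegrableOn (fun x => w x a * fderiv ℝ φ x (EuclideanSpace.single i 1)) Ω volume := by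
    intro w hw
    have := integrable_smul_of_locallyIntegrableOn (LocallyIntegrableOn.component hw a) hd (hφs.fderiv_apply ℝ _)
      ((HasCompactSupport.fderiv_apply_tsupport_subset _).trans hφΩ)
    simp only [smul_eq_mul, mul_comm (fderiv ℝ φ _ _)] at this
    exact this.integrableOn
  have hi2 : ∀ {w : Vec n → EuclideanSpace ℝ (ι × Fin n)}, LocallyIntegrableOn w Ω volume →
      IntegrableOn (fun x => w x (a, i) * φ x) Ω volume := by
    intro w hw
    have := integrable_smul_of_locallyIntegrableOn (LocallyIntegrableOn.component hw (a, i)) hφ.continuous hφs hφΩ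
    simp only [smul_eq_mul, mul_comm (φ _)] at this
    exact this.integrableOn
  simp only [PiLp.add_apply, add_mul]
  rw [integral_add (hi1 h.1) (hi1 h'.1), integral_add (hi2 h.2.1) (hi2 h'.2.1),
    h.2.2 φ hφ hφs hφΩ a i, h'.2.2 φ hφ hφs hφΩ a i, neg_add]

/-- The Euler-Lagrange inequality, tested with smooth functions: the set where `|V| ≤ 1`, on which
the energy density need not be differentiable, only contributes an error term. -/
def EulerLagrangeIneq (Ω : Set (Vec n)) (F : Vec n → Mat n N → ℝ) (f : Vec n → Vec N)
    (V : Vec n → Mat n N) : Prop :=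
  ∀ K : Set (Vec n), IsCompact K → K ⊆ Ω → ∃ C : NNReal, ∀ φ : Vec n → Vec N,
    ContDiff ℝ ∞ φ → HasCompactSupport φ → tsupport φ ⊆ K →
      -∫ x in K, (‖f x‖ + 2) * ‖φ x‖ ≤
        (∫ x in K, inner ℝ (exteriorGradient F V x) (jacobian φ x)) +
          C * ∫ x in K, indicator {x | ‖V x‖ ≤ 1} (fun x => ‖jacobian φ x‖) x

theorem MemLpLoc.exists_bound {E : Type} [NormedAddCommGroup E] {V : Vec n → E} {Ω : Set (Vec n)}
    (h : MemLpLoc V ⊤ Ω) {K : Set (Vec n)} (hK : IsCompact K) (hKΩ : K ⊆ Ω) :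
    ∃ M : ℝ, 1 ≤ M ∧ ∀ᵐ x ∂(volume.restrict K), ‖V x‖ ≤ M := by
  have h1 := h K hK hKΩ
  have h2 : eLpNormEssSup V (volume.restrict K) ≠ ⊤ := by
    have := h1.eLpNorm_ne_top
    rwa [eLpNorm_exponent_top] at this
  refine ⟨max 1 (eLpNormEssSup V (volume.restrict K)).toReal, le_max_left _ _, ?_⟩
  filter_upwards [ae_le_eLpNormEssSup (f := V) (μ := volume.restrict K)] with x hx
  refine le_max_of_le_right ?_
  have := ENNReal.toReal_mono h2 hx
  simpa using this

theorem exists_bound_jacobian {φ : Vec n → Vec N} (hφ : ContDiff ℝ ∞ φ)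
    (hφs : HasCompactSupport φ) : ∃ B, ∀ x, ‖jacobian φ x‖ ≤ B :=
  (hasCompactSupport_jacobian hφs).exists_bound_of_continuous (continuous_jacobian hφ)

theorem integrable_integrand {Ω A : Set (Vec n)} {p L L₁ ν s : ℝ} {k : Vec n → ℝ}
    {F : Vec n → Mat n N → ℝ} (hS : StructureConditions Ω p L L₁ ν s k F) (hp : 0 < p)
    (hA : A ⊆ Ω) (hAf : volume A ≠ ⊤) {W : Vec n → Mat n N}
    (hW : MemLp W (ENNReal.ofReal p) (volume.restrict A)) :
    Integrable (fun x => F x (W x)) (volume.restrict A) := by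
  have hle : volume.restrict A ≤ (volume.restrict Ω : Measure (Vec n)) :=
    Measure.restrict_mono hA le_rfl
  haveI : IsFiniteMeasure (volume.restrict A : Measure (Vec n)) :=
    ⟨by simpa using hAf.lt_top⟩
  obtain ⟨C, _, h⟩ := hS.exists_abs_le
  have h1 : AEMeasurable (fun x => F x (W x)) (volume.restrict A) :=
    aemeasurable_integrand (fun ξ => (hS.aemeasurable ξ).mono_measure hle)
      (ae_mono hle hS.continuous) hW.1.aemeasurable
  have h2 : Integrable (fun x => ‖W x‖ ^ p) (volume.restrict A) := by
    have := hW.integrable_norm_rpow (by simpa using hp) ENNReal.ofReal_ne_top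
    rwa [ENNReal.toReal_ofReal hp.le] at this
  refine Integrable.mono' ((h2.add (integrable_const 1)).const_mul C) h1.aestronglyMeasurable ?_
  filter_upwards [ae_mono hle h] with x hx
  exact hx (W x)

theorem energy_sub_eq {A : Set (Vec n)} {F : Vec n → Mat n N → ℝ} {f u φ : Vec n → Vec N}
    {V J : Vec n → Mat n N} {t : ℝ}
    (h1 : Integrable (fun x => F x (V x)) (volume.restrict A))
    (h2 : Integrable (fun x => F x (V x + t • J x)) (volume.restrict A))
    (h3 : Integrable (fun x => (inner ℝ (f x) (u x) : ℝ)) (volume.restrict A))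
    (h4 : Integrable (fun x => (inner ℝ (f x) (φ x) : ℝ)) (volume.restrict A)) :
    energy F f A (fun x => u x + t • φ x) (fun x => V x + t • J x) - energy F f A u V
      = (∫ x in A, (F x (V x + t • J x) - F x (V x))) + t * ∫ x in A, inner ℝ (f x) (φ x) := by
  have e1 : ∀ x, (inner ℝ (f x) (u x + t • φ x) : ℝ)
      = inner ℝ (f x) (u x) + t * inner ℝ (f x) (φ x) := by
    intro x; rw [inner_add_right, inner_smul_right]
  unfold energy
  simp only [e1]
  have h5 : Integrable (fun x => (inner ℝ (f x) (u x) : ℝ) + t * inner ℝ (f x) (φ x))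
      (volume.restrict A) := h3.add (h4.const_mul t)
  rw [integral_add h2 h5, integral_add h3 (h4.const_mul t), integral_const_mul, integral_add h1 h3,
    integral_sub h2 h1]
  ring

theorem integrable_inner_of_memLp_two {A : Set (Vec n)} {f u : Vec n → Vec N}
    (hf : MemLp f 2 (volume.restrict A)) (hu : MemLp u 2 (volume.restrict A)) :
    Integrable (fun x => (inner ℝ (f x) (u x) : ℝ)) (volume.restrict A) := by
  refine Integrable.mono' (integrable_norm_mul_norm hf hu) (hf.1.inner hu.1)
    (Eventually.of_forall fun x => ?_)
  exact norm_inner_le_norm _ _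

theorem MemLpLoc.two {E : Type} [NormedAddCommGroup E] {f : Vec n → E} {q : ℝ} {Ω : Set (Vec n)}
    (h : MemLpLoc f (ENNReal.ofReal q) Ω) (hq : 2 ≤ q) {K : Set (Vec n)} (hK : IsCompact K)
    (hKΩ : K ⊆ Ω) : MemLp f 2 (volume.restrict K) := by
  haveI : IsFiniteMeasure (volume.restrict K : Measure (Vec n)) :=
    ⟨by simpa using hK.measure_lt_top⟩
  refine (h K hK hKΩ).mono_exponent ?_
  rw [← ENNReal.ofReal_ofNat]
  exact ENNReal.ofReal_le_ofReal hq

theorem smul_memLp_jacobian {φ : Vec n → Vec N} (hφ : ContDiff ℝ ∞ φ)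
    (hφs : HasCompactSupport φ) (t : ℝ) (q : ℝ≥0∞) (A : Set (Vec n)) :
    MemLp (fun x => t • jacobian φ x) q (volume.restrict A) :=
  (((continuous_jacobian hφ).memLp_of_hasCompactSupport
    (hasCompactSupport_jacobian hφs)).restrict A).const_smul t

theorem smul_memLp_smooth {φ : Vec n → Vec N} (hφ : ContDiff ℝ ∞ φ)
    (hφs : HasCompactSupport φ) (t : ℝ) (q : ℝ≥0∞) (A : Set (Vec n)) :
    MemLp (fun x => t • φ x) q (volume.restrict A) :=
  ((hφ.continuous.memLp_of_hasCompactSupport hφs).restrict A).const_smul t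

theorem IsWeakGrad.add_smul_smooth {Ω : Set (Vec n)} {g : Vec n → Vec N} {G : Vec n → Mat n N}
    (h : IsWeakGrad Ω g G) {φ : Vec n → Vec N} (hφ : ContDiff ℝ ∞ φ) (t : ℝ) :
    IsWeakGrad Ω (fun x => g x + t • φ x) (fun x => G x + t • jacobian φ x) := by
  have h1 := h.add (isWeakGrad_smooth (Ω := Ω) (φ := fun y => t • φ y) (hφ.const_smul t))
  have : jacobian (fun y => t • φ y) = fun x => t • jacobian φ x := by
    ext1 x
    exact jacobian_const_smul hφ t x
  simp only [this] at h1
  exact h1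

theorem integral_inner_le_integral_norm {A : Set (Vec n)} {f φ : Vec n → Vec N} {c : ℝ}
    (hf : MemLp f 2 (volume.restrict A)) (hφ : MemLp φ 2 (volume.restrict A))
    (hA : volume A ≠ ⊤) :
    (∫ x in A, (inner ℝ (f x) (φ x) : ℝ)) + c * ∫ x in A, ‖φ x‖
      ≤ ∫ x in A, (‖f x‖ + c) * ‖φ x‖ := by
  haveI : IsFiniteMeasure (volume.restrict A : Measure (Vec n)) :=
    ⟨by simpa using hA.lt_top⟩
  have h1 := integrable_norm_mul_norm hf hφ
  have h2 : Integrable (fun x => ‖φ x‖) (volume.restrict A) :=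
    (hφ.integrable (by norm_num)).norm
  simp only [add_mul]
  rw [integral_add h1 (h2.const_mul c), integral_const_mul]
  have h3 := integral_mono (integrable_inner_of_memLp_two hf hφ) h1
    fun x => real_inner_le_norm _ _
  linarith

/-- `u + tφ` with `t > 0` is a competitor on `K`, so the one-sided difference quotients of the
energy are nonnegative. The summand 2 next to `|f|` is not needed here; it is kept so that local and
perturbed minimizers obey the same inequality. -/
theorem IsLocalMinimizer.eulerLagrangeIneq {Ω : Set (Vec n)} {p L L₁ ν s : ℝ} {k : Vec n → ℝ}
    {F : Vec n → Mat n N → ℝ} {f u : Vec n → Vec N} {Du : Vec n → Mat n N}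
    (hΩ : IsOpen Ω) (hp : 2 ≤ p) (hs : 2 ≤ s) (hS : StructureConditions Ω p L L₁ ν s k F)
    (hf : MemLpLoc f (ENNReal.ofReal s) Ω) (hDu : MemLpLoc Du ⊤ Ω)
    (hmin : IsLocalMinimizer Ω p F f u Du) : EulerLagrangeIneq Ω F f Du := by
  intro K hK hKΩ
  haveI : IsFiniteMeasure (volume.restrict K : Measure (Vec n)) :=
    ⟨by simpa using hK.measure_lt_top⟩
  have hle : volume.restrict K ≤ (volume.restrict Ω : Measure (Vec n)) :=
    Measure.restrict_mono hKΩ le_rfl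
  obtain ⟨M, hM1, hM⟩ := hDu.exists_bound hK hKΩ
  obtain ⟨C, hC⟩ := hS.exists_lipschitz (by linarith) (M := M)
  refine ⟨C, fun φ hφ hφs hφK => ?_⟩
  obtain ⟨B, hB⟩ := exists_bound_jacobian hφ hφs
  have hf2 := hf.two hs hK hKΩ
  have hu2 : MemLp u 2 (volume.restrict K) := hmin.1.2.1.two hp hK hKΩ
  have hφ2 : MemLp φ 2 (volume.restrict K) :=
    (hφ.continuous.memLp_of_hasCompactSupport hφs).restrict K
  have hDup := hmin.1.2.2 K hK hKΩ
  refine neg_le_of_diffQuot_nonneg (fun ξ => (hS.aemeasurable ξ).mono_measure hle)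
    (ae_mono hle hS.continuous) (ae_mono hle hS.contDiff) (ae_mono hle hC) hDup.1.aemeasurable hM
    (continuous_jacobian hφ) hB fun t ht => ?_
  have hcomp : MemW1Loc Ω (ENNReal.ofReal p) (fun x => u x + t • φ x)
      (fun x => Du x + t • jacobian φ x) :=
    ⟨hmin.1.1.add_smul_smooth hφ t,
      fun K' h1 h2 => (hmin.1.2.1 K' h1 h2).add (smul_memLp_smooth hφ hφs t _ _),
      fun K' h1 h2 => (hmin.1.2.2 K' h1 h2).add (smul_memLp_jacobian hφ hφs t _ _)⟩
  have h1 := hmin.2 K hK hKΩ _ _ hcomp (by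
    rw [ae_restrict_iff' (hΩ.measurableSet.diff hK.isClosed.measurableSet)]
    refine Eventually.of_forall fun x hx => ?_
    have : φ x = 0 := image_eq_zero_of_notMem_tsupport fun h => hx.2 (hφK h)
    simp [this])
  have h2 := energy_sub_eq (J := jacobian φ) (t := t) (φ := φ)
    (integrable_integrand hS (by linarith) hKΩ hK.measure_lt_top.ne hDup)
    (integrable_integrand hS (by linarith) hKΩ hK.measure_lt_top.ne
      (hDup.add (smul_memLp_jacobian hφ hφs t _ _)))
    (integrable_inner_of_memLp_two hf2 hu2) (integrable_inner_of_memLp_two hf2 hφ2)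
  have h3 := integral_inner_le_integral_norm (c := 2) hf2 hφ2 hK.measure_lt_top.ne
  have h4 : 0 ≤ ∫ x in K, ‖φ x‖ := integral_nonneg fun x => norm_nonneg _
  have h5 : (∫ x in K, (inner ℝ (f x) (φ x) : ℝ)) ≤ ∫ x in K, (‖f x‖ + 2) * ‖φ x‖ := by linarith
  have h6 := mul_le_mul_of_nonneg_left h5 ht.le
  linarith

/-- The derivative `2r/(1 + r⁴)` of `arctan(r²)` has modulus at most 2. This is the source of the 2
in `|f| + 2`. -/
theorem abs_arctan_sq_sub_le {E : Type*} [NormedAddCommGroup E] (a b : E) :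
    |Real.arctan (‖a‖ ^ 2) - Real.arctan (‖b‖ ^ 2)| ≤ 2 * ‖a - b‖ := by
  have hd : ∀ r : ℝ, HasDerivAt (fun r : ℝ => Real.arctan (r ^ 2))
      (1 / (1 + (r ^ 2) ^ 2) * (2 * r)) r := by
    intro r
    refine ((Real.hasDerivAt_arctan (r ^ 2)).comp r (hasDerivAt_pow 2 r)).congr_deriv ?_
    simp
  have h := convex_univ.norm_image_sub_le_of_norm_hasDerivWithin_le (C := 2)
    (fun r _ => (hd r).hasDerivWithinAt) (fun r _ => by
      rw [norm_mul, norm_div, norm_one, Real.norm_eq_abs, Real.norm_eq_abs,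
        abs_of_pos (by positivity : 0 < 1 + (r ^ 2) ^ 2), abs_mul, abs_two, div_mul_eq_mul_div,
        one_mul, div_le_iff₀ (by positivity)]
      nlinarith [sq_nonneg (|r| - 1), sq_abs r, abs_nonneg r, sq_nonneg (r ^ 2 - 1),
        sq_nonneg (|r| ^ 2 - |r|)]) (mem_univ ‖b‖) (mem_univ ‖a‖)
  rw [Real.norm_eq_abs, Real.norm_eq_abs] at h
  refine h.trans ?_
  gcongr
  exact abs_norm_sub_norm_le a b

/-- Variations by `tφ` stay in the Dirichlet class, because `tφ` can be added to the approximating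
smooth functions. The arctan term changes by at most `2t ∫ |φ|`, whatever `ubar` is; `ubar` matters
only through its measurability. -/
theorem IsPerturbedMinimizer.eulerLagrangeIneq {Ω B : Set (Vec n)} {p L L₁ ν s : ℝ}
    {k : Vec n → ℝ} {F : Vec n → Mat n N → ℝ} {f u v ubar : Vec n → Vec N}
    {Du Dv : Vec n → Mat n N}
    (hp : 2 ≤ p) (hs : 2 ≤ s) (hS : StructureConditions Ω p L L₁ ν s k F)
    (hf : MemLpLoc f (ENNReal.ofReal s) Ω) (hBo : IsOpen B) (hB : IsCompact (closure B))
    (hBΩ : closure B ⊆ Ω) (hu : MemW1 B (ENNReal.ofReal p) u Du)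
    (hub : AEStronglyMeasurable ubar (volume.restrict B)) (hDv : MemLpLoc Dv ⊤ B)
    (hmin : IsPerturbedMinimizer B p F f ubar u Du v Dv) : EulerLagrangeIneq B F f Dv := by
  intro K hK hKB
  have hBsub : B ⊆ Ω := subset_closure.trans hBΩ
  have hKΩ : K ⊆ Ω := hKB.trans hBsub
  have hBfin : volume B ≠ ⊤ := (measure_mono subset_closure).trans_lt hB.measure_lt_top |>.ne
  haveI : IsFiniteMeasure (volume.restrict K : Measure (Vec n)) :=
    ⟨by simpa using hK.measure_lt_top⟩
  haveI : IsFiniteMeasure (volume.restrict B : Measure (Vec n)) :=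
    ⟨by simpa using hBfin.lt_top⟩
  have hle : volume.restrict K ≤ (volume.restrict Ω : Measure (Vec n)) :=
    Measure.restrict_mono hKΩ le_rfl
  have hleB : volume.restrict K ≤ (volume.restrict B : Measure (Vec n)) :=
    Measure.restrict_mono hKB le_rfl
  obtain ⟨M, hM1, hM⟩ := hDv.exists_bound hK hKB
  obtain ⟨C, hC⟩ := hS.exists_lipschitz (by linarith) (M := M)
  refine ⟨C, fun φ hφ hφs hφK => ?_⟩
  obtain ⟨b, hb⟩ := exists_bound_jacobian hφ hφs
  have hf2B : MemLp f 2 (volume.restrict B) :=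
    (hf.two hs hB hBΩ).mono_measure (Measure.restrict_mono subset_closure le_rfl)
  have hp2 : (2 : ℝ≥0∞) ≤ ENNReal.ofReal p := by
    rw [← ENNReal.ofReal_ofNat]
    exact ENNReal.ofReal_le_ofReal hp
  have hvp : MemLp v (ENNReal.ofReal p) (volume.restrict B) := by
    have := hmin.1.1.2.1.add hu.2.1
    refine this.ae_eq (Eventually.of_forall fun x => ?_)
    simp
  have hDvp : MemLp Dv (ENNReal.ofReal p) (volume.restrict B) := by
    have := hmin.1.1.2.2.add hu.2.2
    refine this.ae_eq (Eventually.of_forall fun x => ?_)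
    simp
  have hv2 : MemLp v 2 (volume.restrict B) := hvp.mono_exponent hp2
  have hφ2 : MemLp φ 2 (volume.restrict B) :=
    (hφ.continuous.memLp_of_hasCompactSupport hφs).restrict B
  refine neg_le_of_diffQuot_nonneg (fun ξ => (hS.aemeasurable ξ).mono_measure hle)
    (ae_mono hle hS.continuous) (ae_mono hle hS.contDiff) (ae_mono hle hC)
    (hDvp.1.mono_measure hleB).aemeasurable hM (continuous_jacobian hφ) hb fun t ht => ?_
  have hcomp : MemW1Zero B (ENNReal.ofReal p) (fun x => (v x + t • φ x) - u x)
      (fun x => (Dv x + t • jacobian φ x) - Du x) := by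
    have e1 : (fun x => (v x + t • φ x) - u x) = fun x => (v x - u x) + t • φ x := by
      ext1 x; abel
    have e2 : (fun x => (Dv x + t • jacobian φ x) - Du x)
        = fun x => (Dv x - Du x) + t • jacobian φ x := by
      ext1 x; abel
    rw [e1, e2]
    refine ⟨⟨hmin.1.1.1.add_smul_smooth hφ t, hmin.1.1.2.1.add (smul_memLp_smooth hφ hφs t _ _),
      hmin.1.1.2.2.add (smul_memLp_jacobian hφ hφs t _ _)⟩, fun ε hε => ?_⟩
    obtain ⟨ψ, h1, h2, h3, h4⟩ := hmin.1.2 ε hε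
    have htφ : ContDiff ℝ ∞ (fun x => t • φ x) := hφ.const_smul t
    have htφs : HasCompactSupport (fun x => t • φ x) := hφs.smul_left (f := fun _ => t)
    refine ⟨fun x => ψ x + t • φ x, h1.add htφ, h2.add htφs, ?_, ?_⟩
    · refine (tsupport_add ψ (fun x => t • φ x)).trans (union_subset h3 ?_)
      refine (closure_mono ?_).trans (hφK.trans hKB)
      intro x hx h0
      exact hx (by simp [h0])
    · refine le_trans (le_of_eq ?_) h4
      congr 2
      · ext1 x
        change v x - u x + t • φ x - (ψ x + t • φ x) = v x - u x - ψ x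
        exact add_sub_add_right_eq_sub _ _ _
      · ext1 x
        rw [jacobian_add h1 htφ, jacobian_const_smul hφ]
        exact add_sub_add_right_eq_sub _ _ _
  have h1 := hmin.2 _ _ hcomp
  have h2 := energy_sub_eq (J := jacobian φ) (t := t) (φ := φ)
    (integrable_integrand hS (by linarith) hBsub hBfin hDvp)
    (integrable_integrand hS (by linarith) hBsub hBfin
      (hDvp.add (smul_memLp_jacobian hφ hφs t _ _)))
    (integrable_inner_of_memLp_two hf2B hv2) (integrable_inner_of_memLp_two hf2B hφ2)
  have hai : ∀ {w : Vec n → Vec N}, AEStronglyMeasurable w (volume.restrict B) →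
      Integrable (fun x => Real.arctan (‖w x - ubar x‖ ^ 2)) (volume.restrict B) := by
    intro w hw
    refine Integrable.mono' (integrable_const (Real.pi / 2))
      (Real.continuous_arctan.comp_aestronglyMeasurable ((hw.sub hub).norm.pow 2))
      (Eventually.of_forall fun x => ?_)
    rw [Real.norm_eq_abs, abs_le]
    exact ⟨(Real.neg_pi_div_two_lt_arctan _).le, (Real.arctan_lt_pi_div_two _).le⟩
  have ha1 := hai hv2.1
  have ha2 := hai (w := fun x => v x + t • φ x) (hv2.1.add (smul_memLp_smooth hφ hφs t 2 B).1)
  have h7 : (∫ x in B, Real.arctan (‖(v x + t • φ x) - ubar x‖ ^ 2))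
      - (∫ x in B, Real.arctan (‖v x - ubar x‖ ^ 2)) ≤ t * (2 * ∫ x in B, ‖φ x‖) := by
    have hφ1 : Integrable (fun x => ‖φ x‖) (volume.restrict B) :=
      (hφ2.integrable (by norm_num)).norm
    rw [← integral_sub ha2 ha1, ← integral_const_mul, ← integral_const_mul]
    refine integral_mono (ha2.sub ha1) ((hφ1.const_mul 2).const_mul t) fun x => ?_
    refine (le_abs_self _).trans ((abs_arctan_sq_sub_le _ _).trans ?_)
    have : v x + t • φ x - ubar x - (v x - ubar x) = t • φ x := by abel
    rw [this, norm_smul, Real.norm_of_nonneg ht.le]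
    exact le_of_eq (by ring)
  have h3 := integral_inner_le_integral_norm (c := 2) hf2B hφ2 hBfin
  have h6 := mul_le_mul_of_nonneg_left h3 ht.le
  -- The energies are compared on `B`, but the integrand changes only on `K`, where `Dv` is bounded.
  have e1 : ∫ x in B, (F x (Dv x + t • jacobian φ x) - F x (Dv x))
      = ∫ x in K, (F x (Dv x + t • jacobian φ x) - F x (Dv x)) := by
    refine setIntegral_eq_of_subset_of_forall_sdiff_eq_zero hBo.measurableSet hKB fun x hx => ?_
    rw [jacobian_eq_zero fun h => hx.2 (hφK h)]
    simp
  have e2 : ∫ x in B, (‖f x‖ + 2) * ‖φ x‖ = ∫ x in K, (‖f x‖ + 2) * ‖φ x‖ := by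
    refine setIntegral_eq_of_subset_of_forall_sdiff_eq_zero hBo.measurableSet hKB fun x hx => ?_
    rw [image_eq_zero_of_notMem_tsupport fun h => hx.2 (hφK h)]
    simp
  rw [e2] at h6
  rw [e1] at h2
  unfold perturbedEnergy at h1
  linarith

end Minimizers

/-! ### Extension of the test class to `W^{1,2}`. -/

section SobolevTestFunctions

open Filter Topology

variable {n N : ℕ}

theorem tendsto_integral_mul_norm {α ι E : Type*} [MeasurableSpace α] {μ : Measure α}
    [NormedAddCommGroup E] [NormedSpace ℝ E] [CompleteSpace E] {l : Filter ι} {w : ι → α → E} {w₀ : α → E}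
    {c : α → ℝ} (hw : ∀ i, MemLp (w i) 2 μ) (hw₀ : MemLp w₀ 2 μ) (hc : MemLp c 2 μ)
    (h : Tendsto (fun i => eLpNorm (fun x => w i x - w₀ x) 2 μ) l (𝓝 0)) :
    Tendsto (fun i => ∫ x, c x * ‖w i x‖ ∂μ) l (𝓝 (∫ x, c x * ‖w₀ x‖ ∂μ)) := by
  have hi : ∀ {w : α → E}, MemLp w 2 μ → Integrable (fun x => c x * ‖w x‖) μ := by
    intro w hw
    refine Integrable.mono' (integrable_norm_mul_norm hc hw) (hc.1.mul hw.1.norm)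
      (Eventually.of_forall fun x => ?_)
    simp
  rw [tendsto_iff_norm_sub_tendsto_zero]
  refine squeeze_zero (fun i => norm_nonneg _) (fun i => ?_)
    (tendsto_integral_norm_mul_norm_zero (fun i => ((hw i).sub hw₀).1) hc h)
  rw [← integral_sub (hi (hw i)) (hi hw₀)]
  refine norm_integral_le_of_norm_le (integrable_norm_mul_norm ((hw i).sub hw₀) hc)
    (Eventually.of_forall fun x => ?_)
  rw [← mul_sub, norm_mul, mul_comm]
  exact mul_le_mul_of_nonneg_right (abs_norm_sub_norm_le _ _) (norm_nonneg _)

theorem tendsto_integral_inner {α ι E : Type*} [MeasurableSpace α] {μ : Measure α}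
    [NormedAddCommGroup E] [InnerProductSpace ℝ E] [CompleteSpace E] {l : Filter ι} {w : ι → α → E} {w₀ : α → E}
    {c : α → E} (hw : ∀ i, MemLp (w i) 2 μ) (hw₀ : MemLp w₀ 2 μ) (hc : MemLp c 2 μ)
    (h : Tendsto (fun i => eLpNorm (fun x => w i x - w₀ x) 2 μ) l (𝓝 0)) :
    Tendsto (fun i => ∫ x, (inner ℝ (c x) (w i x) : ℝ) ∂μ) l
      (𝓝 (∫ x, (inner ℝ (c x) (w₀ x) : ℝ) ∂μ)) := by
  have hi : ∀ {w : α → E}, MemLp w 2 μ → Integrable (fun x => (inner ℝ (c x) (w x) : ℝ)) μ :=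
    fun {w} hw => Integrable.mono' (integrable_norm_mul_norm hc hw) (hc.1.inner hw.1)
      (Eventually.of_forall fun x => norm_inner_le_norm _ _)
  rw [tendsto_iff_norm_sub_tendsto_zero]
  refine squeeze_zero (fun i => norm_nonneg _) (fun i => ?_)
    (tendsto_integral_norm_mul_norm_zero (fun i => ((hw i).sub hw₀).1) hc h)
  rw [← integral_sub (hi (hw i)) (hi hw₀)]
  refine norm_integral_le_of_norm_le (integrable_norm_mul_norm ((hw i).sub hw₀) hc)
    (Eventually.of_forall fun x => ?_)
  rw [← inner_sub_right, mul_comm]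
  exact norm_inner_le_norm _ _

theorem norm_le_sum_norm_column {ι : Type} [Fintype ι] (T : EuclideanSpace ℝ (ι × Fin n)) :
    ‖T‖ ≤ ∑ i, ‖column i T‖ := by
  have h := sum_norm_column_sq T
  refine le_of_sq_le_sq ?_ (Finset.sum_nonneg fun i _ => norm_nonneg _)
  rw [← h]
  exact Finset.sum_sq_le_sq_sum_of_nonneg fun i _ => norm_nonneg _

theorem eLpNorm_le_sum_eLpNorm_column {ι : Type} [Fintype ι] {μ : Measure (Vec n)}
    {T : Vec n → EuclideanSpace ℝ (ι × Fin n)} (hT : AEStronglyMeasurable T μ) :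
    eLpNorm T 2 μ ≤ ∑ i, eLpNorm (fun x => column i (T x)) 2 μ := by
  have hm : ∀ i, AEStronglyMeasurable (fun x => ‖column i (T x)‖) μ := fun i =>
    ((column i).continuous.comp_aestronglyMeasurable hT).norm
  refine (eLpNorm_mono_real (g := ∑ i, fun x => ‖column i (T x)‖) fun x => ?_).trans
    ((eLpNorm_sum_le (fun i _ => hm i) (by norm_num)).trans
      (Finset.sum_le_sum fun i _ => (eLpNorm_norm _).le))
  rw [Finset.sum_apply]
  exact norm_le_sum_norm_column _

/-- The Euler-Lagrange inequality holds for compactly supported test functions in `W^{1,2}`. -/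
theorem EulerLagrangeIneq.sobolev {Ω : Set (Vec n)} {F : Vec n → Mat n N → ℝ}
    {f : Vec n → Vec N} {V : Vec n → Mat n N} (h : EulerLagrangeIneq Ω F f V) {x₀ : Vec n}
    {R₁ R₂ : ℝ} (hR₁ : 0 ≤ R₁) (hR : R₁ < R₂) (hΩ : Metric.closedBall x₀ R₂ ⊆ Ω)
    (hγ : MemLp (exteriorGradient F V) 2 (volume.restrict (Metric.closedBall x₀ R₂)))
    (hf : MemLp f 2 (volume.restrict (Metric.closedBall x₀ R₂)))
    (hV : AEMeasurable V (volume.restrict (Metric.closedBall x₀ R₂))) :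
    ∃ C : NNReal, ∀ (φ : Vec n → Vec N) (Y : Vec n → Mat n N), MemLp φ 2 volume →
      MemLp Y 2 volume → tsupport φ ⊆ Metric.closedBall x₀ R₁ →
      (∀ i, HasWeakDeriv univ (EuclideanSpace.single i 1) φ (fun x => column i (Y x))) →
      -∫ x in Metric.closedBall x₀ R₂, (‖f x‖ + 2) * ‖φ x‖ ≤
        (∫ x in Metric.closedBall x₀ R₂, inner ℝ (exteriorGradient F V x) (Y x)) +
          C * ∫ x in Metric.closedBall x₀ R₂, indicator {x | ‖V x‖ ≤ 1} (fun x => ‖Y x‖) x := by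
  set K := Metric.closedBall x₀ R₂ with hKdef
  have hK : IsCompact K := isCompact_closedBall _ _
  haveI : IsFiniteMeasure (volume.restrict K : Measure (Vec n)) :=
    ⟨by simpa using hK.measure_lt_top⟩
  obtain ⟨C, hC⟩ := h K hK hΩ
  refine ⟨C, fun φ Y hφ hY hφs hw => ?_⟩
  have hε : ∀ m : ℕ, 0 < (R₂ - R₁) / (m + 1) := fun m =>
    div_pos (sub_pos.2 hR) (by positivity)
  have hcs : HasCompactSupport φ := (isCompact_closedBall _ _).of_isClosed_subset
    (isClosed_tsupport _) hφs
  have hYc : ∀ i, MemLp (fun x => column i (Y x)) 2 volume := fun i =>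
    hY.of_le ((column i).continuous.comp_aestronglyMeasurable hY.1)
      (Eventually.of_forall fun x => norm_column_le i (Y x))
  -- Mollification at scales at most `R₂ - R₁` keeps the supports in the larger ball. All three
  -- integrals are continuous in `(φ, Dφ)` with respect to `L²`, since `f`, the exterior gradient
  -- and the indicator belong to `L²`.
  choose ψ hψ hψs hψt hψ0 hψ1 using fun m => exists_smooth_approx
    (G := fun i x => column i (Y x)) hφ hcs hYc hw (hε m)
  have hlim : Tendsto (fun m : ℕ => ENNReal.ofReal ((R₂ - R₁) / (m + 1))) atTop (𝓝 0) := by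
    rw [← ENNReal.ofReal_zero]
    refine ENNReal.tendsto_ofReal ?_
    have := (tendsto_one_div_add_atTop_nhds_zero_nat (𝕜 := ℝ)).const_mul (R₂ - R₁)
    simpa [div_eq_mul_inv] using this
  have hKsub : ∀ m, tsupport (ψ m) ⊆ K := by
    intro m
    refine (hψt m).trans ((Metric.cthickening_subset_of_subset _ hφs).trans ?_)
    rw [cthickening_closedBall (hε m).le hR₁]
    refine Metric.closedBall_subset_closedBall ?_
    have : (R₂ - R₁) / (m + 1) ≤ R₂ - R₁ :=
      div_le_self (sub_nonneg.2 hR.le) (by linarith [(Nat.cast_nonneg m : (0:ℝ) ≤ m)])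
    linarith
  have hJm : ∀ m, MemLp (jacobian (ψ m)) 2 (volume.restrict K) := fun m =>
    ((continuous_jacobian (hψ m)).memLp_of_hasCompactSupport
      (hasCompactSupport_jacobian (hψs m))).restrict K
  have hψm : ∀ m, MemLp (ψ m) 2 (volume.restrict K) := fun m =>
    ((hψ m).continuous.memLp_of_hasCompactSupport (hψs m)).restrict K
  have t0 : Tendsto (fun m => eLpNorm (fun x => ψ m x - φ x) 2 (volume.restrict K)) atTop (𝓝 0) :=
    tendsto_of_tendsto_of_tendsto_of_le_of_le tendsto_const_nhds hlim (fun _ => zero_le)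
      fun m => (eLpNorm_mono_measure _ Measure.restrict_le_self).trans (hψ0 m)
  have t1 : Tendsto (fun m => eLpNorm (fun x => jacobian (ψ m) x - Y x) 2 (volume.restrict K))
      atTop (𝓝 0) := by
    have hl : Tendsto (fun m : ℕ => ∑ _i : Fin n, ENNReal.ofReal ((R₂ - R₁) / (m + 1))) atTop
        (𝓝 0) := by
      have := tendsto_finsetSum (Finset.univ : Finset (Fin n)) fun _ _ => hlim
      simpa using this
    refine tendsto_of_tendsto_of_tendsto_of_le_of_le tendsto_const_nhds hl (fun _ => zero_le)
      fun m => ?_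
    refine (eLpNorm_le_sum_eLpNorm_column ((hJm m).sub (hY.restrict K)).1).trans
      (Finset.sum_le_sum fun i _ => ?_)
    refine (eLpNorm_mono_measure _ Measure.restrict_le_self).trans (le_trans (le_of_eq ?_) (hψ1 m i))
    refine congrArg (fun g => eLpNorm g 2 volume) ?_
    ext1 x
    rw [Pi.sub_apply, map_sub, column_jacobian]
  have hf2 : MemLp (fun x => ‖f x‖ + 2) 2 (volume.restrict K) := hf.norm.add (memLp_const 2)
  have hind : MemLp (indicator {x | ‖V x‖ ≤ 1} fun _ => (1 : ℝ)) 2 (volume.restrict K) := by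
    refine MemLp.of_bound (aestronglyMeasurable_const.indicator₀ (hV.norm.nullMeasurable
      measurableSet_Iic)) 1 (Eventually.of_forall fun x => ?_)
    refine (norm_indicator_le_norm_self _ _).trans (by simp)
  have l0 := tendsto_integral_mul_norm hψm (hφ.restrict K) hf2 t0
  have l1 := tendsto_integral_inner hJm (hY.restrict K) hγ t1
  have l2 := tendsto_integral_mul_norm hJm (hY.restrict K) hind t1
  have e : ∀ y : Vec n → ℝ, (fun x => indicator {x | ‖V x‖ ≤ 1} (fun _ => (1 : ℝ)) x * y x)
      = fun x => indicator {x | ‖V x‖ ≤ 1} y x := by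
    intro y
    ext1 x
    by_cases hx : ‖V x‖ ≤ 1 <;> simp [hx]
  simp only [e] at l2
  exact le_of_tendsto_of_tendsto' l0.neg (l1.add (l2.const_mul (C : ℝ)))
    fun m => hC (ψ m) (hψ m) (hψs m) (hKsub m)

theorem exists_exteriorGradient_bound {Ω K : Set (Vec n)} {p L L₁ ν s : ℝ} {k : Vec n → ℝ}
    {F : Vec n → Mat n N → ℝ} {V : Vec n → Mat n N} (hp : 0 ≤ p)
    (hS : StructureConditions Ω p L L₁ ν s k F) (hV : MemLpLoc V ⊤ Ω)
    (hK : IsCompact K) (hKΩ : K ⊆ Ω) :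
    AEStronglyMeasurable (exteriorGradient F V) (volume.restrict K) ∧
      ∃ C : ℝ, 0 ≤ C ∧ ∀ᵐ x ∂(volume.restrict K), ‖exteriorGradient F V x‖ ≤ C := by
  have hle : volume.restrict K ≤ (volume.restrict Ω : Measure (Vec n)) :=
    Measure.restrict_mono hKΩ le_rfl
  obtain ⟨M, hM1, hM⟩ := hV.exists_bound hK hKΩ
  obtain ⟨C, hC⟩ := hS.exists_lipschitz hp (M := M)
  refine ⟨(aemeasurable_exteriorGradient (fun ξ => (hS.aemeasurable ξ).mono_measure hle)
    (ae_mono hle hS.continuous) (ae_mono hle hS.contDiff)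
    (hV K hK hKΩ).1.aemeasurable).aestronglyMeasurable, C, C.2, ?_⟩
  filter_upwards [ae_mono hle hC, ae_mono hle hS.contDiff, hM] with x h1 h2 h3
  unfold exteriorGradient
  split_ifs with h
  · exact norm_gradient_le h1 h2 h (by linarith)
  · simp

end SobolevTestFunctions

/-! ### Local difference quotients and translates of `D_ξ F` in `x`. -/

section Translation

open Filter Topology

variable {n N : ℕ}

theorem exists_closedBall_subset {Ω : Set (Vec n)} (hΩ : IsOpen Ω) {x₀ : Vec n} {R : ℝ}
    (hR : 0 ≤ R) (h : Metric.closedBall x₀ R ⊆ Ω) :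
    ∃ ε : ℝ, 0 < ε ∧ Metric.closedBall x₀ (R + ε) ⊆ Ω := by
  obtain ⟨ε, hε, h1⟩ := (isCompact_closedBall x₀ R).exists_cthickening_subset_open hΩ h
  refine ⟨ε, hε, ?_⟩
  rwa [cthickening_closedBall hε.le hR, add_comm] at h1

theorem exists_cutoff (x₀ : Vec n) {r R : ℝ} (hr : 0 ≤ r) (hR : r < R) :
    ∃ χ : Vec n → ℝ, ContDiff ℝ ∞ χ ∧ HasCompactSupport χ ∧ tsupport χ ⊆ Metric.closedBall x₀ R ∧
      (∀ x, 0 ≤ χ x ∧ χ x ≤ 1) ∧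
      ∀ x ∈ Metric.closedBall x₀ r, χ x = 1 ∧ ∀ e, fderiv ℝ χ x e = 0 := by
  let b : ContDiffBump x₀ := ⟨(r + R) / 2, R, by linarith, by linarith⟩
  refine ⟨b, b.contDiff, b.hasCompactSupport, b.tsupport_eq.subset,
    fun x => ⟨b.nonneg, b.le_one⟩, fun x hx => ⟨b.one_of_mem_closedBall ?_, fun e => ?_⟩⟩
  · exact Metric.closedBall_subset_closedBall (show r ≤ (r + R) / 2 by linarith) hx
  · have hx' : x ∈ Metric.ball x₀ ((r + R) / 2) :=
      Metric.closedBall_subset_ball (show r < (r + R) / 2 by linarith) hx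
    have : (b : Vec n → ℝ) =ᶠ[𝓝 x] fun _ => 1 := by
      filter_upwards [Metric.isOpen_ball.mem_nhds hx'] with y hy
      exact b.one_of_mem_closedBall (Metric.ball_subset_closedBall hy)
    rw [this.fderiv_eq]
    simp

section Generic

variable {E : Type*} [NormedAddCommGroup E] [NormedSpace ℝ E] [CompleteSpace E]

theorem HasWeakDeriv.comp_sub {e : Vec n} {g G : Vec n → E} (h : HasWeakDeriv univ e g G)
    (c : Vec n) : HasWeakDeriv univ e (fun x => g (x - c)) (fun x => G (x - c)) := by
  intro φ hφ hφs _
  have e1 := integral_add_right_eq_self (μ := (volume : Measure (Vec n)))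
    (fun x => fderiv ℝ φ x e • g (x - c)) c
  have e2 := integral_add_right_eq_self (μ := (volume : Measure (Vec n)))
    (fun x => φ x • G (x - c)) c
  simp only [add_sub_cancel_right] at e1 e2
  rw [← e1, ← e2]
  have := h (fun x => φ (x + c)) (hφ.comp (contDiff_id.add contDiff_const))
    (hφs.comp_homeomorph (Homeomorph.addRight c)) (subset_univ _)
  simpa only [fderiv_comp_add_right] using this

theorem integrable_smul_of_memLp_two {g : Vec n → E} (hg : MemLp g 2 volume) {c : Vec n → ℝ}
    (hc : Continuous c) (hcs : HasCompactSupport c) : Integrable (fun x => c x • g x) :=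
  integrable_smul_of_locallyIntegrableOn
    ((hg.locallyIntegrable (by norm_num)).locallyIntegrableOn univ) hc hcs (subset_univ _)

theorem HasWeakDeriv.smul_sub {e : Vec n} {g G g' G' : Vec n → E} (h : HasWeakDeriv univ e g G)
    (h' : HasWeakDeriv univ e g' G') (hg : MemLp g 2 volume) (hG : MemLp G 2 volume)
    (hg' : MemLp g' 2 volume) (hG' : MemLp G' 2 volume) (c : ℝ) :
    HasWeakDeriv univ e (fun x => c • (g x - g' x)) (fun x => c • (G x - G' x)) := by
  intro φ hφ hφs hφu
  have hd : Continuous (fun x => fderiv ℝ φ x e) :=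
    (hφ.continuous_fderiv (by simp)).clm_apply continuous_const
  have hds : HasCompactSupport (fun x => fderiv ℝ φ x e) := hφs.fderiv_apply ℝ _
  simp only [smul_comm _ c, integral_smul]
  simp only [_root_.smul_sub]
  rw [integral_sub (integrable_smul_of_memLp_two hg hd hds)
      (integrable_smul_of_memLp_two hg' hd hds),
    integral_sub (integrable_smul_of_memLp_two hG hφ.continuous hφs)
      (integrable_smul_of_memLp_two hG' hφ.continuous hφs)]
  rw [h φ hφ hφs hφu, h' φ hφ hφs hφu]
  module

theorem MemLp.integrable_of_eq_zero {g : Vec n → E} (hg : MemLp g 2 volume) {K : Set (Vec n)}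
    (hK : IsCompact K) (h : ∀ x, x ∉ K → g x = 0) : Integrable g := by
  haveI : IsFiniteMeasure (volume.restrict K : Measure (Vec n)) :=
    ⟨by simpa using hK.measure_lt_top⟩
  have h1 : IntegrableOn g K volume := (hg.restrict K).integrable (by norm_num)
  refine (integrableOn_iff_integrable_of_support_subset ?_).1 h1
  intro x hx
  by_contra h2
  exact hx (h x h2)

theorem memLp_of_eq_zero {g : Vec n → E} {q : ℝ≥0∞} {K : Set (Vec n)} (hK : MeasurableSet K)
    (hg : MemLp g q (volume.restrict K)) (h : ∀ x, x ∉ K → g x = 0) : MemLp g q volume := by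
  rw [← memLp_indicator_iff_restrict hK] at hg
  refine hg.ae_eq (Eventually.of_forall fun x => ?_)
  by_cases hx : x ∈ K
  · rw [indicator_of_mem hx]
  · rw [indicator_of_notMem hx, h x hx]

theorem memLp_weakDeriv_smul {K : Set (Vec n)} (hK : MeasurableSet K) {e : Vec n}
    {g G : Vec n → E} (hg : MemLp g 2 (volume.restrict K)) (hG : MemLp G 2 (volume.restrict K))
    {χ : Vec n → ℝ} (hχ : ContDiff ℝ ∞ χ) (hχs : HasCompactSupport χ) (hχK : tsupport χ ⊆ K) :
    MemLp (fun x => χ x • G x + fderiv ℝ χ x e • g x) 2 volume := by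
  obtain ⟨C, hC⟩ := exists_bound_fderiv hχ hχs e
  obtain ⟨C', hC'⟩ := hχs.exists_bound_of_continuous hχ.continuous
  have hd : Continuous (fun x => fderiv ℝ χ x e) :=
    (hχ.continuous_fderiv (by simp)).clm_apply continuous_const
  refine memLp_of_eq_zero hK ?_ fun x hx => ?_
  · refine ((hG.norm.const_mul C').add (hg.norm.const_mul C)).mono
      ((hχ.continuous.aestronglyMeasurable.smul hG.1).add (hd.aestronglyMeasurable.smul hg.1))
      (Eventually.of_forall fun x => ?_)
    refine (norm_add_le _ _).trans (le_trans ?_ (le_abs_self _))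
    refine add_le_add ?_ ?_
    · rw [norm_smul]
      exact mul_le_mul_of_nonneg_right (hC' x) (norm_nonneg _)
    · rw [norm_smul]
      exact mul_le_mul_of_nonneg_right (hC x) (norm_nonneg _)
  · have h1 : χ x = 0 := image_eq_zero_of_notMem_tsupport fun h => hx (hχK h)
    have h2 : fderiv ℝ χ x e = 0 :=
      image_eq_zero_of_notMem_tsupport (f := fun y => fderiv ℝ χ y e) fun h =>
        hx (hχK (HasCompactSupport.fderiv_apply_tsupport_subset e h))
    simp [h1, h2]

/-- Local version of the `L²` convergence of difference quotients. -/
theorem HasWeakDeriv.tendsto_diffQuot_restrict {Ω : Set (Vec n)} {e : Vec n} (he : ‖e‖ = 1)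
    {g G : Vec n → E} (h : HasWeakDeriv Ω e g G) {x₀ : Vec n} {R R' : ℝ} (hR0 : 0 ≤ R)
    (hR : R < R') (hΩ : Metric.closedBall x₀ R' ⊆ Ω)
    (hg : MemLp g 2 (volume.restrict (Metric.closedBall x₀ R')))
    (hG : MemLp G 2 (volume.restrict (Metric.closedBall x₀ R')))
    (hgl : LocallyIntegrableOn g Ω volume) (hGl : LocallyIntegrableOn G Ω volume) :
    Tendsto (fun τ : ℝ => eLpNorm (fun x => τ⁻¹ • (g (x + τ • e) - g x) - G x) 2
      (volume.restrict (Metric.closedBall x₀ R))) (𝓝[>] 0) (𝓝 0) := by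
  obtain ⟨χ, hχ, hχs, hχt, hχ01, hχ1⟩ := exists_cutoff x₀ (r := (R + R') / 2) (R := R')
    (by linarith) (by linarith)
  have hχΩ := hχt.trans hΩ
  have hw := h.smul_cutoff hgl hGl hχ hχs hχΩ
  have i1 := integrable_smul_of_locallyIntegrableOn hgl hχ.continuous hχs hχΩ
  have i2 := integrable_weakDeriv_smul (e := e) hgl hGl hχ hχs hχΩ
  have m1 := memLp_weakDeriv_smul (e := e) measurableSet_closedBall hg hG hχ hχs hχt
  have ht := (hw.tendsto_diffQuot i1 i2 m1).mono_left
    (nhdsWithin_mono (0 : ℝ) (s := Ioi 0) fun x hx => (ne_of_gt hx : x ≠ 0))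
  refine tendsto_of_tendsto_of_tendsto_of_le_of_le' tendsto_const_nhds ht
    (Eventually.of_forall fun _ => zero_le) ?_
  filter_upwards [Ioo_mem_nhdsGT (show (0 : ℝ) < (R' - R) / 2 by linarith)] with τ hτ
  refine le_trans (le_of_eq ?_) (eLpNorm_mono_measure _
    (Measure.restrict_le_self (s := Metric.closedBall x₀ R)))
  refine eLpNorm_congr_ae ?_
  filter_upwards [ae_restrict_mem measurableSet_closedBall] with x hx
  have hx1 : x ∈ Metric.closedBall x₀ ((R + R') / 2) :=
    Metric.closedBall_subset_closedBall (by linarith) hx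
  have hx2 : x + τ • e ∈ Metric.closedBall x₀ ((R + R') / 2) := by
    rw [Metric.mem_closedBall, dist_eq_norm] at hx ⊢
    have : x + τ • e - x₀ = (x - x₀) + τ • e := by abel
    rw [this]
    refine (norm_add_le _ _).trans ?_
    rw [norm_smul, he, Real.norm_of_nonneg hτ.1.le]
    linarith [hτ.2]
  rw [(hχ1 _ hx1).1, (hχ1 _ hx2).1, (hχ1 _ hx1).2]
  simp

theorem mem_closedBall_add_smul {x₀ x e : Vec n} (he : ‖e‖ = 1) {R R' τ : ℝ}
    (hx : x ∈ Metric.closedBall x₀ R) (hτ : 0 ≤ τ) (hR : R + τ ≤ R') :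
    x + τ • e ∈ Metric.closedBall x₀ R' := by
  rw [Metric.mem_closedBall, dist_eq_norm] at hx ⊢
  have : x + τ • e - x₀ = (x - x₀) + τ • e := by abel
  rw [this]
  refine (norm_add_le _ _).trans ?_
  rw [norm_smul, he, Real.norm_of_nonneg hτ]
  linarith

theorem setIntegral_eq_of_eq_zero {K B : Set (Vec n)} (hK : MeasurableSet K) (hBK : B ⊆ K)
    {Y : Vec n → E} (hY : ∀ x, x ∉ B → Y x = 0) {q : Vec n → E → ℝ} (hq : ∀ x, q x 0 = 0) :
    ∫ x in K, q x (Y x) = ∫ x in B, q x (Y x) :=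
  setIntegral_eq_of_subset_of_forall_sdiff_eq_zero hK hBK fun x hx => by rw [hY x hx.2, hq]

theorem setIntegral_comp_sub {K B : Set (Vec n)} (hK : MeasurableSet K) (hB : MeasurableSet B)
    {c : Vec n} (hBK : ∀ x ∈ B, x + c ∈ K) {Y : Vec n → E} (hY : ∀ x, x ∉ B → Y x = 0)
    {q : Vec n → E → ℝ} (hq : ∀ x, q x 0 = 0) :
    ∫ x in K, q x (Y (x - c)) = ∫ x in B, q (x + c) (Y x) := by
  rw [← integral_indicator hK, ← integral_indicator hB,
    ← integral_add_right_eq_self (μ := (volume : Measure (Vec n))) _ c]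
  congr 1
  ext1 x
  by_cases hx : x ∈ B
  · rw [indicator_of_mem hx, indicator_of_mem (hBK x hx), add_sub_cancel_right]
  · rw [indicator_of_notMem hx]
    by_cases hx' : x + c ∈ K
    · rw [indicator_of_mem hx', add_sub_cancel_right, hY x hx, hq]
    · rw [indicator_of_notMem hx']

end Generic

/-- Pointwise `L^s`-control of the translates of `x ↦ D_ξ F(x, ξ)`, uniformly in `ξ`. -/
theorem StructureConditions.gradient_translate_le {Ω : Set (Vec n)} {p L L₁ ν s : ℝ}
    {k : Vec n → ℝ} {F : Vec n → Mat n N → ℝ} (hS : StructureConditions Ω p L L₁ ν s k F)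
    (hs : 2 ≤ s) {x₀ : Vec n} {R R₁ R₂ : ℝ} (hR0 : 0 ≤ R) (hR₁ : R < R₁) (hR₂ : R₁ < R₂)
    (hΩ : Metric.closedBall x₀ R₂ ⊆ Ω) (i : Fin n) {h : ℝ} (hh : 0 < h) (hhR : R + h ≤ R₁) :
    ∀ᵐ x, x ∈ Metric.closedBall x₀ R → ∀ ξ, 1 < ‖ξ‖ →
      ‖gradient (F (x + h • EuclideanSpace.single i (1 : ℝ))) ξ - gradient (F x) ξ‖ ≤
        h * (∫ t in Ioc (0 : ℝ) 1, indicator (Metric.closedBall x₀ R₁) k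
          (x + (t * h) • EuclideanSpace.single i (1 : ℝ))) * ‖ξ‖ ^ (p - 1) := by
  set e : Vec n := EuclideanSpace.single i 1 with he_def
  have he : ‖e‖ = 1 := by simp [he_def]
  set K := Metric.closedBall x₀ R₁ with hK_def
  have hKΩ : K ⊆ Ω := (Metric.closedBall_subset_closedBall hR₂.le).trans hΩ
  have hKc : IsCompact K := isCompact_closedBall _ _
  set kK := indicator K k with hkK
  haveI : IsFiniteMeasure (volume.restrict K : Measure (Vec n)) :=
    ⟨by simpa using hKc.measure_lt_top⟩
  have hkint : Integrable kK volume := by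
    rw [hkK, integrable_indicator_iff measurableSet_closedBall]
    exact (hS.k_mem.two hs hKc hKΩ).integrable (by norm_num)
  obtain ⟨Mx, hM1, hM2⟩ := hS.mixed
  obtain ⟨χ, hχ, hχs, hχt, -, hχ1⟩ := exists_cutoff x₀ (by linarith : 0 ≤ R₁) hR₂
  have hχΩ := hχt.trans hΩ
  have hmeas : Measurable fun t : ℝ => (t * h) • e := by fun_prop
  have hqmp := quasiMeasurePreserving_add_comp (μ := volume.restrict (Ioc (0 : ℝ) 1)) hmeas
  have hki : ∀ᵐ x : Vec n, Integrable (fun t => kK (x + (t * h) • e))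
      (volume.restrict (Ioc (0 : ℝ) 1)) :=
    (integrable_translate_prod (μ := volume.restrict (Ioc (0 : ℝ) 1)) hkint hmeas).prod_right_ae
  -- For a single `ξ` the increment is `h` times an average of the weak derivative along the
  -- segment, bounded there by `k |ξ|^(p-1)`.
  have hfix : ∀ ξ : Mat n N, 1 < ‖ξ‖ → ∀ᵐ x, x ∈ Metric.closedBall x₀ R →
      ‖gradient (F (x + h • e)) ξ - gradient (F x) ξ‖ ≤
        h * (∫ t in Ioc (0 : ℝ) 1, kK (x + (t * h) • e)) * ‖ξ‖ ^ (p - 1) := by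
    intro ξ hξ
    have hwg := hM1 ξ hξ
    have hGl : LocallyIntegrableOn (fun x => column i (Mx x ξ)) Ω volume := by
      intro x hx
      obtain ⟨t, ht, hti⟩ := hwg.2.1 x hx
      exact ⟨t, ht, Integrable.mono hti ((column i).continuous.comp_aestronglyMeasurable hti.1)
        (Eventually.of_forall fun y => norm_column_le i _)⟩
    have hav := ((hwg.hasWeakDeriv i).smul_cutoff hwg.1 hGl hχ hχs hχΩ).sub_eq_average
      (integrable_smul_of_locallyIntegrableOn hwg.1 hχ.continuous hχs hχΩ)
      (integrable_weakDeriv_smul (e := e) hwg.1 hGl hχ hχs hχΩ) h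
    have hb : ∀ᵐ y, y ∈ K → ‖χ y • column i (Mx y ξ) + fderiv ℝ χ y e • gradient (F y) ξ‖
        ≤ kK y * ‖ξ‖ ^ (p - 1) := by
      have : ∀ᵐ y ∂(volume.restrict K), ∀ ξ, 1 < ‖ξ‖ → ‖Mx y ξ‖ ≤ k y * ‖ξ‖ ^ (p - 1) :=
        ae_mono (Measure.restrict_mono hKΩ le_rfl) hM2
      rw [ae_restrict_iff' measurableSet_closedBall] at this
      filter_upwards [this] with y hy hyK
      rw [(hχ1 y hyK).1, (hχ1 y hyK).2, one_smul, zero_smul, add_zero, hkK, indicator_of_mem hyK]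
      exact (norm_column_le _ _).trans (hy hyK ξ hξ)
    have hb2 := Measure.ae_ae_of_ae_prod (hqmp.ae hb)
    filter_upwards [hav, hb2, hki] with x h1 h2 h3 hx
    have hx0 : x ∈ K := Metric.closedBall_subset_closedBall hR₁.le hx
    have hx1 : x + h • e ∈ K := mem_closedBall_add_smul he hx hh.le hhR
    rw [(hχ1 _ hx0).1, (hχ1 _ hx1).1, one_smul, one_smul] at h1
    rw [h1, norm_smul, Real.norm_of_nonneg hh.le, mul_assoc, ← integral_mul_const]
    refine mul_le_mul_of_nonneg_left ?_ hh.le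
    refine norm_integral_le_of_norm_le (h3.mul_const _) ?_
    filter_upwards [h2, ae_restrict_mem measurableSet_Ioc] with t ht ht01
    exact ht (mem_closedBall_add_smul he hx (mul_nonneg ht01.1.le hh.le)
      (by nlinarith [ht01.2]))
  -- The exceptional null set depends on `ξ`. A countable dense set of `ξ` together with continuity
  -- of the gradients in `ξ` yields one null set for all of them, as needed for inserting `ξ = V(x +
  -- he)`.
  obtain ⟨S, hSc, hSd⟩ := TopologicalSpace.exists_countable_dense (Mat n N)
  have hopen : IsOpen {ξ : Mat n N | 1 < ‖ξ‖} := isOpen_lt continuous_const continuous_norm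
  have hall : ∀ᵐ x, ∀ ξ ∈ S, 1 < ‖ξ‖ → x ∈ Metric.closedBall x₀ R →
      ‖gradient (F (x + h • e)) ξ - gradient (F x) ξ‖ ≤
        h * (∫ t in Ioc (0 : ℝ) 1, kK (x + (t * h) • e)) * ‖ξ‖ ^ (p - 1) := by
    rw [ae_ball_iff hSc]
    intro ξ _
    by_cases hξ : 1 < ‖ξ‖
    · filter_upwards [hfix ξ hξ] with x hx _ using hx
    · exact Eventually.of_forall fun x h' => absurd h' hξ
  have hc2 : ∀ᵐ x, x ∈ K → ContDiffOn ℝ 2 (F x) {ξ | 1 < ‖ξ‖} := by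
    rw [← ae_restrict_iff' measurableSet_closedBall]
    exact ae_mono (Measure.restrict_mono hKΩ le_rfl) hS.contDiff
  have hc3 : ∀ᵐ x, x + h • e ∈ K → ContDiffOn ℝ 2 (F (x + h • e)) {ξ | 1 < ‖ξ‖} :=
    (measurePreserving_add_right volume (h • e)).quasiMeasurePreserving.ae hc2
  filter_upwards [hall, hc2, hc3] with x h1 h2 h3 hx ξ hξ
  have hx0 : x ∈ K := Metric.closedBall_subset_closedBall hR₁.le hx
  have hx1 : x + h • e ∈ K := mem_closedBall_add_smul he hx hh.le hhR
  have hcl : ξ ∈ closure ({ξ : Mat n N | 1 < ‖ξ‖} ∩ S) :=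
    hSd.open_subset_closure_inter hopen hξ
  have c1 : ContinuousAt (gradient (F x)) ξ := (hasFDerivAt_gradient (h2 hx0) hξ).continuousAt
  have c2 : ContinuousAt (gradient (F (x + h • e))) ξ :=
    (hasFDerivAt_gradient (h3 hx1) hξ).continuousAt
  have c3 : ContinuousAt (fun ξ : Mat n N =>
      h * (∫ t in Ioc (0 : ℝ) 1, kK (x + (t * h) • e)) * ‖ξ‖ ^ (p - 1)) ξ :=
    continuousAt_const.mul ((continuous_norm.continuousAt).rpow_const
      (Or.inl (by positivity)))
  exact ContinuousWithinAt.closure_le hcl (c2.sub c1).norm.continuousWithinAt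
    c3.continuousWithinAt fun η hη => h1 η hη.2 hη.1 hx

end Translation

/-! ### Pointwise control of difference quotients of `D_ξ F(x, V)`. -/

section DifferentiatedEquation

open Filter Topology

variable {n N : ℕ}

/-- Here `v₀, v₁` are the values of `V` at `x` and `x + he`, and `d` is the weak derivative. If
neither `hd` nor `v₁ - v₀ - hd` is large compared with `δ`, then `v₁` is close to `v₀`, both lie
outside the unit ball, and the quotient splits into a variation in `x` (controlled by `k`) and a
Lipschitz variation in `ξ`. Otherwise `1/h` is at most a multiple of the error `|(v₁ - v₀)/h - d|`
plus a tail of `|d|`; this absorbs every crude bound of order `1/h`, including the penalty for `|v₁|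
≤ 1`. -/
theorem norm_diffQuot_sub_le {W : Type*} [NormedAddCommGroup W] [NormedSpace ℝ W]
    {g₀ g₁ : W → W} {v₀ v₁ d γ₀ γ₁ : W} {h δ A B c Λ p : ℝ} (hp : 1 ≤ p) (hh : 0 < h)
    (hδ : 0 < δ) (hA : 0 ≤ A) (hΛ : 0 ≤ Λ) (hB : 0 ≤ B) (hc : 0 ≤ c)
    (hv₀ : 1 + δ < ‖v₀‖)
    (hγ₀ : γ₀ = g₀ v₀) (hγ₁ : 1 < ‖v₁‖ → γ₁ = g₁ v₁) (hb₀ : ‖γ₀‖ ≤ B) (hb₁ : ‖γ₁‖ ≤ B)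
    (hL : ∀ ξ ∈ Metric.ball v₀ (δ / 2), ∀ η ∈ Metric.ball v₀ (δ / 2), ‖g₀ ξ - g₀ η‖ ≤ Λ * ‖ξ - η‖)
    (ht : ∀ ξ, 1 < ‖ξ‖ → ‖g₁ ξ - g₀ ξ‖ ≤ h * A * ‖ξ‖ ^ (p - 1)) {T : W}
    (hT : T = if h * ‖d‖ < δ / 4 then h⁻¹ • (g₀ (v₀ + h • d) - g₀ v₀) else 0) :
    ‖T‖ ≤ Λ * ‖d‖ ∧
    ‖h⁻¹ • (γ₁ - γ₀) - T‖ + c * h⁻¹ * (if ‖v₁‖ ≤ 1 then 1 else 0) ≤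
      2 ^ (p - 1) * A * ‖v₀‖ ^ (p - 1) + (Λ + (2 * B + c) * (4 / δ)) *
        (‖h⁻¹ • (v₁ - v₀) - d‖ + if h * ‖d‖ < δ / 4 then 0 else ‖d‖) := by
  have hhi : 0 < h⁻¹ := inv_pos.2 hh
  have hhd : ‖h • d‖ = h * ‖d‖ := by rw [norm_smul, Real.norm_of_nonneg hh.le]
  have hv0mem : v₀ ∈ Metric.ball v₀ (δ / 2) := Metric.mem_ball_self (by positivity)
  have hTle : ‖T‖ ≤ Λ * ‖d‖ := by
    rw [hT]
    split_ifs with h1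
    · rw [norm_smul, Real.norm_of_nonneg hhi.le, inv_mul_le_iff₀ hh]
      refine (hL _ ?_ _ hv0mem).trans (le_of_eq ?_)
      · rw [mem_ball_iff_norm, add_sub_cancel_left, hhd]
        linarith
      · rw [add_sub_cancel_left, hhd]
        ring
    · rw [norm_zero]
      positivity
  refine ⟨hTle, ?_⟩
  set E := ‖h⁻¹ • (v₁ - v₀) - d‖ + if h * ‖d‖ < δ / 4 then 0 else ‖d‖ with hE
  have hE1 : ‖h⁻¹ • (v₁ - v₀) - d‖ ≤ E := by
    rw [hE]
    refine le_add_of_nonneg_right ?_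
    split_ifs <;> positivity
  have hEd : ‖v₁ - v₀ - h • d‖ = h * ‖h⁻¹ • (v₁ - v₀) - d‖ := by
    rw [← Real.norm_of_nonneg hh.le, ← norm_smul, smul_sub, smul_smul, Real.norm_of_nonneg hh.le,
      mul_inv_cancel₀ hh.ne', one_smul]
  have hE0 : 0 ≤ E := (norm_nonneg _).trans hE1
  have hmain : 0 ≤ 2 ^ (p - 1) * A * ‖v₀‖ ^ (p - 1) := by positivity
  -- The thresholds add up to `δ/2`, half of the margin `|v₀| - 1`, so the segment stays where `g₀`
  -- is Lipschitz.
  by_cases hgood : h * ‖d‖ < δ / 4 ∧ ‖v₁ - v₀ - h • d‖ < δ / 4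
  · obtain ⟨g1, g2⟩ := hgood
    have hdist : ‖v₁ - v₀‖ < δ / 2 := by
      have : v₁ - v₀ = (v₁ - v₀ - h • d) + h • d := by abel
      rw [this]
      refine (norm_add_le _ _).trans_lt ?_
      rw [hhd]
      linarith
    have hv1 : 1 < ‖v₁‖ := by
      have := norm_sub_norm_le v₀ v₁
      rw [norm_sub_rev] at this
      linarith
    have hv1' : ‖v₁‖ ≤ 2 * ‖v₀‖ := by
      have := norm_sub_norm_le v₁ v₀
      linarith
    have e1 : h⁻¹ • (γ₁ - γ₀) - T
        = h⁻¹ • (g₁ v₁ - g₀ v₁) + h⁻¹ • (g₀ v₁ - g₀ (v₀ + h • d)) := by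
      rw [hT, if_pos g1, hγ₀, hγ₁ hv1]
      module
    have b1 : ‖h⁻¹ • (g₁ v₁ - g₀ v₁)‖ ≤ 2 ^ (p - 1) * A * ‖v₀‖ ^ (p - 1) := by
      rw [norm_smul, Real.norm_of_nonneg hhi.le, inv_mul_le_iff₀ hh]
      refine (ht v₁ hv1).trans ?_
      have : ‖v₁‖ ^ (p - 1) ≤ 2 ^ (p - 1) * ‖v₀‖ ^ (p - 1) := by
        rw [← Real.mul_rpow (by norm_num) (norm_nonneg _)]
        exact Real.rpow_le_rpow (norm_nonneg _) hv1' (by linarith)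
      calc h * A * ‖v₁‖ ^ (p - 1) ≤ h * A * (2 ^ (p - 1) * ‖v₀‖ ^ (p - 1)) := by gcongr
        _ = _ := by ring
    have b2 : ‖h⁻¹ • (g₀ v₁ - g₀ (v₀ + h • d))‖ ≤ Λ * E := by
      rw [norm_smul, Real.norm_of_nonneg hhi.le, inv_mul_le_iff₀ hh]
      refine (hL v₁ (by rwa [mem_ball_iff_norm]) _ ?_).trans ?_
      · rw [mem_ball_iff_norm, add_sub_cancel_left, hhd]
        linarith
      · have : v₁ - (v₀ + h • d) = v₁ - v₀ - h • d := by abel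
        rw [this, hEd]
        calc Λ * (h * ‖h⁻¹ • (v₁ - v₀) - d‖) ≤ Λ * (h * E) := by gcongr
          _ = _ := by ring
    rw [if_neg (not_le.2 hv1), mul_zero, add_zero, e1]
    refine (norm_add_le _ _).trans ?_
    have : 0 ≤ (2 * B + c) * (4 / δ) * E := by positivity
    linarith [b1, b2]
  -- At bad points one of the two displacements is at least `δ/4`, and `hE` dominates it.
  · have hbad : h⁻¹ ≤ 4 / δ * E := by
      rw [not_and_or, not_lt, not_lt] at hgood
      have key : δ / 4 ≤ h * E := by
        rcases hgood with g | g
        · refine g.trans (mul_le_mul_of_nonneg_left ?_ hh.le)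
          rw [hE, if_neg (not_lt.2 g)]
          exact le_add_of_nonneg_left (norm_nonneg _)
        · rw [hEd] at g
          exact g.trans (mul_le_mul_of_nonneg_left hE1 hh.le)
      rw [inv_le_iff_one_le_mul₀ hh]
      have h2 : (4 / δ) * (δ / 4) = 1 := by field_simp
      calc (1 : ℝ) = (4 / δ) * (δ / 4) := h2.symm
        _ ≤ (4 / δ) * (h * E) := by gcongr
        _ = _ := by ring
    have bT : ‖T‖ ≤ Λ * E := by
      by_cases h1 : h * ‖d‖ < δ / 4
      · refine hTle.trans (mul_le_mul_of_nonneg_left ?_ hΛ)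
        have h3 : δ / 4 ≤ h * E := by
          rw [not_and_or] at hgood
          rcases hgood with g | g
          · exact absurd h1 g
          · rw [not_lt, hEd] at g
            exact g.trans (mul_le_mul_of_nonneg_left hE1 hh.le)
        exact le_of_mul_le_mul_left (h1.le.trans h3) hh
      · rw [hT, if_neg h1, norm_zero]
        positivity
    have b1 : ‖h⁻¹ • (γ₁ - γ₀)‖ ≤ h⁻¹ * (2 * B) := by
      rw [norm_smul, Real.norm_of_nonneg hhi.le]
      refine mul_le_mul_of_nonneg_left ((norm_sub_le _ _).trans ?_) hhi.le
      linarith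
    have b2 : c * h⁻¹ * (if ‖v₁‖ ≤ 1 then (1 : ℝ) else 0) ≤ h⁻¹ * c := by
      rw [mul_comm c]
      refine mul_le_of_le_one_right (by positivity) ?_
      split_ifs <;> norm_num
    have b3 : h⁻¹ * (2 * B) + h⁻¹ * c ≤ (2 * B + c) * (4 / δ) * E := by
      calc h⁻¹ * (2 * B) + h⁻¹ * c = (2 * B + c) * h⁻¹ := by ring
        _ ≤ (2 * B + c) * (4 / δ * E) := by gcongr
        _ = _ := by ring
    have := norm_sub_le (h⁻¹ • (γ₁ - γ₀)) T
    linarith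

theorem lipschitz_gradient_of_hessianNorm_le {F₀ : Mat n N → ℝ} {Λ δ : ℝ} {v₀ : Mat n N}
    (hF : ContDiffOn ℝ 2 F₀ {ξ | 1 < ‖ξ‖}) (hv₀ : 1 + δ < ‖v₀‖) (hδ : 0 ≤ δ)
    (hH : ∀ ξ ∈ Metric.ball v₀ (δ / 2), hessianNorm F₀ ξ ≤ Λ) :
    ∀ ξ ∈ Metric.ball v₀ (δ / 2), ∀ η ∈ Metric.ball v₀ (δ / 2),
      ‖gradient F₀ ξ - gradient F₀ η‖ ≤ Λ * ‖ξ - η‖ := by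
  intro ξ hξ η hη
  have hlt : ∀ ζ ∈ Metric.ball v₀ (δ / 2), 1 < ‖ζ‖ := by
    intro ζ hζ
    rw [mem_ball_iff_norm'] at hζ
    have := norm_sub_norm_le v₀ ζ
    linarith
  refine (convex_ball v₀ (δ / 2)).norm_image_sub_le_of_norm_hasFDerivWithin_le
    (f' := fun ζ => fderiv ℝ (gradient F₀) ζ)
    (fun ζ hζ => (hasFDerivAt_gradient hF (hlt ζ hζ)).hasFDerivWithinAt) (fun ζ hζ => ?_) hη hξ
  have h0 : 0 ≤ Λ := (Real.sqrt_nonneg _).trans (hH ζ hζ)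
  refine ContinuousLinearMap.opNorm_le_bound _ h0 fun y => ?_
  exact (norm_apply_le_hilbertSchmidt _ y).trans
    (mul_le_mul_of_nonneg_right (hH ζ hζ) (norm_nonneg _))

end DifferentiatedEquation

/-! ### Testing with difference quotients. -/

section DifferentiatedInequality

open Filter Topology

variable {n N : ℕ}

theorem MemLp.comp_add_restrict {E : Type*} [NormedAddCommGroup E] {g : Vec n → E} {q : ℝ≥0∞}
    {K B : Set (Vec n)} (hK : MeasurableSet K) (hB : MeasurableSet B) {c : Vec n}
    (hBK : ∀ x ∈ B, x + c ∈ K) (hg : MemLp g q (volume.restrict K)) :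
    MemLp (fun x => g (x + c)) q (volume.restrict B) := by
  rw [← memLp_indicator_iff_restrict hK] at hg
  have h := (hg.comp_measurePreserving (measurePreserving_add_right volume c)).restrict B
  refine h.ae_eq ?_
  filter_upwards [ae_restrict_mem hB] with x hx
  simp [hBK x hx]

theorem ae_restrict_comp_add {P : Vec n → Prop} {K B : Set (Vec n)} (hK : MeasurableSet K)
    (hB : MeasurableSet B) {c : Vec n} (hBK : ∀ x ∈ B, x + c ∈ K)
    (h : ∀ᵐ x ∂(volume.restrict K), P x) : ∀ᵐ x ∂(volume.restrict B), P (x + c) := by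
  rw [ae_restrict_iff' hK] at h
  rw [ae_restrict_iff' hB]
  filter_upwards [(measurePreserving_add_right volume c).quasiMeasurePreserving.ae h] with x hx hxB
  exact hx (hBK x hxB)

theorem memLp_average_translate {g : Vec n → ℝ} (hg : Integrable g) (hg2 : MemLp g 2 volume)
    (e : Vec n) (h : ℝ) :
    MemLp (fun x => ∫ t in Ioc (0 : ℝ) 1, g (x + (t * h) • e)) 2 volume := by
  have hmeas : Measurable fun t : ℝ => (t * h) • e := by fun_prop
  have h1 : eLpNorm (fun x => (∫ t in Ioc (0 : ℝ) 1, g (x + (t * h) • e)) - g x) 2 volume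
      ≤ 2 * eLpNorm g 2 volume := by
    refine eLpNorm_average_translate_sub_le hmeas hg.1 (Eventually.of_forall fun t => ?_)
    have h2 := hg2.comp_measurePreserving (measurePreserving_add_right volume ((t * h) • e))
    have h3 := eLpNorm_sub_le h2.1 hg2.1 (p := 2) (by norm_num)
    rw [eLpNorm_comp_measurePreserving hg.1 (measurePreserving_add_right volume _)] at h3
    rw [two_mul]
    exact h3
  have hm : AEStronglyMeasurable (fun x => ∫ t in Ioc (0 : ℝ) 1, g (x + (t * h) • e)) volume :=
    (integrable_translate_prod (μ := volume.restrict (Ioc (0 : ℝ) 1)) hg hmeas).integral_prod_left.1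
  have h4 : MemLp (fun x => (∫ t in Ioc (0 : ℝ) 1, g (x + (t * h) • e)) - g x) 2 volume :=
    ⟨hm.sub hg.1, h1.trans_lt (ENNReal.mul_lt_top (by norm_num) hg2.2)⟩
  refine (h4.add hg2).ae_eq (Eventually.of_forall fun x => ?_)
  simp

theorem tendsto_average_translate {g : Vec n → ℝ} (hg : Integrable g) (hg2 : MemLp g 2 volume)
    (e : Vec n) :
    Tendsto (fun h : ℝ => eLpNorm (fun x => (∫ t in Ioc (0 : ℝ) 1, g (x + (t * h) • e)) - g x) 2
      volume) (𝓝 0) (𝓝 0) := by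
  rw [ENNReal.tendsto_nhds_zero]
  intro η hη
  have h0 := ENNReal.tendsto_nhds_zero.1 (tendsto_eLpNorm_translate_sub hg2) η hη
  obtain ⟨r, hr, hball⟩ := Metric.eventually_nhds_iff.1 h0
  have hc : Tendsto (fun h : ℝ => |h| * ‖e‖) (𝓝 0) (𝓝 0) := by
    have : Continuous fun h : ℝ => |h| * ‖e‖ := by fun_prop
    simpa using this.tendsto 0
  filter_upwards [hc.eventually (gt_mem_nhds hr)] with h hh
  have hmeas : Measurable fun t : ℝ => (t * h) • e := by fun_prop
  refine eLpNorm_average_translate_sub_le hmeas hg.1 ?_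
  filter_upwards [ae_restrict_mem measurableSet_Ioc] with t ht
  apply hball
  rw [dist_zero_right, norm_smul, norm_mul, Real.norm_of_nonneg ht.1.le, Real.norm_eq_abs]
  refine lt_of_le_of_lt ?_ hh
  exact mul_le_mul_of_nonneg_right (mul_le_of_le_one_left (abs_nonneg _) ht.2) (norm_nonneg _)

/-- The Euler-Lagrange inequality tested with difference quotients. -/
theorem diffQuot_test_le {K B : Set (Vec n)} (hK : MeasurableSet K) (hB : MeasurableSet B)
    (hBK : B ⊆ K) {c : Vec n} (hcK : ∀ x ∈ B, x + c ∈ K) {γ V Y : Vec n → Mat n N}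
    (hγ : MemLp γ 2 (volume.restrict K)) (hV : AEMeasurable V (volume.restrict K))
    [IsFiniteMeasure (volume.restrict K : Measure (Vec n))]
    (hY : MemLp Y 2 volume) (hYB : ∀ x, x ∉ B → Y x = 0) (hYV : ∀ x, ‖V x‖ ≤ 1 → Y x = 0)
    {h C a : ℝ} (hh : 0 < h) (hC : 0 ≤ C)
    (hEL : -a ≤ (∫ x in K, inner ℝ (γ x) (h⁻¹ • (Y x - Y (x - c)))) +
      C * ∫ x in K, indicator {x | ‖V x‖ ≤ 1} (fun x => ‖h⁻¹ • (Y x - Y (x - c))‖) x) :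
    ∃ q : Vec n → ℝ, Integrable q (volume.restrict B) ∧
      (∀ x, q x = inner ℝ (h⁻¹ • (γ (x + c) - γ x)) (Y x) -
        C * h⁻¹ * (if ‖V (x + c)‖ ≤ 1 then 1 else 0) * ‖Y x‖) ∧
      ∫ x in B, q x ≤ a := by
  set I : Vec n → ℝ := indicator {x | ‖V x‖ ≤ 1} fun _ => 1 with hI
  have hIm : MemLp I 2 (volume.restrict K) := by
    refine MemLp.of_bound (aestronglyMeasurable_const.indicator₀ (hV.norm.nullMeasurable
      measurableSet_Iic)) 1 (Eventually.of_forall fun x => ?_)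
    refine (norm_indicator_le_norm_self _ _).trans (by simp)
  have hIif : ∀ x, I x = if ‖V x‖ ≤ 1 then 1 else 0 := fun x => by
    rw [hI, indicator_apply]; rfl
  have hI0 : ∀ x, 0 ≤ I x := fun x => by rw [hIif]; split_ifs <;> norm_num
  have hYc : MemLp (fun x => Y (x - c)) 2 (volume.restrict K) :=
    (hY.comp_measurePreserving (measurePreserving_sub_right volume c)).restrict K
  have hYK := hY.restrict K
  have hγc := MemLp.comp_add_restrict hK hB hcK hγ
  have hIc := MemLp.comp_add_restrict hK hB hcK hIm
  have hγB : MemLp γ 2 (volume.restrict B) := hγ.mono_measure (Measure.restrict_mono hBK le_rfl)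
  have hYB2 := hY.restrict B
  have hin : ∀ {μ : Measure (Vec n)} {w z : Vec n → Mat n N}, MemLp w 2 μ → MemLp z 2 μ →
      Integrable (fun x => (inner ℝ (w x) (z x) : ℝ)) μ := fun hw hz =>
    Integrable.mono' (integrable_norm_mul_norm hw hz) (hw.1.inner hz.1)
      (Eventually.of_forall fun x => norm_inner_le_norm _ _)
  have hmu : ∀ {μ : Measure (Vec n)} {w : Vec n → ℝ} {z : Vec n → Mat n N}, MemLp w 2 μ →
      MemLp z 2 μ → Integrable (fun x => w x * ‖z x‖) μ := fun hw hz =>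
    Integrable.mono' (integrable_norm_mul_norm hw hz) (hw.1.mul hz.1.norm)
      (Eventually.of_forall fun x => by simp)
  have e1 : ∫ x in K, (inner ℝ (γ x) (h⁻¹ • (Y x - Y (x - c))) : ℝ)
      = h⁻¹ * ((∫ x in B, (inner ℝ (γ x) (Y x) : ℝ)) - ∫ x in B, (inner ℝ (γ (x + c)) (Y x) : ℝ)) := by
    simp only [inner_smul_right, inner_sub_right]
    rw [integral_const_mul, integral_sub (hin hγ hYK) (hin hγ hYc),
      setIntegral_eq_of_eq_zero hK hBK hYB (q := fun x y => (inner ℝ (γ x) y : ℝ))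
        (fun x => inner_zero_right _),
      setIntegral_comp_sub hK hB hcK hYB (q := fun x y => (inner ℝ (γ x) y : ℝ))
        (fun x => inner_zero_right _)]
  have e2 : ∫ x in K, indicator {x | ‖V x‖ ≤ 1} (fun x => ‖h⁻¹ • (Y x - Y (x - c))‖) x
      ≤ h⁻¹ * ∫ x in B, I (x + c) * ‖Y x‖ := by
    -- `Y` vanishes where `|V| ≤ 1`, so only its translate meets the bad set; after a change of
    -- variables the indicator is evaluated at `x + c`.
    have hz : ∫ x in K, I x * ‖Y x‖ = 0 := by
      have : ∀ x, I x * ‖Y x‖ = 0 := fun x => by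
        by_cases hx : ‖V x‖ ≤ 1
        · rw [hYV x hx, norm_zero, mul_zero]
        · rw [hIif, if_neg hx, zero_mul]
      simp only [this, integral_zero]
    have hc := setIntegral_comp_sub hK hB hcK hYB (q := fun x y => I x * ‖y‖)
        (fun x => by simp)
    rw [← hc, ← zero_add (∫ x in K, I x * ‖Y (x - c)‖), ← hz,
      ← integral_add (hmu hIm hYK) (hmu hIm hYc), ← integral_const_mul]
    have heq : ∀ x, indicator {x | ‖V x‖ ≤ 1} (fun x => ‖h⁻¹ • (Y x - Y (x - c))‖) x
        = I x * ‖h⁻¹ • (Y x - Y (x - c))‖ := fun x => by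
      by_cases hx : ‖V x‖ ≤ 1 <;> simp [hI, hx]
    simp only [heq]
    refine integral_mono (hmu hIm ((hYK.sub hYc).const_smul h⁻¹))
      (((hmu hIm hYK).add (hmu hIm hYc)).const_mul h⁻¹) fun x => ?_
    change I x * ‖h⁻¹ • (Y x - Y (x - c))‖ ≤ h⁻¹ * (I x * ‖Y x‖ + I x * ‖Y (x - c)‖)
    rw [norm_smul, Real.norm_of_nonneg (inv_pos.2 hh).le]
    calc I x * (h⁻¹ * ‖Y x - Y (x - c)‖) ≤ I x * (h⁻¹ * (‖Y x‖ + ‖Y (x - c)‖)) := by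
          have := inv_pos.2 hh
          have := hI0 x
          gcongr
          exact norm_sub_le _ _
      _ = _ := by ring
  have q1 : Integrable (fun x => (inner ℝ (h⁻¹ • (γ (x + c) - γ x)) (Y x) : ℝ))
      (volume.restrict B) := hin ((hγc.sub hγB).const_smul h⁻¹) hYB2
  have q2 : Integrable (fun x => C * h⁻¹ * (I (x + c) * ‖Y x‖)) (volume.restrict B) :=
    (hmu hIc hYB2).const_mul _
  refine ⟨fun x => inner ℝ (h⁻¹ • (γ (x + c) - γ x)) (Y x) - C * h⁻¹ * (I (x + c) * ‖Y x‖),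
    q1.sub q2, fun x => ?_, ?_⟩
  · beta_reduce
    rw [hIif, ← mul_assoc]
  · rw [integral_sub q1 q2, integral_const_mul]
    have e3 : ∫ x in B, (inner ℝ (h⁻¹ • (γ (x + c) - γ x)) (Y x) : ℝ)
        = h⁻¹ * ((∫ x in B, (inner ℝ (γ (x + c)) (Y x) : ℝ)) - ∫ x in B, (inner ℝ (γ x) (Y x) : ℝ)) := by
      simp only [real_inner_smul_left, inner_sub_left]
      rw [integral_const_mul, integral_sub (hin hγc hYB2) (hin hγB hYB2)]
    have e4 := mul_le_mul_of_nonneg_left e2 hC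
    rw [e3]
    rw [e1] at hEL
    linarith

end DifferentiatedInequality

/-! ### The second-order inequality. -/

section DifferentiatedInequality

open Filter Topology

variable {n N : ℕ}

theorem exteriorGradient_of_one_lt {F : Vec n → Mat n N → ℝ} {V : Vec n → Mat n N} {x : Vec n}
    (h : 1 < ‖V x‖) : exteriorGradient F V x = gradient (F x) (V x) := if_pos h

theorem tendsto_diffQuot_gradient_hessian {F₀ : Mat n N → ℝ}
    (hF : ContDiffOn ℝ 2 F₀ {ξ | 1 < ‖ξ‖}) {v : Mat n N} (hv : 1 < ‖v‖) (d : Mat n N) {δ : ℝ}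
    (hδ : 0 < δ) {h : ℕ → ℝ} (hh : Tendsto h atTop (𝓝[>] 0)) :
    Tendsto (fun m => if h m * ‖d‖ < δ then
      (h m)⁻¹ • (gradient F₀ (v + h m • d) - gradient F₀ v) else 0) atTop (𝓝 (hessian F₀ v d)) ∧
    Tendsto (fun m => if h m * ‖d‖ < δ then 0 else ‖d‖) atTop (𝓝 0) := by
  have hev : ∀ᶠ m in atTop, h m * ‖d‖ < δ := by
    have h0 : Tendsto (fun m => h m * ‖d‖) atTop (𝓝 (0 * ‖d‖)) :=
      (hh.mono_right nhdsWithin_le_nhds).mul_const _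
    rw [zero_mul] at h0
    exact h0.eventually (gt_mem_nhds hδ)
  constructor
  · have h1 := ((hasFDerivAt_gradient hF hv).hasLineDerivAt d).tendsto_slope_zero_right.comp hh
    refine h1.congr' ?_
    filter_upwards [hev] with m hm
    rw [if_pos hm]
    rfl
  · refine tendsto_const_nhds.congr' ?_
    filter_upwards [hev] with m hm
    rw [if_pos hm]

theorem le_of_weighted_sum {a b c v r z y t u w κ : ℝ}
    (h : (a + b) * y ≤ (c * r * v + κ * (t + z)) * y) (hw : |w| ≤ a * y) :
    u - w - κ * (z * y) ≤ u - b * y + (c * v * y * r + κ * y * t) := by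
  linarith [neg_abs_le w]

set_option maxHeartbeats 800000 in
/-- The Euler-Lagrange inequality, differentiated in the direction `e_i` on the set `|V| > 1 + δ`. -/
theorem EulerLagrangeIneq.differentiated {Ω : Set (Vec n)} {p L L₁ ν s : ℝ} {k : Vec n → ℝ}
    {F : Vec n → Mat n N → ℝ} {f : Vec n → Vec N} {V : Vec n → Mat n N} {D2 : Vec n → Tens n N}
    (hΩ : IsOpen Ω) (hp : 2 ≤ p) (hs : 2 ≤ s) (hL₁ : 0 ≤ L₁)
    (hS : StructureConditions Ω p L L₁ ν s k F)
    (hf : MemLpLoc f (ENNReal.ofReal s) Ω) (hEL : EulerLagrangeIneq Ω F f V)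
    (hVw : IsWeakGrad Ω V D2) (hV : MemLpLoc V ⊤ Ω) (hD : MemLpLoc D2 2 Ω)
    {x₀ : Vec n} {R : ℝ} (hR : 0 ≤ R) (hRΩ : Metric.closedBall x₀ R ⊆ Ω) {δ : ℝ} (hδ : 0 < δ)
    (hδ1 : δ ≤ 1) (i : Fin n) {ψ : Vec n → Vec N} {Y : Vec n → Mat n N}
    (hψ : MemLp ψ 2 volume) (hY : MemLp Y 2 volume) (hψs : tsupport ψ ⊆ Metric.closedBall x₀ R)
    (hYB : ∀ x, x ∉ Metric.closedBall x₀ R → Y x = 0)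
    (hw : ∀ j, HasWeakDeriv univ (EuclideanSpace.single j 1) ψ (fun x => column j (Y x)))
    (hYV : ∀ x, ‖V x‖ ≤ 1 + δ → Y x = 0) :
    Integrable (fun x => (inner ℝ (hessian (F x) (V x) (column i (D2 x))) (Y x) : ℝ))
      (volume.restrict (Metric.closedBall x₀ R)) ∧
    ∫ x in Metric.closedBall x₀ R, inner ℝ (hessian (F x) (V x) (column i (D2 x))) (Y x) ≤
      (∫ x in Metric.closedBall x₀ R, 2 ^ (p - 1) * k x * ‖V x‖ ^ (p - 1) * ‖Y x‖) +
        ∫ x in Metric.closedBall x₀ R, (‖f x‖ + 2) * ‖column i (Y x)‖ := by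
  set e : Vec n := EuclideanSpace.single i 1 with he_def
  have he : ‖e‖ = 1 := by simp [he_def]
  -- Three collars of width `ε`: the difference quotients of `ψ` live in radius `R + ε`, the
  -- first-order inequality is used in radius `R + 2ε`, and the estimate of translates of `D_ξ F`
  -- needs room up to `R + 3ε`.
  obtain ⟨ε₀, hε₀, hΩ₀⟩ := exists_closedBall_subset hΩ hR hRΩ
  set ε := ε₀ / 3 with hε_def
  have hε : 0 < ε := by positivity
  have hΩ₃ : Metric.closedBall x₀ (R + 3 * ε) ⊆ Ω := by
    rw [hε_def, mul_div_cancel₀ _ (by norm_num)]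
    exact hΩ₀
  set K := Metric.closedBall x₀ (R + 2 * ε) with hK_def
  set B := Metric.closedBall x₀ R with hB_def
  have hKc : IsCompact K := isCompact_closedBall _ _
  have hKm : MeasurableSet K := measurableSet_closedBall
  have hBm : MeasurableSet B := measurableSet_closedBall
  have hBK : B ⊆ K := Metric.closedBall_subset_closedBall (by linarith)
  have hKΩ : K ⊆ Ω := (Metric.closedBall_subset_closedBall (by linarith)).trans hΩ₃
  haveI : IsFiniteMeasure (volume.restrict K : Measure (Vec n)) :=
    ⟨by simpa using hKc.measure_lt_top⟩
  haveI : IsFiniteMeasure (volume.restrict B : Measure (Vec n)) :=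
    ⟨by simpa using (isCompact_closedBall x₀ R).measure_lt_top⟩
  have hleB : volume.restrict B ≤ (volume.restrict K : Measure (Vec n)) :=
    Measure.restrict_mono hBK le_rfl
  have hleΩ : volume.restrict K ≤ (volume.restrict Ω : Measure (Vec n)) :=
    Measure.restrict_mono hKΩ le_rfl
  obtain ⟨M, hM1, hM⟩ := hV.exists_bound hKc hKΩ
  obtain ⟨hγm, Cγ, hCγ0, hCγ⟩ := exists_exteriorGradient_bound (by linarith) hS hV hKc hKΩ
  have hγ2 : MemLp (exteriorGradient F V) 2 (volume.restrict K) := MemLp.of_bound hγm Cγ hCγ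
  have hf2 := hf.two hs hKc hKΩ
  have hVm : AEMeasurable V (volume.restrict K) := (hV K hKc hKΩ).1.aemeasurable
  have hV2 : MemLp V 2 (volume.restrict K) := MemLp.of_bound hVm.aestronglyMeasurable M hM
  obtain ⟨C, hC⟩ := hEL.sobolev (R₁ := R + ε) (by linarith) (by linarith) hKΩ hγ2 hf2 hVm
  -- the second derivatives in direction `e`
  set d : Vec n → Mat n N := fun x => column i (D2 x) with hd_def
  have hdm : ∀ {μ : Measure (Vec n)}, MemLp D2 2 μ → MemLp d 2 μ := fun h =>
    h.of_le ((column i).continuous.comp_aestronglyMeasurable h.1)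
      (Eventually.of_forall fun x => norm_column_le i (D2 x))
  have hdK : MemLp d 2 (volume.restrict K) := hdm (hD K hKc hKΩ)
  have hdB := hdK.mono_measure hleB
  have hVB := hV2.mono_measure hleB
  have hYB2 := hY.restrict B
  -- the function `k`
  set kK := indicator K k with hkK
  have hk2K := hS.k_mem.two hs hKc hKΩ
  have hk2 : MemLp kK 2 volume := (memLp_indicator_iff_restrict hKm).2 hk2K
  have hkint : Integrable kK volume := by
    rw [hkK, integrable_indicator_iff hKm]
    exact hk2K.integrable (by norm_num)
  set A : ℝ → Vec n → ℝ := fun h x => ∫ t in Ioc (0 : ℝ) 1, kK (x + (t * h) • e) with hA_def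
  -- constants
  set Λ := L₁ * (M + 1) ^ (p - 2) with hΛ_def
  have hΛ0 : 0 ≤ Λ := by positivity
  set C' := Λ + (2 * Cγ + C) * (4 / δ) with hC'_def
  have hC'0 : 0 ≤ C' := by positivity
  -- the sequence of increments
  set h : ℕ → ℝ := fun m => ε / (m + 2) with hh_def
  have hh0 : ∀ m, 0 < h m := fun m => by positivity
  have hhε : ∀ m, h m < ε := fun m => by
    rw [hh_def]
    exact div_lt_self hε (by linarith [(Nat.cast_nonneg m : (0 : ℝ) ≤ m)])
  have hh1 : Tendsto h atTop (𝓝 0) := by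
    have h1 := (tendsto_natCast_atTop_atTop (R := ℝ)).atTop_add (tendsto_const_nhds (x := (2 : ℝ)))
    exact h1.const_div_atTop ε
  have hh2 : Tendsto h atTop (𝓝[>] 0) := tendsto_nhdsWithin_iff.2
    ⟨hh1, Eventually.of_forall hh0⟩
  have hmem : ∀ m, ∀ x ∈ B, x + h m • e ∈ K := fun m x hx =>
    mem_closedBall_add_smul he hx (hh0 m).le (by linarith [hhε m])
  -- the difference quotients
  set Δ : ℕ → Vec n → Mat n N := fun m x => (h m)⁻¹ • (V (x + h m • e) - V x) - d x with hΔ_def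
  have hΔ2 : ∀ m, MemLp (Δ m) 2 (volume.restrict B) := by
    intro m
    have h1 : MemLp (fun x => V (x + h m • e)) 2 (volume.restrict B) :=
      MemLp.comp_add_restrict hKm hBm (hmem m) hV2
    have h2 : MemLp (fun x => (h m)⁻¹ • (V (x + h m • e) - V x)) 2 (volume.restrict B) :=
      (h1.sub hVB).const_smul (h m)⁻¹
    exact h2.sub hdB
  have hcl : LocallyIntegrableOn d Ω volume := by
    intro x hx
    obtain ⟨t, ht, hti⟩ := hVw.2.1 x hx
    exact ⟨t, ht, Integrable.mono hti ((column i).continuous.comp_aestronglyMeasurable hti.1)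
      (Eventually.of_forall fun y => norm_column_le i _)⟩
  have hΔt : Tendsto (fun m => eLpNorm (Δ m) 2 (volume.restrict B)) atTop (𝓝 0) :=
    ((hVw.hasWeakDeriv i).tendsto_diffQuot_restrict he hR (by linarith : R < R + 2 * ε) hKΩ hV2 hdK
      hVw.1 hcl).comp hh2
  -- the truncated difference quotients of the gradient
  set S : ℕ → Set (Vec n) := fun m => {x | 1 + δ < ‖V x‖ ∧ h m * ‖d x‖ < δ / 4} with hS_def
  set T : ℕ → Vec n → Mat n N := fun m => indicator (S m) fun x => (h m)⁻¹ •
    (exteriorGradient F (fun y => V y + h m • d y) x - exteriorGradient F V x) with hT_def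
  set Z : ℕ → Vec n → ℝ := fun m => indicator {x | δ / 4 ≤ h m * ‖d x‖} fun x => ‖d x‖ with hZ_def
  have hVmB : AEMeasurable V (volume.restrict B) := hVB.1.aemeasurable
  have hdmB : AEMeasurable d (volume.restrict B) := hdB.1.aemeasurable
  have hleBΩ := hleB.trans hleΩ
  have hegm : ∀ {W : Vec n → Mat n N}, AEMeasurable W (volume.restrict B) →
      AEMeasurable (exteriorGradient F W) (volume.restrict B) := fun hW =>
    aemeasurable_exteriorGradient (fun ξ => (hS.aemeasurable ξ).mono_measure hleBΩ)
      (ae_mono hleBΩ hS.continuous) (ae_mono hleBΩ hS.contDiff) hW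
  have hTm : ∀ m, AEStronglyMeasurable (T m) (volume.restrict B) := fun m =>
    (((hegm (hVmB.add (hdmB.const_smul (h m)))).sub
      (hegm hVmB)).const_smul (h m)⁻¹).aestronglyMeasurable.indicator₀
      ((nullMeasurableSet_lt aemeasurable_const hVmB.norm).inter
        (nullMeasurableSet_lt (hdmB.norm.const_mul _) aemeasurable_const))
  have hZm : ∀ m, AEStronglyMeasurable (Z m) (volume.restrict B) := fun m =>
    hdmB.norm.aestronglyMeasurable.indicator₀
      (nullMeasurableSet_le aemeasurable_const (hdmB.norm.const_mul _))
  have hTif : ∀ m x, 1 + δ < ‖V x‖ → T m x = if h m * ‖d x‖ < δ / 4 then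
      (h m)⁻¹ • (gradient (F x) (V x + h m • d x) - gradient (F x) (V x)) else 0 := by
    intro m x hx
    by_cases h1 : h m * ‖d x‖ < δ / 4
    · have hgt : 1 < ‖V x + h m • d x‖ := by
        have := norm_sub_le (V x + h m • d x) (h m • d x)
        rw [add_sub_cancel_right, norm_smul, Real.norm_of_nonneg (hh0 m).le] at this
        linarith
      rw [if_pos h1, hT_def]
      beta_reduce
      rw [indicator_of_mem (show x ∈ S m from ⟨hx, h1⟩),
        exteriorGradient_of_one_lt (V := fun y => V y + h m • d y) hgt,
        exteriorGradient_of_one_lt (by linarith)]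
    · rw [if_neg h1, hT_def]
      beta_reduce
      rw [indicator_of_notMem (fun h2 : x ∈ S m => h1 h2.2)]
  have hZif : ∀ m x, Z m x = if h m * ‖d x‖ < δ / 4 then 0 else ‖d x‖ := by
    intro m x
    rw [hZ_def]
    by_cases h1 : h m * ‖d x‖ < δ / 4
    · rw [if_pos h1]
      exact indicator_of_notMem (show x ∉ {x | δ / 4 ≤ h m * ‖d x‖} from not_le.2 h1) _
    · rw [if_neg h1]
      exact indicator_of_mem (show x ∈ {x | δ / 4 ≤ h m * ‖d x‖} from not_lt.1 h1) _
  -- pointwise estimate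
  have hpt : ∀ m, ∀ᵐ x ∂(volume.restrict B), 1 + δ < ‖V x‖ → ‖T m x‖ ≤ Λ * ‖d x‖ ∧
      ‖(h m)⁻¹ • (exteriorGradient F V (x + h m • e) - exteriorGradient F V x) - T m x‖
        + C * (h m)⁻¹ * (if ‖V (x + h m • e)‖ ≤ 1 then 1 else 0) ≤
      2 ^ (p - 1) * |A (h m) x| * ‖V x‖ ^ (p - 1) + C' * (‖Δ m x‖ + Z m x) := by
    intro m
    have ht := ae_restrict_of_ae (s := B) (hS.gradient_translate_le hs hR
      (by linarith : R < R + 2 * ε) (by linarith : R + 2 * ε < R + 3 * ε) hΩ₃ i (hh0 m)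
      (by linarith [hhε m]))
    filter_upwards [ht, ae_restrict_mem hBm, ae_mono hleB hM, ae_mono hleB hCγ,
      ae_restrict_comp_add hKm hBm (hmem m) hCγ, ae_mono hleBΩ hS.contDiff,
      ae_mono hleBΩ hS.hessian_le] with x a1 a2 a3 a4 a5 a6 a7 hx
    rw [hZif]
    refine norm_diffQuot_sub_le (p := p) (g₀ := gradient (F x))
      (g₁ := gradient (F (x + h m • e)))
      (by linarith) (hh0 m) hδ (abs_nonneg _) hΛ0 hCγ0 C.2 hx
      (exteriorGradient_of_one_lt (by linarith)) (fun h1 => exteriorGradient_of_one_lt h1) a4 a5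
      (lipschitz_gradient_of_hessianNorm_le a6 hx hδ.le fun ξ hξ => ?_)
      (fun ξ hξ => (a1 a2 ξ hξ).trans ?_) (hTif m x hx)
    · rw [mem_ball_iff_norm] at hξ
      have h1 := norm_sub_norm_le ξ (V x)
      have h2 := norm_sub_norm_le (V x) ξ
      rw [norm_sub_rev] at h2
      refine (a7 ξ (by linarith)).trans (mul_le_mul_of_nonneg_left ?_ hL₁)
      exact Real.rpow_le_rpow (norm_nonneg _) (by linarith) (by linarith)
    · have := hh0 m
      gcongr
      exact le_abs_self _
  -- the key inequality for a fixed increment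
  set c₁ : Vec n → ℝ := fun x => 2 ^ (p - 1) * ‖V x‖ ^ (p - 1) * ‖Y x‖ with hc₁_def
  have hc₁ : MemLp c₁ 2 (volume.restrict B) := by
    refine MemLp.of_le (hYB2.norm.const_mul (2 ^ (p - 1) * M ^ (p - 1)))
      (((hVmB.norm.pow_const _).const_mul _).aestronglyMeasurable.mul hYB2.1.norm) ?_
    filter_upwards [ae_mono hleB hM] with x hx
    rw [hc₁_def]
    beta_reduce
    rw [Real.norm_of_nonneg (by positivity), Real.norm_of_nonneg (by positivity)]
    gcongr
    linarith
  -- The truncation error `Z` is carried inside `J`: it tends to zero pointwise below `|d|`, so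
  -- dominated convergence handles it together with `T`. The other error `Δ` is left outside because
  -- it is small in `L²`.
  set J : ℕ → Vec n → ℝ := fun m x => inner ℝ (T m x) (Y x) - C' * (Z m x * ‖Y x‖) with hJ_def
  have hJm : ∀ m, AEStronglyMeasurable (J m) (volume.restrict B) := fun m =>
    ((hTm m).inner hYB2.1).sub (((hZm m).mul hYB2.1.norm).const_mul _)
  set bd : Vec n → ℝ := fun x => (Λ + C') * (‖d x‖ * ‖Y x‖) with hbd_def
  have hbd : Integrable bd (volume.restrict B) := (integrable_norm_mul_norm hdB hYB2).const_mul _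
  have hZle : ∀ m x, 0 ≤ Z m x ∧ Z m x ≤ ‖d x‖ := fun m x => by
    rw [hZif]
    split_ifs <;> simp
  have hJbd : ∀ m, ∀ᵐ x ∂(volume.restrict B), ‖J m x‖ ≤ bd x := by
    intro m
    filter_upwards [hpt m] with x hx
    by_cases hVx : 1 + δ < ‖V x‖
    · have h1 := (hx hVx).1
      have h2 := norm_inner_le_norm (𝕜 := ℝ) (T m x) (Y x)
      have h3 : ‖C' * (Z m x * ‖Y x‖)‖ ≤ C' * (‖d x‖ * ‖Y x‖) := by
        rw [Real.norm_of_nonneg (mul_nonneg hC'0 (mul_nonneg (hZle m x).1 (norm_nonneg _)))]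
        gcongr
        exact (hZle m x).2
      have h4 : ‖T m x‖ * ‖Y x‖ ≤ Λ * ‖d x‖ * ‖Y x‖ := by gcongr
      refine (norm_sub_le _ _).trans ?_
      rw [hbd_def]
      beta_reduce
      linarith
    · have hY0 := hYV x (not_lt.1 hVx)
      simp [hJ_def, hbd_def, hY0]
  have hJi : ∀ m, Integrable (J m) (volume.restrict B) := fun m =>
    Integrable.mono' hbd (hJm m) (hJbd m)
  set φ : ℕ → Vec n → Vec N := fun m x => (h m)⁻¹ • (ψ x - ψ (x - h m • e)) with hφ_def
  have hψc : ∀ m, MemLp (fun x => ψ (x - h m • e)) 2 volume := fun m =>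
    hψ.comp_measurePreserving (measurePreserving_sub_right volume _)
  have hYc : ∀ m, MemLp (fun x => Y (x - h m • e)) 2 volume := fun m =>
    hY.comp_measurePreserving (measurePreserving_sub_right volume _)
  have hφ2 : ∀ m, MemLp (φ m) 2 volume := fun m =>
    (hψ.sub (hψc m)).const_smul (h m)⁻¹
  have hcol : ∀ {W : Vec n → Mat n N}, MemLp W 2 volume → ∀ j,
      MemLp (fun x => column j (W x)) 2 volume := fun hW j =>
    hW.of_le ((column j).continuous.comp_aestronglyMeasurable hW.1)
      (Eventually.of_forall fun x => norm_column_le j _)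
  have hkey : ∀ m, ∫ x in B, J m x ≤ (∫ x in K, (‖f x‖ + 2) * ‖φ m x‖) +
      ((∫ x in B, c₁ x * ‖A (h m) x‖) + ∫ x in B, (C' * ‖Y x‖) * ‖Δ m x‖) := by
    intro m
    have hφs : tsupport (φ m) ⊆ Metric.closedBall x₀ (R + ε) := by
      refine closure_minimal (fun x hx => ?_) Metric.isClosed_closedBall
      by_contra hx'
      have h1 : ψ x = 0 := image_eq_zero_of_notMem_tsupport fun h2 =>
        hx' (Metric.closedBall_subset_closedBall (by linarith) (hψs h2))
      have h2 : ψ (x - h m • e) = 0 := image_eq_zero_of_notMem_tsupport fun h3 => hx' (by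
        have := mem_closedBall_add_smul he (hψs h3) (hh0 m).le (by linarith [hhε m] :
          R + h m ≤ R + ε)
        rwa [sub_add_cancel] at this)
      exact hx (by simp [hφ_def, h1, h2])
    have h1 := hC (φ m) (fun x => (h m)⁻¹ • (Y x - Y (x - h m • e))) (hφ2 m)
      ((hY.sub (hYc m)).const_smul (h m)⁻¹) hφs (fun j => by
        have := (hw j).smul_sub ((hw j).comp_sub (h m • e)) hψ (hcol hY j) (hψc m)
          (hcol (hYc m) j) (h m)⁻¹
        simp only [map_smul, map_sub]
        exact this)
    obtain ⟨q, hq1, hq2, hq3⟩ := diffQuot_test_le hKm hBm hBK (hmem m) hγ2 hVm hY hYB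
      (fun x hx => hYV x (by linarith)) (hh0 m) C.2 h1
    have i1 : Integrable (fun x => c₁ x * ‖A (h m) x‖) (volume.restrict B) :=
      Integrable.mono' (integrable_norm_mul_norm hc₁ ((memLp_average_translate hkint hk2 e
        (h m)).restrict B)) (hc₁.1.mul ((memLp_average_translate hkint hk2 e (h m)).restrict B).1.norm)
        (Eventually.of_forall fun x => by rw [norm_mul, norm_norm])
    have i2 : Integrable (fun x => (C' * ‖Y x‖) * ‖Δ m x‖) (volume.restrict B) := by
      have := (integrable_norm_mul_norm hYB2 (hΔ2 m)).const_mul C'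
      simpa only [mul_assoc] using this
    -- Replacing the true quotient of the exterior gradient by its truncation `T` costs only the
    -- pointwise estimate; where `|V| ≤ 1 + δ` all terms vanish with `Y`.
    have h2 : ∫ x in B, J m x ≤ ∫ x in B, (q x + (c₁ x * ‖A (h m) x‖ + (C' * ‖Y x‖) * ‖Δ m x‖)) := by
      refine integral_mono_ae (hJi m) (hq1.add (i1.add i2)) ?_
      filter_upwards [hpt m] with x hx
      rw [hq2]
      by_cases hVx : 1 + δ < ‖V x‖
      · have h3 := mul_le_mul_of_nonneg_right (hx hVx).2 (norm_nonneg (Y x))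
        set G := (h m)⁻¹ • (exteriorGradient F V (x + h m • e) - exteriorGradient F V x)
        have h4 : (inner ℝ (T m x) (Y x) : ℝ) = inner ℝ G (Y x) - inner ℝ (G - T m x) (Y x) := by
          rw [inner_sub_left]; ring
        have h5 := norm_inner_le_norm (𝕜 := ℝ) (G - T m x) (Y x)
        rw [Real.norm_eq_abs] at h5
        simp only [hJ_def, hc₁_def, Real.norm_eq_abs]
        rw [h4]
        exact le_of_weighted_sum h3 h5
      · have hY0 := hYV x (not_lt.1 hVx)
        simp [hJ_def, hc₁_def, hY0]
    have hq3' : ∫ x in B, q x ≤ ∫ x in K, (‖f x‖ + 2) * ‖φ m x‖ := hq3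
    have i3 : Integrable (fun x => c₁ x * ‖A (h m) x‖ + (C' * ‖Y x‖) * ‖Δ m x‖)
        (volume.restrict B) := i1.add i2
    rw [integral_add hq1 i3, integral_add i1 i2] at h2
    linarith
  -- passage to the limit
  have hJlim : ∀ᵐ x ∂(volume.restrict B), Tendsto (fun m => J m x) atTop
      (𝓝 (inner ℝ (hessian (F x) (V x) (d x)) (Y x))) := by
    filter_upwards [ae_mono hleBΩ hS.contDiff] with x hx
    by_cases hVx : 1 + δ < ‖V x‖
    · obtain ⟨t1, t2⟩ := tendsto_diffQuot_gradient_hessian hx (v := V x) (by linarith) (d x)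
        (show 0 < δ / 4 by positivity) hh2
      have t3 := (t1.inner (tendsto_const_nhds (x := Y x))).sub
        ((t2.mul_const ‖Y x‖).const_mul C')
      rw [zero_mul, mul_zero, sub_zero] at t3
      refine t3.congr fun m => ?_
      simp only [hJ_def]
      rw [hTif m x hVx, hZif m x]
    · have hY0 := hYV x (not_lt.1 hVx)
      simp [hJ_def, hY0]
  have hHm : AEStronglyMeasurable
      (fun x => (inner ℝ (hessian (F x) (V x) (d x)) (Y x) : ℝ)) (volume.restrict B) :=
    aestronglyMeasurable_of_tendsto_ae atTop hJm hJlim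
  refine ⟨Integrable.mono' hbd hHm ?_, ?_⟩
  · filter_upwards [hJlim, ae_all_iff.2 hJbd] with x h1 h2
    exact le_of_tendsto h1.norm (Eventually.of_forall h2)
  have l0 := tendsto_integral_of_dominated_convergence bd hJm hbd hJbd hJlim
  have hψi : Integrable ψ := MemLp.integrable_of_eq_zero hψ (isCompact_closedBall x₀ R)
    fun x hx => image_eq_zero_of_notMem_tsupport fun h => hx (hψs h)
  have hYi : Integrable (fun x => column i (Y x)) := MemLp.integrable_of_eq_zero (hcol hY i)
    (isCompact_closedBall x₀ R) fun x hx => by rw [hYB x hx, map_zero]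
  -- The test function is the difference quotient of `ψ` with the negative increment `-h m`.
  have hneg : Tendsto (fun m => -h m) atTop (𝓝[≠] 0) := by
    refine tendsto_nhdsWithin_iff.2 ⟨by simpa using hh1.neg, Eventually.of_forall fun m => ?_⟩
    exact neg_ne_zero.2 (hh0 m).ne'
  have hφt : Tendsto (fun m => eLpNorm (fun x => φ m x - column i (Y x)) 2 (volume.restrict K))
      atTop (𝓝 0) := by
    have h1 := ((hw i).tendsto_diffQuot hψi hYi (hcol hY i)).comp hneg
    refine tendsto_of_tendsto_of_tendsto_of_le_of_le tendsto_const_nhds h1 (fun _ => zero_le)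
      fun m => ?_
    refine (eLpNorm_mono_measure _ Measure.restrict_le_self).trans (le_of_eq ?_)
    refine congrArg (fun g => eLpNorm g 2 volume) ?_
    ext1 x
    simp only [hφ_def]
    congr 1
    rw [neg_smul, ← sub_eq_add_neg, inv_neg, neg_smul, ← smul_neg, neg_sub]
  have l1 := tendsto_integral_mul_norm (fun m => (hφ2 m).restrict K) ((hcol hY i).restrict K)
    (hf2.norm.add (memLp_const 2)) hφt
  have l2 := tendsto_integral_mul_norm (fun m => (memLp_average_translate hkint hk2 e
    (h m)).restrict B) (hk2.restrict B) hc₁ (tendsto_of_tendsto_of_tendsto_of_le_of_le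
      tendsto_const_nhds ((tendsto_average_translate hkint hk2 e).comp hh1) (fun _ => zero_le)
      fun m => eLpNorm_mono_measure _ Measure.restrict_le_self)
  have l3 := tendsto_integral_mul_norm (w₀ := fun _ => (0 : Mat n N)) hΔ2 (MemLp.zero')
    (hYB2.norm.const_mul C') (by simpa using hΔt)
  have hfin := le_of_tendsto_of_tendsto' l0 (l1.add (l2.add l3)) hkey
  have e1 : ∫ x in K, (‖f x‖ + 2) * ‖column i (Y x)‖ = ∫ x in B, (‖f x‖ + 2) * ‖column i (Y x)‖ :=
    setIntegral_eq_of_eq_zero hKm hBK hYB (q := fun x y => (‖f x‖ + 2) * ‖column i y‖)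
      fun x => by simp
  have e2 : ∫ x in B, c₁ x * ‖kK x‖ = ∫ x in B, 2 ^ (p - 1) * k x * ‖V x‖ ^ (p - 1) * ‖Y x‖ := by
    refine integral_congr_ae ?_
    filter_upwards [ae_restrict_mem hBm, ae_mono hleBΩ hS.k_nonneg] with x hx hk0
    rw [hkK, indicator_of_mem (hBK hx), Real.norm_of_nonneg hk0]
    simp only [hc₁_def]
    ring
  have e3 : ∫ x in B, (C' * ‖Y x‖) * ‖(0 : Mat n N)‖ = 0 := by simp
  simp only [Pi.add_apply] at hfin
  rw [e2, e3, add_zero] at hfin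
  rw [← e1, add_comm]
  exact hfin

end DifferentiatedInequality

/-! ### Weak derivatives of `θ Ψ(V)` and radial functions of `V`. -/

section TestFunctions

open Filter Topology

variable {n N : ℕ}

theorem aestronglyMeasurable_clm_apply {α E E' : Type*} [MeasurableSpace α] {μ : Measure α}
    [NormedAddCommGroup E] [NormedSpace ℝ E] [NormedAddCommGroup E'] [NormedSpace ℝ E']
    {A : α → E →L[ℝ] E'} {w : α → E} (hA : AEStronglyMeasurable A μ)
    (hw : AEStronglyMeasurable w μ) : AEStronglyMeasurable (fun x => A x (w x)) μ :=
  (continuous_fst.clm_apply continuous_snd : Continuous fun q : (E →L[ℝ] E') × E => q.1 q.2)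
    |>.comp_aestronglyMeasurable (hA.prodMk hw)

/-- Weak derivative of `θ Ψ(V)` for a locally bounded `V ∈ W^{1,2}_loc`, a `C¹` function `Ψ` and a
cutoff function `θ`. -/
theorem IsWeakGrad.hasWeakDeriv_smul_comp {ι : Type} [Fintype ι] {E' : Type*}
    [NormedAddCommGroup E'] [NormedSpace ℝ E'] [CompleteSpace E'] {Ω : Set (Vec n)} (hΩ : IsOpen Ω)
    {V : Vec n → EuclideanSpace ℝ ι} {D2 : Vec n → EuclideanSpace ℝ (ι × Fin n)}
    (h : IsWeakGrad Ω V D2) (hV : MemLpLoc V ⊤ Ω) (hD : MemLpLoc D2 2 Ω) {x₀ : Vec n} {R : ℝ}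
    (hR : 0 ≤ R) (hRΩ : Metric.closedBall x₀ R ⊆ Ω) {Ψ : EuclideanSpace ℝ ι → E'}
    (hΨ : ContDiff ℝ 1 Ψ) {θ : Vec n → ℝ} (hθ : ContDiff ℝ ∞ θ)
    (hθs : tsupport θ ⊆ Metric.closedBall x₀ R) :
    MemLp (fun x => θ x • Ψ (V x)) 2 volume ∧ ∀ i,
      MemLp (fun x => θ x • fderiv ℝ Ψ (V x) (column i (D2 x))
        + fderiv ℝ θ x (EuclideanSpace.single i 1) • Ψ (V x)) 2 volume ∧
      HasWeakDeriv univ (EuclideanSpace.single i 1) (fun x => θ x • Ψ (V x))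
        (fun x => θ x • fderiv ℝ Ψ (V x) (column i (D2 x))
          + fderiv ℝ θ x (EuclideanSpace.single i 1) • Ψ (V x)) := by
  obtain ⟨ε, hε, hΩε⟩ := exists_closedBall_subset hΩ hR hRΩ
  set K := Metric.closedBall x₀ (R + ε) with hK_def
  have hKc : IsCompact K := isCompact_closedBall _ _
  have hKm : MeasurableSet K := measurableSet_closedBall
  haveI : IsFiniteMeasure (volume.restrict K : Measure (Vec n)) :=
    ⟨by simpa using hKc.measure_lt_top⟩
  have hBK : Metric.closedBall x₀ R ⊆ K := Metric.closedBall_subset_closedBall (by linarith)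
  -- `V` is only locally a Sobolev function, so the chain rule is applied to `χV`, which is global
  -- and bounded; `χ = 1` on the ball containing the support of `θ`.
  obtain ⟨χ, hχ, hχs, hχt, hχ01, hχ1⟩ := exists_cutoff x₀ hR (by linarith : R < R + ε)
  have hχΩ := hχt.trans hΩε
  have hθc : HasCompactSupport θ := (isCompact_closedBall _ _).of_isClosed_subset
    (isClosed_tsupport _) hθs
  have hθK := hθs.trans hBK
  obtain ⟨M, hM1, hM⟩ := hV.exists_bound hKc hΩε
  have hVm := (hV K hKc hΩε).1
  have hV2 : MemLp V 2 (volume.restrict K) := MemLp.of_bound hVm M hM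
  have hΨm : AEStronglyMeasurable (fun x => Ψ (V x)) (volume.restrict K) :=
    hΨ.continuous.comp_aestronglyMeasurable hVm
  have hcont' : Continuous (fderiv ℝ Ψ) := hΨ.continuous_fderiv (by simp)
  obtain ⟨C₀, hC₀⟩ := (isCompact_closedBall (0 : EuclideanSpace ℝ ι) M).exists_bound_of_continuousOn
    hΨ.continuous.continuousOn
  obtain ⟨C₁, hC₁⟩ := (isCompact_closedBall (0 : EuclideanSpace ℝ ι) M).exists_bound_of_continuousOn
    hcont'.continuousOn
  have hΨ2 : MemLp (fun x => Ψ (V x)) 2 (volume.restrict K) := by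
    refine MemLp.of_bound hΨm C₀ ?_
    filter_upwards [hM] with x hx
    exact hC₀ _ (by simpa using hx)
  have hd2 : ∀ i, MemLp (fun x => column i (D2 x)) 2 (volume.restrict K) := fun i =>
    (hD K hKc hΩε).of_le ((column i).continuous.comp_aestronglyMeasurable (hD K hKc hΩε).1)
      (Eventually.of_forall fun x => norm_column_le i (D2 x))
  have hF2 : ∀ i, MemLp (fun x => fderiv ℝ Ψ (V x) (column i (D2 x))) 2 (volume.restrict K) := by
    intro i
    refine MemLp.of_le ((hd2 i).norm.const_mul C₁) (aestronglyMeasurable_clm_apply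
      (hcont'.comp_aestronglyMeasurable hVm) (hd2 i).1) ?_
    filter_upwards [hM] with x hx
    refine (ContinuousLinearMap.le_opNorm _ _).trans (le_trans ?_ (le_abs_self _))
    exact mul_le_mul_of_nonneg_right (hC₁ _ (by simpa using hx)) (norm_nonneg _)
  refine ⟨memLp_of_eq_zero hKm (K := K) ?_ fun x hx => ?_, fun i => ⟨?_, ?_⟩⟩
  · obtain ⟨C, hC⟩ := hθc.exists_bound_of_continuous hθ.continuous
    refine MemLp.of_le (hΨ2.norm.const_mul C) (hθ.continuous.aestronglyMeasurable.smul hΨm)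
      (Eventually.of_forall fun x => ?_)
    rw [norm_smul]
    refine le_trans ?_ (le_abs_self _)
    exact mul_le_mul_of_nonneg_right (hC x) (norm_nonneg _)
  · rw [image_eq_zero_of_notMem_tsupport fun h => hx (hθK h), zero_smul]
  · exact memLp_weakDeriv_smul hKm hΨ2 (hF2 i) hθ hθc hθK
  · have hcl : LocallyIntegrableOn (fun x => column i (D2 x)) Ω volume := by
      intro x hx
      obtain ⟨t, ht, hti⟩ := h.2.1 x hx
      exact ⟨t, ht, Integrable.mono hti ((column i).continuous.comp_aestronglyMeasurable hti.1)
        (Eventually.of_forall fun y => norm_column_le i _)⟩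
    have hw := (h.hasWeakDeriv i).smul_cutoff h.1 hcl hχ hχs hχΩ
    have i1 := integrable_smul_of_locallyIntegrableOn h.1 hχ.continuous hχs hχΩ
    have i2 := integrable_weakDeriv_smul (e := EuclideanSpace.single i 1) h.1 hcl hχ hχs hχΩ
    have m2 := memLp_weakDeriv_smul (e := EuclideanSpace.single i 1) hKm hV2 (hd2 i) hχ hχs hχt
    have hb : ∀ᵐ x, ‖χ x • V x‖ ≤ M := by
      rw [ae_restrict_iff' hKm] at hM
      filter_upwards [hM] with x hx
      by_cases hxK : x ∈ K
      · rw [norm_smul, Real.norm_of_nonneg (hχ01 x).1]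
        exact (mul_le_of_le_one_left (norm_nonneg _) (hχ01 x).2).trans (hx hxK)
      · rw [image_eq_zero_of_notMem_tsupport fun h => hxK (hχt h), zero_smul, norm_zero]
        linarith
    have hc := hw.comp_bounded i1 i2 m2 hb hΨ
    have l1 : LocallyIntegrable (fun x => Ψ (χ x • V x)) volume := by
      refine (memLp_top_of_bound (μ := volume)
        (hΨ.continuous.comp_aestronglyMeasurable i1.1) C₀ ?_).locallyIntegrable le_top
      filter_upwards [hb] with x hx
      exact hC₀ _ (by simpa using hx)
    have l2 : LocallyIntegrable (fun x => fderiv ℝ Ψ (χ x • V x)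
        (χ x • column i (D2 x) + fderiv ℝ χ x (EuclideanSpace.single i 1) • V x)) volume := by
      refine (Integrable.mono (i2.norm.const_mul C₁) (aestronglyMeasurable_clm_apply
        (hcont'.comp_aestronglyMeasurable i1.1) i2.1) ?_).locallyIntegrable
      filter_upwards [hb] with x hx
      refine (ContinuousLinearMap.le_opNorm _ _).trans (le_trans ?_ (le_abs_self _))
      exact mul_le_mul_of_nonneg_right (hC₁ _ (by simpa using hx)) (norm_nonneg _)
    have hfin := hc.smul_cutoff (l1.locallyIntegrableOn _) (l2.locallyIntegrableOn _) hθ hθc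
      (subset_univ _)
    have hsupp : ∀ x, x ∉ Metric.closedBall x₀ R → θ x = 0 ∧
        fderiv ℝ θ x (EuclideanSpace.single i 1) = 0 := fun x hx =>
      ⟨image_eq_zero_of_notMem_tsupport fun h => hx (hθs h),
        image_eq_zero_of_notMem_tsupport (f := fun y => fderiv ℝ θ y (EuclideanSpace.single i 1))
          fun h => hx (hθs (HasCompactSupport.fderiv_apply_tsupport_subset _ h))⟩
    refine hfin.congr_ae (Eventually.of_forall fun x => ?_) (Eventually.of_forall fun x => ?_)
    · by_cases hx : x ∈ Metric.closedBall x₀ R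
      · simp only [(hχ1 x hx).1, one_smul]
      · simp only [(hsupp x hx).1, zero_smul]
    · by_cases hx : x ∈ Metric.closedBall x₀ R
      · simp only [(hχ1 x hx).1, (hχ1 x hx).2, one_smul, zero_smul, add_zero]
      · simp only [(hsupp x hx).1, (hsupp x hx).2, zero_smul]

section Radial

variable {W W' : Type*} [NormedAddCommGroup W] [InnerProductSpace ℝ W] [NormedAddCommGroup W']
  [NormedSpace ℝ W'] {Φ : ℝ → ℝ} {c r : ℝ}

/-- `Φ` is constant near the origin, so the singularity of the norm does no harm; there the formula
reads `0`, since the inner product with `0` vanishes. -/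
theorem hasFDerivAt_comp_norm (hΦ : ContDiff ℝ 1 Φ) (hr : 0 < r) (h0 : ∀ t ≤ r, Φ t = c) (ξ : W) :
    HasFDerivAt (fun ξ : W => Φ ‖ξ‖) ((deriv Φ ‖ξ‖ / ‖ξ‖) • innerSL ℝ ξ) ξ := by
  rcases eq_or_ne ξ 0 with rfl | hξ
  · have : (fun ξ : W => Φ ‖ξ‖) =ᶠ[𝓝 0] fun _ => c := by
      filter_upwards [Metric.ball_mem_nhds (0 : W) hr] with y hy
      exact h0 _ (by simpa using (mem_ball_zero_iff.1 hy).le)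
    refine ((hasFDerivAt_const c (0 : W)).congr_of_eventuallyEq this).congr_fderiv ?_
    simp
  · have hn : 0 < ‖ξ‖ := norm_pos_iff.2 hξ
    have h1 : HasFDerivAt (fun y : W => ‖y‖) ((1 / (2 * ‖ξ‖)) • (2 • innerSL ℝ ξ)) ξ := by
      have h2 := ((hasStrictFDerivAt_norm_sq ξ).hasFDerivAt).sqrt (by positivity)
      simpa only [Real.sqrt_sq (norm_nonneg _)] using h2
    refine (((hΦ.differentiable (by simp) ‖ξ‖).hasDerivAt).comp_hasFDerivAt ξ h1).congr_fderiv ?_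
    ext y
    simp
    field_simp

theorem contDiff_comp_norm (hΦ : ContDiff ℝ 1 Φ) (hr : 0 < r) (h0 : ∀ t ≤ r, Φ t = c) :
    ContDiff ℝ 1 (fun ξ : W => Φ ‖ξ‖) := by
  rw [contDiff_iff_contDiffAt]
  intro ξ
  rcases eq_or_ne ξ 0 with rfl | hξ
  · have : (fun ξ : W => Φ ‖ξ‖) =ᶠ[𝓝 0] fun _ => c := by
      filter_upwards [Metric.ball_mem_nhds (0 : W) hr] with y hy
      exact h0 _ (by simpa using (mem_ball_zero_iff.1 hy).le)
    exact contDiffAt_const.congr_of_eventuallyEq this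
  · exact hΦ.contDiffAt.comp ξ (contDiffAt_norm ℝ hξ)

/-- The derivative is determined by its left part, which also covers the endpoint `t = r`. -/
theorem deriv_eq_zero_of_le (hΦ : ContDiff ℝ 1 Φ) (h0 : ∀ t ≤ r, Φ t = c) {t : ℝ} (ht : t ≤ r) :
    deriv Φ t = 0 := by
  have h1 := ((hΦ.differentiable (by simp) t).hasDerivAt).hasDerivWithinAt (s := Iic t)
  have h2 : HasDerivWithinAt Φ 0 (Iic t) t :=
    (hasDerivWithinAt_const t (Iic t) c).congr (fun y hy => h0 y (le_trans hy ht)) (h0 t ht)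
  exact (uniqueDiffWithinAt_Iic t).eq_deriv _ h1 h2

end Radial

end TestFunctions

/-! ### The algebra of the Caccioppoli inequality. -/

section CaccioppoliPointwise

open Filter Topology

variable {n N : ℕ}

/-- Young's inequality as an explicit sum of squares. With `u = η|D|`, `w = |∇η||V|` and `t = κη|V|`
it is the part of the balance multiplied by `Φ |V|^(p-2)`. -/
theorem quadratic_form_nonneg {ν L m t u w : ℝ} (hν : 0 < ν) :
    0 ≤ ν / 2 * u ^ 2 - 2 * L * u * w - 2 * m * t * w - m * t * u
      + (m ^ 2 / ν + m ^ 2 + 1 + 4 * L ^ 2 / ν) * (w ^ 2 + t ^ 2) := by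
  have e : ν / 2 * u ^ 2 - 2 * L * u * w - 2 * m * t * w - m * t * u
      + (m ^ 2 / ν + m ^ 2 + 1 + 4 * L ^ 2 / ν) * (w ^ 2 + t ^ 2)
      = (ν * u - 4 * L * w) ^ 2 / (4 * ν) + (ν * u - 2 * m * t) ^ 2 / (4 * ν) + (m * t - w) ^ 2
        + m ^ 2 * w ^ 2 + t ^ 2 + m ^ 2 / ν * w ^ 2 + 4 * L ^ 2 / ν * t ^ 2 := by
    field_simp
    ring
  rw [e]
  positivity

/-- The companion for the part multiplied by `Φ' |V|^(p-1)`, where `u = η|z|/|V|`; this part has no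
cross term with the gradient of the cutoff. -/
theorem quadratic_form_nonneg' {ν L m t u w : ℝ} (hν : 0 < ν) :
    0 ≤ ν / 2 * u ^ 2 - m * t * u
      + (m ^ 2 / ν + m ^ 2 + 1 + 4 * L ^ 2 / ν) * (w ^ 2 + t ^ 2) := by
  have e : ν / 2 * u ^ 2 - m * t * u
      + (m ^ 2 / ν + m ^ 2 + 1 + 4 * L ^ 2 / ν) * (w ^ 2 + t ^ 2)
      = (ν * u - m * t) ^ 2 / (2 * ν) + m ^ 2 / (2 * ν) * t ^ 2
        + (m ^ 2 + 1 + 4 * L ^ 2 / ν) * (w ^ 2 + t ^ 2) + m ^ 2 / ν * w ^ 2 := by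
    field_simp
    ring
  rw [e]
  positivity

/-- The constant of the Caccioppoli inequality. -/
noncomputable def caccioppoliConst (n : ℕ) (ν L : ℝ) : ℝ := (n : ℝ) ^ 2 / ν + (n : ℝ) ^ 2 + 1 + 4 * L ^ 2 / ν

theorem caccioppoli_algebra {ν L m a b d y z η κ P : ℝ} (hν : 0 < ν) (ha : 0 ≤ a) (hb : 0 ≤ b) :
    ν / 2 * (η ^ 2 * (a * d ^ 2 + b * z ^ 2)) ≤
      ν * (η ^ 2 * (a * d ^ 2 + b * z ^ 2)) - 2 * L * η * a * P * d * y
        - m * κ * (2 * η * a * y * P ^ 2 + η ^ 2 * b * z * P + η ^ 2 * a * d * P)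
        + (m ^ 2 / ν + m ^ 2 + 1 + 4 * L ^ 2 / ν) * ((y ^ 2 + κ ^ 2 * η ^ 2) * ((a + b) * P ^ 2)) := by
  have h1 := mul_nonneg ha (quadratic_form_nonneg (L := L) (m := m) (t := κ * η * P) (u := η * d)
    (w := y * P) hν)
  have h2 := mul_nonneg hb (quadratic_form_nonneg' (L := L) (m := m) (t := κ * η * P) (u := η * z)
    (w := y * P) hν)
  linear_combination h1 + h2

variable {V : Mat n N} {D : Tens n N}

theorem sum_norm_column_le (T : Mat n N) : ∑ s, ‖column s T‖ ≤ n * ‖T‖ := by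
  refine (Finset.sum_le_sum fun s _ => norm_column_le s T).trans (le_of_eq ?_)
  simp

theorem sum_norm_column_le' (T : Tens n N) : ∑ s, ‖column s T‖ ≤ n * ‖T‖ := by
  refine (Finset.sum_le_sum fun s _ => norm_column_le s T).trans (le_of_eq ?_)
  simp

theorem sum_norm_column_mul_le (V : Mat n N) (D : Tens n N) :
    ∑ s, ‖column s D‖ * ‖column s V‖ ≤ ‖D‖ * ‖V‖ := by
  have h := Finset.sum_mul_sq_le_sq_mul_sq Finset.univ (fun s => ‖column s D‖)
    (fun s => ‖column s V‖)
  rw [sum_norm_column_sq, sum_norm_column_sq, ← mul_pow] at h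
  exact le_of_sq_le_sq h (by positivity)

/-- The gradient (divided by the length of `V`) direction: `z_i = ⟨V, D_i⟩`. -/
noncomputable def radialPart (V : Mat n N) (D : Tens n N) : Vec n :=
  WithLp.toLp 2 fun i => inner ℝ V (column i D)

theorem radialPart_apply (V : Mat n N) (D : Tens n N) (i : Fin n) :
    radialPart V D i = inner ℝ V (column i D) := rfl

theorem norm_radialPart_le (V : Mat n N) (D : Tens n N) : ‖radialPart V D‖ ≤ ‖V‖ * ‖D‖ := by
  refine le_of_sq_le_sq ?_ (by positivity)
  rw [EuclideanSpace.norm_sq_eq, mul_pow, ← sum_norm_column_sq D, Finset.mul_sum]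
  refine Finset.sum_le_sum fun i _ => ?_
  rw [← mul_pow, radialPart_apply]
  exact pow_le_pow_left₀ (norm_nonneg _) (norm_inner_le_norm _ _) 2

/-- The weak gradient of the test function `η² Φ(|V|) V_{·s}`. -/
noncomputable def testGradient (Φ : ℝ → ℝ) (η : ℝ) (y : Vec n) (V : Mat n N) (D : Tens n N)
    (s : Fin n) : Mat n N :=
  (2 * η * Φ ‖V‖) • tensorRow y V s
    + (η ^ 2 * (deriv Φ ‖V‖ / ‖V‖)) • tensorRow (radialPart V D) V s
    + (η ^ 2 * Φ ‖V‖) • column s D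

theorem sum_norm_testGradient_le {Φ : ℝ → ℝ} (h0 : ∀ t, 0 ≤ Φ t) (h1 : ∀ t, 0 ≤ deriv Φ t) {η : ℝ}
    (hη : 0 ≤ η) (y : Vec n) (V : Mat n N) (D : Tens n N) :
    ∑ s, ‖testGradient Φ η y V D s‖ ≤ n * (2 * η * Φ ‖V‖ * ‖y‖ * ‖V‖
      + η ^ 2 * deriv Φ ‖V‖ * (‖radialPart V D‖ / ‖V‖) * ‖V‖ + η ^ 2 * Φ ‖V‖ * ‖D‖) := by
  have b1 := h0 ‖V‖
  have b2 := h1 ‖V‖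
  have hs : ∀ s, ‖testGradient Φ η y V D s‖ ≤ 2 * η * Φ ‖V‖ * ‖y‖ * ‖column s V‖
      + η ^ 2 * deriv Φ ‖V‖ * (‖radialPart V D‖ / ‖V‖) * ‖column s V‖
      + η ^ 2 * Φ ‖V‖ * ‖column s D‖ := by
    intro s
    refine (norm_add_le _ _).trans (add_le_add ((norm_add_le _ _).trans (add_le_add ?_ ?_)) ?_)
    · rw [norm_smul, Real.norm_of_nonneg (by positivity), norm_tensorRow]
      exact le_of_eq (by ring)
    · rw [norm_smul, Real.norm_of_nonneg (by positivity), norm_tensorRow]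
      exact le_of_eq (by ring)
    · rw [norm_smul, Real.norm_of_nonneg (by positivity)]
  refine (Finset.sum_le_sum fun s _ => hs s).trans ?_
  rw [Finset.sum_add_distrib, Finset.sum_add_distrib, ← Finset.mul_sum, ← Finset.mul_sum,
    ← Finset.mul_sum, mul_add, mul_add]
  have c1 := sum_norm_column_le V
  have c2 := sum_norm_column_le' D
  have d1 := mul_le_mul_of_nonneg_left c1 (show 0 ≤ 2 * η * Φ ‖V‖ * ‖y‖ by positivity)
  have d2 := mul_le_mul_of_nonneg_left c1
    (show 0 ≤ η ^ 2 * deriv Φ ‖V‖ * (‖radialPart V D‖ / ‖V‖) by positivity)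
  have d3 := mul_le_mul_of_nonneg_left c2 (show 0 ≤ η ^ 2 * Φ ‖V‖ by positivity)
  linarith

/-- The three pieces of the test gradient play different roles. The piece `D_s` gives full
ellipticity, the piece containing `Φ'` is nonnegative thanks to the radial structure, and the piece
containing `∇η` is merely bounded by the Hessian norm. The dimensions provide the two distinct
matrix entries needed for the eigenvalue bounds. -/
theorem le_sum_inner_testGradient {F₀ : Mat n N → ℝ} {g : ℝ → ℝ} {p ν L₁ : ℝ} (hn : 2 ≤ n)
    (hN : 1 ≤ N) (hF : ContDiffOn ℝ 2 F₀ {ξ | 1 < ‖ξ‖}) (hg : ∀ ξ, 1 ≤ ‖ξ‖ → F₀ ξ = g ‖ξ‖)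
    (hV : 1 < ‖V‖)
    (hell : ∀ η : Mat n N, ν * ‖V‖ ^ (p - 2) * ‖η‖ ^ 2 ≤ inner ℝ (hessian F₀ V η) η)
    (hH : hessianNorm F₀ V ≤ L₁ * ‖V‖ ^ (p - 2))
    (hD : ∀ a i j, D ((a, i), j) = D ((a, j), i)) {Φ : ℝ → ℝ} (h0 : ∀ t, 0 ≤ Φ t)
    (h1 : ∀ t, 0 ≤ deriv Φ t) {η : ℝ} (hη : 0 ≤ η) (y : Vec n) :
    ν * (η ^ 2 * (Φ ‖V‖ * ‖V‖ ^ (p - 2) * ‖D‖ ^ 2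
        + deriv Φ ‖V‖ * ‖V‖ ^ (p - 1) * (‖radialPart V D‖ / ‖V‖) ^ 2))
      - 2 * L₁ * η * (Φ ‖V‖ * ‖V‖ ^ (p - 2)) * ‖V‖ * ‖D‖ * ‖y‖ ≤
      ∑ s, inner ℝ (hessian F₀ V (column s D)) (testGradient Φ η y V D s) := by
  have hV0 : 0 < ‖V‖ := by linarith
  have b1 := h0 ‖V‖
  have b2 := h1 ‖V‖
  have hPp : ‖V‖ ^ (p - 1) = ‖V‖ ^ (p - 2) * ‖V‖ := by
    rw [← Real.rpow_add_one hV0.ne']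
    ring_nf
  have e : ∀ s, (inner ℝ (hessian F₀ V (column s D)) (testGradient Φ η y V D s) : ℝ)
      = 2 * η * Φ ‖V‖ * inner ℝ (hessian F₀ V (column s D)) (tensorRow y V s)
        + η ^ 2 * (deriv Φ ‖V‖ / ‖V‖) *
          inner ℝ (hessian F₀ V (column s D)) (tensorRow (radialPart V D) V s)
        + η ^ 2 * Φ ‖V‖ * inner ℝ (hessian F₀ V (column s D)) (column s D) := by
    intro s
    rw [testGradient, inner_add_right, inner_add_right, inner_smul_right, inner_smul_right,
      inner_smul_right]
  simp only [e]
  rw [Finset.sum_add_distrib, Finset.sum_add_distrib, ← Finset.mul_sum, ← Finset.mul_sum,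
    ← Finset.mul_sum]
  have t3 : ν * ‖V‖ ^ (p - 2) * ‖D‖ ^ 2
      ≤ ∑ s, (inner ℝ (hessian F₀ V (column s D)) (column s D) : ℝ) := by
    rw [← sum_norm_column_sq D, Finset.mul_sum]
    exact Finset.sum_le_sum fun s _ => hell _
  have t2 : ν * ‖V‖ ^ (p - 2) * ‖radialPart V D‖ ^ 2
      ≤ ∑ s, (inner ℝ (hessian F₀ V (column s D)) (tensorRow (radialPart V D) V s) : ℝ) := by
    obtain ⟨a, b, hab⟩ := exists_hessian_radial hF hg hV
    have hne : ((⟨0, hN⟩, ⟨0, by omega⟩) : Fin N × Fin n) ≠ (⟨0, hN⟩, ⟨1, by omega⟩) := by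
      simp
    obtain ⟨c1, c2⟩ := coeff_bounds_of_elliptic hne (norm_pos_iff.1 hV0)
      (A := fun η => hessian F₀ V η) hab hell
    exact le_sum_inner_hessian_tensorRow hD (A := fun η => hessian F₀ V η) hab c1 c2
      (fun i => radialPart_apply V D i)
  have t1 : -(L₁ * ‖V‖ ^ (p - 2) * ‖y‖ * (‖D‖ * ‖V‖))
      ≤ ∑ s, (inner ℝ (hessian F₀ V (column s D)) (tensorRow y V s) : ℝ) := by
    have hL0 : 0 ≤ L₁ * ‖V‖ ^ (p - 2) := (Real.sqrt_nonneg _).trans hH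
    have h2 : ∀ s, -(L₁ * ‖V‖ ^ (p - 2) * ‖y‖ * (‖column s D‖ * ‖column s V‖))
        ≤ (inner ℝ (hessian F₀ V (column s D)) (tensorRow y V s) : ℝ) := by
      intro s
      have h3 := norm_inner_le_norm (𝕜 := ℝ) (hessian F₀ V (column s D)) (tensorRow y V s)
      rw [norm_tensorRow, Real.norm_eq_abs] at h3
      have h4 := neg_abs_le (inner ℝ (hessian F₀ V (column s D)) (tensorRow y V s) : ℝ)
      have h5 : ‖hessian F₀ V (column s D)‖ ≤ L₁ * ‖V‖ ^ (p - 2) * ‖column s D‖ :=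
        (norm_apply_le_hilbertSchmidt _ _).trans (mul_le_mul_of_nonneg_right hH (norm_nonneg _))
      have h6 := mul_le_mul_of_nonneg_right h5 (show 0 ≤ ‖y‖ * ‖column s V‖ by positivity)
      linarith
    refine le_trans ?_ (Finset.sum_le_sum fun s _ => h2 s)
    rw [Finset.sum_neg_distrib, ← Finset.mul_sum, neg_le_neg_iff]
    exact mul_le_mul_of_nonneg_left (sum_norm_column_mul_le V D) (by positivity)
  have m1 := mul_le_mul_of_nonneg_left t1 (show 0 ≤ 2 * η * Φ ‖V‖ by positivity)
  have m2 := mul_le_mul_of_nonneg_left t2 (show 0 ≤ η ^ 2 * (deriv Φ ‖V‖ / ‖V‖) by positivity)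
  have m3 := mul_le_mul_of_nonneg_left t3 (show 0 ≤ η ^ 2 * Φ ‖V‖ by positivity)
  refine le_trans (le_of_eq ?_) (add_le_add (add_le_add m1 m2) m3)
  rw [hPp]
  field_simp
  ring

/-- The pointwise form of the Caccioppoli inequality. -/
theorem caccioppoli_pointwise {F₀ : Mat n N → ℝ} {g : ℝ → ℝ} {p ν L₁ κ : ℝ} (hn : 2 ≤ n)
    (hN : 1 ≤ N) (hν : 0 < ν) (hκ : 0 ≤ κ) (hF : ContDiffOn ℝ 2 F₀ {ξ | 1 < ‖ξ‖})
    (hg : ∀ ξ, 1 ≤ ‖ξ‖ → F₀ ξ = g ‖ξ‖) (hV : 1 < ‖V‖)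
    (hell : ∀ η : Mat n N, ν * ‖V‖ ^ (p - 2) * ‖η‖ ^ 2 ≤ inner ℝ (hessian F₀ V η) η)
    (hH : hessianNorm F₀ V ≤ L₁ * ‖V‖ ^ (p - 2))
    (hD : ∀ a i j, D ((a, i), j) = D ((a, j), i)) {Φ : ℝ → ℝ} (h0 : ∀ t, 0 ≤ Φ t)
    (h1 : ∀ t, 0 ≤ deriv Φ t) {η : ℝ} (hη : 0 ≤ η) (y : Vec n) :
    ν / 2 * (η ^ 2 * (Φ ‖V‖ * ‖V‖ ^ (p - 2) * ‖D‖ ^ 2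
        + deriv Φ ‖V‖ * ‖V‖ ^ (p - 1) * (‖radialPart V D‖ / ‖V‖) ^ 2)) ≤
      ∑ s, inner ℝ (hessian F₀ V (column s D)) (testGradient Φ η y V D s)
        - ∑ s, κ * ‖V‖ ^ (p - 1) * ‖testGradient Φ η y V D s‖
        + caccioppoliConst n ν L₁ * ((‖y‖ ^ 2 + κ ^ 2 * η ^ 2) *
          (Φ ‖V‖ * ‖V‖ ^ p + deriv Φ ‖V‖ * ‖V‖ ^ (p + 1))) := by
  have hV0 : 0 < ‖V‖ := by linarith
  have hPp : ‖V‖ ^ (p - 1) = ‖V‖ ^ (p - 2) * ‖V‖ := by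
    rw [← Real.rpow_add_one hV0.ne']
    ring_nf
  have hPq : ‖V‖ ^ p = ‖V‖ ^ (p - 2) * ‖V‖ ^ 2 := by
    rw [← Real.rpow_natCast, ← Real.rpow_add hV0]
    norm_num
  have hPr : ‖V‖ ^ (p + 1) = ‖V‖ ^ (p - 2) * ‖V‖ * ‖V‖ ^ 2 := by
    rw [Real.rpow_add_one hV0.ne', hPq]
    ring
  have a1 := le_sum_inner_testGradient hn hN hF hg hV hell hH hD h0 h1 hη y
  have a2 := mul_le_mul_of_nonneg_left (sum_norm_testGradient_le h0 h1 hη y V D)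
    (show 0 ≤ κ * ‖V‖ ^ (p - 1) by positivity)
  have b1 := h0 ‖V‖
  have b2 := h1 ‖V‖
  have a3 := caccioppoli_algebra (L := L₁) (m := (n : ℝ)) (a := Φ ‖V‖ * ‖V‖ ^ (p - 2))
    (b := deriv Φ ‖V‖ * ‖V‖ ^ (p - 1)) (d := ‖D‖) (y := ‖y‖) (z := ‖radialPart V D‖ / ‖V‖)
    (η := η) (κ := κ) (P := ‖V‖) hν (by positivity) (by positivity)
  rw [← Finset.mul_sum, caccioppoliConst]
  rw [hPp] at a1 a2 a3 ⊢
  rw [hPq, hPr]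
  generalize ∑ s, (inner ℝ (hessian F₀ V (column s D)) (testGradient Φ η y V D s) : ℝ) = X at *
  generalize ∑ s, ‖testGradient Φ η y V D s‖ = S at *
  generalize ‖radialPart V D‖ / ‖V‖ = z at *
  generalize ‖V‖ ^ (p - 2) = q at *
  linarith

end CaccioppoliPointwise

/-! ### The integrated Caccioppoli inequality. -/

section Caccioppoli

open Filter Topology

variable {n N : ℕ}

/-- A locally bounded gradient `V` with weak derivative `D2 ∈ L²_loc` solving the Euler-Lagrange
inequality of an energy satisfying the structure conditions. -/
structure RegularSolution (Ω : Set (Vec n)) (p L L₁ ν s : ℝ) (k : Vec n → ℝ)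
    (F : Vec n → Mat n N → ℝ) (f : Vec n → Vec N) (V : Vec n → Mat n N) (D2 : Vec n → Tens n N) :
    Prop where
  two_le_dim : 2 ≤ n
  one_le_codim : 1 ≤ N
  two_le_p : 2 ≤ p
  dim_lt : (n : ℝ) < s
  L₁_nonneg : 0 ≤ L₁
  ν_pos : 0 < ν
  isOpen : IsOpen Ω
  conditions : StructureConditions Ω p L L₁ ν s k F
  f_mem : MemLpLoc f (ENNReal.ofReal s) Ω
  euler : EulerLagrangeIneq Ω F f V
  weakGrad : IsWeakGrad Ω V D2
  bounded : MemLpLoc V ⊤ Ω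
  sq_integrable : MemLpLoc D2 2 Ω
  symm : ∀ᵐ x ∂(volume.restrict Ω), ∀ a i j, D2 x ((a, i), j) = D2 x ((a, j), i)

/-- The partial derivatives of a scalar function as a vector. -/
noncomputable def gradVec (η : Vec n → ℝ) (x : Vec n) : Vec n :=
  WithLp.toLp 2 fun i => fderiv ℝ η x (EuclideanSpace.single i 1)

theorem continuous_gradVec {η : Vec n → ℝ} (hη : ContDiff ℝ ∞ η) : Continuous (gradVec η) :=
  (PiLp.continuous_toLp 2 _).comp (continuous_pi fun _ =>
    (hη.continuous_fderiv (by simp)).clm_apply continuous_const)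

/-- The function `2^(p-1) k + |f| + 2` controlling the data. -/
noncomputable def dataFun (p : ℝ) (k : Vec n → ℝ) (f : Vec n → Vec N) (x : Vec n) : ℝ :=
  2 ^ (p - 1) * k x + (‖f x‖ + 2)

/-- The left-hand side of the Caccioppoli inequality. -/
noncomputable def energyDensity (p : ℝ) (Φ : ℝ → ℝ) (V : Mat n N) (D : Tens n N) : ℝ :=
  Φ ‖V‖ * ‖V‖ ^ (p - 2) * ‖D‖ ^ 2
    + deriv Φ ‖V‖ * ‖V‖ ^ (p - 1) * (‖radialPart V D‖ / ‖V‖) ^ 2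

/-- The weight on the right-hand side of the Caccioppoli inequality. -/
noncomputable def growthWeight (p : ℝ) (Φ : ℝ → ℝ) (t : ℝ) : ℝ :=
  Φ t * t ^ p + deriv Φ t * t ^ (p + 1)

theorem continuous_tensorRow (s : Fin n) :
    Continuous fun q : Vec n × Mat n N => tensorRow q.1 q.2 s := by
  refine (PiLp.continuous_toLp 2 _).comp (continuous_pi fun ai => ?_)
  exact ((EuclideanSpace.proj (𝕜 := ℝ) ai.2).continuous.comp continuous_fst).mul
    ((EuclideanSpace.proj (𝕜 := ℝ) (ai.1, s)).continuous.comp continuous_snd)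

theorem continuous_radialPart : Continuous fun q : Mat n N × Tens n N => radialPart q.1 q.2 := by
  refine (PiLp.continuous_toLp 2 _).comp (continuous_pi fun i => ?_)
  exact continuous_fst.inner ((column i).continuous.comp continuous_snd)

theorem aemeasurable_radialPart {μ : Measure (Vec n)} {V : Vec n → Mat n N} {D : Vec n → Tens n N}
    (hV : AEMeasurable V μ) (hD : AEMeasurable D μ) :
    AEMeasurable (fun x => radialPart (V x) (D x)) μ :=
  (continuous_radialPart.comp_aestronglyMeasurable
    (hV.aestronglyMeasurable.prodMk hD.aestronglyMeasurable)).aemeasurable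

theorem aemeasurable_testGradient {μ : Measure (Vec n)} {Φ : ℝ → ℝ} (hΦ : ContDiff ℝ 1 Φ)
    {η : Vec n → ℝ} {y : Vec n → Vec n} (hη : Continuous η) (hy : Continuous y)
    {V : Vec n → Mat n N} {D : Vec n → Tens n N} (hV : AEMeasurable V μ) (hD : AEMeasurable D μ)
    (s : Fin n) : AEMeasurable (fun x => testGradient Φ (η x) (y x) (V x) (D x) s) μ := by
  have h1 : AEMeasurable (fun x => Φ ‖V x‖) μ := hΦ.continuous.measurable.comp_aemeasurable hV.norm
  have h2 : AEMeasurable (fun x => deriv Φ ‖V x‖ / ‖V x‖) μ :=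
    ((hΦ.continuous_deriv (by simp)).measurable.comp_aemeasurable hV.norm).div hV.norm
  have h3 : AEMeasurable (fun x => tensorRow (y x) (V x) s) μ :=
    (continuous_tensorRow s).measurable.comp_aemeasurable (hy.measurable.aemeasurable.prodMk hV)
  have h4 : AEMeasurable (fun x => radialPart (V x) (D x)) μ :=
    aemeasurable_radialPart hV hD
  have h5 : AEMeasurable (fun x => tensorRow (radialPart (V x) (D x)) (V x) s) μ :=
    (continuous_tensorRow s).measurable.comp_aemeasurable (h4.prodMk hV)
  have h6 : AEMeasurable (fun x => column s (D x)) μ :=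
    (column s).continuous.measurable.comp_aemeasurable hD
  have h7 : AEMeasurable η μ := hη.measurable.aemeasurable
  have c1 : AEMeasurable (fun x => 2 * η x * Φ ‖V x‖) μ := (h7.const_mul 2).mul h1
  have c2 : AEMeasurable (fun x => η x ^ 2 * (deriv Φ ‖V x‖ / ‖V x‖)) μ := (h7.pow_const 2).mul h2
  have c3 : AEMeasurable (fun x => η x ^ 2 * Φ ‖V x‖) μ := (h7.pow_const 2).mul h1
  unfold testGradient
  exact ((c1.smul h3).add (c2.smul h5)).add (c3.smul h6)

theorem column_tensorRow (z : Vec n) (V : Mat n N) (i s : Fin n) :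
    column i (tensorRow z V s) = z i • column s V := by
  ext a
  simp [column_apply]

theorem column_column {D : Tens n N} (hD : ∀ a i j, D ((a, i), j) = D ((a, j), i)) (i s : Fin n) :
    column i (column s D) = column s (column i D) := by
  ext a
  simp [column_apply, hD a i s]

theorem column_testGradient {Φ : ℝ → ℝ} {r : ℝ} (hΦ : ContDiff ℝ 1 Φ) (hr : 0 < r)
    (h0 : ∀ t ≤ r, Φ t = 0) {η : Vec n → ℝ} (hη : ContDiff ℝ ∞ η) {x : Vec n} {V : Mat n N}
    {D : Tens n N} (hD : ∀ a i j, D ((a, i), j) = D ((a, j), i)) (i s : Fin n) :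
    column i (testGradient Φ (η x) (gradVec η x) V D s) =
      η x ^ 2 • fderiv ℝ (fun ξ : Mat n N => Φ ‖ξ‖ • column s ξ) V (column i D)
        + fderiv ℝ (fun x => η x ^ 2) x (EuclideanSpace.single i 1) • (Φ ‖V‖ • column s V) := by
  have h1 := ((hasFDerivAt_comp_norm hΦ hr h0 V).smul (column s).hasFDerivAt).fderiv
  have h2 : fderiv ℝ (fun ξ : Mat n N => Φ ‖ξ‖ • column s ξ) V = _ := h1
  have h3 := ((hη.differentiable (by simp) x).hasFDerivAt.pow 2).fderiv
  rw [h2, h3, testGradient]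
  simp only [map_add, map_smul, column_tensorRow, column_column hD, radialPart_apply,
    add_apply, smul_apply,
    ContinuousLinearMap.smulRight_apply, innerSL_apply_apply, gradVec, smul_eq_mul, nsmul_eq_mul]
  simp only [Nat.cast_ofNat, pow_one, Nat.add_one_sub_one]
  module

theorem testGradient_eq_zero {Φ : ℝ → ℝ} {η : ℝ} {y : Vec n} {V : Mat n N} {D : Tens n N}
    (h1 : Φ ‖V‖ = 0) (h2 : deriv Φ ‖V‖ = 0) (s : Fin n) : testGradient Φ η y V D s = 0 := by
  simp [testGradient, h1, h2]

theorem testGradient_zero {Φ : ℝ → ℝ} {y : Vec n} {V : Mat n N} {D : Tens n N} (s : Fin n) :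
    testGradient Φ 0 y V D s = 0 := by
  simp [testGradient]

set_option maxHeartbeats 800000 in
/-- The Caccioppoli inequality. -/
theorem RegularSolution.caccioppoli {Ω : Set (Vec n)} {p L L₁ ν s : ℝ} {k : Vec n → ℝ}
    {F : Vec n → Mat n N → ℝ} {f : Vec n → Vec N} {V : Vec n → Mat n N} {D2 : Vec n → Tens n N}
    (hS : RegularSolution Ω p L L₁ ν s k F f V D2) {x₀ : Vec n} {R : ℝ} (hR : 0 ≤ R)
    (hRΩ : Metric.closedBall x₀ R ⊆ Ω) {δ : ℝ} (hδ : 0 < δ) (hδ1 : δ ≤ 1) {Φ : ℝ → ℝ}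
    (hΦ : ContDiff ℝ 1 Φ) (hΦ0 : ∀ t ≤ 1 + δ, Φ t = 0) (hΦn : ∀ t, 0 ≤ Φ t)
    (hΦd : ∀ t, 0 ≤ deriv Φ t) {η : Vec n → ℝ} (hη : ContDiff ℝ ∞ η) (hηn : ∀ x, 0 ≤ η x)
    (hηs : tsupport η ⊆ Metric.closedBall x₀ R) :
    Integrable (fun x => η x ^ 2 * energyDensity p Φ (V x) (D2 x))
      (volume.restrict (Metric.closedBall x₀ R)) ∧
    Integrable (fun x => (‖gradVec η x‖ ^ 2 + dataFun p k f x ^ 2 * η x ^ 2)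
      * growthWeight p Φ ‖V x‖) (volume.restrict (Metric.closedBall x₀ R)) ∧
    ν / 2 * ∫ x in Metric.closedBall x₀ R, η x ^ 2 * energyDensity p Φ (V x) (D2 x) ≤
      caccioppoliConst n ν L₁ * ∫ x in Metric.closedBall x₀ R,
        (‖gradVec η x‖ ^ 2 + dataFun p k f x ^ 2 * η x ^ 2) * growthWeight p Φ ‖V x‖ := by
  set B := Metric.closedBall x₀ R with hB_def
  have hp := hS.two_le_p
  have hs2 : 2 ≤ s := by
    have h1 : (2 : ℝ) ≤ n := by exact_mod_cast hS.two_le_dim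
    linarith [hS.dim_lt]
  have hBc : IsCompact B := isCompact_closedBall _ _
  have hBm : MeasurableSet B := measurableSet_closedBall
  haveI : IsFiniteMeasure (volume.restrict B : Measure (Vec n)) :=
    ⟨by simpa using hBc.measure_lt_top⟩
  have hle : volume.restrict B ≤ (volume.restrict Ω : Measure (Vec n)) :=
    Measure.restrict_mono hRΩ le_rfl
  obtain ⟨M, hM1, hM⟩ := hS.bounded.exists_bound hBc hRΩ
  have hVm : AEMeasurable V (volume.restrict B) := (hS.bounded B hBc hRΩ).1.aemeasurable
  have hD2 := hS.sq_integrable B hBc hRΩ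
  have hDm : AEMeasurable D2 (volume.restrict B) := hD2.1.aemeasurable
  have hΦ1 : ∀ t ≤ 1 + δ, deriv Φ t = 0 := fun t ht => deriv_eq_zero_of_le hΦ hΦ0 ht
  have hΦc : Continuous (deriv Φ) := hΦ.continuous_deriv (by simp)
  have hyc := continuous_gradVec hη
  have hηc : HasCompactSupport η := hBc.of_isClosed_subset (isClosed_tsupport _) hηs
  -- the test functions and their gradients
  set Y : Fin n → Vec n → Mat n N := fun i x =>
    testGradient Φ (η x) (gradVec η x) (V x) (D2 x) i with hY_def
  have hη2 : ContDiff ℝ ∞ (fun x => η x ^ 2) := hη.pow 2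
  have hη2s : tsupport (fun x => η x ^ 2) ⊆ B := by
    refine (closure_mono fun x hx => ?_).trans hηs
    intro h0
    exact hx (by simp [h0])
  have hΨ : ∀ i : Fin n, ContDiff ℝ 1 (fun ξ : Mat n N => Φ ‖ξ‖ • column i ξ) := fun i =>
    (contDiff_comp_norm hΦ (by linarith : 0 < 1 + δ) hΦ0).smul
      (column (ι := Fin N) i).contDiff
  have htest := fun i => hS.weakGrad.hasWeakDeriv_smul_comp hS.isOpen hS.bounded hS.sq_integrable
    hR hRΩ (hΨ i) hη2 hη2s
  have hη0 : ∀ x, x ∉ B → η x = 0 := fun x hx =>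
    image_eq_zero_of_notMem_tsupport fun h => hx (hηs h)
  have hYB : ∀ i x, x ∉ B → Y i x = 0 := by
    intro i x hx
    rw [hY_def]
    beta_reduce
    rw [hη0 x hx, testGradient_zero]
  have hYV : ∀ i x, ‖V x‖ ≤ 1 + δ → Y i x = 0 := fun i x hx =>
    testGradient_eq_zero (hΦ0 _ hx) (hΦ1 _ hx) i
  have hYm : ∀ i, AEStronglyMeasurable (Y i) (volume.restrict B) := fun i =>
    (aemeasurable_testGradient hΦ hη.continuous hyc hVm hDm i).aestronglyMeasurable
  have hsymB : ∀ᵐ x ∂(volume.restrict B), ∀ a i j, D2 x ((a, i), j) = D2 x ((a, j), i) :=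
    ae_mono hle hS.symm
  -- The columns of the test gradient are the weak derivatives of `η² Φ(|V|) V_i`; the
  -- identification uses the a.e. symmetry of `D2`.
  have hcol : ∀ i j, (fun x => η x ^ 2 • fderiv ℝ (fun ξ : Mat n N => Φ ‖ξ‖ • column i ξ) (V x)
      (column j (D2 x)) + fderiv ℝ (fun x => η x ^ 2) x (EuclideanSpace.single j 1) •
        (Φ ‖V x‖ • column i (V x))) =ᵐ[volume] fun x => column j (Y i x) := by
    intro i j
    rw [ae_restrict_iff' hBm] at hsymB
    filter_upwards [hsymB] with x hx
    by_cases hxB : x ∈ B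
    · exact (column_testGradient hΦ (by linarith) hΦ0 hη (hx hxB) j i).symm
    · have h1 : fderiv ℝ (fun x => η x ^ 2) x (EuclideanSpace.single j 1) = 0 :=
        image_eq_zero_of_notMem_tsupport
          (f := fun y => fderiv ℝ (fun x => η x ^ 2) y (EuclideanSpace.single j 1))
          fun h => hxB (hη2s (HasCompactSupport.fderiv_apply_tsupport_subset _ h))
      rw [hYB i x hxB, h1, hη0 x hxB]
      simp
  have hY2 : ∀ i, MemLp (Y i) 2 volume := by
    intro i
    refine memLp_of_eq_zero hBm ⟨hYm i, ?_⟩ (hYB i)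
    refine (eLpNorm_le_sum_eLpNorm_column (hYm i)).trans_lt (ENNReal.sum_lt_top.2 fun j _ => ?_)
    exact ((((htest i).2 j).1.ae_eq (hcol i j)).restrict B).2
  have hY2B := fun i => (hY2 i).restrict B
  -- The inequality differentiated in direction `i` is tested with the function built from the
  -- `i`-th column of `V`; only the sum over `i` has a sign.
  have hDI := fun i => hS.euler.differentiated hS.isOpen hp hs2 hS.L₁_nonneg hS.conditions
    hS.f_mem hS.weakGrad hS.bounded hS.sq_integrable hR hRΩ hδ hδ1 i (htest i).1 (hY2 i)
    ((closure_mono fun x hx => by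
      intro h0
      exact hx (by simp [h0])).trans hηs) (hYB i)
    (fun j => ((htest i).2 j).2.congr_ae (EventuallyEq.refl _ _) (hcol i j)) (hYV i)
  -- the data
  have hk2 : MemLp k 2 (volume.restrict B) := hS.conditions.k_mem.two hs2 hBc hRΩ
  have hf2 : MemLp f 2 (volume.restrict B) := hS.f_mem.two hs2 hBc hRΩ
  have hκ2 : MemLp (dataFun p k f) 2 (volume.restrict B) :=
    (hk2.const_mul _).add (hf2.norm.add (memLp_const 2))
  have hPm : ∀ q : ℝ, AEMeasurable (fun x => ‖V x‖ ^ q) (volume.restrict B) := fun q =>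
    hVm.norm.pow_const q
  have hPY : ∀ i, MemLp (fun x => ‖V x‖ ^ (p - 1) * ‖Y i x‖) 2 (volume.restrict B) := by
    intro i
    refine MemLp.of_le ((hY2B i).norm.const_mul (M ^ (p - 1)))
      ((hPm _).aestronglyMeasurable.mul (hYm i).norm) ?_
    filter_upwards [hM] with x hx
    rw [Real.norm_of_nonneg (by positivity), Real.norm_of_nonneg (by positivity)]
    gcongr
    linarith
  have hmulint : ∀ {w z : Vec n → ℝ}, MemLp w 2 (volume.restrict B) →
      MemLp z 2 (volume.restrict B) → Integrable (fun x => w x * z x) (volume.restrict B) :=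
    fun hw hz => Integrable.mono' (integrable_norm_mul_norm hw hz) (hw.1.mul hz.1)
      (Eventually.of_forall fun x => by rw [norm_mul])
  set X : Fin n → Vec n → ℝ := fun i x =>
    inner ℝ (hessian (F x) (V x) (column i (D2 x))) (Y i x) with hX_def
  set W : Fin n → Vec n → ℝ := fun i x =>
    dataFun p k f x * ‖V x‖ ^ (p - 1) * ‖Y i x‖ with hW_def
  have hXi : ∀ i, Integrable (X i) (volume.restrict B) := fun i => (hDI i).1
  have hWi : ∀ i, Integrable (W i) (volume.restrict B) := fun i => by
    have := hmulint hκ2 (hPY i)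
    simpa only [hW_def, mul_assoc] using this
  have hXW : ∀ i, ∫ x in B, X i x ≤ ∫ x in B, W i x := by
    intro i
    refine (hDI i).2.trans ?_
    have i1 : Integrable (fun x => 2 ^ (p - 1) * k x * ‖V x‖ ^ (p - 1) * ‖Y i x‖)
        (volume.restrict B) := by
      have := (hmulint hk2 (hPY i)).const_mul (2 ^ (p - 1))
      simpa only [mul_assoc] using this
    have hci : MemLp (fun x => column i (Y i x)) 2 (volume.restrict B) :=
      (hY2B i).of_le ((column i).continuous.comp_aestronglyMeasurable (hYm i))
        (Eventually.of_forall fun x => norm_column_le i _)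
    have i2 : Integrable (fun x => (‖f x‖ + 2) * ‖column i (Y i x)‖) (volume.restrict B) :=
      hmulint (hf2.norm.add (memLp_const 2)) hci.norm
    rw [← integral_add i1 i2]
    refine integral_mono (i1.add i2) (hWi i) fun x => ?_
    -- On the support of the test gradient `|V| ≥ 1`, so the factor `|V|^(p-1)` can be inserted for
    -- free. This merges `k` and `f` into the single function `dataFun`.
    have h1 : (‖f x‖ + 2) * ‖column i (Y i x)‖ ≤ (‖f x‖ + 2) * (‖V x‖ ^ (p - 1) * ‖Y i x‖) := by
      refine mul_le_mul_of_nonneg_left ?_ (by positivity)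
      by_cases hVx : ‖V x‖ ≤ 1 + δ
      · rw [hYV i x hVx]
        simp
      · have : 1 ≤ ‖V x‖ ^ (p - 1) := Real.one_le_rpow (by linarith) (by linarith)
        exact (norm_column_le _ _).trans (le_mul_of_one_le_left (norm_nonneg _) this)
    simp only [hW_def, dataFun]
    linarith
  -- integrability of the right-hand side
  have hgc : ContinuousOn (growthWeight p Φ) (Icc 0 M) := by
    refine ((hΦ.continuous.mul (Real.continuous_rpow_const (by linarith))).add
      (hΦc.mul (Real.continuous_rpow_const (by linarith)))).continuousOn
  have hgcont : Continuous (growthWeight p Φ) :=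
    (hΦ.continuous.mul (Real.continuous_rpow_const (by linarith))).add
      (hΦc.mul (Real.continuous_rpow_const (by linarith)))
  obtain ⟨Cg, hCg⟩ := isCompact_Icc.exists_bound_of_continuousOn hgc
  obtain ⟨Cy, hCy⟩ : ∃ C, ∀ x, ‖gradVec η x‖ ≤ C := by
    refine HasCompactSupport.exists_bound_of_continuous (hηc.mono' fun x hx => ?_) hyc
    by_contra hx'
    refine hx ?_
    ext i
    exact image_eq_zero_of_notMem_tsupport (f := fun y => fderiv ℝ η y (EuclideanSpace.single i 1))
      fun h => hx' (HasCompactSupport.fderiv_apply_tsupport_subset _ h)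
  obtain ⟨Cη, hCη⟩ := hηc.exists_bound_of_continuous hη.continuous
  have hRi : Integrable (fun x => (‖gradVec η x‖ ^ 2 + dataFun p k f x ^ 2 * η x ^ 2)
      * growthWeight p Φ ‖V x‖) (volume.restrict B) := by
    have hκi : Integrable (fun x => dataFun p k f x ^ 2) (volume.restrict B) := by
      have := hmulint hκ2 hκ2
      simpa only [sq] using this
    have b1 : Integrable (fun x => ‖gradVec η x‖ ^ 2 + dataFun p k f x ^ 2 * η x ^ 2)
        (volume.restrict B) := by
      refine Integrable.add ?_ ?_
      · refine Integrable.of_bound (hyc.norm.pow 2).aestronglyMeasurable (Cy ^ 2)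
          (Eventually.of_forall fun x => ?_)
        rw [norm_pow, norm_norm]
        exact pow_le_pow_left₀ (norm_nonneg _) (hCy x) 2
      · refine hκi.mul_bdd (c := Cη ^ 2) (hη.continuous.pow 2).aestronglyMeasurable
          (Eventually.of_forall fun x => ?_)
        rw [norm_pow]
        exact pow_le_pow_left₀ (norm_nonneg _) (hCη x) 2
    refine b1.mul_bdd (c := Cg) (hgcont.measurable.comp_aemeasurable
      hVm.norm).aestronglyMeasurable ?_
    filter_upwards [hM] with x hx
    exact hCg _ ⟨norm_nonneg _, hx⟩
  -- the pointwise inequality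
  obtain ⟨g, hg⟩ := hS.conditions.radial
  have hpt : ∀ᵐ x ∂(volume.restrict B), ν / 2 * (η x ^ 2 * energyDensity p Φ (V x) (D2 x)) ≤
      (∑ i, X i x - ∑ i, W i x) + caccioppoliConst n ν L₁ *
        ((‖gradVec η x‖ ^ 2 + dataFun p k f x ^ 2 * η x ^ 2) * growthWeight p Φ ‖V x‖) := by
    filter_upwards [hsymB, ae_mono hle hg, ae_mono hle hS.conditions.contDiff,
      ae_mono hle hS.conditions.elliptic, ae_mono hle hS.conditions.hessian_le,
      ae_mono hle hS.conditions.k_nonneg] with x a1 a2 a3 a4 a5 a6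
    by_cases hVx : 1 + δ < ‖V x‖
    · have hκ0 : 0 ≤ dataFun p k f x := by
        unfold dataFun
        positivity
      exact caccioppoli_pointwise hS.two_le_dim hS.one_le_codim hS.ν_pos hκ0 a3 a2
        (by linarith : 1 < ‖V x‖) (a4 _ (by linarith)) (a5 _ (by linarith)) a1 hΦn hΦd (hηn x)
        (gradVec η x)
    · rw [not_lt] at hVx
      have hX0 : ∀ i, X i x = 0 := fun i => by
        simp only [hX_def]
        rw [hYV i x hVx, inner_zero_right]
      have hW0 : ∀ i, W i x = 0 := fun i => by
        simp only [hW_def]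
        rw [hYV i x hVx, norm_zero, mul_zero]
      simp only [hX0, hW0, energyDensity, growthWeight, hΦ0 _ hVx, hΦ1 _ hVx]
      simp
  have hXs : Integrable (fun x => ∑ i, X i x) (volume.restrict B) :=
    integrable_finsetSum _ fun i _ => hXi i
  have hWs : Integrable (fun x => ∑ i, W i x) (volume.restrict B) :=
    integrable_finsetSum _ fun i _ => hWi i
  have hrhs := (hXs.sub hWs).add (hRi.const_mul (caccioppoliConst n ν L₁))
  have hE0 : ∀ x, 0 ≤ η x ^ 2 * energyDensity p Φ (V x) (D2 x) := by
    intro x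
    have b1 := hΦn ‖V x‖
    have b2 := hΦd ‖V x‖
    unfold energyDensity
    positivity
  have hEm : AEStronglyMeasurable (fun x => η x ^ 2 * energyDensity p Φ (V x) (D2 x))
      (volume.restrict B) := by
    have h1 : AEMeasurable (fun x => Φ ‖V x‖) (volume.restrict B) :=
      hΦ.continuous.measurable.comp_aemeasurable hVm.norm
    have h2 : AEMeasurable (fun x => deriv Φ ‖V x‖) (volume.restrict B) :=
      hΦc.measurable.comp_aemeasurable hVm.norm
    have h4 : AEMeasurable (fun x => radialPart (V x) (D2 x)) (volume.restrict B) :=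
      aemeasurable_radialPart hVm hDm
    have h7 : AEMeasurable η (volume.restrict B) := hη.continuous.measurable.aemeasurable
    unfold energyDensity
    exact ((h7.pow_const 2).mul (((h1.mul (hPm _)).mul (hDm.norm.pow_const 2)).add
      ((h2.mul (hPm _)).mul ((h4.norm.div hVm.norm).pow_const 2)))).aestronglyMeasurable
  have hν := hS.ν_pos
  -- Integrability of the energy term follows from the pointwise inequality itself, without assuming
  -- any weighted integrability of `D2`.
  have hEi : Integrable (fun x => η x ^ 2 * energyDensity p Φ (V x) (D2 x))
      (volume.restrict B) := by
    refine Integrable.mono' (hrhs.const_mul (2 / ν)) hEm ?_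
    filter_upwards [hpt] with x hx
    rw [Real.norm_of_nonneg (hE0 x), div_mul_eq_mul_div, le_div_iff₀ hν]
    simp only [Pi.add_apply, Pi.sub_apply]
    linarith
  refine ⟨hEi, hRi, ?_⟩
  have hfin := integral_mono_ae (hEi.const_mul (ν / 2)) hrhs hpt
  have e1 : ∫ x in B, ((∑ i, X i x - ∑ i, W i x) + caccioppoliConst n ν L₁ *
        ((‖gradVec η x‖ ^ 2 + dataFun p k f x ^ 2 * η x ^ 2) * growthWeight p Φ ‖V x‖))
      = (∑ i, ∫ x in B, X i x) - (∑ i, ∫ x in B, W i x) + caccioppoliConst n ν L₁ *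
        ∫ x in B, (‖gradVec η x‖ ^ 2 + dataFun p k f x ^ 2 * η x ^ 2) * growthWeight p Φ ‖V x‖ := by
    have i1 : Integrable (fun x => ∑ i, X i x - ∑ i, W i x) (volume.restrict B) := hXs.sub hWs
    rw [integral_add i1 (hRi.const_mul _), integral_sub hXs hWs,
      integral_finsetSum _ fun i _ => hXi i, integral_finsetSum _ fun i _ => hWi i,
      integral_const_mul]
  have e2 : ∑ i, ∫ x in B, X i x ≤ ∑ i, ∫ x in B, W i x := Finset.sum_le_sum fun i _ => hXW i
  rw [integral_const_mul] at hfin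
  have hfin' : ν / 2 * ∫ x in B, η x ^ 2 * energyDensity p Φ (V x) (D2 x) ≤
      ∫ x in B, ((∑ i, X i x - ∑ i, W i x) + caccioppoliConst n ν L₁ *
        ((‖gradVec η x‖ ^ 2 + dataFun p k f x ^ 2 * η x ^ 2) * growthWeight p Φ ‖V x‖)) := hfin
  rw [e1] at hfin'
  linarith

end Caccioppoli

/-! ### Cutoffs and the weights of the Moser iteration. -/

section MoserAuxiliary

open Filter Topology

variable {n N : ℕ}

theorem exists_bound_deriv_smoothTransition :
    ∃ C : ℝ, 0 < C ∧ (∀ t, |deriv Real.smoothTransition t| ≤ C) ∧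
      ∀ t < 0, deriv Real.smoothTransition t = 0 := by
  have hc : Continuous (deriv Real.smoothTransition) :=
    (Real.smoothTransition.contDiff (n := 1)).continuous_deriv (by simp)
  have h0 : ∀ t < 0, deriv Real.smoothTransition t = 0 := fun t ht => by
    have : Real.smoothTransition =ᶠ[𝓝 t] fun _ => 0 := by
      filter_upwards [Iio_mem_nhds ht] with y hy
      exact Real.smoothTransition.zero_of_nonpos (le_of_lt hy)
    rw [this.deriv_eq, deriv_const]
  have h1 : ∀ t, 1 < t → deriv Real.smoothTransition t = 0 := fun t ht => by
    have : Real.smoothTransition =ᶠ[𝓝 t] fun _ => 1 := by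
      filter_upwards [Ioi_mem_nhds ht] with y hy
      exact Real.smoothTransition.one_of_one_le (le_of_lt hy)
    rw [this.deriv_eq, deriv_const]
  obtain ⟨C, hC⟩ := isCompact_Icc.exists_bound_of_continuousOn (hc.continuousOn (s := Icc 0 1))
  refine ⟨|C| + 1, by positivity, fun t => ?_, h0⟩
  by_cases ht0 : t < 0
  · rw [h0 t ht0, abs_zero]
    positivity
  by_cases ht1 : 1 < t
  · rw [h1 t ht1, abs_zero]
    positivity
  · have := hC t ⟨not_lt.1 ht0, not_lt.1 ht1⟩
    rw [Real.norm_eq_abs] at this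
    linarith [le_abs_self C]

/-- A smooth transition of the quadratic `(r'² - |x - x₀|²)/(r'² - r²)`, which is smooth at the
centre as well. Its gradient is at most a multiple of `r'/(r'² - r²) ≤ 1/(r' - r)`; the constant
does not depend on the radii, as the iteration requires. -/
theorem exists_cutoff_gradVec_le (n : ℕ) : ∃ C : ℝ, 0 < C ∧ ∀ (x₀ : Vec n) (r r' : ℝ), 0 ≤ r →
    r < r' → ∃ η : Vec n → ℝ, ContDiff ℝ ∞ η ∧ (∀ x, 0 ≤ η x) ∧ (∀ x, η x ≤ 1) ∧
      (∀ x ∈ Metric.closedBall x₀ r, η x = 1) ∧ tsupport η ⊆ Metric.closedBall x₀ r' ∧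
      ∀ x, ‖gradVec η x‖ ≤ C / (r' - r) := by
  obtain ⟨C, hC, hCb, hC0⟩ := exists_bound_deriv_smoothTransition
  refine ⟨2 * C, by positivity, fun x₀ r r' hr hrr => ?_⟩
  have hd : 0 < r' ^ 2 - r ^ 2 := by nlinarith
  set u : Vec n → ℝ := fun x => (r' ^ 2 - ‖x - x₀‖ ^ 2) / (r' ^ 2 - r ^ 2) with hu_def
  have hu : ContDiff ℝ ∞ u :=
    (contDiff_const.sub ((contDiff_id.sub contDiff_const).norm_sq ℝ)).div_const _
  refine ⟨fun x => Real.smoothTransition (u x), Real.smoothTransition.contDiff.comp hu,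
    fun x => Real.smoothTransition.nonneg _, fun x => Real.smoothTransition.le_one _,
    fun x hx => ?_, ?_, fun x => ?_⟩
  · refine Real.smoothTransition.one_of_one_le ?_
    rw [mem_closedBall_iff_norm] at hx
    rw [hu_def]
    beta_reduce
    rw [le_div_iff₀ hd]
    nlinarith [norm_nonneg (x - x₀)]
  · refine closure_minimal (fun x hx => ?_) Metric.isClosed_closedBall
    by_contra hx'
    rw [mem_closedBall_iff_norm, not_le] at hx'
    refine hx (Real.smoothTransition.zero_of_nonpos ?_)
    rw [hu_def]
    exact div_nonpos_of_nonpos_of_nonneg (by nlinarith) hd.le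
  · have h1 : HasFDerivAt u ((-(2 / (r' ^ 2 - r ^ 2))) • innerSL ℝ (x - x₀)) x := by
      have h2 := ((hasFDerivAt_id x).sub_const x₀).norm_sq
      refine ((h2.const_sub (r' ^ 2)).mul_const (r' ^ 2 - r ^ 2)⁻¹).congr_fderiv ?_
      ext y
      simp
      ring
    have h3 := (((Real.smoothTransition.contDiff (n := 1)).differentiable (by simp)
      (u x)).hasDerivAt.comp_hasFDerivAt x h1).fderiv
    have h3' : fderiv ℝ (fun x => Real.smoothTransition (u x)) x = _ := h3
    have h4 : gradVec (fun x => Real.smoothTransition (u x)) x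
        = (deriv Real.smoothTransition (u x) * -(2 / (r' ^ 2 - r ^ 2))) • (x - x₀) := by
      ext i
      simp [gradVec, h3', EuclideanSpace.inner_single_right]
      ring
    rw [h4, norm_smul]
    by_cases hx : ‖x - x₀‖ ≤ r'
    · rw [norm_mul, Real.norm_eq_abs, norm_neg, norm_div, Real.norm_two,
        Real.norm_of_nonneg hd.le]
      have e : 2 * C / (r' - r) = C * (2 / (r' ^ 2 - r ^ 2)) * (r' + r) := by
        have h5 : r' - r ≠ 0 := by linarith
        have h6 : r' ^ 2 - r ^ 2 = (r' - r) * (r' + r) := by ring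
        have h7 : r' + r ≠ 0 := by linarith
        rw [h6]
        field_simp
      rw [e]
      have := hCb (u x)
      gcongr
      linarith
    · have hneg : u x < 0 := by
        rw [hu_def]
        exact div_neg_of_neg_of_pos (by nlinarith) hd
      rw [hC0 _ hneg, zero_mul, norm_zero, zero_mul]
      have : 0 < r' - r := by linarith
      positivity

/-- A vanishing derivative at 0 makes the constant branch and the given branch fit together to first
order. -/
theorem hasDerivAt_comp_max {h h' : ℝ → ℝ} (hh : ∀ t, 0 ≤ t → HasDerivAt h (h' t) t)
    (h0 : h' 0 = 0) (u : ℝ) : HasDerivAt (fun u => h (max u 0)) (h' (max u 0)) u := by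
  rcases lt_trichotomy u 0 with hu | rfl | hu
  · rw [max_eq_right hu.le, h0]
    refine (hasDerivAt_const u (h 0)).congr_of_eventuallyEq ?_
    filter_upwards [Iio_mem_nhds hu] with y hy
    rw [max_eq_right (le_of_lt hy)]
  · have h1 : HasDerivWithinAt (fun u => h (max u 0)) (h' (max 0 0)) (Iic 0) 0 := by
      rw [max_self, h0]
      refine (hasDerivWithinAt_const 0 (Iic 0) (h 0)).congr (fun y hy => ?_) (by simp)
      rw [max_eq_right hy]
    have h2 : HasDerivWithinAt (fun u => h (max u 0)) (h' (max 0 0)) (Ici 0) 0 := by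
      rw [max_self]
      refine ((hh 0 le_rfl).hasDerivWithinAt).congr (fun y hy => ?_) (by simp)
      rw [max_eq_left hy]
    have := h1.union h2
    rwa [Iic_union_Ici, hasDerivWithinAt_univ] at this
  · rw [max_eq_left hu.le]
    refine (hh u hu.le).congr_of_eventuallyEq ?_
    filter_upwards [Ioi_mem_nhds hu] with y hy
    rw [max_eq_left (le_of_lt hy)]

/-- The regularization `Θ(P) = 1 + t² / (1 + t)`, `t = (P - 3/2)₊`, of `max(1, P)`. -/
noncomputable def softMax (P : ℝ) : ℝ := 1 + max (P - 3 / 2) 0 ^ 2 / (1 + max (P - 3 / 2) 0)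

/-- The derivative of `softMax`. -/
noncomputable def softMaxDeriv (P : ℝ) : ℝ :=
  (max (P - 3 / 2) 0 ^ 2 + 2 * max (P - 3 / 2) 0) / (1 + max (P - 3 / 2) 0) ^ 2

theorem hasDerivAt_softMax (P : ℝ) : HasDerivAt softMax (softMaxDeriv P) P := by
  have h := hasDerivAt_comp_max (h := fun t => 1 + t ^ 2 / (1 + t))
    (h' := fun t => (t ^ 2 + 2 * t) / (1 + t) ^ 2) (fun t ht => by
      have h1 : (1 + t) ≠ 0 := by positivity
      refine (((hasDerivAt_pow 2 t).div ((hasDerivAt_id t).const_add 1) h1).const_add 1).congr_deriv ?_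
      simp
      ring) (by simp) (P - 3 / 2)
  have h2 := h.comp_sub_const P (3 / 2)
  exact h2

theorem continuous_softMaxDeriv : Continuous softMaxDeriv := by
  unfold softMaxDeriv
  refine Continuous.div (by fun_prop) (by fun_prop) fun x => ?_
  have : 0 ≤ max (x - 3 / 2) 0 := le_max_right _ _
  positivity

theorem contDiff_softMax : ContDiff ℝ 1 softMax := by
  rw [contDiff_one_iff_deriv]
  refine ⟨fun x => (hasDerivAt_softMax x).differentiableAt, ?_⟩
  have : deriv softMax = softMaxDeriv := funext fun x => (hasDerivAt_softMax x).deriv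
  rw [this]
  exact continuous_softMaxDeriv

theorem softMax_of_le {P : ℝ} (h : P ≤ 3 / 2) : softMax P = 1 := by
  rw [softMax, max_eq_right (by linarith)]
  simp

theorem softMaxDeriv_of_le {P : ℝ} (h : P ≤ 3 / 2) : softMaxDeriv P = 0 := by
  rw [softMaxDeriv, max_eq_right (by linarith)]
  simp

theorem one_le_softMax (P : ℝ) : 1 ≤ softMax P := by
  have : 0 ≤ max (P - 3 / 2) 0 := le_max_right _ _
  unfold softMax
  have : 0 ≤ max (P - 3 / 2) 0 ^ 2 / (1 + max (P - 3 / 2) 0) := by positivity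
  linarith

theorem softMaxDeriv_nonneg (P : ℝ) : 0 ≤ softMaxDeriv P := by
  have : 0 ≤ max (P - 3 / 2) 0 := le_max_right _ _
  unfold softMaxDeriv
  positivity

theorem softMaxDeriv_le_one (P : ℝ) : softMaxDeriv P ≤ 1 := by
  have : 0 ≤ max (P - 3 / 2) 0 := le_max_right _ _
  unfold softMaxDeriv
  rw [div_le_one (by positivity)]
  nlinarith

theorem softMax_le {P : ℝ} (h : 1 ≤ P) : softMax P ≤ P := by
  by_cases h1 : P ≤ 3 / 2
  · rwa [softMax_of_le h1]
  · have h2 : 0 ≤ P - 3 / 2 := by linarith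
    rw [softMax, max_eq_left h2]
    have h3 : (P - 3 / 2) ^ 2 / (1 + (P - 3 / 2)) ≤ P - 1 := by
      rw [div_le_iff₀ (by linarith)]
      nlinarith
    linarith

/-- Together with `softMax_le_max` this makes `softMax P` comparable with `max(1, P)`, so integral
bounds transfer to `|V|` and back. -/
theorem le_softMax (P : ℝ) : P ≤ 5 / 2 * softMax P := by
  by_cases h1 : P ≤ 3 / 2
  · rw [softMax_of_le h1]
    linarith
  · have h2 : 0 ≤ P - 3 / 2 := by linarith
    rw [softMax, max_eq_left h2]
    have h3 : 2 / 5 * P - 1 ≤ (P - 3 / 2) ^ 2 / (1 + (P - 3 / 2)) := by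
      rw [le_div_iff₀ (by linarith)]
      nlinarith [sq_nonneg (P - 3 / 2), sq_nonneg (P - 5/2)]
    linarith

theorem softMax_le_max (P : ℝ) : softMax P ≤ max 1 P := by
  by_cases h : 1 ≤ P
  · exact (softMax_le h).trans (le_max_right _ _)
  · rw [softMax_of_le (by linarith)]
    exact le_max_left _ _

theorem hasDerivAt_softMax_rpow (a P : ℝ) :
    HasDerivAt (fun P => softMax P ^ a) (softMaxDeriv P * a * softMax P ^ (a - 1)) P :=
  (hasDerivAt_softMax P).rpow_const (Or.inl (by linarith [one_le_softMax P]))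

theorem contDiff_softMax_rpow (a : ℝ) : ContDiff ℝ 1 (fun P => softMax P ^ a) :=
  contDiff_softMax.rpow_const_of_ne fun x => by linarith [one_le_softMax x]

/-- The function `Q^γ - Q^(γ-1)` of `Q = softMax P`. -/
noncomputable def powerWeight (γ P : ℝ) : ℝ := softMax P ^ γ - softMax P ^ (γ - 1)

variable {γ : ℝ}

theorem contDiff_powerWeight (γ : ℝ) : ContDiff ℝ 1 (powerWeight γ) :=
  (contDiff_softMax_rpow γ).sub (contDiff_softMax_rpow (γ - 1))

theorem deriv_powerWeight (γ P : ℝ) : deriv (powerWeight γ) P =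
    softMaxDeriv P * (softMax P ^ (γ - 2) * (γ * (softMax P - 1) + 1)) := by
  have h := ((hasDerivAt_softMax_rpow γ P).sub (hasDerivAt_softMax_rpow (γ - 1) P)).deriv
  have h' : deriv (powerWeight γ) P = _ := h
  have h0 : softMax P ≠ 0 := by linarith [one_le_softMax P]
  have e : softMax P ^ (γ - 1) = softMax P ^ (γ - 2) * softMax P := by
    rw [← Real.rpow_add_one h0]
    ring_nf
  have e2 : γ - 1 - 1 = γ - 2 := by ring
  rw [h', e2, e]
  ring

theorem powerWeight_of_le {P : ℝ} (h : P ≤ 3 / 2) : powerWeight γ P = 0 := by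
  simp [powerWeight, softMax_of_le h]

theorem powerWeight_nonneg (γ P : ℝ) : 0 ≤ powerWeight γ P :=
  sub_nonneg.2 (Real.rpow_le_rpow_of_exponent_le (one_le_softMax P) (by linarith))

theorem powerWeight_le (γ P : ℝ) : powerWeight γ P ≤ softMax P ^ γ := by
  have := Real.rpow_nonneg (by linarith [one_le_softMax P] : 0 ≤ softMax P) (γ - 1)
  unfold powerWeight
  linarith

theorem deriv_powerWeight_nonneg (hγ : 0 ≤ γ) (P : ℝ) : 0 ≤ deriv (powerWeight γ) P := by
  rw [deriv_powerWeight]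
  have h1 := one_le_softMax P
  have h2 : 0 ≤ softMax P - 1 := by linarith
  have h3 := softMaxDeriv_nonneg P
  have h4 := Real.rpow_nonneg (by linarith : 0 ≤ softMax P) (γ - 2)
  positivity

/-- Differentiation costs only a factor linear in `γ`, because the derivative of `softMax` is at
most 1. Polynomial growth in the exponent is what the iteration tolerates. -/
theorem deriv_powerWeight_mul_le (hγ : 0 ≤ γ) (P : ℝ) :
    deriv (powerWeight γ) P * softMax P ≤ (γ + 1) * softMax P ^ γ := by
  rw [deriv_powerWeight]
  have h1 := one_le_softMax P
  have h2 : 0 ≤ softMax P - 1 := by linarith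
  have h3 := softMaxDeriv_nonneg P
  have h5 := softMaxDeriv_le_one P
  have h4 := Real.rpow_nonneg (by linarith : 0 ≤ softMax P) (γ - 2)
  have e : softMax P ^ γ = softMax P ^ (γ - 2) * softMax P * softMax P := by
    rw [← Real.rpow_add_one (by linarith), ← Real.rpow_add_one (by linarith)]
    ring_nf
  rw [e]
  calc softMaxDeriv P * (softMax P ^ (γ - 2) * (γ * (softMax P - 1) + 1)) * softMax P
      ≤ 1 * (softMax P ^ (γ - 2) * (γ * (softMax P - 1) + 1)) * softMax P := by gcongr
    _ ≤ 1 * (softMax P ^ (γ - 2) * ((γ + 1) * softMax P)) * softMax P := by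
        gcongr
        nlinarith
    _ = _ := by ring

/-- The weight must vanish for `P ≤ 3/2`, hence the subtraction of `Q^(γ-1)`. What is lost is
recovered from `Φ'(P) P`, which contains at least `Q' Q^(γ-1)` because `P ≥ Q`; the sum therefore
controls `Q'² Q^γ`. -/
theorem le_powerWeight_add (hγ : 0 ≤ γ) {P : ℝ} (hP : 3 / 2 ≤ P) :
    softMaxDeriv P ^ 2 * softMax P ^ γ ≤ powerWeight γ P + deriv (powerWeight γ) P * P := by
  rw [deriv_powerWeight, powerWeight]
  have h1 := one_le_softMax P
  have h6 := softMax_le (by linarith : 1 ≤ P)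
  have h2 : 0 ≤ softMax P - 1 := by linarith
  have h3 := softMaxDeriv_nonneg P
  have h5 := softMaxDeriv_le_one P
  have h4 := Real.rpow_nonneg (by linarith : 0 ≤ softMax P) (γ - 2)
  have e1 : softMax P ^ (γ - 1) = softMax P ^ (γ - 2) * softMax P := by
    rw [← Real.rpow_add_one (by linarith)]
    ring_nf
  have e : softMax P ^ γ = softMax P ^ (γ - 2) * softMax P * softMax P := by
    rw [← Real.rpow_add_one (by linarith), ← Real.rpow_add_one (by linarith)]
    ring_nf
  rw [e, e1]
  generalize softMax P ^ (γ - 2) = w at *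
  generalize softMax P = Q at *
  generalize softMaxDeriv P = d at *
  have a1 : d * (w * 1) * Q ≤ d * (w * (γ * (Q - 1) + 1)) * P := by
    gcongr
    nlinarith
  have a2 : d ^ 2 * (w * Q * Q) ≤ d * (w * Q * Q) := by
    have h7 : d ^ 2 ≤ d := by nlinarith
    exact mul_le_mul_of_nonneg_right h7 (by positivity)
  have a3 : d * (w * Q * (Q - 1)) ≤ w * Q * (Q - 1) :=
    mul_le_of_le_one_left (by positivity) h5
  linarith

end MoserAuxiliary

/-! ### Energy estimates for powers of `softMax |V|`. -/

section MoserStep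

open Filter Topology

variable {n N : ℕ}

theorem le_add_rpow_truncate {θ t l : ℝ} (hθ : 1 ≤ θ) (ht : 0 ≤ t) (hl : 0 < l) :
    t ≤ l + l ^ (1 - θ) * t ^ θ := by
  by_cases h : t ≤ l
  · have : 0 ≤ l ^ (1 - θ) * t ^ θ := by positivity
    linarith
  · rw [not_le] at h
    have ht0 : 0 < t := hl.trans h
    have h1 : t ^ (1 - θ) ≤ l ^ (1 - θ) :=
      Real.rpow_le_rpow_of_nonpos hl h.le (by linarith)
    have h2 : t = t ^ (1 - θ) * t ^ θ := by
      rw [← Real.rpow_add ht0]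
      simp
    have h3 : t ^ (1 - θ) * t ^ θ ≤ l ^ (1 - θ) * t ^ θ := by gcongr
    linarith

/-- Split `κ` at level `l`. The small part costs `l ‖w‖₂`; the large part lies below `l^(1-θ) κ^θ`
with `θ = s/s₀`, and `κ^θ` belongs to `L^{s₀}`, so Hölder with `s₀` and `q` applies. When `s > s₀`
the second coefficient becomes small as `l` grows, so the `L^q` term can be absorbed. -/
theorem eLpNorm_mul_le_truncate {α : Type*} [MeasurableSpace α] {μ : Measure α} {s s₀ q : ℝ}
    (hs₀ : 0 < s₀) (hs : s₀ ≤ s) (hq : 0 < q) (hexp : s₀⁻¹ + q⁻¹ = 2⁻¹) {κ w : α → ℝ}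
    (hκ : AEStronglyMeasurable κ μ) (hw : AEStronglyMeasurable w μ) {l K : ℝ} (hl : 0 < l)
    (hK0 : 0 ≤ K) (hK : eLpNorm κ (ENNReal.ofReal s) μ ≤ ENNReal.ofReal K) :
    eLpNorm (fun x => κ x * w x) 2 μ ≤ ENNReal.ofReal l * eLpNorm w 2 μ +
      ENNReal.ofReal (l ^ (1 - s / s₀) * K ^ (s / s₀)) * eLpNorm w (ENNReal.ofReal q) μ := by
  set θ := s / s₀ with hθ_def
  have hθ : 1 ≤ θ := (one_le_div hs₀).2 hs
  have hθ0 : 0 < θ := by linarith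
  have hm : AEStronglyMeasurable (fun x => ‖κ x‖ ^ θ) μ :=
    (hκ.norm.aemeasurable.pow_const θ).aestronglyMeasurable
  haveI : ENNReal.HolderTriple (ENNReal.ofReal s₀) (ENNReal.ofReal q) 2 := by
    refine ⟨?_⟩
    rw [← ENNReal.ofReal_inv_of_pos hs₀, ← ENNReal.ofReal_inv_of_pos hq,
      ← ENNReal.ofReal_add (by positivity) (by positivity), hexp,
      ENNReal.ofReal_inv_of_pos (by norm_num), ENNReal.ofReal_ofNat]
  have h1 : eLpNorm (fun x => l * ‖w x‖) 2 μ = ENNReal.ofReal l * eLpNorm w 2 μ := by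
    have := eLpNorm_const_smul (μ := μ) l (fun x => ‖w x‖) 2
    rw [eLpNorm_norm] at this
    rw [← Real.enorm_of_nonneg hl.le]
    exact this
  have h2 : eLpNorm (fun x => ‖κ x‖ ^ θ • w x) 2 μ
      ≤ ENNReal.ofReal (K ^ θ) * eLpNorm w (ENNReal.ofReal q) μ := by
    refine (eLpNorm_smul_le_mul_eLpNorm (p := ENNReal.ofReal s₀) (q := ENNReal.ofReal q)
      hw hm).trans (mul_le_mul_left ?_ _)
    rw [eLpNorm_norm_rpow _ hθ0, ← ENNReal.ofReal_mul hs₀.le, hθ_def, mul_div_cancel₀ _ hs₀.ne',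
      ← ENNReal.ofReal_rpow_of_nonneg hK0 (by positivity)]
    exact ENNReal.rpow_le_rpow hK (by positivity)
  have h3 : eLpNorm (fun x => l ^ (1 - θ) * ‖‖κ x‖ ^ θ • w x‖) 2 μ
      ≤ ENNReal.ofReal (l ^ (1 - θ) * K ^ θ) * eLpNorm w (ENNReal.ofReal q) μ := by
    have := eLpNorm_const_smul (μ := μ) (l ^ (1 - θ)) (fun x => ‖‖κ x‖ ^ θ • w x‖) 2
    rw [eLpNorm_norm, Real.enorm_of_nonneg (by positivity)] at this
    refine this.le.trans ?_
    rw [ENNReal.ofReal_mul (by positivity), mul_assoc]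
    exact mul_le_mul_right h2 _
  refine (eLpNorm_mono_real (g := fun x => l * ‖w x‖ + l ^ (1 - θ) * ‖‖κ x‖ ^ θ • w x‖)
    fun x => ?_).trans ((eLpNorm_add_le (hw.norm.const_mul _) ((hm.smul hw).norm.const_mul _)
      (by norm_num)).trans (add_le_add h1.le h3))
  rw [norm_mul, norm_smul, Real.norm_of_nonneg (by positivity : 0 ≤ ‖κ x‖ ^ θ), ← mul_assoc,
    ← add_mul]
  exact mul_le_mul_of_nonneg_right (le_add_rpow_truncate hθ (norm_nonneg _) hl) (norm_nonneg _)

theorem softMax_rpow_pos (P a : ℝ) : 0 < softMax P ^ a :=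
  Real.rpow_pos_of_pos (by linarith [one_le_softMax P]) a

theorem growthWeight_powerWeight_le {p γ P : ℝ} (hp : 0 ≤ p) (hγ : 0 ≤ γ) (hP : 0 ≤ P) :
    growthWeight p (powerWeight γ) P ≤ (γ + 2) * (5 / 2) ^ (p + 1) * softMax P ^ (p + γ) := by
  have hQ := one_le_softMax P
  have hQ0 : 0 < softMax P := by linarith
  have h1 : P ^ p ≤ (5 / 2) ^ (p + 1) * softMax P ^ p := by
    calc P ^ p ≤ (5 / 2 * softMax P) ^ p := Real.rpow_le_rpow hP (le_softMax P) hp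
      _ = (5 / 2) ^ p * softMax P ^ p := Real.mul_rpow (by norm_num) hQ0.le
      _ ≤ _ := by
        gcongr
        · norm_num
        · linarith
  have h2 : P ^ (p + 1) ≤ (5 / 2) ^ (p + 1) * softMax P ^ (p + 1) := by
    rw [← Real.mul_rpow (by norm_num) hQ0.le]
    exact Real.rpow_le_rpow hP (le_softMax P) (by linarith)
  have h3 := deriv_powerWeight_mul_le hγ P
  have h4 := deriv_powerWeight_nonneg hγ P
  have h5 := powerWeight_nonneg γ P
  have h6 := powerWeight_le γ P
  rw [growthWeight, Real.rpow_add hQ0]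
  have e : softMax P ^ (p + 1) = softMax P ^ p * softMax P := Real.rpow_add_one hQ0.ne' p
  rw [e] at h2
  have a0 := softMax_rpow_pos P p
  have a1 : powerWeight γ P * P ^ p ≤ softMax P ^ γ * ((5 / 2) ^ (p + 1) * softMax P ^ p) := by
    gcongr
  have a2 : deriv (powerWeight γ) P * P ^ (p + 1) ≤
      (γ + 1) * softMax P ^ γ * ((5 / 2) ^ (p + 1) * softMax P ^ p) := by
    calc deriv (powerWeight γ) P * P ^ (p + 1)
        ≤ deriv (powerWeight γ) P * ((5 / 2) ^ (p + 1) * (softMax P ^ p * softMax P)) := by gcongr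
      _ = deriv (powerWeight γ) P * softMax P * ((5 / 2) ^ (p + 1) * softMax P ^ p) := by ring
      _ ≤ _ := by gcongr
  linarith

/-- With `2a = p + γ`, the energy density controls the squared gradient of `softMax(|V|)^a` up to
the factor `a²`. Besides the bound on the weight, only `|z|/|V| ≤ |D|` and `softMax ≤ |V|` are used.
-/
theorem le_energyDensity_powerWeight {p γ : ℝ} (hp : 2 ≤ p) (hγ : 0 ≤ γ) (V : Mat n N)
    (D : Tens n N) :
    (softMaxDeriv ‖V‖ * softMax ‖V‖ ^ ((p + γ) / 2 - 1)) ^ 2 * (‖radialPart V D‖ / ‖V‖) ^ 2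
      ≤ energyDensity p (powerWeight γ) V D := by
  have h0 := powerWeight_nonneg γ ‖V‖
  have h1 := deriv_powerWeight_nonneg hγ ‖V‖
  by_cases hV : ‖V‖ ≤ 3 / 2
  · rw [softMaxDeriv_of_le hV, energyDensity]
    have : 0 ≤ powerWeight γ ‖V‖ * ‖V‖ ^ (p - 2) * ‖D‖ ^ 2
      + deriv (powerWeight γ) ‖V‖ * ‖V‖ ^ (p - 1) * (‖radialPart V D‖ / ‖V‖) ^ 2 := by positivity
    simpa using this
  · rw [not_le] at hV
    have hV0 : 0 < ‖V‖ := by linarith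
    have hQ := one_le_softMax ‖V‖
    have hQ0 : 0 < softMax ‖V‖ := by linarith
    have hz : ‖radialPart V D‖ / ‖V‖ ≤ ‖D‖ := by
      rw [div_le_iff₀ hV0, mul_comm]
      exact norm_radialPart_le V D
    have hPp : ‖V‖ ^ (p - 1) = ‖V‖ ^ (p - 2) * ‖V‖ := by
      rw [← Real.rpow_add_one hV0.ne']
      ring_nf
    have e : (softMax ‖V‖ ^ ((p + γ) / 2 - 1)) ^ 2 = softMax ‖V‖ ^ (p - 2) * softMax ‖V‖ ^ γ := by
      rw [← Real.rpow_natCast, ← Real.rpow_mul hQ0.le, ← Real.rpow_add hQ0]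
      congr 1
      push_cast
      ring
    have h2 := le_powerWeight_add hγ hV.le
    have h3 : softMax ‖V‖ ^ (p - 2) ≤ ‖V‖ ^ (p - 2) :=
      Real.rpow_le_rpow hQ0.le (softMax_le (by linarith)) (by linarith)
    rw [energyDensity, hPp, mul_pow, e]
    calc softMaxDeriv ‖V‖ ^ 2 * (softMax ‖V‖ ^ (p - 2) * softMax ‖V‖ ^ γ)
          * (‖radialPart V D‖ / ‖V‖) ^ 2
        = softMax ‖V‖ ^ (p - 2) * (softMaxDeriv ‖V‖ ^ 2 * softMax ‖V‖ ^ γ)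
          * (‖radialPart V D‖ / ‖V‖) ^ 2 := by ring
      _ ≤ ‖V‖ ^ (p - 2) * (powerWeight γ ‖V‖ + deriv (powerWeight γ) ‖V‖ * ‖V‖)
          * (‖radialPart V D‖ / ‖V‖) ^ 2 := by
        have := softMax_rpow_pos ‖V‖ γ
        gcongr
      _ = powerWeight γ ‖V‖ * ‖V‖ ^ (p - 2) * (‖radialPart V D‖ / ‖V‖) ^ 2
          + deriv (powerWeight γ) ‖V‖ * (‖V‖ ^ (p - 2) * ‖V‖) * (‖radialPart V D‖ / ‖V‖) ^ 2 := by
        ring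
      _ ≤ _ := by gcongr

/-- The constant in the energy estimate for powers of `softMax |V|`. -/
noncomputable def powerEnergyConst (n : ℕ) (p ν L₁ : ℝ) : ℝ :=
  8 * caccioppoliConst n ν L₁ / ν * (5 / 2) ^ (p + 1) + 2

theorem caccioppoliConst_nonneg (n : ℕ) {ν : ℝ} (hν : 0 < ν) (L : ℝ) :
    0 ≤ caccioppoliConst n ν L := by
  unfold caccioppoliConst
  positivity

/-- Caccioppoli with `γ = 2a - p`. The factor `a³` collects `a²` from differentiating the power and
`a` from the growth weight. -/
theorem RegularSolution.eLpNorm_deriv_power_le {Ω : Set (Vec n)} {p L L₁ ν s : ℝ} {k : Vec n → ℝ}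
    {F : Vec n → Mat n N → ℝ} {f : Vec n → Vec N} {V : Vec n → Mat n N} {D2 : Vec n → Tens n N}
    (hS : RegularSolution Ω p L L₁ ν s k F f V D2) {x₀ : Vec n} {R : ℝ} (hR : 0 ≤ R)
    (hRΩ : Metric.closedBall x₀ R ⊆ Ω) {η : Vec n → ℝ} (hη : ContDiff ℝ ∞ η)
    (hηn : ∀ x, 0 ≤ η x) (hηs : tsupport η ⊆ Metric.closedBall x₀ R) {a : ℝ} (ha : p ≤ 2 * a) :
    Integrable (fun x => (‖gradVec η x‖ ^ 2 + dataFun p k f x ^ 2 * η x ^ 2)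
        * softMax ‖V x‖ ^ (2 * a)) (volume.restrict (Metric.closedBall x₀ R)) ∧
    MemLp (fun x => η x • softMax ‖V x‖ ^ a) 2 volume ∧
    ∃ G : Fin n → Vec n → ℝ, (∀ i, MemLp (G i) 2 volume) ∧
      (∀ i, HasWeakDeriv univ (EuclideanSpace.single i 1)
        (fun x => η x • softMax ‖V x‖ ^ a) (G i)) ∧
      ∀ i, eLpNorm (G i) 2 volume ^ 2 ≤ ENNReal.ofReal (powerEnergyConst n p ν L₁ * a ^ 3 *
        ∫ x in Metric.closedBall x₀ R, (‖gradVec η x‖ ^ 2 + dataFun p k f x ^ 2 * η x ^ 2)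
          * softMax ‖V x‖ ^ (2 * a)) := by
  set B := Metric.closedBall x₀ R with hB_def
  have hp := hS.two_le_p
  have hν := hS.ν_pos
  have ha1 : 1 ≤ a := by linarith
  have hBc : IsCompact B := isCompact_closedBall _ _
  have hBm : MeasurableSet B := measurableSet_closedBall
  haveI : IsFiniteMeasure (volume.restrict B : Measure (Vec n)) :=
    ⟨by simpa using hBc.measure_lt_top⟩
  set γ := 2 * a - p with hγ_def
  have hγ : 0 ≤ γ := by linarith
  have hpγ : p + γ = 2 * a := by rw [hγ_def]; ring
  have hΨ : ContDiff ℝ 1 (fun ξ : Mat n N => softMax ‖ξ‖ ^ a) :=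
    contDiff_comp_norm (contDiff_softMax_rpow a) (r := 3 / 2) (c := 1) (by norm_num)
      fun t ht => by rw [softMax_of_le ht, Real.one_rpow]
  have hΨd : ∀ ξ y : Mat n N, fderiv ℝ (fun ξ : Mat n N => softMax ‖ξ‖ ^ a) ξ y
      = softMaxDeriv ‖ξ‖ * a * softMax ‖ξ‖ ^ (a - 1) / ‖ξ‖ * inner ℝ ξ y := by
    intro ξ y
    have h1 := (hasFDerivAt_comp_norm (contDiff_softMax_rpow a) (r := 3 / 2) (c := 1) (by norm_num)
      (fun t ht => by rw [softMax_of_le ht, Real.one_rpow]) ξ).fderiv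
    rw [h1, (hasDerivAt_softMax_rpow a ‖ξ‖).deriv]
    simp
  obtain ⟨hw2, hG⟩ := hS.weakGrad.hasWeakDeriv_smul_comp hS.isOpen hS.bounded hS.sq_integrable
    hR hRΩ hΨ hη hηs
  -- `δ = 1/2` matches the level `3/2` below which `softMax` is constant.
  obtain ⟨c1, c2, c3⟩ := hS.caccioppoli hR hRΩ (δ := 1 / 2) (by norm_num) (by norm_num)
    (contDiff_powerWeight γ) (fun t ht => powerWeight_of_le (by linarith)) (powerWeight_nonneg γ)
    (deriv_powerWeight_nonneg hγ) hη hηn hηs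
  -- integrability
  obtain ⟨M, hM1, hM⟩ := hS.bounded.exists_bound hBc hRΩ
  have hVm : AEMeasurable V (volume.restrict B) := (hS.bounded B hBc hRΩ).1.aemeasurable
  have hs2 : 2 ≤ s := by
    have h1 : (2 : ℝ) ≤ n := by exact_mod_cast hS.two_le_dim
    linarith [hS.dim_lt]
  have hκ2 : MemLp (dataFun p k f) 2 (volume.restrict B) :=
    ((hS.conditions.k_mem.two hs2 hBc hRΩ).const_mul _).add
      ((hS.f_mem.two hs2 hBc hRΩ).norm.add (memLp_const 2))
  have hηc : HasCompactSupport η := hBc.of_isClosed_subset (isClosed_tsupport _) hηs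
  have hyc := continuous_gradVec hη
  have hint : ∀ {g : Vec n → ℝ}, Integrable g (volume.restrict B) →
      Integrable (fun x => g x * softMax ‖V x‖ ^ (2 * a)) (volume.restrict B) := by
    intro g hg
    refine hg.mul_bdd (c := max 1 M ^ (2 * a)) ((contDiff_softMax_rpow
      (2 * a)).continuous.measurable.comp_aemeasurable hVm.norm).aestronglyMeasurable ?_
    filter_upwards [hM] with x hx
    rw [Real.norm_of_nonneg (softMax_rpow_pos _ _).le]
    exact Real.rpow_le_rpow (by linarith [one_le_softMax ‖V x‖])
      ((softMax_le_max _).trans (max_le_max_left _ hx)) (by linarith)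
  have i1 : Integrable (fun x => ‖gradVec η x‖ ^ 2) (volume.restrict B) :=
    (hyc.norm.pow 2).continuousOn.integrableOn_compact hBc
  have i2 : Integrable (fun x => dataFun p k f x ^ 2 * η x ^ 2) (volume.restrict B) := by
    obtain ⟨Cη, hCη⟩ := hηc.exists_bound_of_continuous hη.continuous
    refine (hκ2.integrable_sq).mul_bdd (c := Cη ^ 2)
      (hη.continuous.pow 2).aestronglyMeasurable (Eventually.of_forall fun x => ?_)
    rw [norm_pow]
    exact pow_le_pow_left₀ (norm_nonneg _) (hCη x) 2
  have i3 := hint (i1.add i2)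
  refine ⟨i3, hw2, _, fun i => (hG i).1, fun i => (hG i).2, fun i => ?_⟩
  set H : Vec n → ℝ := fun x => 2 * a ^ 2 * (η x ^ 2 * energyDensity p (powerWeight γ) (V x) (D2 x))
    + 2 * (‖gradVec η x‖ ^ 2 * softMax ‖V x‖ ^ (2 * a)) with hH_def
  have hHi : Integrable H (volume.restrict B) := (c1.const_mul _).add ((hint i1).const_mul 2)
  have hE0 : ∀ x, 0 ≤ energyDensity p (powerWeight γ) (V x) (D2 x) := fun x =>
    le_trans (by positivity) (le_energyDensity_powerWeight hp hγ (V x) (D2 x))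
  have hH0 : ∀ x, 0 ≤ H x := fun x => by
    have := hE0 x
    have := softMax_rpow_pos ‖V x‖ (2 * a)
    rw [hH_def]
    positivity
  set g : Vec n → ℝ := fun x => η x • fderiv ℝ (fun ξ : Mat n N => softMax ‖ξ‖ ^ a) (V x)
    (column i (D2 x)) + fderiv ℝ η x (EuclideanSpace.single i 1) • softMax ‖V x‖ ^ a with hg_def
  have hgH : ∀ x, ‖g x‖ₑ ^ 2 ≤ indicator B (fun x => ENNReal.ofReal (H x)) x := by
    intro x
    by_cases hx : x ∈ B
    · rw [indicator_of_mem hx, ← ofReal_norm, ← ENNReal.ofReal_pow (norm_nonneg _)]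
      refine ENNReal.ofReal_le_ofReal ?_
      rw [Real.norm_eq_abs, sq_abs, hg_def]
      beta_reduce
      rw [hΨd, smul_eq_mul, smul_eq_mul]
      have h1 : (η x * (softMaxDeriv ‖V x‖ * a * softMax ‖V x‖ ^ (a - 1) / ‖V x‖ *
          inner ℝ (V x) (column i (D2 x)))) ^ 2
          ≤ a ^ 2 * (η x ^ 2 * energyDensity p (powerWeight γ) (V x) (D2 x)) := by
        have h2 := le_energyDensity_powerWeight hp hγ (V x) (D2 x)
        have h3 : (p + γ) / 2 - 1 = a - 1 := by rw [hpγ]; ring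
        rw [h3] at h2
        have h4 : (inner ℝ (V x) (column i (D2 x)) : ℝ) ^ 2 ≤ ‖radialPart (V x) (D2 x)‖ ^ 2 := by
          rw [← radialPart_apply, ← sq_abs]
          exact pow_le_pow_left₀ (abs_nonneg _) (PiLp.norm_apply_le (radialPart (V x) (D2 x)) i) 2
        calc (η x * (softMaxDeriv ‖V x‖ * a * softMax ‖V x‖ ^ (a - 1) / ‖V x‖ *
          inner ℝ (V x) (column i (D2 x)))) ^ 2
            = a ^ 2 * (η x ^ 2 * ((softMaxDeriv ‖V x‖ * softMax ‖V x‖ ^ (a - 1)) ^ 2 *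
              ((inner ℝ (V x) (column i (D2 x)) : ℝ) ^ 2 / ‖V x‖ ^ 2))) := by ring
          _ ≤ a ^ 2 * (η x ^ 2 * ((softMaxDeriv ‖V x‖ * softMax ‖V x‖ ^ (a - 1)) ^ 2 *
              (‖radialPart (V x) (D2 x)‖ ^ 2 / ‖V x‖ ^ 2))) := by gcongr
          _ ≤ _ := by
              rw [← div_pow]
              gcongr
      have h5 : (fderiv ℝ η x (EuclideanSpace.single i 1) * softMax ‖V x‖ ^ a) ^ 2
          ≤ ‖gradVec η x‖ ^ 2 * softMax ‖V x‖ ^ (2 * a) := by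
        have h6 : (softMax ‖V x‖ ^ a) ^ 2 = softMax ‖V x‖ ^ (2 * a) := by
          rw [← Real.rpow_natCast, ← Real.rpow_mul (by linarith [one_le_softMax ‖V x‖]), mul_comm]
          norm_num
        rw [mul_pow, h6]
        refine mul_le_mul_of_nonneg_right ?_ (softMax_rpow_pos _ _).le
        rw [← sq_abs]
        exact pow_le_pow_left₀ (abs_nonneg _) (PiLp.norm_apply_le (gradVec η x) i) 2
      have h7 := add_sq_le (a := η x * (softMaxDeriv ‖V x‖ * a * softMax ‖V x‖ ^ (a - 1) / ‖V x‖ *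
          inner ℝ (V x) (column i (D2 x))))
        (b := fderiv ℝ η x (EuclideanSpace.single i 1) * softMax ‖V x‖ ^ a)
      rw [hH_def]
      beta_reduce
      linarith
    · have h1 : η x = 0 := image_eq_zero_of_notMem_tsupport fun h => hx (hηs h)
      have h2 : fderiv ℝ η x (EuclideanSpace.single i 1) = 0 :=
        image_eq_zero_of_notMem_tsupport (f := fun y => fderiv ℝ η y (EuclideanSpace.single i 1))
          fun h => hx (hηs (HasCompactSupport.fderiv_apply_tsupport_subset _ h))
      rw [hg_def]
      simp [h1, h2]
  rw [eLpNorm_two_sq]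
  refine (lintegral_mono hgH).trans ?_
  rw [lintegral_indicator hBm, ← ofReal_integral_eq_lintegral_ofReal hHi
    (Eventually.of_forall hH0)]
  refine ENNReal.ofReal_le_ofReal ?_
  have hI1 : ∫ x in B, (‖gradVec η x‖ ^ 2 + dataFun p k f x ^ 2 * η x ^ 2)
        * growthWeight p (powerWeight γ) ‖V x‖ ≤ (2 * a * (5 / 2) ^ (p + 1)) *
      ∫ x in B, (‖gradVec η x‖ ^ 2 + dataFun p k f x ^ 2 * η x ^ 2) * softMax ‖V x‖ ^ (2 * a) := by
    rw [← integral_const_mul]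
    refine integral_mono c2 (i3.const_mul _) fun x => ?_
    have h1 := growthWeight_powerWeight_le (by linarith : 0 ≤ p) hγ (norm_nonneg (V x))
    rw [hpγ] at h1
    -- `γ + 2 ≤ 2a` because `p ≥ 2`.
    have h2 : (γ + 2) * (5 / 2 : ℝ) ^ (p + 1) * softMax ‖V x‖ ^ (2 * a) ≤
        (2 * a) * (5 / 2) ^ (p + 1) * softMax ‖V x‖ ^ (2 * a) := by
      have := (softMax_rpow_pos ‖V x‖ (2 * a)).le
      gcongr
      linarith
    have h3 := mul_le_mul_of_nonneg_left (h1.trans h2)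
      (show 0 ≤ ‖gradVec η x‖ ^ 2 + dataFun p k f x ^ 2 * η x ^ 2 by positivity)
    linarith
  have hI2 : ∫ x in B, ‖gradVec η x‖ ^ 2 * softMax ‖V x‖ ^ (2 * a) ≤
      ∫ x in B, (‖gradVec η x‖ ^ 2 + dataFun p k f x ^ 2 * η x ^ 2) * softMax ‖V x‖ ^ (2 * a) := by
    refine integral_mono (hint i1) i3 fun x => ?_
    refine mul_le_mul_of_nonneg_right ?_ (softMax_rpow_pos _ _).le
    nlinarith [sq_nonneg (dataFun p k f x * η x)]
  set I := ∫ x in B, (‖gradVec η x‖ ^ 2 + dataFun p k f x ^ 2 * η x ^ 2) * softMax ‖V x‖ ^ (2 * a)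
  have hI0 : 0 ≤ I := integral_nonneg fun x =>
    mul_nonneg (by positivity) (softMax_rpow_pos _ _).le
  have hC0 := caccioppoliConst_nonneg n hν L₁
  rw [hH_def, integral_add (c1.const_mul _) ((hint i1).const_mul 2), integral_const_mul,
    integral_const_mul]
  set E := ∫ x in B, η x ^ 2 * energyDensity p (powerWeight γ) (V x) (D2 x)
  have hE : E ≤ 4 * caccioppoliConst n ν L₁ / ν * (5 / 2) ^ (p + 1) * a * I := by
    have h1 := c3.trans (mul_le_mul_of_nonneg_left hI1 hC0)
    have h2 : E = 2 / ν * (ν / 2 * E) := by field_simp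
    rw [h2]
    refine (mul_le_mul_of_nonneg_left h1 (by positivity)).trans (le_of_eq ?_)
    field_simp
    ring
  have ha3 : (1 : ℝ) ≤ a ^ 3 := one_le_pow₀ ha1
  calc 2 * a ^ 2 * E + 2 * ∫ x in B, ‖gradVec η x‖ ^ 2 * softMax ‖V x‖ ^ (2 * a)
      ≤ 2 * a ^ 2 * (4 * caccioppoliConst n ν L₁ / ν * (5 / 2) ^ (p + 1) * a * I) + 2 * I := by
        gcongr
    _ ≤ 2 * a ^ 2 * (4 * caccioppoliConst n ν L₁ / ν * (5 / 2) ^ (p + 1) * a * I)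
        + 2 * (a ^ 3 * I) := by
        gcongr
        exact le_mul_of_one_le_left hI0 ha3
    _ = _ := by
        rw [powerEnergyConst]
        ring

end MoserStep

/-! ### Absorption of the data and one step of the iteration. -/

section MoserIteration

open Filter Topology

variable {n N : ℕ}

/-- The truncation level is chosen so large that the `x`-term hidden in `y` uses exactly half of the
left side; the level itself then reappears as a power of `DK^(2θ)` in front of `z²`. -/
theorem sq_le_of_absorb {x y z D Λ K θ : ℝ} (hy : 0 ≤ y) (hD : 1 ≤ D)
    (hK : 1 ≤ K) (hθ : 1 < θ) (hxy : x ^ 2 ≤ D * (Λ ^ 2 * z ^ 2 + y ^ 2))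
    (hyl : ∀ l : ℝ, 0 < l → y ≤ l * z + l ^ (1 - θ) * K ^ θ * x) :
    x ^ 2 ≤ (4 * D * K ^ (2 * θ)) ^ (θ / (θ - 1)) * (1 + Λ ^ 2) * z ^ 2 := by
  have hθ1 : 0 < θ - 1 := by linarith
  have hK0 : 0 < K := by linarith
  have hKθ : 1 ≤ K ^ (2 * θ) := Real.one_le_rpow hK (by linarith)
  set M := 4 * D * K ^ (2 * θ) with hM
  have hDM : 4 * D ≤ M := le_mul_of_one_le_right (by linarith) hKθ
  have hM1 : 1 ≤ M := by linarith
  have hM0 : 0 < M := by linarith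
  -- The solution of `4D (l^(1-θ) K^θ)² = 1`.
  set l := M ^ (1 / (2 * (θ - 1))) with hl
  have hl0 : 0 < l := Real.rpow_pos_of_pos hM0 _
  have hl1 : 1 ≤ l := Real.one_le_rpow hM1 (by positivity)
  set c := l ^ (1 - θ) * K ^ θ with hc
  have hc2 : 4 * D * c ^ 2 = 1 := by
    have h1 : (l ^ (1 - θ)) ^ 2 = M⁻¹ := by
      rw [hl, ← Real.rpow_mul hM0.le, ← Real.rpow_natCast, ← Real.rpow_mul hM0.le,
        ← Real.rpow_neg_one]
      congr 1
      push_cast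
      field_simp
      ring
    have h2 : (K ^ θ) ^ 2 = K ^ (2 * θ) := by
      rw [← Real.rpow_natCast, ← Real.rpow_mul hK0.le, mul_comm]
      norm_num
    rw [hc, mul_pow, h1, h2]
    field_simp
    rw [hM]
  have hl2 : M * l ^ 2 = M ^ (θ / (θ - 1)) := by
    have h1 : l ^ 2 = M ^ (1 / (θ - 1)) := by
      rw [hl, ← Real.rpow_natCast, ← Real.rpow_mul hM0.le]
      congr 1
      push_cast
      field_simp
    have h2 : θ / (θ - 1) = 1 + 1 / (θ - 1) := by field_simp; ring
    rw [h1, h2, Real.rpow_add hM0, Real.rpow_one]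
  have hy2 : y ^ 2 ≤ 2 * (l ^ 2 * z ^ 2) + 2 * (c ^ 2 * x ^ 2) := by
    have h1 := pow_le_pow_left₀ hy (hyl l hl0) 2
    have h2 := add_sq_le (a := l * z) (b := c * x)
    rw [mul_pow, mul_pow] at h2
    linarith
  have h3 : D * y ^ 2 ≤ D * (2 * (l ^ 2 * z ^ 2) + 2 * (c ^ 2 * x ^ 2)) := by gcongr
  have h4 : D * (2 * (c ^ 2 * x ^ 2)) = x ^ 2 / 2 := by linear_combination (x ^ 2 / 2) * hc2
  have h5 : x ^ 2 ≤ 2 * D * Λ ^ 2 * z ^ 2 + 4 * D * l ^ 2 * z ^ 2 := by linarith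
  have h6 : 2 * D * Λ ^ 2 * z ^ 2 ≤ M * l ^ 2 * Λ ^ 2 * z ^ 2 := by
    have : 2 * D ≤ M * l ^ 2 := by
      have := le_mul_of_one_le_right hM0.le (one_le_pow₀ hl1 (n := 2))
      linarith
    gcongr
  have h7 : 4 * D * l ^ 2 * z ^ 2 ≤ M * l ^ 2 * z ^ 2 := by gcongr
  rw [← hl2]
  linarith

theorem ofReal_integral_rpow_eq {α : Type*} [MeasurableSpace α] {μ : Measure α} {g : α → ℝ}
    (hg : ∀ x, 0 ≤ g x) {β : ℝ} (hβ : 0 < β) (hi : Integrable (fun x => g x ^ β) μ) :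
    ENNReal.ofReal (∫ x, g x ^ β ∂μ) = eLpNorm g (ENNReal.ofReal β) μ ^ β := by
  rw [ofReal_integral_eq_lintegral_ofReal hi
    (Eventually.of_forall fun x => Real.rpow_nonneg (hg x) _),
    eLpNorm_eq_lintegral_rpow_enorm_toReal (by simpa using hβ) ENNReal.ofReal_ne_top,
    ENNReal.toReal_ofReal hβ.le, ← ENNReal.rpow_mul, one_div_mul_cancel hβ.ne', ENNReal.rpow_one]
  refine lintegral_congr fun x => ?_
  rw [Real.enorm_of_nonneg (hg x), ENNReal.ofReal_rpow_of_nonneg (hg x) hβ.le]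

theorem eLpNorm_rpow_eq {α : Type*} [MeasurableSpace α] {μ : Measure α} {g : α → ℝ}
    (hg : ∀ x, 0 ≤ g x) {a q : ℝ} (ha : 0 < a) (hq : 0 < q) :
    eLpNorm (fun x => g x ^ a) (ENNReal.ofReal q) μ
      = eLpNorm g (ENNReal.ofReal (a * q)) μ ^ a := by
  have h := eLpNorm_norm_rpow (μ := μ) (p := ENNReal.ofReal q) g ha
  rw [← ENNReal.ofReal_mul hq.le, mul_comm q a] at h
  rw [← h]
  congr 1
  ext x
  rw [Real.norm_of_nonneg (hg x)]

theorem RegularSolution.aestronglyMeasurable_softMax {Ω : Set (Vec n)} {p L L₁ ν s : ℝ}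
    {k : Vec n → ℝ} {F : Vec n → Mat n N → ℝ} {f : Vec n → Vec N} {V : Vec n → Mat n N}
    {D2 : Vec n → Tens n N} (hS : RegularSolution Ω p L L₁ ν s k F f V D2) {B : Set (Vec n)}
    (hB : IsCompact B) (hBΩ : B ⊆ Ω) :
    AEStronglyMeasurable (fun x => softMax ‖V x‖) (volume.restrict B) :=
  contDiff_softMax.continuous.comp_aestronglyMeasurable (hS.bounded B hB hBΩ).1.norm

theorem RegularSolution.integrable_softMax_rpow {Ω : Set (Vec n)} {p L L₁ ν s : ℝ}
    {k : Vec n → ℝ} {F : Vec n → Mat n N → ℝ} {f : Vec n → Vec N} {V : Vec n → Mat n N}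
    {D2 : Vec n → Tens n N} (hS : RegularSolution Ω p L L₁ ν s k F f V D2) {B : Set (Vec n)}
    (hB : IsCompact B) (hBΩ : B ⊆ Ω) {β : ℝ} (hβ : 0 ≤ β) :
    Integrable (fun x => softMax ‖V x‖ ^ β) (volume.restrict B) := by
  haveI : IsFiniteMeasure (volume.restrict B : Measure (Vec n)) :=
    ⟨by simpa using hB.measure_lt_top⟩
  obtain ⟨M, hM1, hM⟩ := hS.bounded.exists_bound hB hBΩ
  refine Integrable.of_bound (C := max 1 M ^ β) ((contDiff_softMax_rpow
    β).continuous.comp_aestronglyMeasurable (hS.bounded B hB hBΩ).1.norm) ?_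
  filter_upwards [hM] with x hx
  rw [Real.norm_of_nonneg (softMax_rpow_pos _ _).le]
  exact Real.rpow_le_rpow (by linarith [one_le_softMax ‖V x‖])
    ((softMax_le_max _).trans (max_le_max_left _ hx)) hβ

theorem RegularSolution.memLp_dataFun_two {Ω : Set (Vec n)} {p L L₁ ν s : ℝ}
    {k : Vec n → ℝ} {F : Vec n → Mat n N → ℝ} {f : Vec n → Vec N} {V : Vec n → Mat n N}
    {D2 : Vec n → Tens n N} (hS : RegularSolution Ω p L L₁ ν s k F f V D2) {B : Set (Vec n)}
    (hB : IsCompact B) (hBΩ : B ⊆ Ω) : MemLp (dataFun p k f) 2 (volume.restrict B) := by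
  haveI : IsFiniteMeasure (volume.restrict B : Measure (Vec n)) :=
    ⟨by simpa using hB.measure_lt_top⟩
  have hs2 : 2 ≤ s := by
    have h1 : (2 : ℝ) ≤ n := by exact_mod_cast hS.two_le_dim
    linarith [hS.dim_lt]
  exact ((hS.conditions.k_mem.two hs2 hB hBΩ).const_mul _).add
    ((hS.f_mem.two hs2 hB hBΩ).norm.add (memLp_const 2))

/-- The exponent with which the `L^s`-norm of the data is raised when the data are absorbed. -/
noncomputable def absorbExp (n : ℕ) (s : ℝ) : ℝ := (s / n + 1) / 2

theorem one_lt_absorbExp (hn : 2 ≤ n) {s : ℝ} (hs : (n : ℝ) < s) : 1 < absorbExp n s := by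
  have h0 : (0 : ℝ) < n := by positivity
  have : 1 < s / n := (one_lt_div h0).2 hs
  unfold absorbExp
  linarith

set_option maxHeartbeats 1000000 in
-- A reverse Hölder step from exponent `β` to `βq/2`: Sobolev for `η Q^(β/2)`, the energy estimate
-- for its gradient, and absorption of the data term. The dependence on `β`, on the gap of radii and
-- on the data is explicit and polynomial, and `A` is independent of the solution, so the step can
-- be iterated.
theorem exists_moser_step_const (hn : 2 ≤ n) {s : ℝ} (hs : (n : ℝ) < s) {p ν L₁ : ℝ} (hp : 2 ≤ p)
    (hν : 0 < ν) (R : ℝ) : ∃ A : ℝ, 1 ≤ A ∧ ∀ {N : ℕ} {Ω : Set (Vec n)} {L : ℝ} {k : Vec n → ℝ}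
      {F : Vec n → Mat n N → ℝ} {f : Vec n → Vec N} {V : Vec n → Mat n N} {D2 : Vec n → Tens n N},
      RegularSolution Ω p L L₁ ν s k F f V D2 → ∀ {x₀ : Vec n} {r r' K β : ℝ}, 0 ≤ r → r < r' →
      r' ≤ R → Metric.closedBall x₀ r' ⊆ Ω → 1 ≤ K →
      eLpNorm (dataFun p k f) (ENNReal.ofReal s) (volume.restrict (Metric.closedBall x₀ r'))
        ≤ ENNReal.ofReal K → p ≤ β →
      eLpNorm (fun x => softMax ‖V x‖) (ENNReal.ofReal (β * (sobolevExp n s / 2)))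
          (volume.restrict (Metric.closedBall x₀ r)) ^ β ≤
        ENNReal.ofReal ((A * β ^ 3 * K ^ (2 * absorbExp n s)) ^
          (absorbExp n s / (absorbExp n s - 1)) * (1 + (A / (r' - r)) ^ 2)) *
        eLpNorm (fun x => softMax ‖V x‖) (ENNReal.ofReal β)
          (volume.restrict (Metric.closedBall x₀ r')) ^ β := by
  obtain ⟨Cs, hCs⟩ := exists_sobolev_const hn hs R
  obtain ⟨Cη, hCη0, hCη⟩ := exists_cutoff_gradVec_le n
  have hC0 := caccioppoliConst_nonneg n hν L₁
  have hPE : 0 < powerEnergyConst n p ν L₁ := by unfold powerEnergyConst; positivity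
  -- The squared Sobolev constant, with `n` for the sum over directions, times the energy constant;
  -- the 1 is added to make it at least 1.
  set D₀ : ℝ := (Cs * n) ^ 2 * powerEnergyConst n p ν L₁ + 1 with hD₀
  have hD₀1 : 1 ≤ D₀ := by
    have : 0 ≤ (Cs * n : ℝ) ^ 2 * powerEnergyConst n p ν L₁ := by positivity
    linarith
  set θ := absorbExp n s with hθ_def
  have hθ : 1 < θ := one_lt_absorbExp hn hs
  have hn' : (2 : ℝ) ≤ n := by exact_mod_cast hn
  have hs0 : 0 < s := by linarith
  set q := sobolevExp n s with hq_def
  have hq : 0 < q := sobolevExp_pos hn hs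
  refine ⟨D₀ + Cη, by linarith, ?_⟩
  intro N Ω L k F f V D2 hS x₀ r r' K β hr hrr' hr'R hΩ hK hκ hβ
  obtain ⟨η, hη, hη0, hη1, hηr, hηs, hηg⟩ := hCη x₀ r r' hr hrr'
  set B := Metric.closedBall x₀ r' with hB
  have hBc : IsCompact B := isCompact_closedBall _ _
  have hBm : MeasurableSet B := measurableSet_closedBall
  set a := β / 2 with ha
  have h2a : 2 * a = β := by rw [ha]; ring
  have ha1 : 1 ≤ a := by linarith
  have ha3 : 1 ≤ a ^ 3 := one_le_pow₀ ha1
  set Λ := Cη / (r' - r) with hΛ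
  have hrr0 : 0 < r' - r := by linarith
  have hΛ0 : 0 ≤ Λ := by positivity
  set Q : Vec n → ℝ := fun x => softMax ‖V x‖ with hQ
  have hQ1 : ∀ x, 1 ≤ Q x := fun x => one_le_softMax _
  have hQ0 : ∀ x, 0 ≤ Q x := fun x => zero_le_one.trans (hQ1 x)
  set w : Vec n → ℝ := fun x => η x • Q x ^ a with hw
  obtain ⟨hJi, hw2, G, hG2, hGw, hGJ⟩ :=
    hS.eLpNorm_deriv_power_le (by linarith) hΩ hη hη0 hηs (a := a) (by linarith)
  set J := ∫ x in B, (‖gradVec η x‖ ^ 2 + dataFun p k f x ^ 2 * η x ^ 2)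
    * softMax ‖V x‖ ^ (2 * a) with hJ
  have hJ0 : 0 ≤ J := integral_nonneg fun x =>
    mul_nonneg (by positivity) (softMax_rpow_pos _ _).le
  have hws : tsupport w ⊆ Metric.closedBall x₀ R :=
    (tsupport_smul_subset_left η _).trans
      (hηs.trans (Metric.closedBall_subset_closedBall hr'R))
  -- Sobolev
  have hX : eLpNorm w (ENNReal.ofReal q) volume ≤
      ENNReal.ofReal (Cs * (n * √(powerEnergyConst n p ν L₁ * a ^ 3 * J))) := by
    refine (hCs x₀ w G hw2 hws hG2 hGw).trans ?_
    rw [ENNReal.ofReal_mul (by positivity), ENNReal.ofReal_coe_nnreal]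
    refine mul_le_mul_right ?_ _
    calc ∑ i, eLpNorm (G i) 2 volume
        ≤ ∑ _i : Fin n, ENNReal.ofReal √(powerEnergyConst n p ν L₁ * a ^ 3 * J) := by
          refine Finset.sum_le_sum fun i _ => ?_
          rw [← ENNReal.pow_le_pow_left_iff two_ne_zero, ← ENNReal.ofReal_pow (Real.sqrt_nonneg _),
            Real.sq_sqrt (by positivity)]
          exact hGJ i
      _ = _ := by
          rw [Finset.sum_const, Finset.card_univ, Fintype.card_fin, nsmul_eq_mul,
            ENNReal.ofReal_mul (by positivity), ENNReal.ofReal_natCast]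
  have hXt : eLpNorm w (ENNReal.ofReal q) volume ≠ ⊤ := ne_top_of_le_ne_top ENNReal.ofReal_ne_top hX
  set x := (eLpNorm w (ENNReal.ofReal q) volume).toReal with hx
  have hx0 : 0 ≤ x := ENNReal.toReal_nonneg
  have hxJ : x ^ 2 ≤ D₀ * a ^ 3 * J := by
    have h1 : x ≤ Cs * (n * √(powerEnergyConst n p ν L₁ * a ^ 3 * J)) :=
      ENNReal.toReal_le_of_le_ofReal (by positivity) hX
    have h2 := pow_le_pow_left₀ hx0 h1 2
    rw [mul_pow, mul_pow, Real.sq_sqrt (by positivity)] at h2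
    have h3 : 0 ≤ a ^ 3 * J := by positivity
    rw [hD₀]
    linarith
  -- the data term
  have hκ2 := hS.memLp_dataFun_two hBc hΩ
  have hyw : MemLp (fun x => dataFun p k f x * w x) 2 (volume.restrict B) := by
    obtain ⟨M, hM1, hM⟩ := hS.bounded.exists_bound hBc hΩ
    refine MemLp.of_le_mul (c := max 1 M ^ a) hκ2 (hκ2.1.mul hw2.1.restrict) ?_
    filter_upwards [hM] with y hy
    rw [norm_mul, mul_comm, hw]
    refine mul_le_mul_of_nonneg_right ?_ (norm_nonneg _)
    rw [norm_smul, Real.norm_of_nonneg (hη0 y), Real.norm_of_nonneg (softMax_rpow_pos _ _).le]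
    have h1 : Q y ^ a ≤ max 1 M ^ a := Real.rpow_le_rpow (hQ0 y)
      ((softMax_le_max _).trans (max_le_max_left _ hy)) (by linarith)
    exact (mul_le_of_le_one_left (softMax_rpow_pos _ _).le (hη1 y)).trans h1
  set y := (eLpNorm (fun x => dataFun p k f x * w x) 2 (volume.restrict B)).toReal with hy
  have hy0 : 0 ≤ y := ENNReal.toReal_nonneg
  have hIi : Integrable (fun x => Q x ^ (2 * a)) (volume.restrict B) :=
    hS.integrable_softMax_rpow hBc hΩ (by linarith)
  set I := ∫ x in B, Q x ^ (2 * a) with hI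
  have hI0 : 0 ≤ I := integral_nonneg fun x => (softMax_rpow_pos _ _).le
  have hQa : ∀ x, (Q x ^ a) ^ 2 = Q x ^ (2 * a) := fun x => by
    rw [← Real.rpow_natCast, ← Real.rpow_mul (hQ0 x), mul_comm]
    norm_num
  have hy2 : y ^ 2 = ∫ x in B, dataFun p k f x ^ 2 * η x ^ 2 * Q x ^ (2 * a) := by
    have h1 : ENNReal.ofReal (y ^ 2)
        = ENNReal.ofReal (∫ x in B, (dataFun p k f x * w x) ^ 2) := by
      rw [ENNReal.ofReal_pow hy0, hy, ENNReal.ofReal_toReal hyw.eLpNorm_ne_top, eLpNorm_two_sq,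
        ofReal_integral_eq_lintegral_ofReal hyw.integrable_sq
          (Eventually.of_forall fun x => sq_nonneg _)]
      refine lintegral_congr fun x => ?_
      rw [← ofReal_norm, ← ENNReal.ofReal_pow (norm_nonneg _), Real.norm_eq_abs, sq_abs]
    rw [ENNReal.ofReal_eq_ofReal_iff (sq_nonneg _) (integral_nonneg fun x => sq_nonneg _)] at h1
    rw [h1]
    refine integral_congr_ae (Eventually.of_forall fun x => ?_)
    beta_reduce
    rw [hw]
    beta_reduce
    rw [smul_eq_mul, mul_pow, mul_pow, hQa, mul_assoc]
  have hJle : J ≤ Λ ^ 2 * √I ^ 2 + y ^ 2 := by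
    have h2 : Integrable (fun x => dataFun p k f x ^ 2 * η x ^ 2 * Q x ^ (2 * a))
        (volume.restrict B) := by
      refine hyw.integrable_sq.congr (Eventually.of_forall fun x => ?_)
      beta_reduce
      rw [hw]
      beta_reduce
      rw [smul_eq_mul, mul_pow, mul_pow, hQa, mul_assoc]
    rw [Real.sq_sqrt hI0, hy2, hI, ← integral_const_mul, ← integral_add (hIi.const_mul _) h2]
    refine integral_mono hJi ((hIi.const_mul _).add h2) fun x => ?_
    rw [add_mul]
    refine add_le_add_left (mul_le_mul_of_nonneg_right ?_ (softMax_rpow_pos _ _).le) _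
    exact pow_le_pow_left₀ (norm_nonneg _) (hηg x) 2
  have hw2I : eLpNorm w 2 (volume.restrict B) ≤ ENNReal.ofReal √I := by
    rw [← ENNReal.pow_le_pow_left_iff two_ne_zero, ← ENNReal.ofReal_pow (Real.sqrt_nonneg _),
      Real.sq_sqrt hI0, eLpNorm_two_sq, hI, ofReal_integral_eq_lintegral_ofReal hIi
        (Eventually.of_forall fun x => (softMax_rpow_pos _ _).le)]
    refine lintegral_mono fun x => ?_
    rw [← ofReal_norm, ← ENNReal.ofReal_pow (norm_nonneg _), Real.norm_eq_abs, sq_abs, hw]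
    beta_reduce
    rw [smul_eq_mul, mul_pow, hQa]
    refine ENNReal.ofReal_le_ofReal (mul_le_of_le_one_left (softMax_rpow_pos _ _).le ?_)
    exact pow_le_one₀ (hη0 x) (hη1 x)
  have hs₀ : (0 : ℝ) < s / θ := by positivity
  have hyl : ∀ l : ℝ, 0 < l → y ≤ l * √I + l ^ (1 - θ) * K ^ θ * x := by
    intro l hl
    -- `s/θ` is the harmonic mean of `n` and `s`; it lies strictly between them, and `q` was defined
    -- to complement it.
    have hexp : (s / θ)⁻¹ + q⁻¹ = 2⁻¹ := by
      rw [hq_def, sobolevExp_inv, inv_div, hθ_def, absorbExp]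
      field_simp
      ring
    have h1 := eLpNorm_mul_le_truncate hs₀ (div_le_self hs0.le hθ.le) hq hexp
      (μ := volume.restrict B) (κ := dataFun p k f) (w := w) hκ2.1 hw2.1.restrict hl
      (by linarith : 0 ≤ K) hκ
    rw [div_div_cancel₀ hs0.ne'] at h1
    have h2 : eLpNorm w (ENNReal.ofReal q) (volume.restrict B) ≤ ENNReal.ofReal x := by
      rw [hx, ENNReal.ofReal_toReal hXt]
      exact eLpNorm_mono_measure _ Measure.restrict_le_self
    refine ENNReal.toReal_le_of_le_ofReal (by positivity) (h1.trans ?_)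
    rw [ENNReal.ofReal_add (by positivity) (by positivity), ENNReal.ofReal_mul hl.le,
      ENNReal.ofReal_mul (p := l ^ (1 - θ) * K ^ θ) (by positivity)]
    gcongr
  have hfin := sq_le_of_absorb (Λ := Λ) hy0
    (one_le_mul_of_one_le_of_one_le hD₀1 ha3) hK hθ
    (hxJ.trans (mul_le_mul_of_nonneg_left hJle (by positivity))) hyl
  rw [Real.sq_sqrt hI0] at hfin
  -- conclusion
  have e1 : eLpNorm Q (ENNReal.ofReal (β * (q / 2))) (volume.restrict (Metric.closedBall x₀ r)) ^ β
      ≤ ENNReal.ofReal (x ^ 2) := by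
    have h1 : eLpNorm (fun x => Q x ^ a) (ENNReal.ofReal q)
        (volume.restrict (Metric.closedBall x₀ r)) ≤ ENNReal.ofReal x := by
      rw [hx, ENNReal.ofReal_toReal hXt]
      refine le_trans (le_of_eq (eLpNorm_congr_ae ?_))
        (eLpNorm_mono_measure w (Measure.restrict_le_self (s := Metric.closedBall x₀ r)))
      refine (ae_restrict_iff' measurableSet_closedBall).2 (Eventually.of_forall fun z hz => ?_)
      rw [hw]
      beta_reduce
      rw [hηr z hz, one_smul]
    rw [eLpNorm_rpow_eq hQ0 (by linarith) hq, show a * q = β * (q / 2) by rw [ha]; ring] at h1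
    rw [← h2a, mul_comm 2 a, ENNReal.rpow_mul, ENNReal.ofReal_pow hx0, ← ENNReal.rpow_natCast]
    rw [h2a.symm, mul_comm 2 a] at h1
    exact ENNReal.rpow_le_rpow h1 (by norm_num)
  have e2 : ENNReal.ofReal I = eLpNorm Q (ENNReal.ofReal β) (volume.restrict B) ^ β := by
    rw [hI, h2a]
    exact ofReal_integral_rpow_eq hQ0 (by linarith) (by rw [← h2a]; exact hIi)
  have hβ0 : 0 < β := by linarith
  have hD₀0 : 0 < D₀ := by linarith
  have hK0 : 0 < K := by linarith
  have ha0 : 0 < a := by linarith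
  have hAD : 0 < D₀ + Cη := by linarith
  have g1 : 4 * (D₀ * a ^ 3) * K ^ (2 * θ) ≤ (D₀ + Cη) * β ^ 3 * K ^ (2 * θ) := by
    have : 4 * (D₀ * a ^ 3) ≤ (D₀ + Cη) * β ^ 3 := by
      rw [ha, div_pow]
      have hb : 0 ≤ β ^ 3 := by positivity
      nlinarith [mul_nonneg hCη0.le hb, mul_nonneg (zero_le_one.trans hD₀1) hb]
    gcongr
  have g2 : Λ ≤ (D₀ + Cη) / (r' - r) := by
    rw [hΛ]
    gcongr
    linarith
  rw [← e2, ← ENNReal.ofReal_mul (by positivity)]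
  refine e1.trans (ENNReal.ofReal_le_ofReal (hfin.trans ?_))
  have g3 : 0 ≤ θ / (θ - 1) := div_nonneg (by linarith) (by linarith)
  gcongr

end MoserIteration

/-! ### The supremum bound. -/

section LocalBoundedness

open Filter Topology

variable {n N : ℕ}

/-- Chebyshev: for `m > M` the set `|g| ≥ m` has measure at most `(M/m)^(β j)`, which tends to 0. -/
theorem eLpNorm_top_le_of_forall_le {α : Type*} [MeasurableSpace α] {μ : Measure α} {g : α → ℝ}
    (hg : AEStronglyMeasurable g μ) {β : ℕ → ℝ} (hβ : ∀ j, 0 < β j) (hβt : Tendsto β atTop atTop)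
    {M : ℝ≥0∞} (h : ∀ j, eLpNorm g (ENNReal.ofReal (β j)) μ ≤ M) : eLpNorm g ⊤ μ ≤ M := by
  refine le_of_forall_gt_imp_ge_of_dense fun m hm => ?_
  by_cases hmt : m = ⊤
  · rw [hmt]
    exact le_top
  have hm0 : m ≠ 0 := (zero_le.trans_lt hm).ne'
  have hset : μ {x | m ≤ ‖g x‖ₑ} = 0 := by
    have h1 : ∀ j, μ {x | m ≤ ‖g x‖ₑ} ≤ (m⁻¹ * M) ^ β j := fun j => by
      have h2 := meas_ge_le_mul_pow_eLpNorm_enorm μ (p := ENNReal.ofReal (β j))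
        (by simpa using hβ j) ENNReal.ofReal_ne_top hg hm0 (fun h => absurd h hmt)
      rw [ENNReal.toReal_ofReal (hβ j).le] at h2
      rw [ENNReal.mul_rpow_of_nonneg _ _ (hβ j).le]
      exact h2.trans (mul_le_mul_right (ENNReal.rpow_le_rpow (h j) (hβ j).le) _)
    have h3 : m⁻¹ * M < 1 := by
      rw [mul_comm, ← div_eq_mul_inv]
      exact ENNReal.div_lt_of_lt_mul (by rwa [one_mul])
    have h4 := (ENNReal.tendsto_rpow_atTop_of_base_lt_one h3).comp hβt
    exact le_antisymm (ge_of_tendsto' h4 h1) zero_le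
  rw [eLpNorm_exponent_top]
  refine essSup_le_of_ae_le m ?_
  have h5 : ∀ᵐ x ∂μ, ¬ m ≤ ‖g x‖ₑ := by
    rw [ae_iff]
    simpa using hset
  filter_upwards [h5] with x hx
  exact (not_le.1 hx).le

/-- Taking roots of order `p χ^j` leaves exponents `χ^(-j)/p` on `Γ` and `j χ^(-j)/p` on `b`; both
series converge, so the product of all factors stays bounded. -/
theorem le_of_geometric_rpow_recursion {J : ℕ → ℝ≥0∞} {Γ b p χ : ℝ} (hΓ : 1 ≤ Γ) (hb : 1 ≤ b)
    (hp : 0 < p) (hχ : 1 < χ)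
    (h : ∀ j, J (j + 1) ^ (p * χ ^ j) ≤ ENNReal.ofReal (Γ * b ^ j) * J j ^ (p * χ ^ j)) (m : ℕ) :
    J m ≤ ENNReal.ofReal (Γ ^ (p⁻¹ * (1 - χ⁻¹)⁻¹) * b ^ (p⁻¹ * ∑' j : ℕ, (j : ℝ) * χ⁻¹ ^ j))
      * J 0 := by
  have hχ0 : 0 < χ := by linarith
  have hΓ0 : 0 < Γ := by linarith
  have hb0 : 0 < b := by linarith
  have hχi : χ⁻¹ < 1 := inv_lt_one_of_one_lt₀ hχ
  have hχi0 : 0 < χ⁻¹ := inv_pos.2 hχ0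
  have hstep : ∀ j, J (j + 1) ≤
      ENNReal.ofReal (Γ ^ (p⁻¹ * χ⁻¹ ^ j) * b ^ (p⁻¹ * (j * χ⁻¹ ^ j))) * J j := by
    intro j
    have hβ : 0 < p * χ ^ j := by positivity
    have h1 := ENNReal.rpow_le_rpow (h j) (inv_pos.2 hβ).le
    rw [ENNReal.mul_rpow_of_nonneg _ _ (inv_pos.2 hβ).le, ← ENNReal.rpow_mul, ← ENNReal.rpow_mul,
      mul_inv_cancel₀ hβ.ne', ENNReal.rpow_one, ENNReal.rpow_one,
      ENNReal.ofReal_rpow_of_pos (by positivity)] at h1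
    have e1 : (p * χ ^ j)⁻¹ = p⁻¹ * χ⁻¹ ^ j := by rw [mul_inv, inv_pow]
    have e2 : (Γ * b ^ j) ^ (p * χ ^ j)⁻¹ = Γ ^ (p⁻¹ * χ⁻¹ ^ j) * b ^ (p⁻¹ * (j * χ⁻¹ ^ j)) := by
      rw [e1, Real.mul_rpow hΓ0.le (by positivity), ← Real.rpow_natCast b j, ← Real.rpow_mul hb0.le]
      congr 2
      ring
    rwa [e2] at h1
  have hsum : ∀ m, J m ≤ ENNReal.ofReal (Γ ^ (p⁻¹ * ∑ j ∈ Finset.range m, χ⁻¹ ^ j) *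
      b ^ (p⁻¹ * ∑ j ∈ Finset.range m, (j : ℝ) * χ⁻¹ ^ j)) * J 0 := by
    intro m
    induction m with
    | zero => simp
    | succ m ih =>
      refine (hstep m).trans ((mul_le_mul_right ih _).trans (le_of_eq ?_))
      rw [← mul_assoc, ← ENNReal.ofReal_mul (by positivity), Finset.sum_range_succ,
        Finset.sum_range_succ, mul_add, mul_add, Real.rpow_add hΓ0, Real.rpow_add hb0]
      congr 2
      ring
  refine (hsum m).trans (mul_le_mul_left (ENNReal.ofReal_le_ofReal ?_) _)
  have s1 : ∑ j ∈ Finset.range m, χ⁻¹ ^ j ≤ (1 - χ⁻¹)⁻¹ := by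
    rw [← tsum_geometric_of_lt_one hχi0.le hχi]
    exact (summable_geometric_of_lt_one hχi0.le hχi).sum_le_tsum _ fun j _ => by positivity
  have s2 : ∑ j ∈ Finset.range m, (j : ℝ) * χ⁻¹ ^ j ≤ ∑' j : ℕ, (j : ℝ) * χ⁻¹ ^ j := by
    have hsm : Summable fun j : ℕ => (j : ℝ) * χ⁻¹ ^ j := by
      have := summable_pow_mul_geometric_of_norm_lt_one (R := ℝ) 1
        (by rwa [Real.norm_of_nonneg hχi0.le] : ‖χ⁻¹‖ < 1)
      simpa using this
    exact hsm.sum_le_tsum _ fun j _ => by positivity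
  gcongr

/-- The power of the norm of the data in the local bound of `|V|^p`. -/
noncomputable def supExp (n : ℕ) (s : ℝ) : ℝ :=
  2 * absorbExp n s * (absorbExp n s / (absorbExp n s - 1)) * (1 - (sobolevExp n s / 2)⁻¹)⁻¹

theorem supExp_pos (hn : 2 ≤ n) {s : ℝ} (hs : (n : ℝ) < s) : 0 < supExp n s := by
  have h1 := one_lt_absorbExp hn hs
  have h2 := two_lt_sobolevExp hn hs
  have h3 : (sobolevExp n s / 2)⁻¹ < 1 := inv_lt_one_of_one_lt₀ (by linarith)
  have h4 : 0 < absorbExp n s - 1 := by linarith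
  have h5 : 0 < 1 - (sobolevExp n s / 2)⁻¹ := by linarith
  unfold supExp
  positivity

/-- Moser iteration over shrinking balls with exponents `p χ^j`, `χ = q/2 > 1`. Each step
contributes the same power of `K`, and summing the geometric weights yields `supExp n s / p`. -/
theorem exists_sup_const (hn : 2 ≤ n) {s : ℝ} (hs : (n : ℝ) < s) {p ν L₁ : ℝ} (hp : 2 ≤ p)
    (hν : 0 < ν) {ρ R : ℝ} (hρ : 0 ≤ ρ) (hρR : ρ < R) : ∃ C : ℝ, 0 < C ∧ ∀ {N : ℕ}
      {Ω : Set (Vec n)} {L : ℝ} {k : Vec n → ℝ} {F : Vec n → Mat n N → ℝ} {f : Vec n → Vec N}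
      {V : Vec n → Mat n N} {D2 : Vec n → Tens n N},
      RegularSolution Ω p L L₁ ν s k F f V D2 → ∀ {x₀ : Vec n} {K : ℝ},
      Metric.closedBall x₀ R ⊆ Ω → 1 ≤ K →
      eLpNorm (dataFun p k f) (ENNReal.ofReal s) (volume.restrict (Metric.closedBall x₀ R))
        ≤ ENNReal.ofReal K →
      eLpNorm (fun x => softMax ‖V x‖) ⊤ (volume.restrict (Metric.closedBall x₀ ρ)) ≤
        ENNReal.ofReal (C * K ^ (supExp n s / p)) * eLpNorm (fun x => softMax ‖V x‖) (ENNReal.ofReal p)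
          (volume.restrict (Metric.closedBall x₀ R)) := by
  obtain ⟨A, hA1, hA⟩ := exists_moser_step_const hn hs (L₁ := L₁) hp hν R
  have hθ := one_lt_absorbExp hn hs
  have hq := two_lt_sobolevExp hn hs
  have hsup : supExp n s = 2 * absorbExp n s * (absorbExp n s / (absorbExp n s - 1))
    * (1 - (sobolevExp n s / 2)⁻¹)⁻¹ := rfl
  set θ := absorbExp n s
  set χ := sobolevExp n s / 2 with hχ_def
  have hχ : 1 < χ := by linarith
  have hχ0 : 0 < χ := by linarith
  have hθ1 : 0 < θ - 1 := by linarith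
  have hθ0 : 0 < θ := by linarith
  set μ := θ / (θ - 1) with hμ_def
  have hμ : 0 < μ := by positivity
  have hA0 : 0 < A := by linarith
  have hp0 : 0 < p := by linarith
  have hRρ : 0 < R - ρ := by linarith
  have hχi : χ⁻¹ < 1 := inv_lt_one_of_one_lt₀ hχ
  have hχ1 : 0 < 1 - χ⁻¹ := by linarith
  set S₀ := p⁻¹ * (1 - χ⁻¹)⁻¹ with hS₀
  have hS₀0 : 0 < S₀ := by positivity
  -- Growth per step: `χ^(3μ)` from the factor `β³` and 4 from halving the gap of radii, which
  -- enters squared.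
  set b := (χ ^ (3 : ℕ)) ^ μ * 4 with hb_def
  have hb : 1 ≤ b := by
    have : 1 ≤ (χ ^ (3 : ℕ)) ^ μ := Real.one_le_rpow (one_le_pow₀ hχ.le) hμ.le
    rw [hb_def]
    linarith
  set Γ₀ := (A * p ^ 3) ^ μ * (1 + (2 * A / (R - ρ)) ^ 2) with hΓ₀
  have hΓ₀0 : 0 < Γ₀ := by positivity
  have hΓ₀1 : 1 ≤ Γ₀ := by
    have h1 : 1 ≤ (A * p ^ 3) ^ μ := Real.one_le_rpow
      (one_le_mul_of_one_le_of_one_le hA1 (one_le_pow₀ (by linarith))) hμ.le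
    have h2 : 1 ≤ 1 + (2 * A / (R - ρ)) ^ 2 := by linarith [sq_nonneg (2 * A / (R - ρ))]
    exact one_le_mul_of_one_le_of_one_le h1 h2
  refine ⟨Γ₀ ^ S₀ * b ^ (p⁻¹ * ∑' j : ℕ, (j : ℝ) * χ⁻¹ ^ j), by positivity, ?_⟩
  intro N Ω L k F f V D2 hS x₀ K hΩ hK hκ
  have hK0 : 0 < K := by linarith
  set Q : Vec n → ℝ := fun x => softMax ‖V x‖
  -- The radii decrease from `R` to `ρ` but never reach it, so every norm dominates the one on the
  -- inner ball.
  set r : ℕ → ℝ := fun j => ρ + (R - ρ) / 2 ^ j with hr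
  have hrρ : ∀ j, ρ < r j := fun j => lt_add_of_pos_right _ (by positivity)
  have hrR : ∀ j, r j ≤ R := fun j => by
    have : (R - ρ) / 2 ^ j ≤ R - ρ := div_le_self hRρ.le (one_le_pow₀ (by norm_num))
    rw [hr]
    linarith
  have hrr : ∀ j, r j - r (j + 1) = (R - ρ) / 2 ^ (j + 1) := fun j => by
    rw [hr, pow_succ]
    field_simp
    ring
  set J : ℕ → ℝ≥0∞ := fun j => eLpNorm Q (ENNReal.ofReal (p * χ ^ j))
    (volume.restrict (Metric.closedBall x₀ (r j))) with hJ
  set Γ := Γ₀ * (K ^ (2 * θ)) ^ μ with hΓ_def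
  have hKθ : 1 ≤ (K ^ (2 * θ)) ^ μ :=
    Real.one_le_rpow (Real.one_le_rpow hK (by linarith)) hμ.le
  have hΓ : 1 ≤ Γ := one_le_mul_of_one_le_of_one_le hΓ₀1 hKθ
  have hrec : ∀ j, J (j + 1) ^ (p * χ ^ j) ≤ ENNReal.ofReal (Γ * b ^ j) * J j ^ (p * χ ^ j) := by
    intro j
    have hj : r (j + 1) < r j := by
      have : 0 < (R - ρ) / 2 ^ (j + 1) := by positivity
      linarith [hrr j]
    have h1 := hA hS (x₀ := x₀) (r := r (j + 1)) (r' := r j) (K := K) (β := p * χ ^ j)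
      (hρ.trans (hrρ _).le) hj (hrR j) ((Metric.closedBall_subset_closedBall (hrR j)).trans hΩ) hK
      ((eLpNorm_mono_measure _ (Measure.restrict_mono
        (Metric.closedBall_subset_closedBall (hrR j)) le_rfl)).trans hκ)
      (le_mul_of_one_le_right hp0.le (one_le_pow₀ hχ.le))
    rw [show p * χ ^ j * χ = p * χ ^ (j + 1) by rw [pow_succ]; ring] at h1
    refine h1.trans (mul_le_mul_left (ENNReal.ofReal_le_ofReal ?_) _)
    have e1 : (A * (p * χ ^ j) ^ 3 * K ^ (2 * θ)) ^ μ
        = (A * p ^ 3) ^ μ * ((χ ^ (3 : ℕ)) ^ μ) ^ j * (K ^ (2 * θ)) ^ μ := by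
      have : A * (p * χ ^ j) ^ 3 * K ^ (2 * θ) = A * p ^ 3 * (χ ^ 3) ^ j * K ^ (2 * θ) := by ring
      rw [this, Real.mul_rpow (by positivity) (by positivity),
        Real.mul_rpow (by positivity) (by positivity)]
      congr 2
      rw [← Real.rpow_natCast (χ ^ 3) j, ← Real.rpow_natCast ((χ ^ 3) ^ μ) j,
        ← Real.rpow_mul (by positivity), ← Real.rpow_mul (by positivity), mul_comm]
    have e2 : 1 + (A / (r j - r (j + 1))) ^ 2 ≤ (1 + (2 * A / (R - ρ)) ^ 2) * 4 ^ j := by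
      have e3 : (A / (r j - r (j + 1))) ^ 2 = (2 * A / (R - ρ)) ^ 2 * 4 ^ j := by
        rw [hrr, show (4 : ℝ) = 2 ^ 2 by norm_num, ← pow_mul, mul_comm 2 j, pow_mul, ← mul_pow]
        congr 1
        field_simp
        ring_nf
      have e4 : (1 : ℝ) ≤ 4 ^ j := one_le_pow₀ (by norm_num)
      rw [e3]
      linarith
    rw [e1]
    calc (A * p ^ 3) ^ μ * ((χ ^ (3 : ℕ)) ^ μ) ^ j * (K ^ (2 * θ)) ^ μ
          * (1 + (A / (r j - r (j + 1))) ^ 2)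
        ≤ (A * p ^ 3) ^ μ * ((χ ^ (3 : ℕ)) ^ μ) ^ j * (K ^ (2 * θ)) ^ μ
          * ((1 + (2 * A / (R - ρ)) ^ 2) * 4 ^ j) := by gcongr
      _ = Γ * b ^ j := by rw [hΓ_def, hΓ₀, hb_def]; ring
  have hiter := le_of_geometric_rpow_recursion hΓ hb hp0 hχ hrec
  have hJ0 : J 0 = eLpNorm Q (ENNReal.ofReal p) (volume.restrict (Metric.closedBall x₀ R)) := by
    rw [hJ, hr]
    simp
  rw [hJ0] at hiter
  have hρΩ : Metric.closedBall x₀ ρ ⊆ Ω :=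
    (Metric.closedBall_subset_closedBall hρR.le).trans hΩ
  refine eLpNorm_top_le_of_forall_le
    (hS.aestronglyMeasurable_softMax (isCompact_closedBall _ _) hρΩ)
    (β := fun j => p * χ ^ j) (fun j => by positivity)
    ((tendsto_pow_atTop_atTop_of_one_lt hχ).const_mul_atTop hp0) fun j => ?_
  refine (eLpNorm_mono_measure _ (Measure.restrict_mono
    (Metric.closedBall_subset_closedBall (hrρ j).le) le_rfl)).trans ((hiter j).trans
      (mul_le_mul_left (ENNReal.ofReal_le_ofReal ?_) _))
  have hKs : ((K ^ (2 * θ)) ^ μ) ^ S₀ = K ^ (supExp n s / p) := by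
    rw [← Real.rpow_mul hK0.le, ← Real.rpow_mul hK0.le, hsup, hS₀]
    congr 1
    ring
  have hb0 : 0 < b := by linarith
  rw [hΓ_def, Real.mul_rpow hΓ₀0.le (by positivity), hKs]
  exact le_of_eq (by ring)

end LocalBoundedness

/-! ### The weighted estimate for second derivatives. -/

section ExcessCaccioppoli

open Filter Topology

variable {n N : ℕ}

/-- The weight `t² / (1 + t)²`, `t = (P - c)₊`. -/
noncomputable def excessWeight (c P : ℝ) : ℝ := max (P - c) 0 ^ 2 / (1 + max (P - c) 0) ^ 2

theorem hasDerivAt_excessWeight (c P : ℝ) :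
    HasDerivAt (excessWeight c) (2 * max (P - c) 0 / (1 + max (P - c) 0) ^ 3) P := by
  have h := hasDerivAt_comp_max (h := fun t => t ^ 2 / (1 + t) ^ 2)
    (h' := fun t => 2 * t / (1 + t) ^ 3) (fun t ht => by
      have h1 : (1 + t) ≠ 0 := by positivity
      refine ((hasDerivAt_pow 2 t).div (((hasDerivAt_id t).const_add 1).pow 2)
        (pow_ne_zero 2 h1)).congr_deriv ?_
      simp
      field_simp
      ring) (by simp) (P - c)
  have h2 := h.comp_sub_const P c
  exact h2

theorem contDiff_excessWeight (c : ℝ) : ContDiff ℝ 1 (excessWeight c) := by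
  rw [contDiff_one_iff_deriv]
  refine ⟨fun x => (hasDerivAt_excessWeight c x).differentiableAt, ?_⟩
  rw [funext fun x => (hasDerivAt_excessWeight c x).deriv]
  refine Continuous.div (by fun_prop) (by fun_prop) fun x => ?_
  have : 0 ≤ max (x - c) 0 := le_max_right _ _
  positivity

theorem excessWeight_of_le {c P : ℝ} (h : P ≤ c) : excessWeight c P = 0 := by
  simp [excessWeight, max_eq_right (sub_nonpos.2 h)]

theorem excessWeight_nonneg (c P : ℝ) : 0 ≤ excessWeight c P := by
  unfold excessWeight
  positivity

theorem deriv_excessWeight_nonneg (c P : ℝ) : 0 ≤ deriv (excessWeight c) P := by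
  rw [(hasDerivAt_excessWeight c P).deriv]
  have : 0 ≤ max (P - c) 0 := le_max_right _ _
  positivity

/-- The weight is at most 1, and `Φ'(P) P = 2tP/(1+t)³ ≤ 2` because `P ≤ t + 2`; the extra power of
`P` in the growth weight is thus paid for by the decay of `Φ'`. -/
theorem growthWeight_excessWeight_le {p c P : ℝ} (hc : c ≤ 2) (hP : 0 ≤ P) (hp : 0 ≤ p) :
    growthWeight p (excessWeight c) P ≤ 3 * P ^ p := by
  have hPp : 0 ≤ P ^ p := Real.rpow_nonneg hP p
  rw [growthWeight, (hasDerivAt_excessWeight c P).deriv, excessWeight,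
    Real.rpow_add_one' hP (by linarith)]
  by_cases h : P ≤ c
  · rw [max_eq_right (sub_nonpos.2 h)]
    simp
    positivity
  · rw [not_le] at h
    rw [max_eq_left (by linarith)]
    set t := P - c with ht
    have ht0 : 0 < t := by linarith
    have h1 : t ^ 2 / (1 + t) ^ 2 ≤ 1 := by
      rw [div_le_one (by positivity)]
      exact pow_le_pow_left₀ ht0.le (by linarith) 2
    have h2 : 2 * t / (1 + t) ^ 3 * P ≤ 2 := by
      rw [div_mul_eq_mul_div, div_le_iff₀ (by positivity)]
      have h3 : P ≤ t + 2 := by linarith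
      have h4 : 2 * t * P ≤ 2 * t * (t + 2) := by gcongr
      nlinarith [pow_pos ht0 3, pow_pos ht0 2]
    calc t ^ 2 / (1 + t) ^ 2 * P ^ p + 2 * t / (1 + t) ^ 3 * (P ^ p * P)
        = t ^ 2 / (1 + t) ^ 2 * P ^ p + (2 * t / (1 + t) ^ 3 * P) * P ^ p := by ring
      _ ≤ 1 * P ^ p + 2 * P ^ p := by gcongr
      _ = _ := by ring

theorem continuous_excessWeight_left (P : ℝ) : Continuous fun c => excessWeight c P := by
  unfold excessWeight
  refine Continuous.div (by fun_prop) (by fun_prop) fun x => ?_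
  have : 0 ≤ max (P - x) 0 := le_max_right _ _
  positivity

theorem integral_dataFun_sq_le {B : Set (Vec n)} (hB : volume B ≠ ⊤) {p s K : ℝ} (hs : 2 ≤ s)
    (hK0 : 0 ≤ K) {k : Vec n → ℝ} {f : Vec n → Vec N}
    (hκ2 : MemLp (dataFun p k f) 2 (volume.restrict B))
    (hκ : eLpNorm (dataFun p k f) (ENNReal.ofReal s) (volume.restrict B) ≤ ENNReal.ofReal K) :
    ∫ x in B, dataFun p k f x ^ 2 ≤ K ^ 2 * (volume B ^ (1 / 2 - 1 / s)).toReal ^ 2 := by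
  have h1 := eLpNorm_le_eLpNorm_mul_rpow_measure_univ (p := 2) (q := ENNReal.ofReal s)
    (by simpa using ENNReal.ofReal_le_ofReal hs) hκ2.1
  rw [Measure.restrict_apply_univ, ENNReal.toReal_ofNat, ENNReal.toReal_ofReal (by linarith)] at h1
  have hfin : volume B ^ (1 / 2 - 1 / s) ≠ ⊤ := by
    refine ENNReal.rpow_ne_top_of_nonneg ?_ hB
    rw [sub_nonneg]
    exact one_div_le_one_div_of_le (by norm_num) hs
  have h2 : eLpNorm (dataFun p k f) 2 (volume.restrict B)
      ≤ ENNReal.ofReal (K * (volume B ^ (1 / 2 - 1 / s)).toReal) := by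
    rw [ENNReal.ofReal_mul hK0, ENNReal.ofReal_toReal hfin]
    exact h1.trans (mul_le_mul_left hκ _)
  have h3 : ENNReal.ofReal (∫ x in B, dataFun p k f x ^ 2)
      ≤ ENNReal.ofReal ((K * (volume B ^ (1 / 2 - 1 / s)).toReal) ^ 2) := by
    rw [ENNReal.ofReal_pow (by positivity)]
    refine le_trans (le_of_eq ?_) (pow_le_pow_left' h2 2)
    rw [eLpNorm_two_sq, ofReal_integral_eq_lintegral_ofReal hκ2.integrable_sq
          (Eventually.of_forall fun x => sq_nonneg _)]
    refine lintegral_congr fun x => ?_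
    rw [← ofReal_norm, ← ENNReal.ofReal_pow (norm_nonneg _), Real.norm_eq_abs, sq_abs]
  rw [ENNReal.ofReal_le_ofReal_iff (by positivity), mul_pow] at h3
  exact h3

/-- The product `κ² |V|^p` on the right side is estimated through the pointwise bound `M` for
`|V|^p`, leaving only `∫ κ²`. The nonnegative `Φ'` part of the energy density is discarded. -/
theorem RegularSolution.lintegral_excessWeight_le {Ω : Set (Vec n)} {p L L₁ ν s : ℝ}
    {k : Vec n → ℝ} {F : Vec n → Mat n N → ℝ} {f : Vec n → Vec N} {V : Vec n → Mat n N}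
    {D2 : Vec n → Tens n N} (hS : RegularSolution Ω p L L₁ ν s k F f V D2) {x₀ : Vec n} {r ρ : ℝ}
    (hr : 0 ≤ r) (hrΩ : Metric.closedBall x₀ r ⊆ Ω) {η : Vec n → ℝ} (hη : ContDiff ℝ ∞ η)
    (hη0 : ∀ x, 0 ≤ η x) (hη1 : ∀ x, η x ≤ 1) (hηs : tsupport η ⊆ Metric.closedBall x₀ r)
    (hρr : ρ ≤ r) (hηρ : ∀ x ∈ Metric.closedBall x₀ ρ, η x = 1)
    {Λ : ℝ} (hΛ : ∀ x, ‖gradVec η x‖ ≤ Λ) {M : ℝ}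
    (hM : ∀ᵐ x ∂(volume.restrict (Metric.closedBall x₀ r)), ‖V x‖ ^ p ≤ M) {δ : ℝ} (hδ : 0 < δ)
    (hδ1 : δ ≤ 1) :
    ∫⁻ x in Metric.closedBall x₀ ρ, ENNReal.ofReal
        (excessWeight (1 + δ) ‖V x‖ * ‖V x‖ ^ (p - 2) * ‖D2 x‖ ^ 2) ≤
      ENNReal.ofReal (2 / ν * caccioppoliConst n ν L₁ * (3 * M) *
        ∫ x in Metric.closedBall x₀ r, (Λ ^ 2 + dataFun p k f x ^ 2)) := by
  set B := Metric.closedBall x₀ r with hB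
  have hp := hS.two_le_p
  have hν := hS.ν_pos
  have hBc : IsCompact B := isCompact_closedBall _ _
  haveI : IsFiniteMeasure (volume.restrict B : Measure (Vec n)) :=
    ⟨by simpa using hBc.measure_lt_top⟩
  obtain ⟨c1, c2, c3⟩ := hS.caccioppoli hr hrΩ hδ hδ1 (contDiff_excessWeight (1 + δ))
    (fun t ht => excessWeight_of_le ht) (excessWeight_nonneg _) (deriv_excessWeight_nonneg _)
    hη hη0 hηs
  set Φ := excessWeight (1 + δ)
  have hE1 : ∀ x, Φ ‖V x‖ * ‖V x‖ ^ (p - 2) * ‖D2 x‖ ^ 2 ≤ energyDensity p Φ (V x) (D2 x) := by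
    intro x
    have h1 := deriv_excessWeight_nonneg (1 + δ) ‖V x‖
    rw [energyDensity]
    exact le_add_of_nonneg_right (by positivity)
  have hE0 : ∀ x, 0 ≤ energyDensity p Φ (V x) (D2 x) := fun x => by
    have h1 := excessWeight_nonneg (1 + δ) ‖V x‖
    exact le_trans (by positivity) (hE1 x)
  have hκ2 := hS.memLp_dataFun_two hBc hrΩ
  have hgi : Integrable (fun x => Λ ^ 2 + dataFun p k f x ^ 2) (volume.restrict B) :=
    (integrable_const _).add hκ2.integrable_sq
  have h1 : ∫ x in B, (‖gradVec η x‖ ^ 2 + dataFun p k f x ^ 2 * η x ^ 2) * growthWeight p Φ ‖V x‖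
      ≤ 3 * M * ∫ x in B, (Λ ^ 2 + dataFun p k f x ^ 2) := by
    rw [← integral_const_mul]
    refine integral_mono_ae c2 (hgi.const_mul _) ?_
    filter_upwards [hM] with x hx
    have g1 : growthWeight p Φ ‖V x‖ ≤ 3 * M :=
      (growthWeight_excessWeight_le (by linarith) (norm_nonneg _) (by linarith)).trans (by linarith)
    have g2 : ‖gradVec η x‖ ^ 2 ≤ Λ ^ 2 := pow_le_pow_left₀ (norm_nonneg _) (hΛ x) 2
    have g3 : dataFun p k f x ^ 2 * η x ^ 2 ≤ dataFun p k f x ^ 2 :=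
      mul_le_of_le_one_right (sq_nonneg _) (pow_le_one₀ (hη0 x) (hη1 x))
    have g4 : 0 ≤ M := le_trans (by positivity) hx
    rw [mul_comm (3 * M)]
    exact (mul_le_mul_of_nonneg_left g1 (by positivity)).trans
      (mul_le_mul_of_nonneg_right (add_le_add g2 g3) (by positivity))
  have h2 : ∫ x in B, η x ^ 2 * energyDensity p Φ (V x) (D2 x) ≤
      2 / ν * caccioppoliConst n ν L₁ * (3 * M) * ∫ x in B, (Λ ^ 2 + dataFun p k f x ^ 2) := by
    have h3 := c3.trans (mul_le_mul_of_nonneg_left h1 (caccioppoliConst_nonneg n hν L₁))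
    calc ∫ x in B, η x ^ 2 * energyDensity p Φ (V x) (D2 x)
        = 2 / ν * (ν / 2 * ∫ x in B, η x ^ 2 * energyDensity p Φ (V x) (D2 x)) := by field_simp
      _ ≤ 2 / ν * (caccioppoliConst n ν L₁ *
          (3 * M * ∫ x in B, (Λ ^ 2 + dataFun p k f x ^ 2))) := by gcongr
      _ = _ := by ring
  refine le_trans ?_ (ENNReal.ofReal_le_ofReal h2)
  rw [ofReal_integral_eq_lintegral_ofReal c1
    (Eventually.of_forall fun x => mul_nonneg (sq_nonneg _) (hE0 x))]
  refine (setLIntegral_mono_ae' measurableSet_closedBall (Eventually.of_forall fun x hx =>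
    ENNReal.ofReal_le_ofReal ?_)).trans
    (lintegral_mono_set (Metric.closedBall_subset_closedBall hρr))
  rw [hηρ x hx]
  simpa using hE1 x

/-- On an intermediate ball the supremum estimate gives `|V|^p ≤ C K^(supExp) ∫ Q^p`, and `∫ κ²`
contributes `K²`; hence the exponent `supExp + 2`. -/
theorem exists_caccioppoli_const (hn : 2 ≤ n) {s : ℝ} (hs : (n : ℝ) < s) {p ν L₁ : ℝ} (hp : 2 ≤ p)
    (hν : 0 < ν) {ρ R : ℝ} (hρ : 0 ≤ ρ) (hρR : ρ < R) : ∃ C : ℝ, 0 < C ∧ ∀ {N : ℕ}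
      {Ω : Set (Vec n)} {L : ℝ} {k : Vec n → ℝ} {F : Vec n → Mat n N → ℝ} {f : Vec n → Vec N}
      {V : Vec n → Mat n N} {D2 : Vec n → Tens n N},
      RegularSolution Ω p L L₁ ν s k F f V D2 → ∀ {x₀ : Vec n} {K : ℝ},
      Metric.closedBall x₀ R ⊆ Ω → 1 ≤ K →
      eLpNorm (dataFun p k f) (ENNReal.ofReal s) (volume.restrict (Metric.closedBall x₀ R))
        ≤ ENNReal.ofReal K →
      ∫⁻ x in Metric.closedBall x₀ ρ, ENNReal.ofReal
          (excessWeight 1 ‖V x‖ * ‖V x‖ ^ (p - 2) * ‖D2 x‖ ^ 2) ≤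
        ENNReal.ofReal (C * K ^ (supExp n s + 2)) * ENNReal.ofReal
          (∫ x in Metric.closedBall x₀ R, softMax ‖V x‖ ^ p) := by
  set r := (ρ + R) / 2 with hr_def
  have hr0 : 0 ≤ r := by linarith
  have hρr : ρ < r := by linarith
  have hrR : r < R := by linarith
  obtain ⟨C₀, hC₀, hsup⟩ := exists_sup_const hn hs (L₁ := L₁) hp hν hr0 hrR
  obtain ⟨Cη, hCη0, hCη⟩ := exists_cutoff_gradVec_le n
  have hc := caccioppoliConst_nonneg n hν L₁
  set vol := (volume (Metric.closedBall (0 : Vec n) r)).toReal with hvol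
  set vol' := (volume (Metric.closedBall (0 : Vec n) r) ^ (1 / 2 - 1 / s)).toReal with hvol'
  have hvol0 : 0 ≤ vol := ENNReal.toReal_nonneg
  have hvol'0 : 0 ≤ vol' := ENNReal.toReal_nonneg
  set Λ := Cη / (r - ρ) with hΛ
  have hp0 : 0 < p := by linarith
  set C₁ := 2 / ν * caccioppoliConst n ν L₁ * (3 * ((5 / 2) ^ p * C₀ ^ p))
    * (Λ ^ 2 * vol + vol' ^ 2) with hC₁
  have hC₁0 : 0 ≤ C₁ := by positivity
  refine ⟨C₁ + 1, by linarith, ?_⟩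
  intro N Ω L k F f V D2 hS x₀ K hΩ hK hκ
  obtain ⟨η, hη, hη0, hη1, hηρ, hηs, hηg⟩ := hCη x₀ ρ r hρ hρr
  have hK0 : 0 < K := by linarith
  have hrΩ : Metric.closedBall x₀ r ⊆ Ω := (Metric.closedBall_subset_closedBall hrR.le).trans hΩ
  have hn' : (2 : ℝ) ≤ n := by exact_mod_cast hn
  set I := ∫ x in Metric.closedBall x₀ R, softMax ‖V x‖ ^ p with hI
  have hI0 : 0 ≤ I := integral_nonneg fun x => (softMax_rpow_pos _ _).le
  have hQ0 : ∀ x, 0 ≤ softMax ‖V x‖ := fun x => zero_le_one.trans (one_le_softMax _)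
  have hM : ∀ᵐ x ∂(volume.restrict (Metric.closedBall x₀ r)),
      ‖V x‖ ^ p ≤ (5 / 2) ^ p * C₀ ^ p * K ^ supExp n s * I := by
    have h1 := hsup hS hΩ hK hκ
    have h2 : eLpNorm (fun x => softMax ‖V x‖) (ENNReal.ofReal p)
        (volume.restrict (Metric.closedBall x₀ R)) = ENNReal.ofReal (I ^ p⁻¹) := by
      rw [← ENNReal.ofReal_rpow_of_nonneg hI0 (by positivity), hI, ofReal_integral_rpow_eq hQ0 hp0
        (hS.integrable_softMax_rpow (isCompact_closedBall _ _) hΩ hp0.le), ← ENNReal.rpow_mul,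
        mul_inv_cancel₀ hp0.ne', ENNReal.rpow_one]
    rw [h2, ← ENNReal.ofReal_mul (by positivity), eLpNorm_exponent_top] at h1
    filter_upwards [ae_le_eLpNormEssSup (f := fun x => softMax ‖V x‖)
      (μ := volume.restrict (Metric.closedBall x₀ r))] with x hx
    have h3 := hx.trans h1
    rw [Real.enorm_of_nonneg (hQ0 x), ENNReal.ofReal_le_ofReal_iff (by positivity)] at h3
    have h4 : ‖V x‖ ≤ 5 / 2 * (C₀ * K ^ (supExp n s / p) * I ^ p⁻¹) :=
      (le_softMax _).trans (by linarith)
    refine (Real.rpow_le_rpow (norm_nonneg _) h4 hp0.le).trans (le_of_eq ?_)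
    rw [Real.mul_rpow (by norm_num) (by positivity), Real.mul_rpow (by positivity) (by positivity),
      Real.mul_rpow (by positivity) (by positivity), ← Real.rpow_mul hK0.le, ← Real.rpow_mul hI0,
      div_mul_cancel₀ _ hp0.ne', inv_mul_cancel₀ hp0.ne', Real.rpow_one]
    ring
  have hBvol : volume (Metric.closedBall x₀ r) = volume (Metric.closedBall (0 : Vec n) r) :=
    Measure.addHaar_closedBall_center _ _ _
  have hBfin : volume (Metric.closedBall x₀ r) ≠ ⊤ := measure_closedBall_lt_top.ne
  haveI : IsFiniteMeasure (volume.restrict (Metric.closedBall x₀ r) : Measure (Vec n)) :=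
    ⟨by simpa using hBfin.lt_top⟩
  have hκ2 := hS.memLp_dataFun_two (isCompact_closedBall x₀ r) hrΩ
  have hint : ∫ x in Metric.closedBall x₀ r, (Λ ^ 2 + dataFun p k f x ^ 2)
      ≤ (Λ ^ 2 * vol + vol' ^ 2) * K ^ 2 := by
    rw [integral_add (integrable_const _) hκ2.integrable_sq, setIntegral_const, smul_eq_mul,
      Measure.real, hBvol]
    have h1 := integral_dataFun_sq_le hBfin (by linarith : 2 ≤ s) hK0.le hκ2
      ((eLpNorm_mono_measure _ (Measure.restrict_mono
        (Metric.closedBall_subset_closedBall hrR.le) le_rfl)).trans hκ)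
    rw [hBvol] at h1
    have h2 : vol * Λ ^ 2 ≤ vol * Λ ^ 2 * K ^ 2 :=
      le_mul_of_one_le_right (by positivity) (one_le_pow₀ hK)
    linarith
  -- The bound at threshold `1 + δ` is uniform in `δ`, although the proof of the differentiated
  -- inequality degenerates as `δ → 0`.
  have hδ : ∀ m : ℕ, ∫⁻ x in Metric.closedBall x₀ ρ, ENNReal.ofReal
        (excessWeight (1 + 1 / ((m : ℝ) + 1)) ‖V x‖ * ‖V x‖ ^ (p - 2) * ‖D2 x‖ ^ 2) ≤
      ENNReal.ofReal (C₁ * K ^ (supExp n s + 2) * I) := by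
    intro m
    have hm1 : 1 / ((m : ℝ) + 1) ≤ 1 := by
      rw [div_le_one (by positivity)]
      linarith [(Nat.cast_nonneg m : (0 : ℝ) ≤ m)]
    refine (hS.lintegral_excessWeight_le hr0 hrΩ hη hη0 hη1 hηs hρr.le hηρ hηg hM
      (by positivity) hm1).trans (ENNReal.ofReal_le_ofReal ?_)
    refine (mul_le_mul_of_nonneg_left hint (by positivity)).trans (le_of_eq ?_)
    rw [Real.rpow_add hK0, Real.rpow_two, hC₁]
    ring
  have hVm : AEMeasurable V (volume.restrict (Metric.closedBall x₀ ρ)) :=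
    (hS.bounded _ (isCompact_closedBall _ _)
      ((Metric.closedBall_subset_closedBall hρr.le).trans hrΩ)).1.aemeasurable
  have hDm : AEMeasurable D2 (volume.restrict (Metric.closedBall x₀ ρ)) :=
    (hS.sq_integrable _ (isCompact_closedBall _ _)
      ((Metric.closedBall_subset_closedBall hρr.le).trans hrΩ)).1.aemeasurable
  have hlim : Tendsto (fun m : ℕ => 1 + 1 / ((m : ℝ) + 1)) atTop (𝓝 1) := by
    simpa using (tendsto_one_div_add_atTop_nhds_zero_nat (𝕜 := ℝ)).const_add 1
  -- Fatou: the weight is continuous in its threshold.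
  calc ∫⁻ x in Metric.closedBall x₀ ρ, ENNReal.ofReal
          (excessWeight 1 ‖V x‖ * ‖V x‖ ^ (p - 2) * ‖D2 x‖ ^ 2)
      = ∫⁻ x in Metric.closedBall x₀ ρ, liminf (fun m : ℕ => ENNReal.ofReal
        (excessWeight (1 + 1 / ((m : ℝ) + 1)) ‖V x‖ * ‖V x‖ ^ (p - 2) * ‖D2 x‖ ^ 2)) atTop := by
        refine lintegral_congr fun x => ?_
        refine (Tendsto.liminf_eq (ENNReal.tendsto_ofReal ?_)).symm
        exact ((((continuous_excessWeight_left ‖V x‖).tendsto 1).comp hlim).mul_const _).mul_const _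
    _ ≤ liminf (fun m : ℕ => ∫⁻ x in Metric.closedBall x₀ ρ, ENNReal.ofReal
        (excessWeight (1 + 1 / ((m : ℝ) + 1)) ‖V x‖ * ‖V x‖ ^ (p - 2) * ‖D2 x‖ ^ 2)) atTop := by
        refine lintegral_liminf_le' fun m => ENNReal.measurable_ofReal.comp_aemeasurable ?_
        exact (((contDiff_excessWeight _).continuous.measurable.comp_aemeasurable hVm.norm).mul
          (hVm.norm.pow_const _)).mul (hDm.norm.pow_const _)
    _ ≤ ENNReal.ofReal (C₁ * K ^ (supExp n s + 2) * I) :=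
        (liminf_le_liminf (Eventually.of_forall hδ)).trans (liminf_const _).le
    _ ≤ _ := by
        rw [← ENNReal.ofReal_mul (by positivity)]
        refine ENNReal.ofReal_le_ofReal ?_
        gcongr
        linarith

end ExcessCaccioppoli

/-! ### Localization, norms of the data and the final constants. -/

section Conclusion

open Filter Topology

variable {n N : ℕ}

theorem MemLpLoc.mono {E : Type} [NormedAddCommGroup E] {g : Vec n → E} {q : ℝ≥0∞}
    {U Ω : Set (Vec n)} (h : MemLpLoc g q Ω) (hU : U ⊆ Ω) : MemLpLoc g q U :=
  fun K hK hKU => h K hK (hKU.trans hU)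

theorem IsWeakGrad.mono {ι : Type} [Fintype ι] {U Ω : Set (Vec n)} (hΩ : IsOpen Ω)
    (hUΩ : U ⊆ Ω) {g : Vec n → EuclideanSpace ℝ ι}
    {G : Vec n → EuclideanSpace ℝ (ι × Fin n)} (h : IsWeakGrad Ω g G) : IsWeakGrad U g G := by
  refine ⟨h.1.mono_set hUΩ, h.2.1.mono_set hUΩ, fun φ hφ hφc hφs a i => ?_⟩
  have h1 := h.2.2 φ hφ hφc (hφs.trans hUΩ) a i
  rw [setIntegral_eq_of_subset_of_forall_sdiff_eq_zero hΩ.measurableSet hUΩ,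
    setIntegral_eq_of_subset_of_forall_sdiff_eq_zero hΩ.measurableSet hUΩ] at h1
  · exact h1
  · intro x hx
    rw [image_eq_zero_of_notMem_tsupport fun h => hx.2 (hφs h), mul_zero]
  · intro x hx
    have : fderiv ℝ φ x = 0 := image_eq_zero_of_notMem_tsupport fun h =>
      hx.2 (hφs (tsupport_fderiv_subset ℝ h))
    rw [this]
    simp

theorem StructureConditions.mono {U Ω : Set (Vec n)} {p L L₁ ν s : ℝ} {k : Vec n → ℝ}
    {F : Vec n → Mat n N → ℝ} (hΩ : IsOpen Ω) (hUΩ : U ⊆ Ω)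
    (h : StructureConditions Ω p L L₁ ν s k F) : StructureConditions U p L L₁ ν s k F where
  aemeasurable ξ := (h.aemeasurable ξ).mono_set hUΩ
  continuous := ae_restrict_of_ae_restrict_of_subset hUΩ h.continuous
  convex := ae_restrict_of_ae_restrict_of_subset hUΩ h.convex
  contDiff := ae_restrict_of_ae_restrict_of_subset hUΩ h.contDiff
  growth := by
    obtain ⟨l, hl, h1⟩ := h.growth
    exact ⟨l, hl, ae_restrict_of_ae_restrict_of_subset hUΩ h1⟩
  radial := by
    obtain ⟨g, hg⟩ := h.radial
    exact ⟨g, ae_restrict_of_ae_restrict_of_subset hUΩ hg⟩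
  elliptic := ae_restrict_of_ae_restrict_of_subset hUΩ h.elliptic
  hessian_le := ae_restrict_of_ae_restrict_of_subset hUΩ h.hessian_le
  k_nonneg := ae_restrict_of_ae_restrict_of_subset hUΩ h.k_nonneg
  k_mem := h.k_mem.mono hUΩ
  mixed := by
    obtain ⟨M, hM, hk⟩ := h.mixed
    exact ⟨M, fun ξ hξ => (hM ξ hξ).mono hΩ hUΩ,
      ae_restrict_of_ae_restrict_of_subset hUΩ hk⟩

theorem restrict_closedBall_eq {R : ℝ} (hR : R ≠ 0) (x : Vec n) :
    (volume : Measure (Vec n)).restrict (Metric.closedBall x R)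
      = volume.restrict (Metric.ball x R) := by
  refine Measure.restrict_congr_set ?_
  rw [← Metric.ball_union_sphere]
  exact union_ae_eq_left_of_ae_eq_empty
    (ae_eq_empty.2 (Measure.addHaar_sphere_of_ne_zero volume x hR))

theorem GradientBound.mono {C C' τ p s : ℝ} {k : Vec n → ℝ} {f : Vec n → Vec N}
    {V : Vec n → Mat n N} {B' B : Set (Vec n)} (hC : C ≤ C')
    (h : GradientBound C τ p s k f V B' B) : GradientBound C' τ p s k f V B' B :=
  h.trans (mul_le_mul_left (mul_le_mul_left (ENNReal.ofReal_le_ofReal hC) _) _)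

theorem CaccioppoliBound.mono {C C' τ p s : ℝ} {k : Vec n → ℝ} {f : Vec n → Vec N}
    {V : Vec n → Mat n N} {D2 : Vec n → Tens n N} {B' B : Set (Vec n)} (hC : C ≤ C')
    (h : CaccioppoliBound C τ p s k f V D2 B' B) : CaccioppoliBound C' τ p s k f V D2 B' B :=
  h.trans (mul_le_mul_left (mul_le_mul_left (ENNReal.ofReal_le_ofReal hC) _) _)

/-- Triangle inequality; the constant 2 in `dataFun` has norm `2 |B|^(1/s)` and is absorbed by the
summand 1 of `dataSize`. -/
theorem eLpNorm_dataFun_le {p s : ℝ} (hs : 1 ≤ s) {k : Vec n → ℝ} {f : Vec n → Vec N}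
    {B : Set (Vec n)} (hB : volume B ≠ ⊤)
    (hk : MemLp k (ENNReal.ofReal s) (volume.restrict B))
    (hf : MemLp f (ENNReal.ofReal s) (volume.restrict B)) :
    eLpNorm (dataFun p k f) (ENNReal.ofReal s) (volume.restrict B) ≤
      ENNReal.ofReal ((2 ^ (p - 1) + 1 + 2 * (volume B ^ (1 / s)).toReal)
        * (dataSize s k f B).toReal) := by
  have hs1 : (1 : ℝ≥0∞) ≤ ENNReal.ofReal s := by simpa using ENNReal.ofReal_le_ofReal hs
  have hs0 : 0 < s := by linarith
  have hfin : volume B ^ (1 / s) ≠ ⊤ := ENNReal.rpow_ne_top_of_nonneg (by positivity) hB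
  have hd : dataSize s k f B ≠ ⊤ :=
    ENNReal.add_ne_top.2 ⟨ENNReal.add_ne_top.2 ⟨ENNReal.one_ne_top, hk.2.ne⟩, hf.2.ne⟩
  have h2 : (0 : ℝ) ≤ 2 ^ (p - 1) := by positivity
  have e1 : eLpNorm (fun x => (2 : ℝ) ^ (p - 1) * k x) (ENNReal.ofReal s) (volume.restrict B)
      = ENNReal.ofReal (2 ^ (p - 1)) * eLpNorm k (ENNReal.ofReal s) (volume.restrict B) := by
    have := eLpNorm_const_smul (μ := volume.restrict B) ((2 : ℝ) ^ (p - 1)) k (ENNReal.ofReal s)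
    rwa [Real.enorm_of_nonneg h2] at this
  have e2 : eLpNorm (fun _ : Vec n => (2 : ℝ)) (ENNReal.ofReal s) (volume.restrict B)
      ≤ ENNReal.ofReal (2 * (volume B ^ (1 / s)).toReal) := by
    rw [ENNReal.ofReal_mul (by norm_num), ENNReal.ofReal_toReal hfin]
    refine (eLpNorm_const' (2 : ℝ) (by simpa using hs0) ENNReal.ofReal_ne_top).le.trans ?_
    rw [Measure.restrict_apply_univ, ENNReal.toReal_ofReal hs0.le,
      Real.enorm_of_nonneg (by norm_num)]
  have e3 : eLpNorm (dataFun p k f) (ENNReal.ofReal s) (volume.restrict B) ≤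
      ENNReal.ofReal (2 ^ (p - 1)) * eLpNorm k (ENNReal.ofReal s) (volume.restrict B)
        + (eLpNorm f (ENNReal.ofReal s) (volume.restrict B)
          + ENNReal.ofReal (2 * (volume B ^ (1 / s)).toReal)) := by
    refine (eLpNorm_add_le (hk.1.const_mul _) (hf.1.norm.add aestronglyMeasurable_const)
      hs1).trans (add_le_add e1.le ?_)
    refine (eLpNorm_add_le hf.1.norm aestronglyMeasurable_const hs1).trans ?_
    rw [eLpNorm_norm]
    exact add_le_add_right e2 _
  refine e3.trans ?_
  rw [ENNReal.ofReal_mul (q := (dataSize s k f B).toReal) (by positivity),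
    ENNReal.ofReal_toReal hd,
    ENNReal.ofReal_add (by positivity) (by positivity), ENNReal.ofReal_add h2 zero_le_one, add_mul,
    add_mul, ENNReal.ofReal_one, one_mul, add_assoc]
  have d1 : eLpNorm k (ENNReal.ofReal s) (volume.restrict B) ≤ dataSize s k f B :=
    le_trans (le_add_left le_rfl) (le_add_right le_rfl)
  have d2 : eLpNorm f (ENNReal.ofReal s) (volume.restrict B) ≤ dataSize s k f B :=
    le_add_left le_rfl
  have d3 : 1 ≤ dataSize s k f B := le_trans (le_add_right le_rfl) (le_add_right le_rfl)
  exact add_le_add (mul_le_mul_right d1 _) (add_le_add d2 (le_mul_of_one_le_right' d3))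

theorem softMax_rpow_le {p P : ℝ} (hp : 0 ≤ p) (hP : 0 ≤ P) : softMax P ^ p ≤ 1 + P ^ p := by
  refine (Real.rpow_le_rpow (by linarith [one_le_softMax P]) (softMax_le_max P) hp).trans ?_
  have : 0 ≤ P ^ p := Real.rpow_nonneg hP p
  rcases le_total 1 P with h | h
  · rw [max_eq_right h]
    linarith
  · rw [max_eq_left h, Real.one_rpow]
    linarith

/-- Both estimates with `K` a multiple of `dataSize`. The growth constants of `F` and the Lipschitz
constants they produce disappear in the limit of difference quotients, so `C` does not depend on
them. -/
theorem exists_apriori_const (hn : 2 ≤ n) {s : ℝ} (hs : (n : ℝ) < s) {p ν L₁ : ℝ} (hp : 2 ≤ p)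
    (hν : 0 < ν) {ρ R : ℝ} (hρ : 0 ≤ ρ) (hρR : ρ < R) : ∃ C : ℝ, 0 < C ∧ ∀ {N : ℕ}
      {Ω : Set (Vec n)} {L : ℝ} {k : Vec n → ℝ} {F : Vec n → Mat n N → ℝ} {f : Vec n → Vec N}
      {V : Vec n → Mat n N} {D2 : Vec n → Tens n N},
      RegularSolution Ω p L L₁ ν s k F f V D2 → ∀ {x₀ : Vec n}, Metric.closedBall x₀ R ⊆ Ω →
      GradientBound C (supExp n s + 2) p s k f V (Metric.ball x₀ ρ) (Metric.ball x₀ R) ∧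
      CaccioppoliBound C (supExp n s + 2) p s k f V D2 (Metric.ball x₀ ρ) (Metric.ball x₀ R) := by
  obtain ⟨C₁, hC₁, hsup⟩ := exists_sup_const hn hs (L₁ := L₁) hp hν hρ hρR
  obtain ⟨C₂, hC₂, hcac⟩ := exists_caccioppoli_const hn hs (L₁ := L₁) hp hν hρ hρR
  have hR : R ≠ 0 := by linarith
  have hp0 : 0 < p := by linarith
  have hσ := supExp_pos hn hs
  have hn' : (2 : ℝ) ≤ n := by exact_mod_cast hn
  set τ := supExp n s + 2 with hτ
  set c := 2 ^ (p - 1) + 1 + 2 * (volume (Metric.ball (0 : Vec n) R) ^ (1 / s)).toReal with hc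
  have hc1 : 1 ≤ c := by
    have : (0 : ℝ) ≤ 2 ^ (p - 1) := by positivity
    have : 0 ≤ (volume (Metric.ball (0 : Vec n) R) ^ (1 / s)).toReal := ENNReal.toReal_nonneg
    linarith
  have hc0 : 0 < c := by linarith
  refine ⟨5 / 2 * C₁ * c ^ τ + C₂ * c ^ τ, by positivity, ?_⟩
  intro N Ω L k F f V D2 hS x₀ hΩ
  have hbv : volume (Metric.ball x₀ R) = volume (Metric.ball (0 : Vec n) R) :=
    Measure.addHaar_ball_center _ _ _
  have hk := hS.conditions.k_mem _ (isCompact_closedBall x₀ R) hΩ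
  have hf := hS.f_mem _ (isCompact_closedBall x₀ R) hΩ
  rw [restrict_closedBall_eq hR] at hk hf
  have hκ := eLpNorm_dataFun_le (p := p) (by linarith : 1 ≤ s) measure_ball_lt_top.ne hk hf
  rw [hbv, ← hc, ← restrict_closedBall_eq hR] at hκ
  set d := dataSize s k f (Metric.ball x₀ R) with hd_def
  have hd : d ≠ ⊤ :=
    ENNReal.add_ne_top.2 ⟨ENNReal.add_ne_top.2 ⟨ENNReal.one_ne_top, hk.2.ne⟩, hf.2.ne⟩
  have hd1 : 1 ≤ d.toReal := by
    have : 1 ≤ d := le_trans (le_add_right le_rfl) (le_add_right le_rfl)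
    simpa using ENNReal.toReal_mono hd this
  have hd0 : 0 < d.toReal := by linarith
  have hK : 1 ≤ c * d.toReal := one_le_mul_of_one_le_of_one_le hc1 hd1
  have hdτ : ENNReal.ofReal (d.toReal ^ τ) = d ^ τ := by
    rw [← ENNReal.ofReal_rpow_of_pos hd0, ENNReal.ofReal_toReal hd]
  have hKτ : (c * d.toReal) ^ τ = c ^ τ * d.toReal ^ τ := Real.mul_rpow hc0.le hd0.le
  have hQ0 : ∀ x, 0 ≤ softMax ‖V x‖ := fun x => zero_le_one.trans (one_le_softMax _)
  have hQi := hS.integrable_softMax_rpow (isCompact_closedBall x₀ R) hΩ hp0.le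
  constructor
  · refine GradientBound.mono (C := 5 / 2 * C₁ * c ^ τ)
      (le_add_of_nonneg_right (by positivity)) ?_
    have h1 : eLpNorm V ⊤ (volume.restrict (Metric.ball x₀ ρ)) ≤ ENNReal.ofReal (5 / 2) *
        eLpNorm (fun x => softMax ‖V x‖) ⊤ (volume.restrict (Metric.closedBall x₀ ρ)) := by
      have h2 := eLpNorm_const_smul (μ := volume.restrict (Metric.closedBall x₀ ρ)) (5 / 2 : ℝ)
        (fun x => softMax ‖V x‖) ⊤
      rw [Real.enorm_of_nonneg (by norm_num)] at h2
      rw [← h2]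
      refine (eLpNorm_mono_measure _ (Measure.restrict_mono Metric.ball_subset_closedBall
        le_rfl)).trans (eLpNorm_mono_real fun x => le_softMax _)
    have h3 : eLpNorm (fun x => softMax ‖V x‖) (ENNReal.ofReal p)
        (volume.restrict (Metric.closedBall x₀ R)) ≤
        (∫⁻ x in Metric.ball x₀ R, ENNReal.ofReal ((1 + ‖V x‖) ^ p)) ^ (1 / p) := by
      rw [restrict_closedBall_eq hR, eLpNorm_eq_lintegral_rpow_enorm_toReal (by simpa using hp0)
        ENNReal.ofReal_ne_top, ENNReal.toReal_ofReal hp0.le]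
      refine ENNReal.rpow_le_rpow (lintegral_mono fun x => ?_) (by positivity)
      rw [Real.enorm_of_nonneg (hQ0 x), ENNReal.ofReal_rpow_of_nonneg (hQ0 x) hp0.le]
      refine ENNReal.ofReal_le_ofReal (Real.rpow_le_rpow (hQ0 x) ((softMax_le_max _).trans ?_)
        hp0.le)
      exact max_le (by linarith [norm_nonneg (V x)]) (by linarith)
    -- The gradient bound needs only the smaller power `supExp/p`; since the base is at least 1, it
    -- may be raised to `τ`, which then serves both estimates.
    have h4 : (c * d.toReal) ^ (supExp n s / p) ≤ c ^ τ * d.toReal ^ τ := by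
      rw [← hKτ]
      refine Real.rpow_le_rpow_of_exponent_le hK ?_
      have : supExp n s / p ≤ supExp n s := div_le_self hσ.le (by linarith)
      linarith
    refine h1.trans ((mul_le_mul_right (hsup hS hΩ hK hκ) _).trans ?_)
    rw [← hdτ, ← ENNReal.ofReal_mul (by positivity), ← mul_assoc,
      ← ENNReal.ofReal_mul (by norm_num)]
    refine mul_le_mul (ENNReal.ofReal_le_ofReal ?_) h3 zero_le zero_le
    calc 5 / 2 * (C₁ * (c * d.toReal) ^ (supExp n s / p))
        ≤ 5 / 2 * (C₁ * (c ^ τ * d.toReal ^ τ)) := by gcongr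
      _ = _ := by ring
  · refine CaccioppoliBound.mono (C := C₂ * c ^ τ) (le_add_of_nonneg_left (by positivity)) ?_
    have h1 : ENNReal.ofReal (∫ x in Metric.closedBall x₀ R, softMax ‖V x‖ ^ p) ≤
        ∫⁻ x in Metric.ball x₀ R, ENNReal.ofReal (1 + ‖V x‖ ^ p) := by
      rw [ofReal_integral_eq_lintegral_ofReal hQi
        (Eventually.of_forall fun x => (softMax_rpow_pos _ _).le), restrict_closedBall_eq hR]
      exact lintegral_mono fun x => ENNReal.ofReal_le_ofReal
        (softMax_rpow_le hp0.le (norm_nonneg _))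
    have h2 := hcac hS hΩ hK hκ
    rw [hKτ, ← mul_assoc, ENNReal.ofReal_mul (by positivity), hdτ] at h2
    exact (lintegral_mono_set Metric.ball_subset_closedBall).trans
      (h2.trans (mul_le_mul_right h1 _))

theorem AprioriRegular.regularSolution {Ω : Set (Vec n)} {p L L₁ ν s : ℝ} {k : Vec n → ℝ}
    {F : Vec n → Mat n N → ℝ} {f u : Vec n → Vec N} {Du : Vec n → Mat n N} {D2u : Vec n → Tens n N}
    (hn : 2 ≤ n) (hN : 1 ≤ N) (hp : 2 ≤ p) (hs : (n : ℝ) < s) (hL₁ : 0 ≤ L₁) (hν : 0 < ν)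
    (hΩ : IsOpen Ω) (hS : StructureConditions Ω p L L₁ ν s k F)
    (hf : MemLpLoc f (ENNReal.ofReal s) Ω) (hE : EulerLagrangeIneq Ω F f Du)
    (h : AprioriRegular Ω p u Du D2u) : RegularSolution Ω p L L₁ ν s k F f Du D2u where
  two_le_dim := hn
  one_le_codim := hN
  two_le_p := hp
  dim_lt := hs
  L₁_nonneg := hL₁
  ν_pos := hν
  isOpen := hΩ
  conditions := hS
  f_mem := hf
  euler := hE
  weakGrad := h.memW2.2.1
  bounded := h.memW1.2.2
  sq_integrable := h.memW2.2.2
  symm := h.memW2.1.1.symm hΩ h.memW2.2.1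

end Conclusion

theorem theorem3p4 (n : ℕ) (hn : 2 ≤ n) (s : ℝ) (hs : (n : ℝ) < s) :
    ∃ τ : ℝ, 0 < τ ∧
      -- local minimizers of the energy
      (∀ (N : ℕ) (p L L₁ ν ρ R : ℝ), 1 ≤ N → 2 ≤ p → 0 < L → 0 < L₁ → 0 < ν → 0 < ρ → ρ ≤ R →
        ∃ C : ℝ, 0 < C ∧
          ∀ (Ω : Set (Vec n)) (k : Vec n → ℝ) (F : Vec n → Mat n N → ℝ) (f : Vec n → Vec N)
            (u : Vec n → Vec N) (Du : Vec n → Mat n N) (D2u : Vec n → Tens n N),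
            IsOpen Ω → IsConnected Ω → Bornology.IsBounded Ω →
            StructureConditions Ω p L L₁ ν s k F →
            MemLpLoc f (ENNReal.ofReal s) Ω →
            AprioriRegular Ω p u Du D2u →
            IsLocalMinimizer Ω p F f u Du →
            ∀ x₀ : Vec n,
              (ρ < R → Metric.closedBall x₀ R ⊆ Ω →
                GradientBound C τ p s k f Du (Metric.ball x₀ ρ) (Metric.ball x₀ R)) ∧
              (Metric.closedBall x₀ (2 * R) ⊆ Ω →
                CaccioppoliBound C τ p s k f Du D2u
                  (Metric.ball x₀ ρ) (Metric.ball x₀ (2 * R)))) ∧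
      -- minimizers of the perturbed energy in a Dirichlet class on a ball
      (∀ (N : ℕ) (p L₁ ν ρ R : ℝ), 1 ≤ N → 2 ≤ p → 0 < L₁ → 0 < ν → 0 < ρ → ρ < R →
        ∃ C₁ : ℝ, 0 < C₁ ∧ ∀ L : ℝ, 0 < L → ∃ C₂ : ℝ, 0 < C₂ ∧
          ∀ (Ω : Set (Vec n)) (k : Vec n → ℝ) (F : Vec n → Mat n N → ℝ) (f : Vec n → Vec N)
            (x₀ : Vec n) (r : ℝ)
            (u ubar : Vec n → Vec N) (Du Dubar : Vec n → Mat n N)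
            (v : Vec n → Vec N) (Dv : Vec n → Mat n N) (D2v : Vec n → Tens n N),
            IsOpen Ω → IsConnected Ω → Bornology.IsBounded Ω →
            StructureConditions Ω p L L₁ ν s k F →
            MemLpLoc f (ENNReal.ofReal s) Ω →
            0 < r → Metric.closedBall x₀ r ⊆ Ω →
            MemW1 (Metric.ball x₀ r) (ENNReal.ofReal p) u Du →
            MemW1 (Metric.ball x₀ r) (ENNReal.ofReal p) ubar Dubar →
            AprioriRegular (Metric.ball x₀ r) p v Dv D2v →
            IsPerturbedMinimizer (Metric.ball x₀ r) p F f ubar u Du v Dv →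
            ∀ x₁ : Vec n, Metric.closedBall x₁ R ⊆ Metric.ball x₀ r →
              GradientBound C₁ τ p s k f Dv (Metric.ball x₁ ρ) (Metric.ball x₁ R) ∧
              CaccioppoliBound C₂ τ p s k f Dv D2v (Metric.ball x₁ ρ) (Metric.ball x₁ R)) := by
  have hn' : (2 : ℝ) ≤ n := by exact_mod_cast hn
  have hs2 : 2 ≤ s := by linarith
  refine ⟨supExp n s + 2, by linarith [supExp_pos hn hs], ?_, ?_⟩
  · intro N p L L₁ ν ρ R hN hp _ hL₁ hν hρ hρR
    obtain ⟨C₂, hC₂, h₂⟩ := exists_apriori_const hn hs (L₁ := L₁) hp hν hρ.le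
      (by linarith : ρ < 2 * R)
    -- The case `ρ = R` is allowed for the second estimate, which reaches out to `2R`; the gradient
    -- bound then claims nothing, and any constant will do.
    obtain ⟨C₁, hC₁, h₁⟩ : ∃ C₁ : ℝ, 0 < C₁ ∧ (ρ < R → ∀ (Ω : Set (Vec n)) (k : Vec n → ℝ)
        (F : Vec n → Mat n N → ℝ) (f : Vec n → Vec N) (V : Vec n → Mat n N) (D2 : Vec n → Tens n N),
        RegularSolution Ω p L L₁ ν s k F f V D2 → ∀ x₀ : Vec n, Metric.closedBall x₀ R ⊆ Ω →
        GradientBound C₁ (supExp n s + 2) p s k f V (Metric.ball x₀ ρ) (Metric.ball x₀ R)) := by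
      by_cases h : ρ < R
      · obtain ⟨C₁, hC₁, h₁⟩ := exists_apriori_const hn hs (L₁ := L₁) hp hν hρ.le h
        exact ⟨C₁, hC₁, fun _ Ω k F f V D2 hS x₀ hx₀ => (h₁ hS hx₀).1⟩
      · exact ⟨1, one_pos, fun h' => absurd h' h⟩
    refine ⟨C₁ + C₂, by positivity, fun Ω k F f u Du D2u hΩ _ _ hS hf hu hmin x₀ => ?_⟩
    have hsol := hu.regularSolution hn hN hp hs hL₁.le hν hΩ hS hf
      (hmin.eulerLagrangeIneq hΩ hp hs2 hS hf hu.memW1.2.2)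
    exact ⟨fun hρR' hx₀ => (h₁ hρR' Ω k F f Du D2u hsol x₀ hx₀).mono (by linarith),
      fun hx₀ => (h₂ hsol hx₀).2.mono (by linarith)⟩
  · intro N p L₁ ν ρ R hN hp hL₁ hν hρ hρR
    obtain ⟨C, hC, h⟩ := exists_apriori_const hn hs (L₁ := L₁) hp hν hρ.le hρR
    -- One constant independent of `L` serves for both estimates.
    refine ⟨C, hC, fun L _ => ⟨C, hC, ?_⟩⟩
    intro Ω k F f x₀ r u ubar Du Dubar v Dv D2v hΩ _ _ hS hf hr hrΩ hu hub hv hmin x₁ hx₁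
    have hBΩ : Metric.ball x₀ r ⊆ Ω := Metric.ball_subset_closedBall.trans hrΩ
    have hcl : closure (Metric.ball x₀ r) = Metric.closedBall x₀ r := closure_ball x₀ hr.ne'
    -- The a priori estimate is applied with the ball `B_r(x₀)` in the role of `Ω`.
    exact h (hv.regularSolution hn hN hp hs hL₁.le hν Metric.isOpen_ball
      (hS.mono hΩ hBΩ) (hf.mono hBΩ)
      (hmin.eulerLagrangeIneq hp hs2 hS hf Metric.isOpen_ball
        (by rw [hcl]; exact isCompact_closedBall _ _) (by rwa [hcl]) hu hub.2.1.1
        hv.memW1.2.2)) hx₁
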